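/- Let $\mathbb K$ be a field of characteristic $0$ and $N\ge 0$ an integer. Signs follow the Koszul rule, and $p(\cdot)$ denotes parity. **Superoperads.** A superoperad is a sequence of linear superspaces $P(n)$ ($n\ge 0$) with even linear right actions $X\mapsto X^\sigma$ of the symmetric groups $\mathfrak S_n$, an even unit $1\in P(1)$ and even multilinear compositions $X\circ(Y_1\odot\dots\odot Y_m)\in P(n)$ for $X\in P(m)$, $Y_j\in P(n_j)$, $n_1+\dots+n_m=n$, $m\geq 0$, such that $1\circ X=X=X\circ(1\odot\dots\odot1)$; for homogeneous $Y_j,Z_k$, $$(X\circ(Y_1\odot\dots\odot Y_m))\circ(Z_1\odot\dots\odot Z_n)=\pm X\circ\bigl((Y_1\circ \mathbf Z_1)\odot\dots\odot(Y_m\circ\mathbf Z_m)\bigr),\qquad \pm=\prod_{i<j}(-1)^{p(\mathbf Z_i)p(Y_j)},$$ where $\mathbf Z_1,\dots,\mathbf Z_m$ are the consecutive blocks, of lengths $n_1,\dots,n_m$, of $Z_1\odot\dots\odot Z_n$; and $X^\sigma\circ(Y_1^{\tau_1}\odot\dots\odot Y_m^{\tau_m})=\bigl(X\circ\sigma(Y_1\odot\dots\odot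 Y_m)\bigr)^{\sigma(\tau_1,\dots,\tau_m)}$, where $\sigma(Y_1\odot\dots\odot Y_m)=\prod_{i<j,\,\sigma(i)>\sigma(j)}(-1)^{p(Y_i)p(Y_j)}\,Y_{\sigma^{-1}(1)}\odot\dots\odot Y_{\sigma^{-1}(m)}$ and $\sigma(\tau_1,\dots,\tau_m)\in\mathfrak S_n$ applies $\tau_j$ inside the $j$-th block and then moves this block to position $\sigma(j)$. **Supermodules.** An $\mathcal H_W$-supermodule $V=(V,\nabla)$, $\nabla=(T,S^1,\dots,S^N)$, is a linear superspace with an even operator $T$ and odd operators $S^i$ such that $TS^i=S^iT$, $S^iS^j+S^jS^i=0$. Let $\mathbb K[\Lambda_k]_{k=1}^n$, $\Lambda_k=(\lambda_k,\theta_k^1,\dots,\theta_k^N)$, be the free commutative superalgebra on even $\lambda_k$ and odd $\theta_k^i$, and put $V[\Lambda_k]_k=\mathbb K[\Lambda_k]_k\otimes V$. Let $V_\nabla[\Lambda_k]_{k=1}^n$ be the quotient of $\mathbb K[\Lambda_k]_{k=1}^n\otimes V$ by $a\sum_k\lambda_k\otimes v+a\otimes Tv$ and $a\sum_k\theta^i_k\otimes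 v+a\otimes S^iv$. The inclusion $V[\Lambda_k]_{k=1}^{n-1}\subset V[\Lambda_k]_{k=1}^{n}$ induces $V[\Lambda_k]_{k=1}^{n-1}\cong V_\nabla[\Lambda_k]_{k=1}^n$ for $n\ge1$; for $n=0$ there is the surjection $V\to V_\nabla[\,]=V/\nabla V$. For an operator $\varphi$ on $V$, $\varphi^{(k)}$ is $\varphi$ applied to the $k$-th factor of $V^{\otimes n}$. **Quivers.** $\mathcal Q(n)$ is the set of quivers without loops with vertex set $\{1,\dots,n\}$ (edges being elements of a fixed ambient set, which may be arbitrary). A cycle of the underlying graph is a closed path of positive length without repeated edges (so two edges joining the same two vertices form a cycle); a directed cycle is a closed directed path of positive length without repeated edges; $Q\setminus\alpha$ is $Q$ without the edge $\alpha$, and $\sigma Q$ is $Q$ with the vertices renamed by $\sigma$. For $\nu=(n_1,\dots,n_m)$ with $n_1+\dots+n_m=n$, cut $\{1,\dots,n\}$ into consecutive blocks of lengths $n_j$. For $Q\in\mathcal Q(n)$, $\Delta_j^\nu(Q)\in\mathcal Q(n_j)$ consists of the $j$-th block and the edges inside it; $\Delta_0^\nu(Q)\in\mathcal Q(m)$ is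 obtained by contracting every block to a vertex and keeping the edges between different blocks. $\mathcal E_Q^\nu(k)\subset\{1,\dots,m\}$ is the set of the $i$ for which the underlying graph of $\Delta^\nu_0(Q)$ has a path without repeated edges, from $i$ to the block of $k$, one of whose edges is incident in $Q$ to the vertex $k$. **The spaces.** $P^{\mathrm{cl}}_W(V)(n)$ is the superspace of the linear maps $X\colon V^{\otimes n}\otimes\mathbb K\mathcal Q(n)\to V_\nabla[\Lambda_k]_{k=1}^n$ whose homogeneous components $X$ satisfy, with $X^Q=X(-\otimes Q)$ and for all $Q$: (i) $X^Q=0$ if the underlying graph has a cycle; $\sum_{q}X^{Q\setminus\alpha_q}=0$ for every directed cycle $(\alpha_1,\dots,\alpha_r)$ of $Q$; (ii) for every connected component $I$ of the underlying graph, $(\partial_{\lambda_k}-\partial_{\lambda_l})X^Q(v)=0$ for $k,l\in I$ and $\sum_{k\in I}X^Q(T^{(k)}v)=-\sum_{k\in I}\lambda_kX^Q(v)$; and $X^Q((S^i)^{(k)}v)=-(-1)^{p(X)}\theta_k^iX^Q(v)$ for all $k\in\{1,\dots,n\}$ and $i$. **Action, unit, composition.** Put $X^\sigma(v\otimes Q)=X_{\Lambda_{\sigma^{-1}(1)},\dots,\Lambda_{\sigma^{-1}(n)}}(\sigma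 v\otimes\sigma Q)$, where $\sigma$ acts on $V^{\otimes n}$ by $\sigma(v_1\otimes\dots\otimes v_n)=\prod_{i<j,\,\sigma(i)>\sigma(j)}(-1)^{p(v_i)p(v_j)}\,v_{\sigma^{-1}(1)}\otimes\dots\otimes v_{\sigma^{-1}(n)}$. The unit is $\mathrm{id}_V\colon V\to V_\nabla[\Lambda_1]\cong V$. For homogeneous $X\in P^{\mathrm{cl}}_W(V)(m)$, $Y_j\in P^{\mathrm{cl}}_W(V)(n_j)$ and $v_1,\dots,v_n\in V$, let $w_j$ be the tensor product of the $v_k$ with $k$ in the $j$-th block. Write $Y_j^{\Delta^\nu_j(Q)}(w_j)=\sum a_ju_j$ in $V[\Lambda_k]_k$, where $k$ runs through the $j$-th block without its last element and all $a_j,u_j$ are homogeneous. Then $X\circ(Y_1\odot\dots\odot Y_m)$ maps $v_1\otimes\dots\otimes v_n\otimes Q$ to $$\prod_{i<j}(-1)^{p(w_i)p(Y_j)}\sum\prod_{i<j}(-1)^{p(u_i)p(a_j)}\;X^{\Delta_0^\nu(Q)}_{\Lambda'_1,\dots,\Lambda'_m}\Bigl(a\big|_{\Xi_j=\Lambda'_j+\nabla^{(j)}}(u_1\otimes\dots\otimes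 u_m)\Bigr),$$ where $\Lambda'_j$ is the sum of the $\Lambda_k$ over the $j$-th block, $a=\prod_{j=1}^m a_j\bigl(\Lambda_k+\sum_{i\in\mathcal E^\nu_Q(k)}\Xi_i\bigr)_k$ with additional supervariables $\Xi_1,\dots,\Xi_m$, and $X_{\Lambda'_1,\dots,\Lambda'_m}(b\,t)=(-1)^{p(X)p(b)}\,b\,X_{\Lambda'_1,\dots,\Lambda'_m}(t)$ for $b\in\mathbb K[\Lambda_k]_{k=1}^n$, $t\in V^{\otimes m}$. **Proposition.** Let $V$ be an $\mathcal H_W$-supermodule. These formulas are well defined and preserve the spaces $P^{\mathrm{cl}}_W(V)(n)$, and $P^{\mathrm{cl}}_W(V)=(P^{\mathrm{cl}}_W(V)(n))_{n\ge0}$ with this action, composition and unit $\mathrm{id}_V$ is a superoperad; that is, there is exactly one superoperad structure on these superspaces given by these formulas. -/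

import Mathlib

open scoped TensorProduct

noncomputable section

namespace SUSYCoisson

/-! ### Signs -/

/-- The sign `(-1)^p` attached to a parity `p`. -/
def sg (p : ZMod 2) : ℤ := if p = 0 then 1 else -1

theorem sg_add_one (p : ZMod 2) : sg (p + 1) = -sg p := by
  revert p; decide

/-- The Koszul sign `∏_{i<j} (-1)^{p_i q_j}` which arises when
`x₁ ⊗ ⋯ ⊗ xₘ ⊗ y₁ ⊗ ⋯ ⊗ yₘ` (with `x_j` of parity `q_j` and `y_j` of parity `p_j`) is shuffled
into `x₁ ⊗ y₁ ⊗ ⋯ ⊗ xₘ ⊗ yₘ`. -/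
def shuffleSign {m : ℕ} (p q : Fin m → ZMod 2) : ℤ :=
  ∏ i, ∏ j ∈ Finset.Ioi i, sg (p i * q j)

/-- The Koszul sign `∏_{i<j, σ(i)>σ(j)} (-1)^{p_i p_j}` of a permutation of homogeneous factors. -/
def permSign {n : ℕ} (σ : Equiv.Perm (Fin n)) (p : Fin n → ZMod 2) : ℤ :=
  ∏ i, ∏ j ∈ (Finset.Ioi i).filter (fun j => σ j < σ i), sg (p i * p j)

/-! ### Blocks of consecutive indices -/

/-- For `n = ν₁ + ⋯ + νₘ`: the pair `(j, k)` goes to the `k`-th element of the `j`-th of the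
consecutive blocks of lengths `ν₁, …, νₘ`. -/
def blk {m n : ℕ} (ν : Fin m → ℕ) (h : ∑ j, ν j = n) : ((j : Fin m) × Fin (ν j)) ≃ Fin n :=
  finSigmaFinEquiv.trans (finCongr h)

/-- The index of the block containing a given element. -/
def blkIdx {m n : ℕ} (ν : Fin m → ℕ) (h : ∑ j, ν j = n) (a : Fin n) : Fin m :=
  ((blk ν h).symm a).1

theorem sum_comp_symm {m n : ℕ} (ν : Fin m → ℕ) (h : ∑ j, ν j = n) (σ : Equiv.Perm (Fin m)) :
    ∑ j, ν (σ.symm j) = n := by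
  rw [← h]; exact Equiv.sum_comp σ.symm ν

/-- The block permutation: on the `j`-th block apply `τ_j`, then move the `j`-th block to the
position `σ(j)`. -/
def blockPerm {m n : ℕ} (ν : Fin m → ℕ) (h : ∑ j, ν j = n) (σ : Equiv.Perm (Fin m))
    (τ : ∀ j, Equiv.Perm (Fin (ν j))) : Equiv.Perm (Fin n) :=
  (blk ν h).symm.trans <| (Equiv.sigmaCongrRight τ).trans <|
    (Equiv.sigmaCongrLeft' σ).trans <| blk (fun j => ν (σ.symm j)) (sum_comp_symm ν h σ)

theorem sum_blocks {l m n : ℕ} {ν : Fin m → ℕ} (h : ∑ j, ν j = n) {μ : Fin n → ℕ}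
    (h' : ∑ k, μ k = l) : ∑ j, ∑ k, μ (blk ν h ⟨j, k⟩) = l := by
  rw [← h', ← Equiv.sum_comp (blk ν h) μ, Fintype.sum_sigma]

/-! ### Superoperads -/

/-- A superoperad structure on a sequence `P(n)` of linear superspaces, the even and the odd part
of `P(n)` being `par n 0` and `par n 1`. -/
structure Superoperad (K : Type*) [Field K] (P : ℕ → Type*) [∀ n, AddCommGroup (P n)]
    [∀ n, Module K (P n)] (par : ∀ n, ZMod 2 → Submodule K (P n)) where
  /-- each `P(n)` is a linear superspace -/
  isInternal : ∀ n, DirectSum.IsInternal (par n)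
  /-- the right action of the symmetric group, `act σ X = X^σ` -/
  act : ∀ {n : ℕ}, Equiv.Perm (Fin n) → P n →ₗ[K] P n
  act_one : ∀ {n : ℕ} (X : P n), act 1 X = X
  act_mul : ∀ {n : ℕ} (σ τ : Equiv.Perm (Fin n)) (X : P n), act (σ * τ) X = act τ (act σ X)
  act_mem : ∀ {n : ℕ} (σ : Equiv.Perm (Fin n)) (p : ZMod 2) (X : P n),
    X ∈ par n p → act σ X ∈ par n p
  /-- the composition `comp ν h X Y = X ∘ (Y₁ ⊙ ⋯ ⊙ Yₘ)` -/
  comp : ∀ {m n : ℕ} (ν : Fin m → ℕ), ∑ j, ν j = n →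
    P m →ₗ[K] MultilinearMap K (fun j => P (ν j)) (P n)
  comp_mem : ∀ {m n : ℕ} (ν : Fin m → ℕ) (h : ∑ j, ν j = n) (x : ZMod 2) (y : Fin m → ZMod 2)
    (X : P m) (Y : ∀ j, P (ν j)), X ∈ par m x → (∀ j, Y j ∈ par (ν j) (y j)) →
    comp ν h X Y ∈ par n (x + ∑ j, y j)
  /-- the unit -/
  one : P 1
  one_mem : one ∈ par 1 0
  one_comp : ∀ {n : ℕ} (h : ∑ _j : Fin 1, n = n) (X : P n),
    comp (fun _ : Fin 1 => n) h one (fun _ => X) = X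
  comp_one : ∀ {n : ℕ} (h : ∑ _j : Fin n, 1 = n) (X : P n),
    comp (fun _ : Fin n => 1) h X (fun _ => one) = X
  /-- associativity, with the Koszul sign of
  `(Y₁ ⊙ ⋯ ⊙ Yₘ) ⊗ (Z₁ ⊙ ⋯ ⊙ Zₙ)` -/
  assoc : ∀ {l m n : ℕ} (ν : Fin m → ℕ) (h : ∑ j, ν j = n) (μ : Fin n → ℕ) (h' : ∑ k, μ k = l)
    (y : Fin m → ZMod 2) (z : Fin n → ZMod 2) (X : P m) (Y : ∀ j, P (ν j)) (Z : ∀ k, P (μ k)),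
    (∀ j, Y j ∈ par (ν j) (y j)) → (∀ k, Z k ∈ par (μ k) (z k)) →
    comp μ h' (comp ν h X Y) Z =
      shuffleSign (fun j => ∑ k, z (blk ν h ⟨j, k⟩)) y •
        comp (fun j => ∑ k, μ (blk ν h ⟨j, k⟩)) (sum_blocks h h') X
          (fun j => comp (fun k => μ (blk ν h ⟨j, k⟩)) rfl (Y j) (fun k => Z (blk ν h ⟨j, k⟩)))
  /-- equivariance: `X^σ ∘ (Y₁^{τ₁} ⊙ ⋯ ⊙ Yₘ^{τₘ}) = (X ∘ σ(Y₁ ⊙ ⋯ ⊙ Yₘ))^{σ(τ₁,…,τₘ)}` -/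
  equivariant : ∀ {m n : ℕ} (ν : Fin m → ℕ) (h : ∑ j, ν j = n) (σ : Equiv.Perm (Fin m))
    (τ : ∀ j, Equiv.Perm (Fin (ν j))) (y : Fin m → ZMod 2) (X : P m) (Y : ∀ j, P (ν j)),
    (∀ j, Y j ∈ par (ν j) (y j)) →
    comp ν h (act σ X) (fun j => act (τ j) (Y j)) =
      act (blockPerm ν h σ τ) (permSign σ y •
        comp (fun j => ν (σ.symm j)) (sum_comp_symm ν h σ) X (fun j => Y (σ.symm j)))

/-! ### Polynomial superalgebras -/

/-- The defining relations of the polynomial superalgebra on even `λ_a` and odd `θ_a^i`. -/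
inductive SPolyRel (K : Type*) [Field K] (N : ℕ) (A : Type*) :
    FreeAlgebra K (A ⊕ A × Fin N) → FreeAlgebra K (A ⊕ A × Fin N) → Prop
  | even_even (a b : A) : SPolyRel K N A
      (FreeAlgebra.ι K (Sum.inl a) * FreeAlgebra.ι K (Sum.inl b))
      (FreeAlgebra.ι K (Sum.inl b) * FreeAlgebra.ι K (Sum.inl a))
  | even_odd (a b : A) (i : Fin N) : SPolyRel K N A
      (FreeAlgebra.ι K (Sum.inl a) * FreeAlgebra.ι K (Sum.inr (b, i)))
      (FreeAlgebra.ι K (Sum.inr (b, i)) * FreeAlgebra.ι K (Sum.inl a))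
  | odd_odd (a b : A) (i j : Fin N) : SPolyRel K N A
      (FreeAlgebra.ι K (Sum.inr (a, i)) * FreeAlgebra.ι K (Sum.inr (b, j)) +
        FreeAlgebra.ι K (Sum.inr (b, j)) * FreeAlgebra.ι K (Sum.inr (a, i))) 0

/-- The polynomial superalgebra `K[Λ_a]_{a ∈ A}` of the `(1|N)_W`-supervariables
`Λ_a = (λ_a, θ_a^1, …, θ_a^N)`. -/
def SPoly (K : Type*) [Field K] (N : ℕ) (A : Type*) : Type _ := RingQuot (SPolyRel K N A)

namespace SPoly

variable {K : Type*} [Field K] {N : ℕ} {A B : Type*}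

instance : Ring (SPoly K N A) := inferInstanceAs (Ring (RingQuot (SPolyRel K N A)))

instance : Algebra K (SPoly K N A) := inferInstanceAs (Algebra K (RingQuot (SPolyRel K N A)))

/-- The quotient map from the free algebra. -/
def mk : FreeAlgebra K (A ⊕ A × Fin N) →ₐ[K] SPoly K N A :=
  RingQuot.mkAlgHom K (SPolyRel K N A)

theorem mk_rel {x y : FreeAlgebra K (A ⊕ A × Fin N)} (h : SPolyRel K N A x y) :
    mk x = (mk y : SPoly K N A) := RingQuot.mkAlgHom_rel K h

/-- The even variable `λ_a`. -/
def ev (a : A) : SPoly K N A := mk (FreeAlgebra.ι K (Sum.inl a))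

/-- The odd variable `θ_a^i`. -/
def od (a : A) (i : Fin N) : SPoly K N A := mk (FreeAlgebra.ι K (Sum.inr (a, i)))

theorem ev_mul_ev (a b : A) : (ev a * ev b : SPoly K N A) = ev b * ev a := by
  have := mk_rel (SPolyRel.even_even (K := K) (N := N) a b)
  simpa only [map_mul, ev, od] using this

theorem ev_mul_od (a b : A) (i : Fin N) : (ev a * od b i : SPoly K N A) = od b i * ev a := by
  have := mk_rel (SPolyRel.even_odd (K := K) a b i)
  simpa only [map_mul, ev, od] using this

theorem od_mul_od (a b : A) (i j : Fin N) :
    (od a i * od b j + od b j * od a i : SPoly K N A) = 0 := by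
  have := mk_rel (SPolyRel.odd_odd (K := K) a b i j)
  simpa only [map_mul, map_add, map_zero, ev, od] using this

/-- The universal property of the polynomial superalgebra. -/
def lift {R : Type*} [Ring R] [Algebra K R] (e : A → R) (o : A → Fin N → R)
    (hee : ∀ a b, e a * e b = e b * e a) (heo : ∀ a b i, e a * o b i = o b i * e a)
    (hoo : ∀ a b i j, o a i * o b j + o b j * o a i = 0) : SPoly K N A →ₐ[K] R :=
  RingQuot.liftAlgHom K ⟨FreeAlgebra.lift K (Sum.elim e (fun q => o q.1 q.2)), by
    intro x y hxy
    cases hxy with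
    | even_even a b => simpa using hee a b
    | even_odd a b i => simpa using heo a b i
    | odd_odd a b i j => simpa using hoo a b i j⟩

section
variable {R : Type*} [Ring R] [Algebra K R] {e : A → R} {o : A → Fin N → R}
    {hee : ∀ a b, e a * e b = e b * e a} {heo : ∀ a b i, e a * o b i = o b i * e a}
    {hoo : ∀ a b i j, o a i * o b j + o b j * o a i = 0}

@[simp] theorem lift_ev (a : A) :
    (lift e o hee heo hoo : SPoly K N A →ₐ[K] R) (ev a) = e a := by
  refine (RingQuot.liftAlgHom_mkAlgHom_apply K _ _ _).trans ?_
  simp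

@[simp] theorem lift_od (a : A) (i : Fin N) :
    (lift e o hee heo hoo : SPoly K N A →ₐ[K] R) (od a i) = o a i := by
  refine (RingQuot.liftAlgHom_mkAlgHom_apply K _ _ _).trans ?_
  simp

end

theorem algHom_ext {R : Type*} [Ring R] [Algebra K R] {f g : SPoly K N A →ₐ[K] R}
    (he : ∀ a, f (ev a) = g (ev a)) (ho : ∀ a i, f (od a i) = g (od a i)) : f = g := by
  refine RingQuot.ringQuot_ext' (S := K) (s := SPolyRel K N A) f g ?_
  refine FreeAlgebra.hom_ext (funext fun q => ?_)
  rcases q with a | ⟨a, i⟩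
  · exact he a
  · exact ho a i

/-- The parity involution `λ_a ↦ λ_a`, `θ_a^i ↦ -θ_a^i`. -/
def tau : SPoly K N A →ₐ[K] SPoly K N A :=
  lift ev (fun a i => -od a i) ev_mul_ev (fun a b i => by simp [ev_mul_od])
    (fun a b i j => by simpa using od_mul_od a b i j)

/-- The even (`p = 0`) and odd (`p = 1`) part of `K[Λ_a]_{a ∈ A}`, as eigenspaces of the parity
involution. -/
def par (p : ZMod 2) : Submodule K (SPoly K N A) where
  carrier := {a | tau a = sg p • a}
  add_mem' := by
    intro a b ha hb
    simp only [Set.mem_ofPred_eq, map_add, smul_add] at *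
    rw [ha, hb]
  zero_mem' := by simp
  smul_mem' := by
    intro c a ha
    simp only [Set.mem_ofPred_eq, map_smul] at *
    rw [ha, smul_comm]

/-- The linear substitution `Λ_a ↦ ∑_b c_{ab} Λ_b`. -/
def linSubst [Fintype B] (c : A → B → K) : SPoly K N A →ₐ[K] SPoly K N B :=
  lift (fun a => ∑ b, c a b • ev b) (fun a i => ∑ b, c a b • od b i)
    (fun a b => by
      exact (Commute.sum_left _ _ _ fun x _ => Commute.sum_right _ _ _ fun y _ =>
        Commute.smul_left (Commute.smul_right (ev_mul_ev x y) _) _).eq)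
    (fun a b i => by
      exact (Commute.sum_left _ _ _ fun x _ => Commute.sum_right _ _ _ fun y _ =>
        Commute.smul_left (Commute.smul_right (ev_mul_od x y i) _) _).eq)
    (fun a b i j => by
      rw [Finset.sum_mul_sum, Finset.sum_mul_sum, Finset.sum_comm, ← Finset.sum_add_distrib]
      refine Finset.sum_eq_zero fun x _ => ?_
      rw [← Finset.sum_add_distrib]
      refine Finset.sum_eq_zero fun y _ => ?_
      rw [smul_mul_smul_comm, smul_mul_smul_comm, mul_comm (c b x), ← smul_add, od_mul_od,
        smul_zero])

theorem linSubst_ev [Fintype B] (c : A → B → K) (a : A) :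
    linSubst c (ev a : SPoly K N A) = ∑ b, c a b • ev b := by
  simp [linSubst]

theorem linSubst_od [Fintype B] (c : A → B → K) (a : A) (i : Fin N) :
    linSubst c (od a i : SPoly K N A) = ∑ b, c a b • od b i := by
  simp [linSubst]

theorem tau_ev (a : A) : tau (ev a : SPoly K N A) = ev a := by simp [tau]

theorem tau_od (a : A) (i : Fin N) : tau (od a i : SPoly K N A) = -od a i := by simp [tau]

open Classical in
/-- The homomorphism `f ↦ f + ε ∂f/∂λ_a`, with `ε² = 0`, that is
`f(Λ) ↦ f(…, λ_a + ε, …)`. -/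
def taylor (a : A) : SPoly K N A →ₐ[K] DualNumber (SPoly K N A) :=
  lift (fun b => TrivSqZeroExt.inl (ev b) + if b = a then DualNumber.eps else 0)
    (fun b i => TrivSqZeroExt.inl (od b i))
    (fun b c => by
      ext
      · by_cases hb : b = a <;> by_cases hc : c = a <;> simp [hb, hc, ev_mul_ev]
      · by_cases hb : b = a <;> by_cases hc : c = a <;> simp [hb, hc, add_comm])
    (fun b c i => by
      ext
      · by_cases hb : b = a <;> simp [hb, ev_mul_od]
      · by_cases hb : b = a <;> simp [hb])
    (fun b c i j => by
      ext
      · simp [od_mul_od b c i j]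
      · simp)

/-- The partial derivative `∂/∂λ_a`. -/
def pd (a : A) : SPoly K N A →ₗ[K] SPoly K N A where
  toFun f := (taylor a f).snd
  map_add' f g := by simp
  map_smul' c f := by simp

theorem taylor_fst (a : A) (f : SPoly K N A) : (taylor a f).fst = f := by
  have : (TrivSqZeroExt.fstHom K (SPoly K N A) (SPoly K N A)).comp (taylor a) =
      AlgHom.id K (SPoly K N A) := by
    refine algHom_ext (fun b => ?_) (fun b i => ?_)
    · by_cases hb : b = a <;> simp [taylor, hb]
    · simp [taylor]
  exact DFunLike.congr_fun this f

theorem pd_mul (a : A) (f g : SPoly K N A) : pd a (f * g) = f * pd a g + pd a f * g := by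
  simp [pd, taylor_fst]

theorem pd_ev [DecidableEq A] (a b : A) : pd a (ev b : SPoly K N A) = if b = a then 1 else 0 := by
  by_cases hb : b = a <;> simp [pd, taylor, hb]

theorem pd_od (a b : A) (i : Fin N) : pd a (od b i : SPoly K N A) = 0 := by
  simp [pd, taylor]

end SPoly

/-! ### Supermodules over `H_W` -/

/-- The structure of an `H_W`-supermodule on `V`: a linear superspace with even and odd part
`par 0`, `par 1`, an even operator `T` and odd operators `S^1, …, S^N` such that
`T S^i = S^i T` and `S^i S^j + S^j S^i = 0`. -/
structure HWSupermodule (K : Type*) [Field K] (N : ℕ) (V : Type*) [AddCommGroup V]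
    [Module K V] where
  par : ZMod 2 → Submodule K V
  isInternal : DirectSum.IsInternal par
  T : V →ₗ[K] V
  S : Fin N → V →ₗ[K] V
  T_mem : ∀ p v, v ∈ par p → T v ∈ par p
  S_mem : ∀ i p v, v ∈ par p → S i v ∈ par (p + 1)
  T_S : ∀ i v, T (S i v) = S i (T v)
  S_S : ∀ i j v, S i (S j v) + S j (S i v) = 0

namespace HWSupermodule

variable {K : Type*} [Field K] {N : ℕ} {V : Type*} [AddCommGroup V] [Module K V]
  (H : HWSupermodule K N V)

/-- The projection of `V` onto its part of parity `p`. -/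
def proj (p : ZMod 2) : V →ₗ[K] V :=
  (H.par p).subtype ∘ₗ DirectSum.component K (ZMod 2) (fun q => H.par q) p ∘ₗ
    (LinearEquiv.ofBijective (DirectSum.coeLinearMap H.par) H.isInternal).symm.toLinearMap

/-- The parity involution `v ↦ (-1)^{p(v)} v` of `V`. -/
def eps : V →ₗ[K] V := H.proj 0 - H.proj 1

theorem proj_of_mem {p q : ZMod 2} {v : V} (hv : v ∈ H.par q) :
    H.proj p v = if q = p then v else 0 := by
  have h1 : (LinearEquiv.ofBijective (DirectSum.coeLinearMap H.par) H.isInternal).symm v =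
      DirectSum.lof K (ZMod 2) (fun q => H.par q) q ⟨v, hv⟩ := by
    rw [LinearEquiv.symm_apply_eq]
    exact (DirectSum.coeLinearMap_lof H.par q ⟨v, hv⟩).symm
  simp only [proj, LinearMap.comp_apply, LinearEquiv.coe_coe, h1]
  by_cases hq : q = p
  · subst hq
    simp [DirectSum.component.lof_self]
  · rw [DirectSum.component.of, dif_neg hq]
    simp [hq]

theorem eps_of_mem {p : ZMod 2} {v : V} (hv : v ∈ H.par p) : H.eps v = sg p • v := by
  simp only [eps, LinearMap.sub_apply, H.proj_of_mem hv, sg]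
  have h2 : ∀ q : ZMod 2, q = 0 ∨ q = 1 := by decide
  rcases h2 p with rfl | rfl <;> simp

theorem hom_induction {P : V → Prop} (hm : ∀ p v, v ∈ H.par p → P v)
    (ha : ∀ v w, P v → P w → P (v + w)) (v : V) : P v := by
  have hv : v ∈ ⨆ p, H.par p := by
    rw [H.isInternal.submodule_iSup_eq_top]; trivial
  exact Submodule.iSup_induction _ (motive := P) hv hm (hm 0 0 (zero_mem _)) ha

theorem eps_T (v : V) : H.eps (H.T v) = H.T (H.eps v) := by
  refine H.hom_induction (P := fun v => H.eps (H.T v) = H.T (H.eps v)) (fun p v hv => ?_)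
    (fun v w hv hw => by simp only [map_add, hv, hw]) v
  rw [H.eps_of_mem hv, H.eps_of_mem (H.T_mem p v hv), map_zsmul]

theorem eps_S (i : Fin N) (v : V) : H.eps (H.S i v) = -H.S i (H.eps v) := by
  refine H.hom_induction (P := fun v => H.eps (H.S i v) = -H.S i (H.eps v)) (fun p v hv => ?_)
    (fun v w hv hw => by simp only [map_add, hv, hw, neg_add]) v
  rw [H.eps_of_mem hv, H.eps_of_mem (H.S_mem i p v hv), map_zsmul, sg_add_one, neg_smul]

/-- The operator `T^{(k)}` on `V^{⊗n}`. -/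
def Tat {n : ℕ} (k : Fin n) : Module.End K (⨂[K] _ : Fin n, V) :=
  PiTensorProduct.map (fun i => if i = k then H.T else LinearMap.id)

/-- The odd operator `(S^i)^{(k)}` on `V^{⊗n}`:
`v₁ ⊗ ⋯ ⊗ vₙ ↦ (-1)^{p(v₁)+⋯+p(v_{k-1})} v₁ ⊗ ⋯ ⊗ S^i v_k ⊗ ⋯ ⊗ vₙ`. -/
def Sat {n : ℕ} (i : Fin N) (k : Fin n) : Module.End K (⨂[K] _ : Fin n, V) :=
  PiTensorProduct.map (fun l => if l < k then H.eps else if l = k then H.S i else LinearMap.id)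

theorem Tat_mul_Tat {n : ℕ} (k l : Fin n) : H.Tat k * H.Tat l = H.Tat l * H.Tat k := by
  refine PiTensorProduct.ext (MultilinearMap.ext fun x => ?_)
  simp only [Tat, LinearMap.compMultilinearMap_apply, Module.End.mul_apply,
    PiTensorProduct.map_tprod]
  congr 1
  funext a
  split_ifs <;> rfl

theorem Tat_mul_Sat {n : ℕ} (k l : Fin n) (i : Fin N) :
    H.Tat k * H.Sat i l = H.Sat i l * H.Tat k := by
  refine PiTensorProduct.ext (MultilinearMap.ext fun x => ?_)
  simp only [Tat, Sat, LinearMap.compMultilinearMap_apply, Module.End.mul_apply,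
    PiTensorProduct.map_tprod]
  congr 1
  funext a
  by_cases h1 : a = k
  · by_cases h2 : a < l
    · simp [h1 ▸ h2, h1, H.eps_T]
    · by_cases h3 : a = l
      · have : k = l := h1.symm.trans h3
        simp [h1, this, H.T_S]
      · simp [h1, h1 ▸ h2, h1 ▸ h3]
  · simp [h1]

theorem tprod_add_eq_zero {n : ℕ} (f g : Fin n → V) (j : Fin n) (h : ∀ l, l ≠ j → f l = g l)
    (hj : f j = -g j) : PiTensorProduct.tprod K f + PiTensorProduct.tprod K g = 0 := by
  have hf : f = Function.update g j ((-1 : K) • g j) := by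
    funext l
    by_cases hl : l = j
    · subst hl; simp [hj]
    · simp [hl, h l hl]
  rw [hf, MultilinearMap.map_update_smul]
  simp

theorem Sat_mul_Sat_aux {n : ℕ} (k l : Fin n) (hkl : k < l) (i j : Fin N) :
    H.Sat i k * H.Sat j l + H.Sat j l * H.Sat i k = 0 := by
  refine PiTensorProduct.ext (MultilinearMap.ext fun x => ?_)
  simp only [Sat, LinearMap.compMultilinearMap_apply, Module.End.mul_apply, LinearMap.add_apply,
    PiTensorProduct.map_tprod, LinearMap.zero_apply]
  refine tprod_add_eq_zero _ _ k (fun a ha => ?_) ?_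
  · by_cases h1 : a < k
    · simp [h1, h1.trans hkl]
    · simp [h1, ha]
  · simp [hkl, H.eps_S]

theorem Sat_mul_Sat {n : ℕ} (k l : Fin n) (i j : Fin N) :
    H.Sat i k * H.Sat j l + H.Sat j l * H.Sat i k = 0 := by
  rcases lt_trichotomy k l with hkl | hkl | hkl
  · exact H.Sat_mul_Sat_aux k l hkl i j
  · subst hkl
    refine PiTensorProduct.ext (MultilinearMap.ext fun x => ?_)
    simp only [Sat, LinearMap.compMultilinearMap_apply, Module.End.mul_apply, LinearMap.add_apply,
      PiTensorProduct.map_tprod, LinearMap.zero_apply]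
    refine tprod_add_eq_zero _ _ k (fun a ha => ?_) ?_
    · by_cases h1 : a < k <;> simp [h1, ha]
    · simpa using eq_neg_of_add_eq_zero_left (H.S_S i j (x k))
  · rw [add_comm]
    exact H.Sat_mul_Sat_aux l k hkl j i

end HWSupermodule

/-! ### The spaces `V_∇[Λ₁, …, Λₙ]` -/

section VNabla

variable {K : Type*} [Field K] {N : ℕ} {V : Type*} [AddCommGroup V] [Module K V]

/-- The relations `a (-∑_k λ_k) ⊗ v = a ⊗ T v` and `a (-∑_k θ_k^i) ⊗ v = a ⊗ S^i v` of the tensor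
product over `H_W`. -/
def relSub (H : HWSupermodule K N V) (n : ℕ) : Submodule K (SPoly K N (Fin n) ⊗[K] V) :=
  Submodule.span K
    ({x | ∃ a v, x = (a * ∑ k, SPoly.ev k) ⊗ₜ[K] v + a ⊗ₜ[K] H.T v} ∪
     {x | ∃ i a v, x = (a * ∑ k, SPoly.od k i) ⊗ₜ[K] v + a ⊗ₜ[K] H.S i v})

/-- `V_∇[Λ_k]_{k=1}^n = K[Λ_k]_{k=1}^n ⊗_{H_W} V`, where `T` and `S^i` act from the right on
`K[Λ_k]_{k=1}^n` as multiplication by `-∑_k λ_k` and `-∑_k θ_k^i`. -/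
def VNabla (H : HWSupermodule K N V) (n : ℕ) : Type _ :=
  (SPoly K N (Fin n) ⊗[K] V) ⧸ relSub H n

instance (H : HWSupermodule K N V) (n : ℕ) : AddCommGroup (VNabla H n) :=
  inferInstanceAs (AddCommGroup ((SPoly K N (Fin n) ⊗[K] V) ⧸ relSub H n))

instance (H : HWSupermodule K N V) (n : ℕ) : Module K (VNabla H n) :=
  inferInstanceAs (Module K ((SPoly K N (Fin n) ⊗[K] V) ⧸ relSub H n))

namespace VNabla

variable (H : HWSupermodule K N V) {m n : ℕ}

/-- The class of `a ⊗ v`. -/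
def mk (n : ℕ) : SPoly K N (Fin n) ⊗[K] V →ₗ[K] VNabla H n := (relSub H n).mkQ

theorem mk_T (a : SPoly K N (Fin n)) (v : V) :
    mk H n ((a * ∑ k, SPoly.ev k) ⊗ₜ[K] v) + mk H n (a ⊗ₜ[K] H.T v) = 0 := by
  rw [← map_add]
  exact (Submodule.Quotient.mk_eq_zero _).2 (Submodule.subset_span (Or.inl ⟨a, v, rfl⟩))

theorem mk_S (i : Fin N) (a : SPoly K N (Fin n)) (v : V) :
    mk H n ((a * ∑ k, SPoly.od k i) ⊗ₜ[K] v) + mk H n (a ⊗ₜ[K] H.S i v) = 0 := by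
  rw [← map_add]
  exact (Submodule.Quotient.mk_eq_zero _).2 (Submodule.subset_span (Or.inr ⟨i, a, v, rfl⟩))

section
variable {H} {W : Type*} [AddCommGroup W] [Module K W]

/-- The universal property of `V_∇[Λ_k]_{k=1}^n`. -/
def lift (f : SPoly K N (Fin n) ⊗[K] V →ₗ[K] W)
    (hT : ∀ a v, f ((a * ∑ k, SPoly.ev k) ⊗ₜ[K] v) + f (a ⊗ₜ[K] H.T v) = 0)
    (hS : ∀ i a v, f ((a * ∑ k, SPoly.od k i) ⊗ₜ[K] v) + f (a ⊗ₜ[K] H.S i v) = 0) :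
    VNabla H n →ₗ[K] W :=
  (relSub H n).liftQ f <| Submodule.span_le.2 <| by
    rintro x (⟨a, v, rfl⟩ | ⟨i, a, v, rfl⟩)
    · exact (map_add f _ _).trans (hT a v)
    · exact (map_add f _ _).trans (hS i a v)

@[simp] theorem lift_mk (f : SPoly K N (Fin n) ⊗[K] V →ₗ[K] W) (hT hS)
    (t : SPoly K N (Fin n) ⊗[K] V) :
    lift (H := H) f hT hS (mk H n t) = f t :=
  Submodule.liftQ_apply _ _ _

theorem hom_ext {f g : VNabla H n →ₗ[K] W}
    (h : ∀ a v, f (mk H n (a ⊗ₜ[K] v)) = g (mk H n (a ⊗ₜ[K] v))) : f = g :=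
  Submodule.linearMap_qext _ (TensorProduct.ext' h)

end

/-- The part of parity `r` of `V_∇[Λ_k]_{k=1}^n`. -/
def par (n : ℕ) (r : ZMod 2) : Submodule K (VNabla H n) :=
  Submodule.span K {x | ∃ p q a v, p + q = r ∧ a ∈ SPoly.par p ∧ v ∈ H.par q ∧
    x = mk H n (a ⊗ₜ[K] v)}

/-- Left multiplication by elements of `K[Λ_k]_{k=1}^n`. -/
def lmul (n : ℕ) : SPoly K N (Fin n) →ₗ[K] Module.End K (VNabla H n) where
  toFun b := lift (mk H n ∘ₗ TensorProduct.map (LinearMap.mulLeft K b) LinearMap.id)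
    (fun a v => by simpa [mul_assoc] using mk_T H (b * a) v)
    (fun i a v => by simpa [mul_assoc] using mk_S H i (b * a) v)
  map_add' b c := hom_ext fun a v => by simp [add_mul, TensorProduct.add_tmul]
  map_smul' r b := hom_ext fun a v => by simp [← TensorProduct.smul_tmul']

/-- The operator `∂/∂λ_k - ∂/∂λ_l` on `V_∇[Λ_k]_{k=1}^n`. -/
def pdSub (k l : Fin n) : Module.End K (VNabla H n) :=
  lift (mk H n ∘ₗ TensorProduct.map (SPoly.pd k - SPoly.pd l) LinearMap.id)
    (fun a v => by
      have h : (SPoly.pd k - SPoly.pd l : SPoly K N (Fin n) →ₗ[K] _) (a * ∑ j, SPoly.ev j) =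
          (SPoly.pd k a - SPoly.pd l a) * ∑ j, SPoly.ev j := by
        simp [SPoly.pd_mul, SPoly.pd_ev, sub_mul]
      simp only [LinearMap.comp_apply, TensorProduct.map_tmul, h]
      exact mk_T H _ v)
    (fun i a v => by
      have h : (SPoly.pd k - SPoly.pd l : SPoly K N (Fin n) →ₗ[K] _) (a * ∑ j, SPoly.od j i) =
          (SPoly.pd k a - SPoly.pd l a) * ∑ j, SPoly.od j i := by
        simp [SPoly.pd_mul, SPoly.pd_od, sub_mul]
      simp only [LinearMap.comp_apply, TensorProduct.map_tmul, h]
      exact mk_S H i _ v)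

/-- The map `V_∇[Λ₁, …, Λₘ] → V_∇[Λ₁, …, Λₙ]` given by the substitution
`Λ_j ↦ ∑_k c_{jk} Λ_k`, for coefficients with `∑_j c_{jk} = 1`. -/
def subst (c : Fin m → Fin n → K) (hc : ∀ k, ∑ j, c j k = 1) : VNabla H m →ₗ[K] VNabla H n :=
  lift (mk H n ∘ₗ TensorProduct.map (SPoly.linSubst c).toLinearMap LinearMap.id)
    (fun a v => by
      have h : SPoly.linSubst c (∑ j, SPoly.ev j : SPoly K N (Fin m)) = ∑ k, SPoly.ev k := by
        simp only [map_sum, SPoly.linSubst_ev]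
        rw [Finset.sum_comm]
        simp [← Finset.sum_smul, hc]
      simp only [LinearMap.comp_apply, TensorProduct.map_tmul, AlgHom.toLinearMap_apply,
        map_mul, h]
      exact mk_T H _ v)
    (fun i a v => by
      have h : SPoly.linSubst c (∑ j, SPoly.od j i : SPoly K N (Fin m)) = ∑ k, SPoly.od k i := by
        simp only [map_sum, SPoly.linSubst_od]
        rw [Finset.sum_comm]
        simp [← Finset.sum_smul, hc]
      simp only [LinearMap.comp_apply, TensorProduct.map_tmul, AlgHom.toLinearMap_apply,
        map_mul, h]
      exact mk_S H i _ v)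

/-- The substitution `Λ_k ↦ Λ_{σ⁻¹(k)}`. -/
def perm (σ : Equiv.Perm (Fin n)) : VNabla H n →ₗ[K] VNabla H n :=
  subst H (fun k l => if σ.symm k = l then 1 else 0) (fun l => by simp [Equiv.symm_apply_eq])

/-- The substitution `Λ_j ↦ Λ'_j = ∑_{k in the j-th block} Λ_k`, the block of `k` being `b k`. -/
def collect (b : Fin n → Fin m) : VNabla H m →ₗ[K] VNabla H n :=
  subst H (fun j k => if b k = j then 1 else 0) (fun k => by simp)

/-- The isomorphism `V[Λ₁, …, Λ_{n-1}] → V_∇[Λ₁, …, Λₙ]` induced by the inclusion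
`K[Λ₁, …, Λ_{n-1}] ⊂ K[Λ₁, …, Λₙ]`, inverse to the substitution
`Λₙ ↦ -Λ₁ - ⋯ - Λ_{n-1} - ∇`. For `n = 0` it is the quotient map `V → V_∇[] = V / ∇V`. -/
def ofReduced (n : ℕ) : SPoly K N (Fin (n - 1)) ⊗[K] V →ₗ[K] VNabla H n :=
  mk H n ∘ₗ TensorProduct.map
    (SPoly.linSubst fun k l => if Fin.castLE (Nat.sub_le n 1) k = l then 1 else 0).toLinearMap
    LinearMap.id

end VNabla

end VNabla

/-! ### Quivers -/

/-- An `n`-quiver without loops, with vertex set `{1, …, n}`, whose edges are elements of the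
ambient set `ι`: `arrow e = some (a, b)` means that `e` is an edge with source `a` and target `b`,
and `arrow e = none` that `e` is not an edge. -/
@[ext]
structure Quiv (ι : Type*) (n : ℕ) where
  arrow : ι → Option (Fin n × Fin n)
  noLoop : ∀ e a, arrow e ≠ some (a, a)

namespace Quiv

variable {ι : Type*} {m n : ℕ}

/-- The edge `e` joins the vertices `a` and `b` in the underlying graph. -/
def Joins (Q : Quiv ι n) (e : ι) (a b : Fin n) : Prop :=
  Q.arrow e = some (a, b) ∨ Q.arrow e = some (b, a)

/-- `L` is the list of the successive edges of a path from `a` to `b` in the underlying graph. -/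
def IsPath (Q : Quiv ι n) : Fin n → List ι → Fin n → Prop
  | a, [], b => a = b
  | a, e :: L, b => ∃ c, Q.Joins e a c ∧ Q.IsPath c L b

/-- `L` is the list of the successive edges of a directed path from `a` to `b`. -/
def IsDirPath (Q : Quiv ι n) : Fin n → List ι → Fin n → Prop
  | a, [], b => a = b
  | a, e :: L, b => ∃ c, Q.arrow e = some (a, c) ∧ Q.IsDirPath c L b

/-- The underlying graph contains no cycle, that is, no closed path of positive length without
repeated edges. -/
def Acyclic (Q : Quiv ι n) : Prop :=
  ∀ a L, L ≠ [] → L.Nodup → ¬Q.IsPath a L a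

/-- `L` is the list of the successive edges of a directed cycle. -/
def IsDirCycle (Q : Quiv ι n) (L : List ι) : Prop :=
  L ≠ [] ∧ L.Nodup ∧ ∃ a, Q.IsDirPath a L a

/-- The vertices `a` and `b` are in the same connected component of the underlying graph. -/
def Conn (Q : Quiv ι n) (a b : Fin n) : Prop := ∃ L, Q.IsPath a L b

/-- The quiver `σQ`. -/
def perm (σ : Equiv.Perm (Fin n)) (Q : Quiv ι n) : Quiv ι n where
  arrow e := (Q.arrow e).map (Prod.map σ σ)
  noLoop e a h := by
    obtain ⟨⟨b, c⟩, h1, h2⟩ := Option.map_eq_some_iff.1 h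
    simp only [Prod.map_apply, Prod.mk.injEq] at h2
    have : b = c := σ.injective (h2.1.trans h2.2.symm)
    subst this
    exact Q.noLoop e b h1

open Classical in
/-- The quiver `Q ∖ α` obtained by removing the edge `α`. -/
def del (Q : Quiv ι n) (α : ι) : Quiv ι n where
  arrow e := if e = α then none else Q.arrow e
  noLoop e a h := by
    split_ifs at h
    exact Q.noLoop e a h

/-- The quiver `Δ_0^ν(Q)`: contract every block to a vertex and keep the edges between different
blocks. -/
def contract (ν : Fin m → ℕ) (h : ∑ j, ν j = n) (Q : Quiv ι n) : Quiv ι m where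
  arrow e := (Q.arrow e).bind fun q =>
    if blkIdx ν h q.1 = blkIdx ν h q.2 then none else some (blkIdx ν h q.1, blkIdx ν h q.2)
  noLoop e a he := by
    obtain ⟨q, -, h2⟩ := Option.bind_eq_some_iff.1 he
    split_ifs at h2 with h3
    simp only [Option.some.injEq, Prod.mk.injEq] at h2
    exact h3 (h2.1.trans h2.2.symm)

/-- The position in the `j`-th block of an element of this block. -/
def pos (ν : Fin m → ℕ) (h : ∑ j, ν j = n) {j : Fin m} {a : Fin n} (ha : blkIdx ν h a = j) :
    Fin (ν j) :=
  Fin.cast (congrArg ν ha) ((blk ν h).symm a).2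

theorem blk_pos (ν : Fin m → ℕ) (h : ∑ j, ν j = n) {j : Fin m} {a : Fin n}
    (ha : blkIdx ν h a = j) : blk ν h ⟨j, pos ν h ha⟩ = a := by
  subst ha
  exact (blk ν h).apply_symm_apply a

/-- The quiver `Δ_j^ν(Q)`: keep the vertices of the `j`-th block and the edges between them. -/
def sub (ν : Fin m → ℕ) (h : ∑ j, ν j = n) (Q : Quiv ι n) (j : Fin m) : Quiv ι (ν j) where
  arrow e := (Q.arrow e).bind fun q =>
    if hq : blkIdx ν h q.1 = j ∧ blkIdx ν h q.2 = j then
      some (pos ν h hq.1, pos ν h hq.2)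
    else none
  noLoop e a he := by
    obtain ⟨⟨b, c⟩, h1, h2⟩ := Option.bind_eq_some_iff.1 he
    split_ifs at h2 with h3
    simp only [Option.some.injEq, Prod.mk.injEq] at h2
    have hb := blk_pos ν h h3.1
    have hc := blk_pos ν h h3.2
    simp only [h2.1] at hb
    simp only [h2.2] at hc
    have : b = c := hb.symm.trans hc
    subst this
    exact Q.noLoop e b h1

/-- The vertex `i ∈ {1, …, m}` is externally connected to the vertex `j ∈ {1, …, n}`: in the
underlying graph of `Δ_0^ν(Q)` there is a path without repeated edges from `i` to the block of
`j`, one of whose edges is incident in `Q` to the vertex `j`. -/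
def ExtConn (ν : Fin m → ℕ) (h : ∑ j, ν j = n) (Q : Quiv ι n) (i : Fin m) (j : Fin n) : Prop :=
  ∃ L : List ι, L.Nodup ∧ (Q.contract ν h).IsPath i L (blkIdx ν h j) ∧
    ∃ e ∈ L, ∃ a, Q.Joins e j a

end Quiv

/-! ### The superspaces `P^cl_W(V)(n)` -/

section Pcl

variable {K : Type*} [Field K] {N : ℕ} {V : Type*} [AddCommGroup V] [Module K V]
  (H : HWSupermodule K N V) (ι : Type*)

/-- The linear maps `V^{⊗n} ⊗ K𝒬(n) → V_∇[Λ₁, …, Λₙ]`. -/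
abbrev PHom (n : ℕ) : Type _ :=
  ((⨂[K] _ : Fin n, V) ⊗[K] (Quiv ι n →₀ K)) →ₗ[K] VNabla H n

variable {H ι} {m n : ℕ}

/-- The linear map `X^Q = X(- ⊗ Q)`. -/
def PHom.at (X : PHom H ι n) (Q : Quiv ι n) : (⨂[K] _ : Fin n, V) →ₗ[K] VNabla H n :=
  X ∘ₗ (TensorProduct.mk K _ _).flip (Finsupp.single Q 1)

open Classical in
/-- `X` is a map of parity `x` which satisfies the cycle relations and the sesquilinearity
conditions. -/
structure IsPcl (x : ZMod 2) (X : PHom H ι n) : Prop where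
  parity : ∀ (Q : Quiv ι n) (p : Fin n → ZMod 2) (v : Fin n → V), (∀ i, v i ∈ H.par (p i)) →
    X.at Q (PiTensorProduct.tprod K v) ∈ VNabla.par H n (x + ∑ i, p i)
  cycle₁ : ∀ Q : Quiv ι n, ¬Q.Acyclic → X.at Q = 0
  cycle₂ : ∀ (Q : Quiv ι n) (L : List ι), Q.IsDirCycle L →
    (L.map fun α => X.at (Q.del α)).sum = 0
  sesq₁ : ∀ (Q : Quiv ι n) (k l : Fin n), Q.Conn k l → ∀ t, VNabla.pdSub H k l (X.at Q t) = 0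
  sesq₂ : ∀ (Q : Quiv ι n) (k : Fin n) (t : ⨂[K] _ : Fin n, V),
    ∑ l with Q.Conn k l, X.at Q (H.Tat l t) =
      -∑ l with Q.Conn k l, VNabla.lmul H n (SPoly.ev l) (X.at Q t)
  sesq₃ : ∀ (Q : Quiv ι n) (k : Fin n) (i : Fin N) (t : ⨂[K] _ : Fin n, V),
    X.at Q (H.Sat i k t) = -(sg x • VNabla.lmul H n (SPoly.od k i) (X.at Q t))

theorem PHom.at_add (X Y : PHom H ι n) (Q : Quiv ι n) : (X + Y).at Q = X.at Q + Y.at Q := rfl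

theorem PHom.at_smul (c : K) (X : PHom H ι n) (Q : Quiv ι n) : (c • X).at Q = c • X.at Q := rfl

theorem PHom.at_zero (Q : Quiv ι n) : (0 : PHom H ι n).at Q = 0 := rfl

variable (H ι n)

/-- The part of parity `x` of `P^cl_W(V)(n)`. -/
def pclPar (x : ZMod 2) : Submodule K (PHom H ι n) where
  carrier := {X | IsPcl x X}
  zero_mem' := by
    constructor <;> intros <;> simp [PHom.at_zero]
  add_mem' := by
    intro X Y hX hY
    constructor
    · intro Q p v hv
      exact add_mem (hX.parity Q p v hv) (hY.parity Q p v hv)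
    · intro Q hQ
      rw [PHom.at_add, hX.cycle₁ Q hQ, hY.cycle₁ Q hQ, add_zero]
    · intro Q L hL
      simp only [PHom.at_add, List.sum_map_add]
      rw [hX.cycle₂ Q L hL, hY.cycle₂ Q L hL, add_zero]
    · intro Q k l hkl t
      rw [PHom.at_add, LinearMap.add_apply, map_add, hX.sesq₁ Q k l hkl, hY.sesq₁ Q k l hkl,
        add_zero]
    · intro Q k t
      simp only [PHom.at_add, LinearMap.add_apply, map_add, Finset.sum_add_distrib]
      rw [hX.sesq₂ Q k t, hY.sesq₂ Q k t, neg_add]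
    · intro Q k i t
      simp only [PHom.at_add, LinearMap.add_apply, map_add, smul_add]
      rw [hX.sesq₃ Q k i t, hY.sesq₃ Q k i t, neg_add]
  smul_mem' := by
    intro c X hX
    constructor
    · intro Q p v hv
      exact Submodule.smul_mem _ c (hX.parity Q p v hv)
    · intro Q hQ
      rw [PHom.at_smul, hX.cycle₁ Q hQ, smul_zero]
    · intro Q L hL
      have := congrArg (fun f => c • f) (hX.cycle₂ Q L hL)
      simpa only [PHom.at_smul, List.smul_sum, List.map_map, Function.comp_def, smul_zero]
        using this
    · intro Q k l hkl t
      rw [PHom.at_smul, LinearMap.smul_apply, map_smul, hX.sesq₁ Q k l hkl, smul_zero]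
    · intro Q k t
      simp only [PHom.at_smul, LinearMap.smul_apply, map_smul, ← Finset.smul_sum]
      rw [hX.sesq₂ Q k t, smul_neg]
    · intro Q k i t
      simp only [PHom.at_smul, LinearMap.smul_apply, map_smul]
      rw [hX.sesq₃ Q k i t, smul_neg, smul_comm]

/-- The linear superspace `P^cl_W(V)(n)`. -/
def Pcl : Submodule K (PHom H ι n) := ⨆ x, pclPar H ι n x

/-- The even and the odd part of `P^cl_W(V)(n)`. -/
def Pcl.par (x : ZMod 2) : Submodule K (Pcl H ι n) :=
  (pclPar H ι n x).comap (Pcl H ι n).subtype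

variable {H ι n}

/-! ### The action of the symmetric groups -/

/-- The left action of the symmetric group on `V^{⊗n}`, with the Koszul sign: for `v_i` of parity
`p_i` one has `σ(v₁ ⊗ ⋯ ⊗ vₙ) = permSign σ p • v_{σ⁻¹(1)} ⊗ ⋯ ⊗ v_{σ⁻¹(n)}`. -/
def permTensor (H : HWSupermodule K N V) (σ : Equiv.Perm (Fin n)) :
    Module.End K (⨂[K] _ : Fin n, V) :=
  ∑ p : Fin n → ZMod 2, permSign σ p •
    ((PiTensorProduct.reindex K (fun _ => V) σ).toLinearMap ∘ₗ
      PiTensorProduct.map (fun i => H.proj (p i)))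

/-- The map `X^σ(v ⊗ Q) = X_{σ(Λ₁,…,Λₙ)}(σ v ⊗ σ Q)`. -/
def PHom.act (σ : Equiv.Perm (Fin n)) (X : PHom H ι n) : PHom H ι n :=
  VNabla.perm H σ ∘ₗ X ∘ₗ
    TensorProduct.map (permTensor H σ) (Finsupp.lmapDomain K K (Quiv.perm σ))

/-! ### The unit and the composition -/

variable (H ι) in
/-- The identity of `V` as a map `V ⊗ K𝒬(1) → V_∇[Λ₁] ≅ V`. -/
def PHom.one : PHom H ι 1 :=
  VNabla.mk H 1 ∘ₗ TensorProduct.mk K (SPoly K N (Fin 1)) V 1 ∘ₗ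
    (TensorProduct.rid K V).toLinearMap ∘ₗ
      TensorProduct.map
        (PiTensorProduct.subsingletonEquiv (R := K) (s := fun _ : Fin 1 => V) 0).toLinearMap
        (Finsupp.linearCombination K fun _ : Quiv ι 1 => (1 : K))

/-- The elements `Λ_k` and `Λ'_j = ∑_{b k = j} Λ_k`: even components. -/
def xiEv (K : Type*) [Field K] (N : ℕ) (b : Fin n → Fin m) :
    Fin n ⊕ Fin m → SPoly K N (Fin n) :=
  Sum.elim SPoly.ev fun j => ∑ k with b k = j, SPoly.ev k

/-- The elements `Λ_k` and `Λ'_j = ∑_{b k = j} Λ_k`: odd components. -/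
def xiOd (K : Type*) [Field K] {N : ℕ} (b : Fin n → Fin m) (i : Fin N) :
    Fin n ⊕ Fin m → SPoly K N (Fin n) :=
  Sum.elim (fun k => SPoly.od k i) fun j => ∑ k with b k = j, SPoly.od k i

section xi
variable (b : Fin n → Fin m)

theorem xiEv_inr (j : Fin m) : ∃ s : Finset (Fin n), xiEv K N b (Sum.inr j) = ∑ k ∈ s, SPoly.ev k :=
  ⟨Finset.univ.filter fun k => b k = j, by rw [xiEv, Sum.elim_inr]⟩

theorem xiOd_inr (i : Fin N) (j : Fin m) :
    ∃ s : Finset (Fin n), xiOd K b i (Sum.inr j) = ∑ k ∈ s, SPoly.od k i :=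
  ⟨Finset.univ.filter fun k => b k = j, by rw [xiOd, Sum.elim_inr]⟩

theorem xiEv_mul_xiEv (x y : Fin n ⊕ Fin m) :
    xiEv K N b x * xiEv K N b y = xiEv K N b y * xiEv K N b x := by
  have h (k l : Fin n) : Commute (SPoly.ev k : SPoly K N (Fin n)) (SPoly.ev l) :=
    SPoly.ev_mul_ev k l
  refine (show Commute _ _ from ?_).eq
  rcases x with x | x <;> rcases y with y | y
  · exact h x y
  · obtain ⟨t, ht⟩ := xiEv_inr (K := K) (N := N) b y
    rw [ht]; exact Commute.sum_right _ _ _ fun l _ => h x l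
  · obtain ⟨s, hs⟩ := xiEv_inr (K := K) (N := N) b x
    rw [hs]; exact Commute.sum_left _ _ _ fun k _ => h k y
  · obtain ⟨s, hs⟩ := xiEv_inr (K := K) (N := N) b x
    obtain ⟨t, ht⟩ := xiEv_inr (K := K) (N := N) b y
    rw [hs, ht]
    exact Commute.sum_left _ _ _ fun k _ => Commute.sum_right _ _ _ fun l _ => h k l

theorem xiEv_mul_xiOd (x y : Fin n ⊕ Fin m) (i : Fin N) :
    xiEv K N b x * xiOd K b i y = xiOd K b i y * xiEv K N b x := by
  have h (k l : Fin n) : Commute (SPoly.ev k : SPoly K N (Fin n)) (SPoly.od l i) :=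
    SPoly.ev_mul_od k l i
  refine (show Commute _ _ from ?_).eq
  rcases x with x | x <;> rcases y with y | y
  · exact h x y
  · obtain ⟨t, ht⟩ := xiOd_inr (K := K) b i y
    rw [ht]; exact Commute.sum_right _ _ _ fun l _ => h x l
  · obtain ⟨s, hs⟩ := xiEv_inr (K := K) (N := N) b x
    rw [hs]; exact Commute.sum_left _ _ _ fun k _ => h k y
  · obtain ⟨s, hs⟩ := xiEv_inr (K := K) (N := N) b x
    obtain ⟨t, ht⟩ := xiOd_inr (K := K) b i y
    rw [hs, ht]
    exact Commute.sum_left _ _ _ fun k _ => Commute.sum_right _ _ _ fun l _ => h k l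

theorem xiOd_mul_xiOd (x y : Fin n ⊕ Fin m) (i j : Fin N) :
    xiOd K b i x * xiOd K b j y + xiOd K b j y * xiOd K b i x = 0 := by
  rcases x with x | x <;> rcases y with y | y <;>
    simp only [xiOd, Sum.elim_inl, Sum.elim_inr]
  · exact SPoly.od_mul_od x y i j
  · simp [Finset.mul_sum, Finset.sum_mul, ← Finset.sum_add_distrib, SPoly.od_mul_od]
  · simp [Finset.mul_sum, Finset.sum_mul, ← Finset.sum_add_distrib, SPoly.od_mul_od]
  · rw [Finset.sum_mul_sum, Finset.sum_mul_sum, Finset.sum_comm, ← Finset.sum_add_distrib]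
    refine Finset.sum_eq_zero fun k _ => ?_
    rw [← Finset.sum_add_distrib]
    exact Finset.sum_eq_zero fun l _ => SPoly.od_mul_od l k i j

theorem tau_xiEv (x : Fin n ⊕ Fin m) : SPoly.tau (xiEv K N b x) = xiEv K N b x := by
  rcases x with x | x <;> simp [xiEv, SPoly.tau_ev]

theorem tau_xiOd (x : Fin n ⊕ Fin m) (i : Fin N) :
    SPoly.tau (xiOd K b i x) = -xiOd K b i x := by
  rcases x with x | x <;> simp [xiOd, SPoly.tau_od]

variable (H) in
/-- The operators `0` and `T^{(j)}` on `V^{⊗m}`: the second components of `Λ_k` and `Ξ_j`. -/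
def xiT : Fin n ⊕ Fin m → Module.End K (⨂[K] _ : Fin m, V) :=
  Sum.elim (fun _ => 0) H.Tat

variable (H) in
/-- The operators `0` and `(S^i)^{(j)}` on `V^{⊗m}`. -/
def xiS (i : Fin N) : Fin n ⊕ Fin m → Module.End K (⨂[K] _ : Fin m, V) :=
  Sum.elim (fun _ => 0) (H.Sat i)

theorem xiT_mul_xiT (x y : Fin n ⊕ Fin m) (t : ⨂[K] _ : Fin m, V) :
    xiT H x (xiT H y t) = xiT H y (xiT H x t) := by
  rcases x with x | x <;> rcases y with y | y <;> simp only [xiT, Sum.elim_inl, Sum.elim_inr,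
    LinearMap.zero_apply, map_zero]
  exact LinearMap.congr_fun (H.Tat_mul_Tat x y) t

theorem xiT_mul_xiS (x y : Fin n ⊕ Fin m) (i : Fin N) (t : ⨂[K] _ : Fin m, V) :
    xiT H x (xiS H i y t) = xiS H i y (xiT H x t) := by
  rcases x with x | x <;> rcases y with y | y <;> simp only [xiT, xiS, Sum.elim_inl, Sum.elim_inr,
    LinearMap.zero_apply, map_zero]
  exact LinearMap.congr_fun (H.Tat_mul_Sat x y i) t

theorem xiS_mul_xiS (x y : Fin n ⊕ Fin m) (i j : Fin N) (t : ⨂[K] _ : Fin m, V) :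
    xiS H i x (xiS H j y t) = -xiS H j y (xiS H i x t) := by
  rcases x with x | x <;> rcases y with y | y <;> simp only [xiS, Sum.elim_inl, Sum.elim_inr,
    LinearMap.zero_apply, map_zero, neg_zero]
  exact eq_neg_of_add_eq_zero_left (LinearMap.congr_fun (H.Sat_mul_Sat x y i j) t)

end xi

/-- The action of `K[Λ₁, …, Λₙ, Ξ₁, …, Ξₘ]` on `K[Λ₁, …, Λₙ] ⊗ V^{⊗m}` in which `Λ_k` acts by
multiplication and `Ξ_j` as `Λ'_j + ∇^{(j)}`, where `Λ'_j` is the sum of the `Λ_k` with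
`b k = j`. The odd operators `(S^i)^{(j)}` act by
`a ⊗ t ↦ (-1)^{p(a)} a ⊗ (S^i)^{(j)} t`. -/
def xiAction (H : HWSupermodule K N V) (b : Fin n → Fin m) :
    SPoly K N (Fin n ⊕ Fin m) →ₐ[K]
      Module.End K (SPoly K N (Fin n) ⊗[K] (⨂[K] _ : Fin m, V)) :=
  SPoly.lift
    (fun x => TensorProduct.map (LinearMap.mulLeft K (xiEv K N b x)) LinearMap.id +
      TensorProduct.map LinearMap.id (xiT H x))
    (fun x i => TensorProduct.map (LinearMap.mulLeft K (xiOd K b i x)) LinearMap.id +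
      TensorProduct.map SPoly.tau.toLinearMap (xiS H i x))
    (fun x y => by
      refine TensorProduct.ext' fun a t => ?_
      simp only [Module.End.mul_apply, LinearMap.add_apply, TensorProduct.map_tmul, map_add,
        LinearMap.mulLeft_apply, LinearMap.id_apply, xiT_mul_xiT x y, ← mul_assoc,
        xiEv_mul_xiEv b x y]
      abel)
    (fun x y i => by
      refine TensorProduct.ext' fun a t => ?_
      simp only [Module.End.mul_apply, LinearMap.add_apply, TensorProduct.map_tmul, map_add,
        LinearMap.mulLeft_apply, LinearMap.id_apply, xiT_mul_xiS x y, ← mul_assoc,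
        xiEv_mul_xiOd b x y, AlgHom.toLinearMap_apply, map_mul, tau_xiEv]
      abel)
    (fun x y i j => by
      refine TensorProduct.ext' fun a t => ?_
      have hO := eq_neg_of_add_eq_zero_left (xiOd_mul_xiOd (K := K) b x y i j)
      simp only [Module.End.mul_apply, LinearMap.add_apply, TensorProduct.map_tmul, map_add,
        LinearMap.mulLeft_apply, LinearMap.id_apply, xiS_mul_xiS x y i j, ← mul_assoc, hO,
        AlgHom.toLinearMap_apply, map_mul, tau_xiOd, neg_mul, TensorProduct.neg_tmul,
        TensorProduct.tmul_neg, LinearMap.zero_apply]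
      abel)

open Classical in
/-- The substitution `Λ_k ↦ Λ_{N_{j-1}+k} + ∑_{i ∈ ℰ(N_{j-1}+k)} Ξ_i` for `k = 1, …, ν_j - 1`, where
`N_{j-1} = ν_1 + ⋯ + ν_{j-1}` and `ℰ(l)` is the set of the vertices `i` externally connected
to `l`. -/
def shift (K : Type*) [Field K] (N : ℕ) (ν : Fin m → ℕ) (h : ∑ j, ν j = n) (Q : Quiv ι n)
    (j : Fin m) : SPoly K N (Fin (ν j - 1)) →ₐ[K] SPoly K N (Fin n ⊕ Fin m) :=
  SPoly.linSubst fun k => Sum.elim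
    (fun l => if blk ν h ⟨j, Fin.castLE (Nat.sub_le _ 1) k⟩ = l then 1 else 0)
    (fun i => if Q.ExtConn ν h i (blk ν h ⟨j, Fin.castLE (Nat.sub_le _ 1) k⟩) then 1 else 0)

/-- The map `a ⊗ t ↦ (-1)^{x p(a)} a X^Q_{Λ'₁,…,Λ'ₘ}(t)`, where `x` is the parity of `X`. -/
def PHom.extend (x : ZMod 2) (X : PHom H ι m) (Q : Quiv ι m) (b : Fin n → Fin m) :
    SPoly K N (Fin n) ⊗[K] (⨂[K] _ : Fin m, V) →ₗ[K] VNabla H n :=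
  TensorProduct.lift
    ((LinearMap.lcomp K (VNabla H n) (VNabla.collect H b ∘ₗ X.at Q)) ∘ₗ VNabla.lmul H n ∘ₗ
      if x = 0 then LinearMap.id else SPoly.tau.toLinearMap)

/-- `Z` is the composite `X ∘ (Y₁ ⊙ ⋯ ⊙ Yₘ)` of the maps `X` of parity `x` and `Y_j` of parity
`y_j`. That is, for homogeneous `v₁, …, vₙ`, the blocks of which are denoted by `w₁, …, wₘ`, write
`Y_j^{Δ_j(Q)}(w_j) = ∑_s a_{j,s} u_{j,s}` in `V[Λ_k]_k`, with `k` running through the `j`-th block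
without its last element and with homogeneous `a_{j,s}` and `u_{j,s}`. Then
`Z^Q(v₁ ⊗ ⋯ ⊗ vₙ)` is the sum over all `s₁, …, sₘ` of the terms
`± X^{Δ_0(Q)}_{Λ'₁,…,Λ'ₘ}(a|_{Ξ_j = Λ'_j + ∇^{(j)}} (u_{1,s₁} ⊗ ⋯ ⊗ u_{m,sₘ}))`, where
`a = ∏_j a_{j,s_j}(Λ_k + ∑_{i ∈ ℰ(k)} Ξ_i)` and `±` is the Koszul sign. -/
def IsComposite (ν : Fin m → ℕ) (h : ∑ j, ν j = n) (x : ZMod 2) (X : PHom H ι m)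
    (y : Fin m → ZMod 2) (Y : ∀ j, PHom H ι (ν j)) (Z : PHom H ι n) : Prop :=
  ∀ (Q : Quiv ι n) (p : Fin n → ZMod 2) (v : Fin n → V)
    (r : Fin m → ℕ) (α β : ∀ j, Fin (r j) → ZMod 2)
    (a : ∀ j, Fin (r j) → SPoly K N (Fin (ν j - 1))) (u : ∀ j, Fin (r j) → V),
    (∀ k, v k ∈ H.par (p k)) →
    (∀ j s, a j s ∈ SPoly.par (α j s)) → (∀ j s, u j s ∈ H.par (β j s)) →
    (∀ j, (Y j).at (Q.sub ν h j) (PiTensorProduct.tprod K fun k => v (blk ν h ⟨j, k⟩)) =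
      VNabla.ofReduced H (ν j) (∑ s, a j s ⊗ₜ[K] u j s)) →
    Z.at Q (PiTensorProduct.tprod K v) =
      shuffleSign (fun j => ∑ k, p (blk ν h ⟨j, k⟩)) y •
        ∑ s : ∀ j, Fin (r j),
          shuffleSign (fun j => β j (s j)) (fun j => α j (s j)) •
            X.extend x (Q.contract ν h) (blkIdx ν h)
              (xiAction H (blkIdx ν h) (List.ofFn fun j => shift K N ν h Q j (a j (s j))).prod
                (1 ⊗ₜ[K] PiTensorProduct.tprod K fun j => u j (s j)))

end Pcl

end SUSYCoisson

end

open SUSYCoisson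

noncomputable section

namespace SUSYCoisson

/-! ### Sign calculus -/

/-! Everything is computed with one multilinear map. For a quiver `Q` on `n` vertices cut into
blocks, `glue x X Q ν h` takes one element of `V_∇[Λ_k]_k` for each block to `V_∇[Λ₁, …, Λₙ]`, and
the composite is, up to the Koszul sign, `glue` applied to the values `Y_j^{Δ_j(Q)}(w_j)`. The
composition formula eliminates the last variable of each block. `preGlue` instead substitutes `Λ_k ↦
Λ_k + ∑_{i ∈ ℰ(k)} Ξ_i` for all variables of arbitrary representatives, and `preGlue_eq_zero` shows
that the defining relations of `V_∇` are respected. Hence the result depends on no choice, and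
eliminating the last variables is just one way of choosing representatives.

Two facts about `X` drive this. The odd components of `Ξ_j = Λ'_j + ∇^{(j)}` are killed by `X`
(`PHom.core_inr_od`), so odd variables contribute only signs. The even components of the `Ξ_j` sum
to zero over every connected component of `Δ_0(Q)` (`PHom.sum_core_inr_ev`). If `Δ_0(Q)` has a
cycle, `X` vanishes there, so `Δ_0(Q)` may be taken to be a forest.

The combinatorics of external connections becomes a calculus of flows. A family `ρ_i` whose sum over
each component of a graph is zero is minus the divergence of a flow on its edges
(`Quiv.exists_flow`). In a forest the flow through an edge is the total of the sinks beyond that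
edge, so the same flow read on `Q` leaves the vertex `a` with the net amount `∑_{i ∈ ℰ(a)} ρ_i`
(`Quiv.flow_unique`). The identities needed are then statements about divergences: summing over a
block gives the relations of `V_∇` (`Quiv.sum_ext_block`), summing over a component of `Q` gives
sesquilinearity in `T` (`Quiv.sum_ext_conn`), a flow through a single edge gives the vanishing of
the differences of derivatives (`Quiv.sum_ext_edge`), adding flows of two levels gives associativity
(`Quiv.sum_ext_assoc`), and subtracting a circulation gives the cycle relation
(`Quiv.sum_ext_cycle`).

The gluing map is characterised by its values on the classes of `1 ⊗ u_j` and by its behaviour under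
multiplication of an argument by `λ_k` or `θ_k^i` (`glue_ev`, `glue_od`). `glue_unique` turns this
into a comparison principle. The left unit law, the associativity law (`glue_collect`,
`glue_composite`) and equivariance (`glue_act`) each reduce to checking that two multilinear maps
obey the same rules; the remaining work is the exponents of signs in `ZMod 2`.

The cycle relation for composites needs more. For a directed cycle which leaves its block, the
substitution depends on the removed edge, and the substitutions for two edges differ by a
circulation whose net flow is zero only after summation over a component of a block. This is enough,
because the values of `Y_j` are polynomials in the sums of the `λ_k` over components, by
sesquilinearity of `Y_j` and characteristic zero (`VNabla.mem_constSub`, proved with an Euler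
operator).

Uniqueness of the superoperad holds because every element of `V_∇[Λ₁, …, Λₙ]` comes from `V[Λ₁, …,
Λ_{n-1}]` (`VNabla.ofReduced_surjective`), so the composition formula determines all values on
homogeneous arguments, and these span. -/

theorem sg_zero : sg 0 = 1 := rfl

theorem sg_add (p q : ZMod 2) : sg (p + q) = sg p * sg q := by
  revert p q; decide

theorem sg_mul_self (p : ZMod 2) : sg p * sg p = 1 := by
  revert p; decide

theorem sg_sum {I : Type*} (s : Finset I) (f : I → ZMod 2) :
    sg (∑ i ∈ s, f i) = ∏ i ∈ s, sg (f i) := by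
  classical
  induction s using Finset.induction_on with
  | empty => rfl
  | insert a s ha ih => rw [Finset.sum_insert ha, Finset.prod_insert ha, sg_add, ih]

theorem sg_smul_smul {M : Type*} [AddCommGroup M] (p q : ZMod 2) (x : M) :
    sg p • sg q • x = sg (p + q) • x := by
  rw [smul_smul, sg_add]

theorem sg_smul_self {M : Type*} [AddCommGroup M] (p : ZMod 2) (x : M) :
    sg p • sg p • x = x := by
  rw [smul_smul, sg_mul_self, one_smul]

theorem add_self_zmod (p : ZMod 2) : p + p = 0 := CharTwo.add_self_eq_zero p

/-- The exponent of `shuffleSign`. -/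
def shuffleExp {m : ℕ} (p q : Fin m → ZMod 2) : ZMod 2 :=
  ∑ i, ∑ j, if i < j then p i * q j else 0

theorem shuffleSign_eq {m : ℕ} (p q : Fin m → ZMod 2) :
    shuffleSign p q = sg (shuffleExp p q) := by
  rw [shuffleSign, shuffleExp, sg_sum]
  refine Finset.prod_congr rfl fun i _ => ?_
  rw [← sg_sum, ← Finset.sum_filter]
  congr 2
  ext j
  simp

/-- The exponent of `permSign`. -/
def permExp {n : ℕ} (σ : Equiv.Perm (Fin n)) (p : Fin n → ZMod 2) : ZMod 2 :=
  ∑ i, ∑ j, if i < j ∧ σ j < σ i then p i * p j else 0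

theorem permSign_eq {n : ℕ} (σ : Equiv.Perm (Fin n)) (p : Fin n → ZMod 2) :
    permSign σ p = sg (permExp σ p) := by
  rw [permSign, permExp, sg_sum]
  refine Finset.prod_congr rfl fun i _ => ?_
  rw [← sg_sum, ← Finset.sum_filter]
  congr 2
  ext j
  simp

/-! ### Supercommutation in the polynomial superalgebra -/

namespace SPoly

variable {K : Type*} [Field K] {N : ℕ} {A B C : Type*}

/-- Induction over products of generators from the left. -/
theorem induction_left {P : SPoly K N A → Prop} (one : P 1)
    (add : ∀ a b, P a → P b → P (a + b)) (smul : ∀ (c : K) a, P a → P (c • a))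
    (ev : ∀ k a, P a → P (ev k * a)) (od : ∀ k i a, P a → P (od k i * a)) (a : SPoly K N A) :
    P a := by
  obtain ⟨x, rfl⟩ : ∃ x, mk x = a := RingQuot.mkAlgHom_surjective K _ a
  suffices h : ∀ b, P b → P (mk x * b) by simpa using h 1 one
  induction x using FreeAlgebra.induction with
  | grade0 r =>
    intro b hb
    rw [AlgHom.commutes, Algebra.algebraMap_eq_smul_one, smul_mul_assoc, one_mul]
    exact smul r b hb
  | grade1 x =>
    intro b hb
    rcases x with k | ⟨k, i⟩
    · exact ev k b hb
    · exact od k i b hb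
  | mul x y hx hy =>
    intro b hb
    rw [map_mul, mul_assoc]
    exact hx _ (hy _ hb)
  | add x y hx hy =>
    intro b hb
    rw [map_add, add_mul]
    exact add _ _ (hx b hb) (hy b hb)

theorem ev_mul (k : A) (a : SPoly K N A) : ev k * a = a * ev k := by
  induction a using induction_left with
  | one => simp
  | add a b ha hb => rw [mul_add, add_mul, ha, hb]
  | smul c a ha => rw [mul_smul_comm, smul_mul_assoc, ha]
  | ev l a ha => rw [← mul_assoc, ev_mul_ev k l, mul_assoc, ha, mul_assoc]
  | od l i a ha => rw [← mul_assoc, ev_mul_od k l, mul_assoc, ha, mul_assoc]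

/-- Each odd generator passed costs a sign, and `tau` collects these signs without any assumption of
homogeneity. -/
theorem od_mul (k : A) (i : Fin N) (a : SPoly K N A) : od k i * a = tau a * od k i := by
  induction a using induction_left with
  | one => simp
  | add a b ha hb => rw [mul_add, map_add, add_mul, ha, hb]
  | smul c a ha => rw [mul_smul_comm, map_smul, smul_mul_assoc, ha]
  | ev l a ha => rw [← mul_assoc, ← ev_mul_od l k, mul_assoc, ha, map_mul, tau_ev, mul_assoc]
  | od l j a ha =>
    rw [← mul_assoc, eq_neg_of_add_eq_zero_left (od_mul_od k l i j), neg_mul, mul_assoc, ha,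
      map_mul, tau_od, neg_mul, neg_mul, mul_assoc]

theorem mem_par {p : ZMod 2} {a : SPoly K N A} : a ∈ par p ↔ tau a = sg p • a := Iff.rfl

theorem one_mem_par : (1 : SPoly K N A) ∈ par 0 := by simp [mem_par, sg_zero]

theorem ev_mem_par (k : A) : (ev k : SPoly K N A) ∈ par 0 := by simp [mem_par, sg_zero, tau_ev]

theorem od_mem_par (k : A) (i : Fin N) : (od k i : SPoly K N A) ∈ par 1 := by
  simp [mem_par, tau_od, sg]

theorem mul_mem_par {p q : ZMod 2} {a b : SPoly K N A} (ha : a ∈ par p) (hb : b ∈ par q) :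
    a * b ∈ par (p + q) := by
  rw [mem_par] at *
  rw [map_mul, ha, hb, smul_mul_smul_comm, sg_add]

theorem od_mul_mem_par {p : ZMod 2} {a : SPoly K N A} (k : A) (i : Fin N) (ha : a ∈ par p) :
    od k i * a ∈ par (p + 1) := by
  simpa [add_comm] using mul_mem_par (od_mem_par k i) ha

theorem od_mul_of_mem {p : ZMod 2} {a : SPoly K N A} (k : A) (i : Fin N) (ha : a ∈ par p) :
    od k i * a = sg p • (a * od k i) := by
  rw [od_mul, mem_par.1 ha, smul_mul_assoc]

/-- Products of generators. The even ones are taken from a family `e`. -/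
inductive IsMon {I : Type*} (e : I → SPoly K N A) : SPoly K N A → ZMod 2 → ℕ → Prop
  | one : IsMon e 1 0 0
  | ev (k : I) (a : SPoly K N A) (p : ZMod 2) (d : ℕ) : IsMon e a p d → IsMon e (e k * a) p (d + 1)
  | od (k : A) (i : Fin N) (a : SPoly K N A) (p : ZMod 2) (d : ℕ) :
      IsMon e a p d → IsMon e (od k i * a) (p + 1) (d + 1)

theorem IsMon.mem_par {I : Type*} {e : I → SPoly K N A} (he : ∀ k, e k ∈ par 0)
    {a : SPoly K N A} {p : ZMod 2} {d : ℕ} (h : IsMon e a p d) : a ∈ par p := by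
  induction h with
  | one => exact one_mem_par
  | ev k a p d _ ih => simpa using mul_mem_par (he k) ih
  | od k i a p d _ ih => exact od_mul_mem_par k i ih

theorem span_isMon : Submodule.span K {a : SPoly K N A | ∃ p d, IsMon ev a p d} = ⊤ := by
  refine eq_top_iff.2 fun a _ => ?_
  induction a using induction_left with
  | one => exact Submodule.subset_span ⟨0, 0, .one⟩
  | add a b ha hb => exact add_mem (ha trivial) (hb trivial)
  | smul c a ha => exact Submodule.smul_mem _ _ (ha trivial)
  | ev k a ha =>
    refine Submodule.span_induction (p := fun a _ => ev k * a ∈ Submodule.span K _)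
      ?_ (by simp) (fun a b _ _ ha hb => by rw [mul_add]; exact add_mem ha hb)
      (fun c a _ ha => by rw [mul_smul_comm]; exact Submodule.smul_mem _ _ ha) (ha trivial)
    rintro a ⟨p, d, h⟩
    exact Submodule.subset_span ⟨_, _, .ev k a p d h⟩
  | od k i a ha =>
    refine Submodule.span_induction (p := fun a _ => od k i * a ∈ Submodule.span K _)
      ?_ (by simp) (fun a b _ _ ha hb => by rw [mul_add]; exact add_mem ha hb)
      (fun c a _ ha => by rw [mul_smul_comm]; exact Submodule.smul_mem _ _ ha) (ha trivial)
    rintro a ⟨p, d, h⟩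
    exact Submodule.subset_span ⟨_, _, .od k i a p d h⟩

/-- Simultaneous induction over tuples of products of generators. -/
theorem mon_induction {m : ℕ} {D I : Fin m → Type*} (e : ∀ j, I j → SPoly K N (D j))
    {P : (∀ j, SPoly K N (D j)) → (Fin m → ZMod 2) → Prop}
    (he : ∀ j k, e j k ∈ par 0)
    (one : P (fun _ => 1) (fun _ => 0))
    (ev : ∀ a α j k, (∀ i, a i ∈ par (α i)) → P a α → P (Function.update a j (e j k * a j)) α)
    (od : ∀ a α j k i, (∀ i, a i ∈ par (α i)) → P a α →
      P (Function.update a j (od k i * a j)) (Function.update α j (α j + 1)))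
    (a : ∀ j, SPoly K N (D j)) (α : Fin m → ZMod 2) (d : Fin m → ℕ)
    (h : ∀ j, IsMon (e j) (a j) (α j) (d j)) : P a α := by
  -- Induction on the total number of generators: some slot holds a nonempty product, and its
  -- leftmost factor is removed.
  induction hd : ∑ j, d j generalizing a α d with
  | zero =>
    have h0 : ∀ j, a j = 1 ∧ α j = 0 := by
      intro j
      have hj : d j = 0 := by simpa using (Finset.sum_eq_zero_iff.1 hd) j (Finset.mem_univ j)
      have := h j
      rw [hj] at this
      generalize a j = x at *
      generalize α j = y at *
      cases this
      exact ⟨rfl, rfl⟩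
    have ha : a = fun _ => 1 := funext fun j => (h0 j).1
    have hα : α = fun _ => 0 := funext fun j => (h0 j).2
    rw [ha, hα]; exact one
  | succ s ih =>
    obtain ⟨j, hj⟩ : ∃ j, d j ≠ 0 := by
      by_contra hc
      push Not at hc
      simp [hc] at hd
    have key : ∀ (a' : SPoly K N (D j)) (p' : ZMod 2) (d' : ℕ), d j = d' + 1 →
        IsMon (e j) a' p' d' → P (Function.update a j a') (Function.update α j p') ∧
          ∀ i, Function.update a j a' i ∈ par (Function.update α j p' i) := by
      intro a' p' d' hd' h'
      have hm : ∀ i, IsMon (e i) (Function.update a j a' i) (Function.update α j p' i)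
          (Function.update d j d' i) := by
        intro i
        by_cases hi : i = j
        · subst hi; simpa using h'
        · simpa [hi] using h i
      refine ⟨ih _ _ (Function.update d j d') hm ?_, fun i => (hm i).mem_par (he i)⟩
      rw [Finset.sum_update_of_mem (Finset.mem_univ j)]
      rw [← Finset.add_sum_erase _ _ (Finset.mem_univ j), hd'] at hd
      rw [Finset.sdiff_singleton_eq_erase]
      omega
    have hj' := h j
    generalize hx : a j = x at hj'
    generalize hy : α j = y at hj'
    generalize hz : d j = z at hj'
    cases hj' with
    | one => exact absurd hz hj
    | ev k a' p d' h' =>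
      obtain ⟨h1, h2⟩ := key a' y d' hz h'
      have := ev _ _ j k h2 h1
      simpa [← hx, ← hy] using this
    | od k i a' p' d' h' =>
      obtain ⟨h1, h2⟩ := key a' p' d' hz h'
      have := od _ _ j k i h2 h1
      simpa [← hx, ← hy] using this

theorem linSubst_tau [Fintype B] (c : A → B → K) (a : SPoly K N A) :
    linSubst c (tau a) = tau (linSubst c a) := by
  have : (linSubst c).comp tau = (tau.comp (linSubst c) : SPoly K N A →ₐ[K] SPoly K N B) :=
    algHom_ext (fun a => by simp [tau_ev, linSubst_ev])
      (fun a i => by simp [tau_od, linSubst_od, Finset.sum_neg_distrib])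
  exact DFunLike.congr_fun this a

theorem linSubst_mem_par [Fintype B] (c : A → B → K) {a : SPoly K N A} {p : ZMod 2}
    (ha : a ∈ par p) : linSubst c a ∈ par p := by
  rw [mem_par] at *
  rw [← linSubst_tau, ha, map_zsmul]

theorem linSubst_linSubst [Fintype B] [Fintype C] (c : A → B → K) (d : B → C → K)
    (a : SPoly K N A) : linSubst d (linSubst c a) = linSubst (fun a e => ∑ b, c a b * d b e) a := by
  have : (linSubst d).comp (linSubst c) =
      (linSubst (fun a e => ∑ b, c a b * d b e) : SPoly K N A →ₐ[K] SPoly K N C) := by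
    refine algHom_ext (fun a => ?_) (fun a i => ?_)
    · simp only [AlgHom.comp_apply, linSubst_ev, map_sum, map_smul, Finset.smul_sum, smul_smul,
        Finset.sum_smul]
      rw [Finset.sum_comm]
    · simp only [AlgHom.comp_apply, linSubst_od, map_sum, map_smul, Finset.smul_sum, smul_smul,
        Finset.sum_smul]
      rw [Finset.sum_comm]
  exact DFunLike.congr_fun this a

theorem linSubst_one [Fintype A] [DecidableEq A] (a : SPoly K N A) :
    linSubst (fun k l => if k = l then 1 else 0) a = a := by
  have : (linSubst (fun k l => if k = l then 1 else 0)) = AlgHom.id K (SPoly K N A) :=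
    algHom_ext (fun a => by simp [linSubst_ev]) (fun a i => by simp [linSubst_od])
  exact DFunLike.congr_fun this a

theorem pd_one (k : A) : pd k (1 : SPoly K N A) = 0 := by simp [pd]

theorem pd_tau (k : A) (a : SPoly K N A) : pd k (tau a) = tau (pd k a) := by
  classical
  induction a using induction_left with
  | one => simp [pd_one]
  | add a b ha hb => simp [ha, hb]
  | smul c a ha => simp [ha]
  | ev l a ha =>
    simp only [map_mul, tau_ev, pd_mul, pd_ev, ha, map_add]
    split_ifs <;> simp
  | od l i a ha => simp [tau_od, pd_mul, pd_od, ha]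

theorem pd_mem_par (k : A) {a : SPoly K N A} {p : ZMod 2} (ha : a ∈ par p) : pd k a ∈ par p := by
  rw [mem_par] at *
  rw [← pd_tau, ha, map_zsmul]

end SPoly

/-! ### Multilinear maps -/

section Multilinear

variable {K : Type*} [Field K] {m : ℕ} {M M' : Fin m → Type*} {E : Type*}
  [∀ j, AddCommGroup (M j)] [∀ j, Module K (M j)] [∀ j, AddCommGroup (M' j)]
  [∀ j, Module K (M' j)] [AddCommGroup E] [Module K E]

/-- Multilinear maps which agree on spanning sets are equal. -/
theorem multilinear_ext_span {Φ Ψ : MultilinearMap K M E} (S : ∀ j, Set (M j))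
    (hS : ∀ j, Submodule.span K (S j) = ⊤) (h : ∀ n, (∀ j, n j ∈ S j) → Φ n = Ψ n) : Φ = Ψ := by
  suffices hs : ∀ s : Finset (Fin m), ∀ n, (∀ j, j ∉ s → n j ∈ S j) → Φ n = Ψ n by
    exact MultilinearMap.ext fun n => hs Finset.univ n (by simp)
  intro s
  induction s using Finset.induction_on with
  | empty => exact fun n hn => h n fun j => hn j (by simp)
  | insert j s hj ih =>
    intro n hn
    have : ∀ x ∈ Submodule.span K (S j), Φ (Function.update n j x) = Ψ (Function.update n j x) := by
      intro x hx
      induction hx using Submodule.span_induction with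
      | mem x hx =>
        refine ih _ fun i hi => ?_
        by_cases hij : i = j
        · subst hij; simpa using hx
        · simpa [hij] using hn i (by simp [hij, hi])
      | zero => simp
      | add x y _ _ hx hy => simp [hx, hy]
      | smul c x _ hx => simp [hx]
    simpa using this (n j) (by rw [hS]; trivial)

/-- Apply the linear map `f` in the `j`-th slot. -/
def slot (Φ : MultilinearMap K M E) (j : Fin m) (f : M j →ₗ[K] M j) : MultilinearMap K M E :=
  Φ.compLinearMap (Function.update (fun _ => LinearMap.id) j f)

theorem slot_apply (Φ : MultilinearMap K M E) (j : Fin m) (f : M j →ₗ[K] M j) (n : ∀ j, M j) :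
    slot Φ j f n = Φ (Function.update n j (f (n j))) := by
  rw [slot, MultilinearMap.compLinearMap_apply]
  congr 1
  funext i
  by_cases h : i = j
  · subst h; simp
  · simp [h]

/-- A multilinear map which vanishes as soon as one argument lies in the kernel of the projection
depends on the projections of the arguments only. -/
theorem multilinear_congr_of_ker (Φ : MultilinearMap K M E) (π : ∀ j, M j →ₗ[K] M' j)
    (hΦ : ∀ n j, π j (n j) = 0 → Φ n = 0) (n n' : ∀ j, M j) (h : ∀ j, π j (n j) = π j (n' j)) :
    Φ n = Φ n' := by
  suffices hs : ∀ s : Finset (Fin m), Φ (s.piecewise n n') = Φ n' by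
    simpa using hs Finset.univ
  intro s
  induction s using Finset.induction_on with
  | empty => simp
  | insert j s hj ih =>
    rw [← ih, Finset.piecewise_insert, ← sub_eq_zero]
    have := Φ.map_update_sub (s.piecewise n n') j (n j) (n' j)
    have h2 : Function.update (s.piecewise n n') j (n' j) = s.piecewise n n' := by
      rw [Function.update_eq_self_iff]; simp [hj]
    rw [h2] at this
    rw [← this]
    exact hΦ _ j (by simp [h j])

/-- Changing one argument changes one block. -/
theorem blocks_update {n : ℕ} (ν : Fin m → ℕ) (h : ∑ j, ν j = n) {L : Fin n → Type*}
    {M : Fin m → Type*} (Ψ : ∀ j, (∀ k : Fin (ν j), L (blk ν h ⟨j, k⟩)) → M j) (y : ∀ k, L k)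
    (j : Fin m) (k : Fin (ν j)) (c : L (blk ν h ⟨j, k⟩)) :
    (fun j' => Ψ j' fun k' => Function.update y (blk ν h ⟨j, k⟩) c (blk ν h ⟨j', k'⟩)) =
      Function.update (fun j' => Ψ j' fun k' => y (blk ν h ⟨j', k'⟩)) j
        (Ψ j (Function.update (fun k' => y (blk ν h ⟨j, k'⟩)) k c)) := by
  funext j'
  by_cases hj : j' = j
  · subst hj
    rw [Function.update_self]
    congr 1
    funext k'
    by_cases hk : k' = k
    · subst hk; simp
    · rw [Function.update_of_ne hk, Function.update_of_ne]
      simpa using hk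
  · rw [Function.update_of_ne hj]
    congr 1
    funext k'
    rw [Function.update_of_ne]
    simp [hj]

/-- Nested composition of multilinear maps over blocks of consecutive indices. -/
def nest {n : ℕ} (ν : Fin m → ℕ) (h : ∑ j, ν j = n) {L : Fin n → Type*}
    [∀ k, AddCommGroup (L k)] [∀ k, Module K (L k)] (Φ : MultilinearMap K M E)
    (Ψ : ∀ j, MultilinearMap K (fun k : Fin (ν j) => L (blk ν h ⟨j, k⟩)) (M j)) :
    MultilinearMap K L E :=
  MultilinearMap.mk' (fun y => Φ fun j => Ψ j fun k => y (blk ν h ⟨j, k⟩))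
    (by
      intro y k a b
      obtain ⟨⟨j, k⟩, rfl⟩ := (blk ν h).surjective k
      simp [blocks_update ν h (fun j => Ψ j)])
    (by
      intro y k c a
      obtain ⟨⟨j, k⟩, rfl⟩ := (blk ν h).surjective k
      simp [blocks_update ν h (fun j => Ψ j)])

theorem nest_apply {n : ℕ} (ν : Fin m → ℕ) (h : ∑ j, ν j = n) {L : Fin n → Type*}
    [∀ k, AddCommGroup (L k)] [∀ k, Module K (L k)] (Φ : MultilinearMap K M E)
    (Ψ : ∀ j, MultilinearMap K (fun k : Fin (ν j) => L (blk ν h ⟨j, k⟩)) (M j)) (y : ∀ k, L k) :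
    nest ν h Φ Ψ y = Φ fun j => Ψ j fun k => y (blk ν h ⟨j, k⟩) := rfl

end Multilinear

/-! ### Homogeneous pure tensors and the operators on tensor powers. -/

namespace HWSupermodule

variable {K : Type*} [Field K] {N : ℕ} {V : Type*} [AddCommGroup V] [Module K V]
  (H : HWSupermodule K N V)

theorem span_hom : Submodule.span K {v : V | ∃ p, v ∈ H.par p} = ⊤ := by
  refine eq_top_iff.2 fun v _ => ?_
  exact H.hom_induction (P := fun v => v ∈ Submodule.span K {v : V | ∃ p, v ∈ H.par p})
    (fun p v hv => Submodule.subset_span ⟨p, hv⟩) (fun v w hv hw => add_mem hv hw) v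

/-- Linear maps which agree on homogeneous pure tensors are equal. -/
theorem tensor_ext {n : ℕ} {E : Type*} [AddCommGroup E] [Module K E]
    {f g : (⨂[K] _ : Fin n, V) →ₗ[K] E}
    (h : ∀ (v : Fin n → V) (p : Fin n → ZMod 2), (∀ i, v i ∈ H.par (p i)) →
      f (PiTensorProduct.tprod K v) = g (PiTensorProduct.tprod K v)) : f = g := by
  refine PiTensorProduct.ext (multilinear_ext_span _ (fun _ => H.span_hom) fun v hv => ?_)
  choose p hp using hv
  exact h v p hp

/-- The parity involution of `V^{⊗n}`. -/
def epsTensor (n : ℕ) : Module.End K (⨂[K] _ : Fin n, V) :=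
  PiTensorProduct.map fun _ => H.eps

theorem epsTensor_tprod {n : ℕ} (v : Fin n → V) :
    H.epsTensor n (PiTensorProduct.tprod K v) = PiTensorProduct.tprod K fun i => H.eps (v i) := by
  rw [epsTensor, PiTensorProduct.map_tprod]

/-- Signs are integers, so they are cast to `K` before multilinearity over `K` can pull them out. -/
theorem tprod_sg_smul {n : ℕ} (v : Fin n → V) (p : Fin n → ZMod 2) :
    PiTensorProduct.tprod K (fun i => sg (p i) • v i) =
      sg (∑ i, p i) • PiTensorProduct.tprod K v := by
  have := (PiTensorProduct.tprod K).map_smul_univ (fun i => ((sg (p i) : ℤ) : K)) v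
  simp only [Int.cast_smul_eq_zsmul] at this
  rw [this, sg_sum, ← Int.cast_prod, Int.cast_smul_eq_zsmul]

theorem epsTensor_of_mem {n : ℕ} {v : Fin n → V} {p : Fin n → ZMod 2}
    (hv : ∀ i, v i ∈ H.par (p i)) :
    H.epsTensor n (PiTensorProduct.tprod K v) =
      sg (∑ i, p i) • PiTensorProduct.tprod K v := by
  rw [epsTensor_tprod, ← tprod_sg_smul]
  congr 1
  funext i
  exact H.eps_of_mem (hv i)

theorem Tat_tprod {n : ℕ} (k : Fin n) (v : Fin n → V) :
    H.Tat k (PiTensorProduct.tprod K v) =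
      PiTensorProduct.tprod K (Function.update v k (H.T (v k))) := by
  rw [Tat, PiTensorProduct.map_tprod]
  congr 1
  funext i
  by_cases h : i = k
  · subst h; simp
  · simp [h]

theorem Sat_tprod {n : ℕ} (i : Fin N) (k : Fin n) (v : Fin n → V) :
    H.Sat i k (PiTensorProduct.tprod K v) = PiTensorProduct.tprod K
      (Function.update (fun l => if l < k then H.eps (v l) else v l) k (H.S i (v k))) := by
  rw [Sat, PiTensorProduct.map_tprod]
  congr 1
  funext l
  by_cases h : l = k
  · subst h; simp
  · by_cases h' : l < k <;> simp [h, h']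

theorem Sat_of_mem {n : ℕ} (i : Fin N) (k : Fin n) {v : Fin n → V} {p : Fin n → ZMod 2}
    (hv : ∀ i, v i ∈ H.par (p i)) :
    H.Sat i k (PiTensorProduct.tprod K v) = sg (∑ l, if l < k then p l else 0) •
      PiTensorProduct.tprod K (Function.update v k (H.S i (v k))) := by
  rw [Sat_tprod, ← tprod_sg_smul]
  congr 1
  funext l
  by_cases h : l = k
  · subst h; simp [sg_zero]
  · by_cases h' : l < k
    · simp [h, h', H.eps_of_mem (hv l)]
    · simp [h, h', sg_zero]

theorem update_T_mem {n : ℕ} {v : Fin n → V} {p : Fin n → ZMod 2} (hv : ∀ i, v i ∈ H.par (p i))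
    (k i : Fin n) : Function.update v k (H.T (v k)) i ∈ H.par (p i) := by
  by_cases h : i = k
  · subst h; simpa using H.T_mem _ _ (hv i)
  · simpa [h] using hv i

theorem update_S_mem {n : ℕ} {v : Fin n → V} {p : Fin n → ZMod 2} (hv : ∀ i, v i ∈ H.par (p i))
    (s : Fin N) (k i : Fin n) : Function.update v k (H.S s (v k)) i ∈
      H.par (Function.update p k (p k + 1) i) := by
  by_cases h : i = k
  · subst h; simpa using H.S_mem s _ _ (hv i)
  · simpa [h] using hv i

end HWSupermodule

/-! ### Operators, parity and substitutions on `V_∇`. -/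

namespace VNabla

variable {K : Type*} [Field K] {N : ℕ} {V : Type*} [AddCommGroup V] [Module K V]
  (H : HWSupermodule K N V) {l m n : ℕ}

theorem mk_surjective : Function.Surjective (mk H n) := Submodule.mkQ_surjective _

theorem ker_mk : LinearMap.ker (mk H n) = relSub H n := Submodule.ker_mkQ _

/-- The even elements `e` replacing the generators are such that the products of the `e` and the
`θ` span. -/
theorem span_mk_mon : Submodule.span K {y : VNabla H n | ∃ a p d u q,
    SPoly.IsMon SPoly.ev a p d ∧ u ∈ H.par q ∧ y = mk H n (a ⊗ₜ[K] u)} = ⊤ := by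
  refine eq_top_iff.2 fun y hy => ?_
  clear hy
  obtain ⟨t, rfl⟩ := mk_surjective H y
  induction t with
  | zero => simp
  | add x y hx hy => rw [map_add]; exact add_mem hx hy
  | tmul a v =>
    have hv : v ∈ Submodule.span K {v : V | ∃ p, v ∈ H.par p} := by rw [H.span_hom]; trivial
    have ha : a ∈ Submodule.span K {a : SPoly K N (Fin n) | ∃ p d, SPoly.IsMon SPoly.ev a p d} := by
      rw [SPoly.span_isMon]; trivial
    induction ha using Submodule.span_induction with
    | zero => simp
    | add x y _ _ hx hy => rw [TensorProduct.add_tmul, map_add]; exact add_mem hx hy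
    | smul c x _ hx => rw [← TensorProduct.smul_tmul', map_smul]; exact Submodule.smul_mem _ _ hx
    | mem a ha =>
      obtain ⟨p, d, ha⟩ := ha
      induction hv using Submodule.span_induction with
      | zero => simp
      | add x y _ _ hx hy => rw [TensorProduct.tmul_add, map_add]; exact add_mem hx hy
      | smul c x _ hx => rw [TensorProduct.tmul_smul, map_smul]; exact Submodule.smul_mem _ _ hx
      | mem v hv =>
        obtain ⟨q, hv⟩ := hv
        exact Submodule.subset_span ⟨a, p, d, v, q, ha, hv, rfl⟩

theorem lmul_mk (b a : SPoly K N (Fin n)) (v : V) :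
    lmul H n b (mk H n (a ⊗ₜ[K] v)) = mk H n ((b * a) ⊗ₜ[K] v) :=
  rfl

theorem lmul_mul (a b : SPoly K N (Fin n)) (y : VNabla H n) :
    lmul H n (a * b) y = lmul H n a (lmul H n b y) := by
  refine LinearMap.congr_fun (f := lmul H n (a * b)) (g := lmul H n a ∘ₗ lmul H n b)
    (hom_ext fun c v => ?_) y
  simp [lmul_mk, mul_assoc]

theorem lmul_one (y : VNabla H n) : lmul H n 1 y = y := by
  refine LinearMap.congr_fun (f := lmul H n 1) (g := LinearMap.id)
    (hom_ext fun c v => ?_) y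
  simp [lmul_mk]

theorem lmul_ev_comm (k : Fin n) (a : SPoly K N (Fin n)) (y : VNabla H n) :
    lmul H n (SPoly.ev k) (lmul H n a y) = lmul H n a (lmul H n (SPoly.ev k) y) := by
  rw [← lmul_mul, ← lmul_mul, SPoly.ev_mul]

theorem mk_tmul_T (a : SPoly K N (Fin n)) (v : V) :
    mk H n (a ⊗ₜ[K] H.T v) = -∑ k, lmul H n (SPoly.ev k) (mk H n (a ⊗ₜ[K] v)) := by
  rw [eq_neg_iff_add_eq_zero, add_comm, ← mk_T H a v]
  congr 1
  simp only [lmul_mk, SPoly.ev_mul, Finset.mul_sum, TensorProduct.sum_tmul, map_sum]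

theorem mk_tmul_S (i : Fin N) {a : SPoly K N (Fin n)} {p : ZMod 2} (ha : a ∈ SPoly.par p) (v : V) :
    mk H n (a ⊗ₜ[K] H.S i v) =
      -(sg p • ∑ k, lmul H n (SPoly.od k i) (mk H n (a ⊗ₜ[K] v))) := by
  rw [eq_neg_iff_add_eq_zero, add_comm, ← mk_S H i a v]
  congr 1
  simp only [lmul_mk, SPoly.od_mul_of_mem _ _ ha, Finset.mul_sum, TensorProduct.sum_tmul, map_sum,
    ← TensorProduct.smul_tmul', map_zsmul]
  rw [← Finset.smul_sum, sg_smul_self]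

/-- The parity involution. -/
def eps (n : ℕ) : Module.End K (VNabla H n) :=
  lift (mk H n ∘ₗ TensorProduct.map SPoly.tau.toLinearMap H.eps)
    (fun a v => by
      simpa [SPoly.tau_ev, H.eps_T] using mk_T H (SPoly.tau a) (H.eps v))
    (fun i a v => by
      have := mk_S H i (SPoly.tau a) (H.eps v)
      simp only [LinearMap.comp_apply, TensorProduct.map_tmul, AlgHom.toLinearMap_apply, map_mul,
        map_sum, SPoly.tau_od, H.eps_S, Finset.sum_neg_distrib, mul_neg, TensorProduct.neg_tmul,
        TensorProduct.tmul_neg, map_neg]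
      rw [← neg_add, this, neg_zero])

theorem eps_mk (a : SPoly K N (Fin n)) (v : V) :
    eps H n (mk H n (a ⊗ₜ[K] v)) = mk H n (SPoly.tau a ⊗ₜ[K] H.eps v) := by
  rw [eps, lift_mk]; rfl

theorem eps_mk_of_mem {a : SPoly K N (Fin n)} {v : V} {p q : ZMod 2} (ha : a ∈ SPoly.par p)
    (hv : v ∈ H.par q) : eps H n (mk H n (a ⊗ₜ[K] v)) = sg (p + q) • mk H n (a ⊗ₜ[K] v) := by
  rw [eps_mk, SPoly.mem_par.1 ha, H.eps_of_mem hv, ← TensorProduct.smul_tmul',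
    TensorProduct.tmul_smul, map_zsmul, map_zsmul, sg_smul_smul]

theorem eps_lmul (b : SPoly K N (Fin n)) (y : VNabla H n) :
    eps H n (lmul H n b y) = lmul H n (SPoly.tau b) (eps H n y) := by
  refine LinearMap.congr_fun (f := eps H n ∘ₗ lmul H n b)
    (g := lmul H n (SPoly.tau b) ∘ₗ eps H n) (hom_ext fun c v => ?_) y
  simp [eps_mk, lmul_mk]

theorem eps_lmul_ev (k : Fin n) (y : VNabla H n) :
    eps H n (lmul H n (SPoly.ev k) y) = lmul H n (SPoly.ev k) (eps H n y) := by
  rw [eps_lmul, SPoly.tau_ev]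

theorem eps_lmul_od (k : Fin n) (i : Fin N) (y : VNabla H n) :
    eps H n (lmul H n (SPoly.od k i) y) = -lmul H n (SPoly.od k i) (eps H n y) := by
  rw [eps_lmul, SPoly.tau_od, map_neg, LinearMap.neg_apply]

/-- For every `y` the element `y + (-1)^r ε(y)` lies in the span defining the part of parity `r`, as
is checked on homogeneous classes. On an eigenvector this element is `2y`, and `2` is invertible.
This replaces membership in a span by an equation. -/
theorem mem_par_iff [CharZero K] {r : ZMod 2} {y : VNabla H n} :
    y ∈ par H n r ↔ eps H n y = sg r • y := by
  constructor
  · intro hy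
    induction hy using Submodule.span_induction with
    | mem y hy =>
      obtain ⟨p, q, a, v, rfl, ha, hv, rfl⟩ := hy
      exact eps_mk_of_mem H ha hv
    | zero => simp
    | add x y _ _ hx hy => rw [map_add, hx, hy, smul_add]
    | smul c x _ hx => rw [map_smul, hx, smul_comm]
  · intro hy
    have key : ∀ y : VNabla H n, y + sg r • eps H n y ∈ par H n r := by
      intro y
      have hy : y ∈ Submodule.span K {y : VNabla H n | ∃ a p d u q,
          SPoly.IsMon SPoly.ev a p d ∧ u ∈ H.par q ∧ y = mk H n (a ⊗ₜ[K] u)} := by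
        rw [span_mk_mon]; trivial
      induction hy using Submodule.span_induction with
      | mem y hy =>
        obtain ⟨a, p, d, v, q, ha, hv, rfl⟩ := hy
        have ha := ha.mem_par SPoly.ev_mem_par
        rw [eps_mk_of_mem H ha hv, sg_smul_smul]
        by_cases hr : p + q = r
        · have h0 : mk H n (a ⊗ₜ[K] v) ∈ par H n r :=
            Submodule.subset_span ⟨p, q, a, v, hr, ha, hv, rfl⟩
          exact add_mem h0 (zsmul_mem h0 _)
        · have : sg (r + (p + q)) = -1 := by
            exact (by decide : ∀ s r : ZMod 2, ¬s = r → sg (r + s) = -1) _ _ hr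
          rw [this, neg_smul, one_smul, add_neg_cancel]; exact zero_mem _
      | zero => simp
      | add x y _ _ hx hy =>
        rw [map_add, smul_add, add_add_add_comm]; exact add_mem hx hy
      | smul c x _ hx =>
        rw [map_smul, smul_comm, ← smul_add]; exact Submodule.smul_mem _ _ hx
    have h2 := key y
    rw [hy, sg_smul_self, ← two_smul K] at h2
    have := Submodule.smul_mem _ (2⁻¹ : K) h2
    rwa [smul_smul, inv_mul_cancel₀ two_ne_zero, one_smul] at this

theorem subst_mk (c : Fin m → Fin n → K) (hc : ∀ k, ∑ j, c j k = 1) (a : SPoly K N (Fin m)) (v : V) :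
    subst H c hc (mk H m (a ⊗ₜ[K] v)) = mk H n (SPoly.linSubst c a ⊗ₜ[K] v) := by
  rw [subst, lift_mk]; rfl

theorem subst_lmul (c : Fin m → Fin n → K) (hc : ∀ k, ∑ j, c j k = 1) (b : SPoly K N (Fin m))
    (y : VNabla H m) :
    subst H c hc (lmul H m b y) = lmul H n (SPoly.linSubst c b) (subst H c hc y) := by
  refine LinearMap.congr_fun (f := subst H c hc ∘ₗ lmul H m b)
    (g := lmul H n (SPoly.linSubst c b) ∘ₗ subst H c hc) (hom_ext fun c v => ?_) y
  simp [subst_mk, lmul_mk]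

theorem eps_subst (c : Fin m → Fin n → K) (hc : ∀ k, ∑ j, c j k = 1) (y : VNabla H m) :
    eps H n (subst H c hc y) = subst H c hc (eps H m y) := by
  refine LinearMap.congr_fun (f := eps H n ∘ₗ subst H c hc)
    (g := subst H c hc ∘ₗ eps H m) (hom_ext fun c v => ?_) y
  simp [subst_mk, eps_mk, SPoly.linSubst_tau]

theorem subst_subst (c : Fin l → Fin m → K) (hc : ∀ k, ∑ j, c j k = 1) (d : Fin m → Fin n → K)
    (hd : ∀ k, ∑ j, d j k = 1) (e : Fin l → Fin n → K) (he : ∀ k, ∑ j, e j k = 1)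
    (h : ∀ i k, ∑ j, c i j * d j k = e i k) (y : VNabla H l) :
    subst H d hd (subst H c hc y) = subst H e he y := by
  obtain rfl : (fun i k => ∑ j, c i j * d j k) = e := funext₂ h
  refine LinearMap.congr_fun (f := subst H d hd ∘ₗ subst H c hc)
    (g := subst H _ he) (hom_ext fun c v => ?_) y
  simp [subst_mk, SPoly.linSubst_linSubst]

theorem collect_collect (b : Fin n → Fin m) (c : Fin m → Fin l) (y : VNabla H l) :
    collect H b (collect H c y) = collect H (c ∘ b) y := by
  refine subst_subst H _ _ _ _ _ _ (fun i k => ?_) y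
  simp

theorem collect_id (y : VNabla H n) : collect H id y = y := by
  refine LinearMap.congr_fun (f := collect H id) (g := LinearMap.id) (hom_ext fun a v => ?_) y
  rw [collect, subst_mk]
  have : (fun j k : Fin n => if id k = j then (1 : K) else 0) =
      fun j k => if j = k then 1 else 0 := by
    funext j k; simp [eq_comm]
  rw [this, SPoly.linSubst_one]; rfl

/-- Renaming variables is collecting along blocks of length one, so one set of rules serves the
action and the composition. -/
theorem perm_eq_collect (σ : Equiv.Perm (Fin n)) : perm H σ = collect H σ := by
  have : (fun k l : Fin n => if σ.symm k = l then (1 : K) else 0) =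
      fun j k => if σ k = j then 1 else 0 := by
    funext j k
    have : σ.symm j = k ↔ σ k = j := by rw [Equiv.symm_apply_eq, eq_comm]
    simp only [this]
  rw [perm, collect]
  congr 1

theorem collect_ev (b : Fin n → Fin m) (j : Fin m) (y : VNabla H m) :
    collect H b (lmul H m (SPoly.ev j) y) =
      ∑ k with b k = j, lmul H n (SPoly.ev k) (collect H b y) := by
  rw [collect, subst_lmul, SPoly.linSubst_ev, Finset.sum_filter, map_sum, LinearMap.sum_apply]
  refine Finset.sum_congr rfl fun k _ => ?_
  split_ifs <;> simp

theorem collect_od (b : Fin n → Fin m) (j : Fin m) (i : Fin N) (y : VNabla H m) :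
    collect H b (lmul H m (SPoly.od j i) y) =
      ∑ k with b k = j, lmul H n (SPoly.od k i) (collect H b y) := by
  rw [collect, subst_lmul, SPoly.linSubst_od, Finset.sum_filter, map_sum, LinearMap.sum_apply]
  refine Finset.sum_congr rfl fun k _ => ?_
  split_ifs <;> simp

theorem eps_collect (b : Fin n → Fin m) (y : VNabla H m) :
    eps H n (collect H b y) = collect H b (eps H m y) := eps_subst H _ _ y

theorem pdSub_mk (k l : Fin n) (a : SPoly K N (Fin n)) (v : V) :
    pdSub H k l (mk H n (a ⊗ₜ[K] v)) = mk H n ((SPoly.pd k a - SPoly.pd l a) ⊗ₜ[K] v) := by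
  rw [pdSub, lift_mk]; rfl

theorem pdSub_ev (k l c : Fin n) (y : VNabla H n) :
    pdSub H k l (lmul H n (SPoly.ev c) y) = lmul H n (SPoly.ev c) (pdSub H k l y) +
      ((if c = k then y else 0) - if c = l then y else 0) := by
  refine LinearMap.congr_fun (f := pdSub H k l ∘ₗ lmul H n (SPoly.ev c))
    (g := lmul H n (SPoly.ev c) ∘ₗ pdSub H k l +
      ((if c = k then LinearMap.id else 0) - if c = l then LinearMap.id else 0))
    (hom_ext fun a v => ?_) y |>.trans ?_
  · simp only [LinearMap.comp_apply, LinearMap.add_apply, lmul_mk, pdSub_mk, SPoly.pd_mul,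
      SPoly.pd_ev, LinearMap.sub_apply]
    have : SPoly.ev c * SPoly.pd k a + (if c = k then 1 else 0) * a -
        (SPoly.ev c * SPoly.pd l a + (if c = l then 1 else 0) * a) =
        SPoly.ev c * (SPoly.pd k a - SPoly.pd l a) +
          ((if c = k then a else 0) - (if c = l then a else 0)) := by
      split_ifs <;> simp [mul_sub] <;> abel
    rw [this, TensorProduct.add_tmul, map_add, TensorProduct.sub_tmul, map_sub]
    split_ifs <;> simp
  · simp only [LinearMap.comp_apply, LinearMap.add_apply, LinearMap.sub_apply]
    split_ifs <;> simp

theorem pdSub_od (k l c : Fin n) (i : Fin N) (y : VNabla H n) :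
    pdSub H k l (lmul H n (SPoly.od c i) y) = lmul H n (SPoly.od c i) (pdSub H k l y) := by
  refine LinearMap.congr_fun (f := pdSub H k l ∘ₗ lmul H n (SPoly.od c i))
    (g := lmul H n (SPoly.od c i) ∘ₗ pdSub H k l) (hom_ext fun a v => ?_) y
  simp [lmul_mk, pdSub_mk, SPoly.pd_mul, SPoly.pd_od, mul_sub]

theorem pdSub_add (k l c : Fin n) (y : VNabla H n) :
    pdSub H k l y + pdSub H l c y = pdSub H k c y := by
  refine LinearMap.congr_fun (f := pdSub H k l + pdSub H l c)
    (g := pdSub H k c) (hom_ext fun a v => ?_) y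
  rw [LinearMap.add_apply, pdSub_mk, pdSub_mk, pdSub_mk, ← map_add, ← TensorProduct.add_tmul,
    sub_add_sub_cancel]

theorem pdSub_self (k : Fin n) (y : VNabla H n) : pdSub H k k y = 0 := by
  refine LinearMap.congr_fun (f := pdSub H k k) (g := 0) (hom_ext fun a v => ?_) y
  simp [pdSub_mk]

/-- Chain rule: `λ_k` enters the substituted polynomial only through `Λ'_{b k}`, with coefficient
one. -/
theorem pd_linSubst (b : Fin n → Fin m) (k : Fin n) (a : SPoly K N (Fin m)) :
    SPoly.pd k (SPoly.linSubst (fun j k => if b k = j then 1 else 0) a) =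
      SPoly.linSubst (fun j k => if b k = j then (1 : K) else 0) (SPoly.pd (b k) a) := by
  induction a using SPoly.induction_left with
  | one => simp [SPoly.pd_one]
  | add a b ha hb => simp [ha, hb]
  | smul c a ha => simp [ha]
  | ev l a ha =>
    rw [map_mul, SPoly.pd_mul, ha, SPoly.pd_mul, map_add, map_mul, SPoly.pd_ev, map_mul]
    congr 2
    simp only [SPoly.linSubst_ev, map_sum, map_smul, SPoly.pd_ev]
    rw [Finset.sum_eq_single k]
    · by_cases h : b k = l
      · simp [h]
      · simp [h, Ne.symm h]
    · intro i _ hi; simp [hi]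
    · simp
  | od l i a ha =>
    rw [map_mul, SPoly.pd_mul, ha, SPoly.pd_mul, map_add, map_mul, SPoly.pd_od, map_mul]
    congr 2
    simp only [SPoly.linSubst_od, map_sum, map_smul, SPoly.pd_od, smul_zero,
      Finset.sum_const_zero, map_zero]

theorem pdSub_collect (b : Fin n → Fin m) (k l : Fin n) (y : VNabla H m) :
    pdSub H k l (collect H b y) = collect H b (pdSub H (b k) (b l) y) := by
  refine LinearMap.congr_fun (f := pdSub H k l ∘ₗ collect H b)
    (g := collect H b ∘ₗ pdSub H (b k) (b l)) (hom_ext fun a v => ?_) y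
  simp [collect, subst_mk, pdSub_mk, pd_linSubst]

theorem ofReduced_tmul (a : SPoly K N (Fin (n - 1))) (v : V) :
    ofReduced H n (a ⊗ₜ[K] v) = mk H n (SPoly.linSubst
      (fun k l => if Fin.castLE (Nat.sub_le n 1) k = l then 1 else 0) a ⊗ₜ[K] v) := rfl

/-- The range contains the classes `1 ⊗ v` and is stable under all variables but the last. It is
also stable under the sums `∑ λ_k` and `∑ θ_k^i`, which act through `-T` and, up to sign, `S^i` on
the factor `V`. Hence it is stable under the last variable too, being such a sum minus the other
variables. -/
theorem ofReduced_surjective : Function.Surjective (ofReduced H n) := by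
  have hod : ∀ (k : Fin (n - 1)) i y, y ∈ LinearMap.range (ofReduced H n) →
      lmul H n (SPoly.od (Fin.castLE (Nat.sub_le n 1) k) i) y ∈ LinearMap.range (ofReduced H n) := by
    rintro k i _ ⟨t, rfl⟩
    induction t with
    | zero => simp
    | add x y hx hy => rw [map_add, map_add]; exact add_mem hx hy
    | tmul a v =>
      refine ⟨(SPoly.od k i * a) ⊗ₜ v, ?_⟩
      rw [ofReduced_tmul, ofReduced_tmul, lmul_mk, map_mul, SPoly.linSubst_od]
      simp
  have hev : ∀ (k : Fin (n - 1)) y, y ∈ LinearMap.range (ofReduced H n) →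
      lmul H n (SPoly.ev (Fin.castLE (Nat.sub_le n 1) k)) y ∈ LinearMap.range (ofReduced H n) := by
    rintro k _ ⟨t, rfl⟩
    induction t with
    | zero => simp
    | add x y hx hy => rw [map_add, map_add]; exact add_mem hx hy
    | tmul a v =>
      refine ⟨(SPoly.ev k * a) ⊗ₜ v, ?_⟩
      rw [ofReduced_tmul, ofReduced_tmul, lmul_mk, map_mul, SPoly.linSubst_ev]
      simp
  have htot : ∀ y, y ∈ LinearMap.range (ofReduced H n) →
      (∑ k, lmul H n (SPoly.ev k) y) ∈ LinearMap.range (ofReduced H n) := by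
    rintro _ ⟨t, rfl⟩
    induction t with
    | zero => simp
    | add x y hx hy => simp only [map_add, Finset.sum_add_distrib]; exact add_mem hx hy
    | tmul a v =>
      refine ⟨-(a ⊗ₜ H.T v), ?_⟩
      rw [map_neg, ofReduced_tmul, mk_tmul_T, neg_neg]; rfl
  have htod : ∀ i y, y ∈ LinearMap.range (ofReduced H n) →
      (∑ k, lmul H n (SPoly.od k i) y) ∈ LinearMap.range (ofReduced H n) := by
    rintro i _ ⟨t, rfl⟩
    induction t with
    | zero => simp
    | add x y hx hy => simp only [map_add, Finset.sum_add_distrib]; exact add_mem hx hy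
    | tmul a v =>
      refine ⟨-(SPoly.tau a ⊗ₜ H.S i v), ?_⟩
      rw [map_neg, ofReduced_tmul, ofReduced_tmul, ← eq_neg_of_add_eq_zero_left (mk_S H i _ v)]
      simp only [lmul_mk, SPoly.od_mul, SPoly.linSubst_tau, Finset.mul_sum, TensorProduct.sum_tmul,
        map_sum]
  intro y
  obtain ⟨t, rfl⟩ := mk_surjective H y
  change _ ∈ LinearMap.range (ofReduced H n)
  induction t with
  | zero => simp
  | add x y hx hy => rw [map_add]; exact add_mem hx hy
  | tmul a v =>
    -- A variable is either one of the first `n - 1`, or all the others are. For `n = 0` there is no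
    -- variable, so the truncated subtraction is harmless.
    have split : ∀ k : Fin n, (∃ k', k = Fin.castLE (Nat.sub_le n 1) k') ∨
        ∀ l, l ≠ k → ∃ k', l = Fin.castLE (Nat.sub_le n 1) k' := by
      intro k
      by_cases hk : (k : ℕ) < n - 1
      · exact Or.inl ⟨⟨k, hk⟩, rfl⟩
      · refine Or.inr fun l hl => ⟨⟨l, ?_⟩, rfl⟩
        have := Fin.val_ne_of_ne hl
        omega
    induction a using SPoly.induction_left with
    | one => exact ⟨1 ⊗ₜ v, by rw [ofReduced_tmul, map_one]⟩
    | add a b ha hb => rw [TensorProduct.add_tmul, map_add]; exact add_mem ha hb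
    | smul c a ha => rw [← TensorProduct.smul_tmul', map_smul]; exact Submodule.smul_mem _ _ ha
    | ev k a ha =>
      rw [← lmul_mk]
      rcases split k with ⟨k', rfl⟩ | hk
      · exact hev k' _ ha
      · have := htot _ ha
        rw [← Finset.add_sum_erase _ _ (Finset.mem_univ k)] at this
        refine (Submodule.add_mem_iff_left _ (Submodule.sum_mem _ fun l hl => ?_)).1 this
        obtain ⟨k', rfl⟩ := hk l (Finset.ne_of_mem_erase hl)
        exact hev k' _ ha
    | od k i a ha =>
      rw [← lmul_mk]
      rcases split k with ⟨k', rfl⟩ | hk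
      · exact hod k' i _ ha
      · have := htod i _ ha
        rw [← Finset.add_sum_erase _ _ (Finset.mem_univ k)] at this
        refine (Submodule.add_mem_iff_left _ (Submodule.sum_mem _ fun l hl => ?_)).1 this
        obtain ⟨k', rfl⟩ := hk l (Finset.ne_of_mem_erase hl)
        exact hod k' i _ ha

end VNabla

namespace Quiv

variable {ι : Type*} {l m n : ℕ}

/-! ### Paths -/

section paths

variable {Q : Quiv ι n} {a b c : Fin n} {e α : ι} {L L' : List ι}

theorem Joins.symm (h : Q.Joins e a b) : Q.Joins e b a := Or.symm h

theorem Joins.ne (h : Q.Joins e a b) : a ≠ b := by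
  rintro rfl
  rcases h with h | h <;> exact Q.noLoop e a h

theorem Joins.eq_or {c d : Fin n} (h : Q.Joins e a b) (h' : Q.Joins e c d) :
    (c = a ∧ d = b) ∨ (c = b ∧ d = a) := by
  rcases h with h | h <;> rcases h' with h' | h' <;> rw [h] at h' <;> simp_all

theorem isPath_append : Q.IsPath a (L ++ L') c ↔ ∃ b, Q.IsPath a L b ∧ Q.IsPath b L' c := by
  induction L generalizing a with
  | nil => simp [IsPath]
  | cons e L ih =>
    simp only [List.cons_append, IsPath, ih]
    constructor
    · rintro ⟨d, h1, b, h2, h3⟩; exact ⟨b, ⟨d, h1, h2⟩, h3⟩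
    · rintro ⟨b, ⟨d, h1, h2⟩, h3⟩; exact ⟨d, h1, b, h2, h3⟩

theorem isPath_singleton : Q.IsPath a [e] b ↔ Q.Joins e a b := by
  simp [IsPath]

theorem IsPath.reverse (h : Q.IsPath a L b) : Q.IsPath b L.reverse a := by
  induction L generalizing a with
  | nil => exact Eq.symm h
  | cons e L ih =>
    obtain ⟨c, h1, h2⟩ := h
    rw [List.reverse_cons]
    exact isPath_append.2 ⟨c, ih h2, isPath_singleton.2 h1.symm⟩

theorem IsPath.split (h : Q.IsPath a L b) (he : e ∈ L) : ∃ L₁ L₂ x y, L = L₁ ++ e :: L₂ ∧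
    Q.IsPath a L₁ x ∧ Q.Joins e x y ∧ Q.IsPath y L₂ b := by
  obtain ⟨L₁, L₂, rfl⟩ := List.append_of_mem he
  obtain ⟨x, h1, y, h2, h3⟩ := isPath_append.1 h
  exact ⟨L₁, L₂, x, y, rfl, h1, h2, h3⟩

theorem Conn.refl (a : Fin n) : Q.Conn a a := ⟨[], rfl⟩

theorem Conn.symm (h : Q.Conn a b) : Q.Conn b a := by
  obtain ⟨L, h⟩ := h; exact ⟨_, h.reverse⟩

theorem Conn.trans (h : Q.Conn a b) (h' : Q.Conn b c) : Q.Conn a c := by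
  obtain ⟨L, h⟩ := h
  obtain ⟨L', h'⟩ := h'
  exact ⟨_, isPath_append.2 ⟨b, h, h'⟩⟩

theorem Joins.conn (h : Q.Joins e a b) : Q.Conn a b := ⟨[e], isPath_singleton.2 h⟩

/-- A path with a repeated edge can be shortened: if two occurrences are traversed in the same
direction, one occurrence and the part between them are removed; if in opposite directions, both
occurrences go with that part. -/
theorem Conn.exists_nodup (h : Q.Conn a b) : ∃ L, L.Nodup ∧ Q.IsPath a L b := by
  classical
  obtain ⟨L, hL⟩ := h
  induction hs : L.length using Nat.strong_induction_on generalizing L with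
  | _ s ih =>
    by_cases hd : L.Nodup
    · exact ⟨L, hd, hL⟩
    · obtain ⟨e, he⟩ := List.exists_duplicate_iff_not_nodup.2 hd
      obtain ⟨L₁, L₂, x, y, rfl, h1, h2, h3⟩ := hL.split he.mem
      by_cases he2 : e ∈ L₂
      · obtain ⟨L₃, L₄, x', y', rfl, h4, h5, h6⟩ := h3.split he2
        by_cases hx : x = x'
        · subst hx
          refine ih _ ?_ (L₁ ++ e :: L₄) (isPath_append.2 ⟨x, h1, y', h5, h6⟩) rfl
          subst hs; simp
        · have hy : y' = x := by rcases h2.eq_or h5 with h | h <;> simp_all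
          subst hy
          refine ih _ ?_ (L₁ ++ L₄) (isPath_append.2 ⟨_, h1, h6⟩) rfl
          subst hs; simp; omega
      · have he1 : e ∈ L₁ := by
          by_contra hne
          have hc := List.duplicate_iff_two_le_count.1 he
          rw [List.count_append, List.count_cons_self, List.count_eq_zero_of_not_mem hne,
            List.count_eq_zero_of_not_mem he2] at hc
          omega
        obtain ⟨L₃, L₄, x', y', rfl, h4, h5, h6⟩ := h1.split he1
        by_cases hx : x = x'
        · subst hx
          refine ih _ ?_ (L₃ ++ e :: L₂) (isPath_append.2 ⟨x, h4, y, h2, h3⟩) rfl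
          subst hs; simp
        · have hy : y = x' := by rcases h2.eq_or h5 with h | h <;> simp_all
          subst hy
          refine ih _ ?_ (L₃ ++ L₂) (isPath_append.2 ⟨_, h4, h3⟩) rfl
          subst hs; simp; omega

theorem del_arrow_of_ne (h : e ≠ α) : (Q.del α).arrow e = Q.arrow e := by
  simp [del, h]

theorem del_arrow_self : (Q.del α).arrow α = none := by
  simp [del]

theorem del_joins : (Q.del α).Joins e a b ↔ e ≠ α ∧ Q.Joins e a b := by
  by_cases h : e = α
  · subst h; simp [Joins, del_arrow_self]
  · simp [Joins, del_arrow_of_ne h, h]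

theorem del_isPath : (Q.del α).IsPath a L b ↔ α ∉ L ∧ Q.IsPath a L b := by
  induction L generalizing a with
  | nil => simp [IsPath]
  | cons e L ih =>
    simp only [IsPath, del_joins, ih, List.mem_cons, not_or]
    constructor
    · rintro ⟨c, ⟨h1, h2⟩, h3, h4⟩; exact ⟨⟨Ne.symm h1, h3⟩, c, h2, h4⟩
    · rintro ⟨⟨h1, h3⟩, c, h2, h4⟩; exact ⟨c, ⟨Ne.symm h1, h2⟩, h3, h4⟩

/-- A path avoiding `e` between its two ends would be closed by `e` to a cycle: each edge of a
forest separates its ends. -/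
theorem Acyclic.bridge (hQ : Q.Acyclic) (h : Q.Joins e a b) : ¬(Q.del e).Conn a b := by
  intro hc
  obtain ⟨L, hL, hp⟩ := hc.exists_nodup
  rw [del_isPath] at hp
  refine hQ a (L ++ [e]) (by simp) ?_ (isPath_append.2 ⟨b, hp.2, isPath_singleton.2 h.symm⟩)
  rw [List.nodup_append]
  refine ⟨hL, by simp, ?_⟩
  rintro x hx y hy rfl
  rw [List.mem_singleton] at hy
  exact hp.1 (hy ▸ hx)

theorem Joins.arrow_ne_none (h : Q.Joins e a b) : Q.arrow e ≠ none := by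
  rcases h with h | h <;> simp [h]

end paths

/-! ### Flows -/

section flows

variable {G : Type*} [AddCommGroup G] (Q : Quiv ι n)

/-- The incidence number of an edge and a vertex. -/
def incid (e : ι) (a : Fin n) : ℤ :=
  (Q.arrow e).elim 0 fun q => (if q.1 = a then 1 else 0) - (if q.2 = a then 1 else 0)

/-- The net flow out of a vertex. -/
def div (f : ι →₀ G) (a : Fin n) : G := f.sum fun e x => Q.incid e a • x

theorem div_add (f g : ι →₀ G) (a : Fin n) : Q.div (f + g) a = Q.div f a + Q.div g a :=
  Finsupp.sum_add_index' (by simp) (by simp)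

theorem div_zero (a : Fin n) : Q.div (0 : ι →₀ G) a = 0 := Finsupp.sum_zero_index

theorem div_single (e : ι) (x : G) (a : Fin n) :
    Q.div (Finsupp.single e x) a = Q.incid e a • x :=
  Finsupp.sum_single_index (by simp)

theorem div_sum {I : Type*} (s : Finset I) (f : I → ι →₀ G) (a : Fin n) :
    Q.div (∑ i ∈ s, f i) a = ∑ i ∈ s, Q.div (f i) a := by
  classical
  induction s using Finset.induction_on with
  | empty => simp [div_zero]
  | insert i s hi ih => rw [Finset.sum_insert hi, Finset.sum_insert hi, div_add, ih]

variable {Q}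

theorem incid_of_none {e : ι} (h : Q.arrow e = none) (a : Fin n) : Q.incid e a = 0 := by
  simp [incid, h]

theorem incid_of_some {e : ι} {s t : Fin n} (h : Q.arrow e = some (s, t)) (a : Fin n) :
    Q.incid e a = (if s = a then 1 else 0) - (if t = a then 1 else 0) := by
  simp [incid, h]

theorem Joins.incid_eq {e : ι} {a b : Fin n} (h : Q.Joins e a b) :
    Q.incid e b = -Q.incid e a := by
  have := h.ne
  rcases h with h | h <;> simp [incid_of_some h, this, this.symm]

theorem incid_eq_zero {e : ι} {a : Fin n} (h : ∀ b, ¬Q.Joins e a b) : Q.incid e a = 0 := by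
  cases hq : Q.arrow e with
  | none => exact incid_of_none hq a
  | some q =>
    obtain ⟨s, t⟩ := q
    have h1 : s ≠ a := by rintro rfl; exact h t (Or.inl hq)
    have h2 : t ≠ a := by rintro rfl; exact h s (Or.inr hq)
    simp [incid_of_some hq, h1, h2]

open Classical in
theorem sum_incid {e : ι} {s t : Fin n} (h : Q.arrow e = some (s, t)) (P : Fin n → Prop) :
    ∑ a with P a, Q.incid e a = (if P s then 1 else 0) - (if P t then 1 else 0) := by
  simp [incid_of_some h, Finset.sum_sub_distrib]

open Classical in
theorem sum_incid_eq_zero {e : ι} (P : Fin n → Prop) (h : ∀ a b, Q.Joins e a b → P a → P b) :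
    ∑ a with P a, Q.incid e a = 0 := by
  cases hq : Q.arrow e with
  | none => simp [incid_of_none hq]
  | some q =>
    obtain ⟨s, t⟩ := q
    have : P s ↔ P t := ⟨h s t (Or.inl hq), h t s (Or.inr hq)⟩
    rw [sum_incid hq]; simp [this]

open Classical in
/-- The sum of the net flows over a set of vertices which the flow does not leave. -/
theorem sum_div_eq_zero (f : ι →₀ G) (P : Fin n → Prop)
    (h : ∀ e a b, f e ≠ 0 → Q.Joins e a b → P a → P b) : ∑ a with P a, Q.div f a = 0 := by
  simp only [div, Finsupp.sum]
  rw [Finset.sum_comm]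
  refine Finset.sum_eq_zero fun e he => ?_
  rw [← Finset.sum_smul, sum_incid_eq_zero P fun a b => h e a b (by simpa using he), zero_smul]

open Classical in
/-- The flow through an edge of an acyclic quiver is the sum of the sinks beyond it. -/
theorem Acyclic.cut (hQ : Q.Acyclic) (f : ι →₀ G) (ρ : Fin n → G) (hf : ∀ j, Q.div f j = -ρ j)
    {e : ι} {x y : Fin n} (he : Q.Joins e x y) :
    Q.incid e x • f e = ∑ i with (Q.del e).Conn i y, ρ i := by
  -- Sum the divergence over the side of `y`. Every other edge has both ends on one side and
  -- cancels; `e` has only the end `y` there.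
  have h1 : ∑ i with (Q.del e).Conn i y, Q.div f i = Q.incid e y • f e := by
    simp only [div, Finsupp.sum]
    rw [Finset.sum_comm]
    simp only [← Finset.sum_smul]
    rw [Finset.sum_eq_single e]
    · congr 1
      have hx := hQ.bridge he
      rcases he with he | he
      · rw [sum_incid he]
        have : x ≠ y := fun hxy => hx (hxy ▸ Conn.refl _)
        simp [incid_of_some he, hx, Conn.refl, this]
      · rw [sum_incid he]
        have : x ≠ y := fun hxy => hx (hxy ▸ Conn.refl _)
        simp [incid_of_some he, hx, Conn.refl, this]
    · intro e' _ hne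
      rw [sum_incid_eq_zero, zero_smul]
      intro a b hab ha
      exact (del_joins.2 ⟨hne, hab⟩).conn.symm.trans ha
    · intro h
      rw [Finsupp.notMem_support_iff.1 h, smul_zero]
  rw [he.incid_eq, neg_smul, Finset.sum_congr rfl fun i _ => hf i, Finset.sum_neg_distrib,
    neg_inj] at h1
  exact h1.symm

/-- The amount `x` is pushed along the path, each edge receiving it with the sign of the direction
in which it is traversed. -/
theorem IsPath.exists_flow {L : List ι} {a b : Fin n} (h : Q.IsPath a L b) (x : G) :
    ∃ f : ι →₀ G, (∀ e, Q.arrow e = none → f e = 0) ∧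
      ∀ c, Q.div f c = (if c = a then x else 0) - (if c = b then x else 0) := by
  classical
  induction L generalizing a with
  | nil =>
    obtain rfl : a = b := h
    exact ⟨0, by simp, fun c => by simp [div_zero]⟩
  | cons e L ih =>
    obtain ⟨d, h1, h2⟩ := h
    obtain ⟨f, hf, hd⟩ := ih h2
    refine ⟨Finsupp.single e (Q.incid e a • x) + f, fun e' he' => ?_, fun c => ?_⟩
    · have : e ≠ e' := by rintro rfl; exact h1.arrow_ne_none he'
      simp [Finsupp.single_eq_of_ne this.symm, hf e' he']
    · rw [div_add, div_single, hd]
      have hne := h1.ne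
      rcases h1 with h1 | h1
      · simp only [incid_of_some h1, sub_smul, ite_smul, one_smul, zero_smul, smul_sub]
        simp only [eq_comm (b := c), hne.symm, if_true, if_false]
        split_ifs <;> simp_all
      · simp only [incid_of_some h1, sub_smul, ite_smul, one_smul, zero_smul, smul_sub]
        simp only [eq_comm (b := c), hne.symm, if_true, if_false]
        split_ifs <;> simp_all

open Classical in
/-- A distribution of sinks which sums to zero over the components comes from a flow. -/
theorem exists_flow (ρ : Fin n → G) (hρ : ∀ i, ∑ k with Q.Conn i k, ρ k = 0) :
    ∃ f : ι →₀ G, (∀ e, Q.arrow e = none → f e = 0) ∧ ∀ j, Q.div f j = -ρ j := by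
  -- Each component gets a root `r i`, and `-ρ i` is pushed from `i` to its root. The amounts
  -- arriving at a root add up to the total of `ρ` over the component with a sign, which is zero.
  let S : Setoid (Fin n) := ⟨Q.Conn, Conn.refl, Conn.symm, Conn.trans⟩
  let r : Fin n → Fin n := fun i => (Quotient.mk S i).out
  have hr : ∀ i, Q.Conn i (r i) := fun i => Conn.symm (Quotient.mk_out (s := S) i)
  have hr' : ∀ i k, r i = r k ↔ Q.Conn i k := fun i k =>
    ⟨fun h => (hr i).trans (h ▸ (hr k).symm), fun h => by
      have : Quotient.mk S i = Quotient.mk S k := Quotient.sound h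
      simp only [r, this]⟩
  choose L hL using hr
  choose f hf hd using fun i => (hL i).exists_flow (-ρ i)
  refine ⟨∑ i, f i, fun e he => ?_, fun j => ?_⟩
  · rw [Finsupp.finsetSum_apply]
    exact Finset.sum_eq_zero fun i _ => hf i e he
  · rw [div_sum]
    simp only [hd, Finset.sum_sub_distrib, Finset.sum_ite_eq, Finset.mem_univ, if_true]
    rw [sub_eq_self, ← Finset.sum_filter, Finset.sum_neg_distrib, neg_eq_zero]
    by_cases hj : ∃ i, r i = j
    · obtain ⟨i, rfl⟩ := hj
      rw [← hρ i]
      congr 1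
      ext k
      simp [hr']
    · push Not at hj
      exact Finset.sum_eq_zero fun k hk => absurd (Finset.mem_filter.1 hk).2.symm (hj k)

end flows

/-! ### Contraction of blocks -/

section contract

variable {ν : Fin m → ℕ} {h : ∑ j, ν j = n} {Q : Quiv ι n} {e α : ι}

theorem contract_arrow_of_some {a b : Fin n} (he : Q.arrow e = some (a, b)) :
    (Q.contract ν h).arrow e =
      if blkIdx ν h a = blkIdx ν h b then none else some (blkIdx ν h a, blkIdx ν h b) := by
  simp [contract, he]

theorem contract_arrow_of_none (he : Q.arrow e = none) : (Q.contract ν h).arrow e = none := by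
  simp [contract, he]

theorem contract_arrow_eq_some {i j : Fin m} : (Q.contract ν h).arrow e = some (i, j) ↔
    ∃ a b, Q.arrow e = some (a, b) ∧ blkIdx ν h a = i ∧ blkIdx ν h b = j ∧ i ≠ j := by
  constructor
  · intro he
    cases hq : Q.arrow e with
    | none => rw [contract_arrow_of_none hq] at he; cases he
    | some q =>
      obtain ⟨a, b⟩ := q
      rw [contract_arrow_of_some hq] at he
      split_ifs at he with hab
      simp only [Option.some.injEq, Prod.mk.injEq] at he
      obtain ⟨rfl, rfl⟩ := he
      exact ⟨a, b, rfl, rfl, rfl, hab⟩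
  · rintro ⟨a, b, he, rfl, rfl, hne⟩
    rw [contract_arrow_of_some he, if_neg hne]

theorem contract_joins {i j : Fin m} : (Q.contract ν h).Joins e i j ↔
    ∃ a b, Q.Joins e a b ∧ blkIdx ν h a = i ∧ blkIdx ν h b = j ∧ i ≠ j := by
  constructor
  · rintro (he | he)
    · obtain ⟨a, b, h1, h2, h3, h4⟩ := contract_arrow_eq_some.1 he
      exact ⟨a, b, Or.inl h1, h2, h3, h4⟩
    · obtain ⟨a, b, h1, h2, h3, h4⟩ := contract_arrow_eq_some.1 he
      exact ⟨b, a, Or.inr h1, h3, h2, h4.symm⟩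
  · rintro ⟨a, b, he | he, h2, h3, h4⟩
    · exact Or.inl (contract_arrow_eq_some.2 ⟨a, b, he, h2, h3, h4⟩)
    · exact Or.inr (contract_arrow_eq_some.2 ⟨b, a, he, h3, h2, h4.symm⟩)

theorem Joins.contract {a b : Fin n} (he : Q.Joins e a b) (hne : blkIdx ν h a ≠ blkIdx ν h b) :
    (Q.contract ν h).Joins e (blkIdx ν h a) (blkIdx ν h b) :=
  contract_joins.2 ⟨a, b, he, rfl, rfl, hne⟩

theorem Joins.of_contract {a b : Fin n} {i j : Fin m} (he : Q.Joins e a b)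
    (hc : (Q.contract ν h).Joins e i j) : blkIdx ν h a ≠ blkIdx ν h b := by
  obtain ⟨a', b', h1, rfl, rfl, hne⟩ := contract_joins.1 hc
  rcases h1.eq_or he with ⟨rfl, rfl⟩ | ⟨rfl, rfl⟩
  · exact hne
  · exact hne.symm

theorem Joins.arrow_contract_ne_none {a b : Fin n} (he : Q.Joins e a b) :
    (Q.contract ν h).arrow e ≠ none ↔ blkIdx ν h a ≠ blkIdx ν h b := by
  rcases he with he | he
  · rw [contract_arrow_of_some he]; split_ifs with h1 <;> simp [h1]
  · rw [contract_arrow_of_some he]; split_ifs with h1 <;> simp [h1, eq_comm]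
    exact fun h2 => h1 h2.symm

theorem sum_incid_contract (e : ι) (j : Fin m) :
    ∑ a with blkIdx ν h a = j, Q.incid e a = (Q.contract ν h).incid e j := by
  classical
  cases hq : Q.arrow e with
  | none => simp [incid_of_none hq, incid_of_none (contract_arrow_of_none hq)]
  | some q =>
    obtain ⟨s, t⟩ := q
    have := sum_incid hq (fun a => blkIdx ν h a = j)
    rw [incid, contract_arrow_of_some hq]
    refine Eq.trans ?_ (this.trans ?_)
    · congr
    · split_ifs with h1 <;> simp_all

theorem sum_div_contract {G : Type*} [AddCommGroup G] (f : ι →₀ G) (j : Fin m) :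
    ∑ a with blkIdx ν h a = j, Q.div f a = (Q.contract ν h).div f j := by
  simp only [div, Finsupp.sum]
  rw [Finset.sum_comm]
  simp only [← Finset.sum_smul, sum_incid_contract]

/-- In a forest, the edge at `a` can be crossed only towards the block of `a`: crossed the other
way, it and the rest of the path would form a cycle. So the initial segment reaches the far end of
the edge without using it, and external connection means that `i` lies beyond one of the edges which
join `a` to other blocks. -/
theorem extConn_iff (hF : (Q.contract ν h).Acyclic) (i : Fin m) (a : Fin n) :
    Q.ExtConn ν h i a ↔ ∃ e c, Q.Joins e a c ∧ blkIdx ν h a ≠ blkIdx ν h c ∧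
      ((Q.contract ν h).del e).Conn i (blkIdx ν h c) := by
  constructor
  · rintro ⟨L, hL, hp, e, he, c, hc⟩
    obtain ⟨L₁, L₂, x, y, rfl, h1, h2, h3⟩ := hp.split he
    have hne := hc.of_contract h2
    refine ⟨e, c, hc, hne, ?_⟩
    have hc' := hc.contract hne
    have hnd := hL
    rw [List.nodup_append, List.nodup_cons] at hL
    have h4 : x = blkIdx ν h c := by
      have hx : x = blkIdx ν h c ∨ x = blkIdx ν h a := by
        rcases hc'.eq_or h2 with h | h <;> simp [h]
      rcases hx with hx | hx
      · exact hx
      · exfalso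
        refine hF x (e :: L₂) (by simp) (List.nodup_cons.2 hL.2.1) ⟨y, h2, ?_⟩
        rw [hx]; exact h3
    subst h4
    exact ⟨L₁, del_isPath.2 ⟨fun hmem => hL.2.2 e hmem e (by simp) rfl, h1⟩⟩
  · rintro ⟨e, c, hc, hne, hconn⟩
    obtain ⟨L, hL, hp⟩ := hconn.exists_nodup
    rw [del_isPath] at hp
    refine ⟨L ++ [e], ?_, isPath_append.2 ⟨_, hp.2, isPath_singleton.2 (hc.contract hne).symm⟩,
      e, by simp, c, hc⟩
    rw [List.nodup_append]
    refine ⟨hL, by simp, ?_⟩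
    rintro x hx y hy rfl
    rw [List.mem_singleton] at hy
    exact hp.1 (hy ▸ hx)

/-- The branches beyond two different edges at `j` are disjoint. A vertex common to both would
connect the ends of one of these edges by a path which avoids that edge. -/
theorem Acyclic.side_disjoint {F : Quiv ι m} (hF : F.Acyclic) {j c c' i : Fin m} {e e' : ι}
    (hne : e ≠ e') (he : F.Joins e j c) (he' : F.Joins e' j c') (h1 : (F.del e).Conn i c)
    (h2 : (F.del e').Conn i c') : False := by
  obtain ⟨L, hL⟩ := h1
  rw [del_isPath] at hL
  by_cases hmem : e' ∈ L
  · obtain ⟨L₁, L₂, x, y, rfl, h3, h4, h5⟩ := hL.2.split hmem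
    have h6 : (F.del e).Conn y c := ⟨L₂, del_isPath.2 ⟨fun h => hL.1 (by simp [h]), h5⟩⟩
    have h7 : (F.del e).Joins e' x y := del_joins.2 ⟨hne.symm, h4⟩
    have hx : j = x ∨ j = y := by rcases he'.eq_or h4 with h | h <;> simp [h]
    rcases hx with rfl | rfl
    · exact hF.bridge he (h7.conn.trans h6)
    · exact hF.bridge he h6
  · have h3 : (F.del e').Conn i c := ⟨L, del_isPath.2 ⟨hmem, hL.2⟩⟩
    have h4 : (F.del e').Joins e j c := del_joins.2 ⟨hne, he⟩
    exact hF.bridge he' ((h4.conn.trans h3.symm).trans h2)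

open Classical in
/-- The net flow out of a vertex is the sum of the sinks externally connected to it. -/
theorem flow_unique {G : Type*} [AddCommGroup G] (hF : (Q.contract ν h).Acyclic) (f : ι →₀ G)
    (hf : ∀ e, (Q.contract ν h).arrow e = none → f e = 0) (ρ : Fin m → G)
    (hρ : ∀ j, (Q.contract ν h).div f j = -ρ j) (a : Fin n) :
    Q.div f a = ∑ i with Q.ExtConn ν h i a, ρ i := by
  let E : Set ι := {e | ∃ c, Q.Joins e a c ∧ blkIdx ν h a ≠ blkIdx ν h c}
  -- The ambient set of edges may be infinite, but two edges from `a` to the same other block would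
  -- violate `side_disjoint`; so there are at most as many edges as blocks.
  have hE : E.Finite := by
    have : Nonempty (Fin n) := ⟨a⟩
    choose! c hc hc' using (fun e he => he : ∀ e ∈ E, ∃ c, Q.Joins e a c ∧ _)
    refine Set.Finite.of_finite_image (f := fun e => blkIdx ν h (c e)) (Set.toFinite _) ?_
    intro e he e' he' hee
    by_contra hne
    exact hF.side_disjoint hne ((hc e he).contract (hc' e he)) ((hc e' he').contract (hc' e' he'))
      (i := blkIdx ν h (c e)) (Conn.refl _) (by
        have : blkIdx ν h (c e) = blkIdx ν h (c e') := hee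
        rw [this]; exact Conn.refl _)
  -- The vertices externally connected to `a` are partitioned into the branches `T e` beyond the
  -- edges at `a`. By `Acyclic.cut` the flow out of `a` through `e` is the sum of the sinks in `T
  -- e`.
  let T : ι → Finset (Fin m) := fun e => Finset.univ.filter fun i => ∃ c, Q.Joins e a c ∧
    blkIdx ν h a ≠ blkIdx ν h c ∧ ((Q.contract ν h).del e).Conn i (blkIdx ν h c)
  have h1 : Finset.univ.filter (fun i => Q.ExtConn ν h i a) = hE.toFinset.biUnion T := by
    ext i
    simp only [Finset.mem_filter, Finset.mem_univ, true_and, Finset.mem_biUnion, T,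
      extConn_iff hF, Set.Finite.mem_toFinset, E, Set.mem_ofPred_eq]
    constructor
    · rintro ⟨e, c, h2, h3, h4⟩; exact ⟨e, ⟨c, h2, h3⟩, c, h2, h3, h4⟩
    · rintro ⟨e, -, c, h2, h3, h4⟩; exact ⟨e, c, h2, h3, h4⟩
  rw [h1, Finset.sum_biUnion]
  · have h2 : Q.div f a = ∑ e ∈ f.support ∪ hE.toFinset, Q.incid e a • f e := by
      rw [div, Finsupp.sum]
      refine Finset.sum_subset Finset.subset_union_left fun e _ he => ?_
      rw [Finsupp.notMem_support_iff.1 he, smul_zero]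
    rw [h2]
    symm
    refine Finset.sum_subset_zero_on_sdiff Finset.subset_union_right (fun e he => ?_)
      fun e he => ?_
    · rw [Finset.mem_sdiff, Finset.mem_union, Set.Finite.mem_toFinset] at he
      have he1 := Finsupp.mem_support_iff.1 (he.1.resolve_right he.2)
      have he2 : (Q.contract ν h).arrow e ≠ none := fun hn => he1 (hf e hn)
      rw [incid_eq_zero, zero_smul]
      intro c hc
      exact he.2 ⟨c, hc, hc.arrow_contract_ne_none.1 he2⟩
    · rw [Set.Finite.mem_toFinset] at he
      obtain ⟨c, hc, hne⟩ := he
      have h3 := hF.cut f ρ hρ (hc.contract hne)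
      have h4 : (Q.contract ν h).incid e (blkIdx ν h a) = Q.incid e a := by
        have hac := hc.ne
        have hne' := hne.symm
        rcases hc with hc | hc
        · rw [incid_of_some hc, incid_of_some (contract_arrow_eq_some.2 ⟨_, _, hc, rfl, rfl, hne⟩)]
          simp [hac.symm, hne']
        · rw [incid_of_some hc, incid_of_some (contract_arrow_eq_some.2 ⟨_, _, hc, rfl, rfl, hne'⟩)]
          simp [hac.symm, hne']
      rw [← h4, h3]
      refine Finset.sum_congr ?_ fun _ _ => rfl
      ext i
      simp only [T, Finset.mem_filter, Finset.mem_univ, true_and]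
      constructor
      · rintro ⟨c', hc', hne', hconn⟩
        have : c' = c := by
          have := hc.ne
          rcases hc.eq_or hc' with h | h <;> simp_all
        exact this ▸ hconn
      · intro hconn; exact ⟨c, hc, hne, hconn⟩
  · intro e he e' he' hne
    rw [Function.onFun, Finset.disjoint_left]
    intro i hi hi'
    simp only [T, Finset.mem_filter, Finset.mem_univ, true_and] at hi hi'
    obtain ⟨c, hc, hc1, hc2⟩ := hi
    obtain ⟨c', hc', hc1', hc2'⟩ := hi'
    exact hF.side_disjoint hne (hc.contract hc1) (hc'.contract hc1') hc2 hc2'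

end contract

end Quiv

/-! ### Consecutive blocks -/

section blocks

variable {l m n : ℕ} {ν : Fin m → ℕ} {h : ∑ j, ν j = n}

@[simp] theorem blkIdx_blk (p : (j : Fin m) × Fin (ν j)) : blkIdx ν h (blk ν h p) = p.1 := by
  rw [blkIdx, Equiv.symm_apply_apply]

theorem exists_blk (a : Fin n) : ∃ k, a = blk ν h ⟨blkIdx ν h a, k⟩ :=
  ⟨_, ((blk ν h).apply_symm_apply a).symm⟩

theorem exists_blk_of_eq {a : Fin n} {j : Fin m} (ha : blkIdx ν h a = j) :
    ∃ k, a = blk ν h ⟨j, k⟩ := by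
  subst ha; exact exists_blk a

theorem blk_val (j : Fin m) (k : Fin (ν j)) :
    (blk ν h ⟨j, k⟩ : ℕ) = ∑ i, (if i < j then ν i else 0) + k := by
  have : (blk ν h ⟨j, k⟩ : ℕ) = (finSigmaFinEquiv (⟨j, k⟩ : (j : Fin m) × Fin (ν j)) : ℕ) := rfl
  rw [this, finSigmaFinEquiv_apply, ← Finset.sum_filter]
  congr 1
  refine Finset.sum_nbij (Fin.castLE j.2.le) (fun i _ => ?_) (fun i _ i' _ hi => ?_)
    (fun i hi => ?_) fun _ _ => rfl
  · exact Finset.mem_coe.2 (Finset.mem_filter.2 ⟨Finset.mem_univ _, i.2⟩)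
  · exact Fin.castLE_injective _ hi
  · simp only [Finset.coe_filter, Finset.mem_univ, true_and, Set.mem_ofPred_eq] at hi
    exact ⟨⟨i, hi⟩, by simp, rfl⟩

theorem blk_lt_of_lt {j j' : Fin m} (k : Fin (ν j)) (k' : Fin (ν j')) (hj : j < j') :
    blk ν h ⟨j, k⟩ < blk ν h ⟨j', k'⟩ := by
  rw [Fin.lt_def, blk_val, blk_val]
  have : ∑ i, (if i < j then ν i else 0) + ν j ≤ ∑ i, (if i < j' then ν i else 0) := by
    rw [← Finset.sum_filter, ← Finset.sum_filter, add_comm, ← Finset.sum_insert (by simp)]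
    refine Finset.sum_le_sum_of_subset fun i hi => ?_
    simp only [Finset.mem_insert, Finset.mem_filter, Finset.mem_univ, true_and] at hi ⊢
    rcases hi with rfl | hi
    · exact hj
    · exact hi.trans hj
  have := k.2
  omega

theorem blk_lt_iff {j j' : Fin m} {k : Fin (ν j)} {k' : Fin (ν j')} :
    blk ν h ⟨j, k⟩ < blk ν h ⟨j', k'⟩ ↔ j < j' ∨ (j = j' ∧ (k : ℕ) < k') := by
  rcases lt_trichotomy j j' with hj | hj | hj
  · simp [hj, blk_lt_of_lt k k' hj]
  · subst hj
    rw [Fin.lt_def, blk_val, blk_val]; simp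
  · have := blk_lt_of_lt (h := h) k' k hj
    simp [hj.not_gt, hj.ne', this.le]

theorem sum_blk {M : Type*} [AddCommMonoid M] (f : Fin n → M) :
    ∑ a, f a = ∑ j, ∑ k, f (blk ν h ⟨j, k⟩) := by
  rw [← Equiv.sum_comp (blk ν h) f, Fintype.sum_sigma]

theorem sum_filter_blkIdx {M : Type*} [AddCommMonoid M] (f : Fin n → M) (j : Fin m) :
    ∑ a with blkIdx ν h a = j, f a = ∑ k, f (blk ν h ⟨j, k⟩) := by
  rw [Finset.sum_filter, sum_blk (ν := ν) (h := h), Finset.sum_eq_single j]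
  · simp
  · intro j' _ hj'; simp [hj']
  · simp

/-- Both sides count the elements before the given one. The smaller blocks before `(j, k)` are those
of the earlier large blocks and the earlier ones of the `j`-th. -/
theorem blk_assoc {μ : Fin n → ℕ} (h' : ∑ k, μ k = l) (j : Fin m) (k : Fin (ν j))
    (i : Fin (μ (blk ν h ⟨j, k⟩))) :
    blk (fun j => ∑ k, μ (blk ν h ⟨j, k⟩)) (sum_blocks h h')
      ⟨j, blk (fun k => μ (blk ν h ⟨j, k⟩)) rfl ⟨k, i⟩⟩ = blk μ h' ⟨blk ν h ⟨j, k⟩, i⟩ := by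
  rw [Fin.ext_iff, blk_val, blk_val, blk_val, ← add_assoc]
  congr 1
  rw [sum_blk (ν := ν) (h := h)]
  simp only [blk_lt_iff]
  rw [← Finset.add_sum_erase _ (fun j' => if j' < j then ∑ k, μ (blk ν h ⟨j', k⟩) else 0)
    (Finset.mem_univ j), ← Finset.add_sum_erase _ (fun j' => ∑ k' : Fin (ν j'),
      if j' < j ∨ j' = j ∧ (k' : ℕ) < k then μ (blk ν h ⟨j', k'⟩) else 0) (Finset.mem_univ j)]
  simp only [lt_irrefl, if_false, zero_add, false_or, true_and]
  rw [add_comm]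
  congr 1
  refine Finset.sum_congr rfl fun j' hj' => ?_
  have : j' ≠ j := Finset.ne_of_mem_erase hj'
  by_cases hlt : j' < j <;> simp [this, hlt]

theorem blkIdx_blkIdx {μ : Fin n → ℕ} (h' : ∑ k, μ k = l) (a : Fin l) :
    blkIdx (fun j => ∑ k, μ (blk ν h ⟨j, k⟩)) (sum_blocks h h') a =
      blkIdx ν h (blkIdx μ h' a) := by
  obtain ⟨⟨k, i⟩, rfl⟩ := (blk μ h').surjective a
  obtain ⟨⟨j, k⟩, rfl⟩ := (blk ν h).surjective k
  rw [blkIdx_blk, blkIdx_blk, ← blk_assoc h', blkIdx_blk]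

end blocks

namespace Quiv

variable {ι : Type*} {l m n : ℕ}

/-! ### Subquivers of the blocks, and cycles inside and between blocks. -/

section sub

variable {ν : Fin m → ℕ} {h : ∑ j, ν j = n} {Q : Quiv ι n} {e α : ι} {L : List ι}

theorem pos_blk {j : Fin m} (k : Fin (ν j)) (hk : blkIdx ν h (blk ν h ⟨j, k⟩) = j) :
    pos ν h hk = k := by
  have := blk_pos ν h hk
  simpa using this

theorem sub_arrow_eq_some {j : Fin m} {x y : Fin (ν j)} : (Q.sub ν h j).arrow e = some (x, y) ↔
    Q.arrow e = some (blk ν h ⟨j, x⟩, blk ν h ⟨j, y⟩) := by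
  constructor
  · intro he
    obtain ⟨⟨a, b⟩, h1, h2⟩ := Option.bind_eq_some_iff.1 he
    split_ifs at h2 with h3
    simp only [Option.some.injEq, Prod.mk.injEq] at h2
    rw [h1, ← h2.1, ← h2.2, blk_pos, blk_pos]
  · intro he
    simp [sub, he, pos_blk]

theorem sub_joins {j : Fin m} {x y : Fin (ν j)} : (Q.sub ν h j).Joins e x y ↔
    Q.Joins e (blk ν h ⟨j, x⟩) (blk ν h ⟨j, y⟩) :=
  or_congr sub_arrow_eq_some sub_arrow_eq_some

theorem IsPath.of_sub {j : Fin m} {x y : Fin (ν j)} (hp : (Q.sub ν h j).IsPath x L y) :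
    Q.IsPath (blk ν h ⟨j, x⟩) L (blk ν h ⟨j, y⟩) := by
  induction L generalizing x with
  | nil => obtain rfl : x = y := hp; rfl
  | cons e L ih =>
    obtain ⟨z, h1, h2⟩ := hp
    exact ⟨_, sub_joins.1 h1, ih h2⟩

theorem Conn.of_sub {j : Fin m} {x y : Fin (ν j)} (hp : (Q.sub ν h j).Conn x y) :
    Q.Conn (blk ν h ⟨j, x⟩) (blk ν h ⟨j, y⟩) := by
  obtain ⟨L, hL⟩ := hp
  exact ⟨L, hL.of_sub⟩

theorem Acyclic.sub (hQ : Q.Acyclic) (j : Fin m) : (Q.sub ν h j).Acyclic :=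
  fun _ L hL hnd hp => hQ _ L hL hnd hp.of_sub

open Classical in
theorem IsPath.contract {a b : Fin n} (hp : Q.IsPath a L b) :
    (Q.contract ν h).IsPath (blkIdx ν h a)
      (L.filter fun e => (Q.contract ν h).arrow e ≠ none) (blkIdx ν h b) := by
  induction L generalizing a with
  | nil => obtain rfl : a = b := hp; rfl
  | cons e L ih =>
    obtain ⟨c, h1, h2⟩ := hp
    by_cases hc : (Q.contract ν h).arrow e ≠ none
    · rw [List.filter_cons_of_pos (by simpa using hc)]
      exact ⟨_, h1.contract (h1.arrow_contract_ne_none.1 hc), ih h2⟩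
    · rw [List.filter_cons_of_neg (by simpa using hc)]
      rw [h1.arrow_contract_ne_none, not_not] at hc
      rw [hc]; exact ih h2

theorem IsPath.sub {j : Fin m} {x : Fin (ν j)} {b : Fin n} (hp : Q.IsPath (blk ν h ⟨j, x⟩) L b)
    (hL : ∀ e ∈ L, (Q.contract ν h).arrow e = none) :
    ∃ y, b = blk ν h ⟨j, y⟩ ∧ (Q.sub ν h j).IsPath x L y := by
  induction L generalizing x with
  | nil => exact ⟨x, Eq.symm hp, rfl⟩
  | cons e L ih =>
    obtain ⟨c, h1, h2⟩ := hp
    have h3 : blkIdx ν h c = j := by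
      have := mt h1.arrow_contract_ne_none.2 (not_not.2 (hL e (by simp)))
      rw [not_not, blkIdx_blk] at this
      exact this.symm
    obtain ⟨z, rfl⟩ := exists_blk_of_eq h3
    obtain ⟨y, hy, hp⟩ := ih h2 fun e he => hL e (by simp [he])
    exact ⟨y, hy, z, sub_joins.2 h1, hp⟩

/-- A cycle either uses an edge between blocks, and then its edges between blocks form a cycle of
the contraction, or it stays inside one block. -/
theorem acyclic_of_blocks (h0 : (Q.contract ν h).Acyclic) (h1 : ∀ j, (Q.sub ν h j).Acyclic) :
    Q.Acyclic := by
  classical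
  intro a L hL hnd hp
  by_cases hc : ∃ e ∈ L, (Q.contract ν h).arrow e ≠ none
  · obtain ⟨e, he, hc⟩ := hc
    refine h0 _ _ ?_ (hnd.filter _) (hp.contract (ν := ν) (h := h))
    exact List.ne_nil_of_mem (List.mem_filter.2 ⟨he, by simpa using hc⟩)
  · push Not at hc
    obtain ⟨x, hx⟩ := exists_blk (ν := ν) (h := h) a
    rw [hx] at hp
    obtain ⟨y, hy, hp⟩ := hp.sub hc
    have : x = y := by simpa using hy
    subst this
    exact h1 _ x L hL hnd hp

theorem IsDirPath.isPath {a b : Fin n} (hp : Q.IsDirPath a L b) : Q.IsPath a L b := by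
  induction L generalizing a with
  | nil => exact hp
  | cons e L ih =>
    obtain ⟨c, h1, h2⟩ := hp
    exact ⟨c, Or.inl h1, ih h2⟩

open Classical in
theorem IsDirPath.contract {a b : Fin n} (hp : Q.IsDirPath a L b) :
    (Q.contract ν h).IsDirPath (blkIdx ν h a)
      (L.filter fun e => (Q.contract ν h).arrow e ≠ none) (blkIdx ν h b) := by
  induction L generalizing a with
  | nil => obtain rfl : a = b := hp; rfl
  | cons e L ih =>
    obtain ⟨c, h1, h2⟩ := hp
    have hj : Q.Joins e a c := Or.inl h1
    by_cases hc : (Q.contract ν h).arrow e ≠ none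
    · rw [List.filter_cons_of_pos (by simpa using hc)]
      exact ⟨_, contract_arrow_eq_some.2 ⟨a, c, h1, rfl, rfl, hj.arrow_contract_ne_none.1 hc⟩,
        ih h2⟩
    · rw [List.filter_cons_of_neg (by simpa using hc)]
      rw [hj.arrow_contract_ne_none, not_not] at hc
      rw [hc]; exact ih h2

theorem IsDirPath.sub {j : Fin m} {x : Fin (ν j)} {b : Fin n}
    (hp : Q.IsDirPath (blk ν h ⟨j, x⟩) L b)
    (hL : ∀ e ∈ L, (Q.contract ν h).arrow e = none) :
    ∃ y, b = blk ν h ⟨j, y⟩ ∧ (Q.sub ν h j).IsDirPath x L y := by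
  induction L generalizing x with
  | nil => exact ⟨x, Eq.symm hp, rfl⟩
  | cons e L ih =>
    obtain ⟨c, h1, h2⟩ := hp
    have hj : Q.Joins e (blk ν h ⟨j, x⟩) c := Or.inl h1
    have h3 : blkIdx ν h c = j := by
      have := mt hj.arrow_contract_ne_none.2 (not_not.2 (hL e (by simp)))
      rw [not_not, blkIdx_blk] at this
      exact this.symm
    obtain ⟨z, rfl⟩ := exists_blk_of_eq h3
    obtain ⟨y, hy, hp⟩ := ih h2 fun e he => hL e (by simp [he])
    exact ⟨y, hy, z, sub_arrow_eq_some.2 h1, hp⟩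

theorem arrow_ext {Q Q' : Quiv ι n}
    (hQ : ∀ e a b, Q.arrow e = some (a, b) ↔ Q'.arrow e = some (a, b)) : Q = Q' := by
  refine Quiv.ext (funext fun e => Option.ext fun ⟨a, b⟩ => hQ e a b)

theorem del_arrow_eq_some {a b : Fin n} :
    (Q.del α).arrow e = some (a, b) ↔ e ≠ α ∧ Q.arrow e = some (a, b) := by
  by_cases he : e = α
  · subst he; simp [del_arrow_self]
  · simp [del_arrow_of_ne he, he]

theorem contract_del (α : ι) : (Q.del α).contract ν h = (Q.contract ν h).del α := by
  refine arrow_ext fun e i j => ?_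
  simp only [contract_arrow_eq_some, del_arrow_eq_some]
  constructor
  · rintro ⟨a, b, ⟨h1, h2⟩, h3⟩; exact ⟨h1, a, b, h2, h3⟩
  · rintro ⟨h1, a, b, h2, h3⟩; exact ⟨a, b, ⟨h1, h2⟩, h3⟩

theorem sub_del (α : ι) (j : Fin m) : (Q.del α).sub ν h j = (Q.sub ν h j).del α := by
  refine arrow_ext fun e i j => ?_
  simp only [sub_arrow_eq_some, del_arrow_eq_some]

theorem del_eq_self (hα : Q.arrow α = none) : Q.del α = Q := by
  refine arrow_ext fun e i j => ?_
  rw [del_arrow_eq_some, and_iff_right_iff_imp]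
  rintro he rfl
  rw [he] at hα; cases hα

/-- An edge absent from the contraction occurs in none of its paths, so it cannot be the edge
incident to `a` either. -/
theorem extConn_del (hα : (Q.contract ν h).arrow α = none) (i : Fin m) (a : Fin n) :
    (Q.del α).ExtConn ν h i a ↔ Q.ExtConn ν h i a := by
  have hc : (Q.del α).contract ν h = Q.contract ν h := by rw [contract_del, del_eq_self hα]
  simp only [ExtConn, hc, del_joins]
  constructor
  · rintro ⟨L, h1, h2, e, h3, b, h4, h5⟩; exact ⟨L, h1, h2, e, h3, b, h5⟩
  · rintro ⟨L, h1, h2, e, h3, b, h5⟩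
    refine ⟨L, h1, h2, e, h3, b, ?_, h5⟩
    rintro rfl
    obtain ⟨L₁, L₂, x, y, -, -, h4, -⟩ := h2.split h3
    exact h4.arrow_ne_none hα

theorem div_sub_self {G : Type*} [AddCommGroup G] {j : Fin m} {f : ι →₀ G}
    (hf : ∀ e, (Q.sub ν h j).arrow e = none → f e = 0) (a : Fin (ν j)) :
    Q.div f (blk ν h ⟨j, a⟩) = (Q.sub ν h j).div f a := by
  refine Finset.sum_congr rfl fun e he => ?_
  change Q.incid e _ • f e = (Q.sub ν h j).incid e a • f e
  cases hq : (Q.sub ν h j).arrow e with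
  | none => exact absurd (hf e hq) (Finsupp.mem_support_iff.1 he)
  | some q =>
    obtain ⟨s, t⟩ := q
    rw [incid_of_some hq, incid_of_some (sub_arrow_eq_some.1 hq)]
    simp

theorem div_sub_of_ne {G : Type*} [AddCommGroup G] {j j' : Fin m} (hj : j' ≠ j) {f : ι →₀ G}
    (hf : ∀ e, (Q.sub ν h j).arrow e = none → f e = 0) (a : Fin (ν j')) :
    Q.div f (blk ν h ⟨j', a⟩) = 0 := by
  refine Finset.sum_eq_zero fun e he => ?_
  cases hq : (Q.sub ν h j).arrow e with
  | none => exact absurd (hf e hq) (Finsupp.mem_support_iff.1 he)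
  | some q =>
    obtain ⟨s, t⟩ := q
    simp [incid_of_some (sub_arrow_eq_some.1 hq), hj.symm]

end sub

/-! ### Iterated blocks -/

section assoc

variable {ν : Fin m → ℕ} {h : ∑ j, ν j = n} {μ : Fin n → ℕ} {h' : ∑ k, μ k = l} {Q : Quiv ι l}

theorem contract_contract : (Q.contract μ h').contract ν h =
    Q.contract (fun j => ∑ k, μ (blk ν h ⟨j, k⟩)) (sum_blocks h h') := by
  refine arrow_ext fun e i j => ?_
  simp only [contract_arrow_eq_some, blkIdx_blkIdx (h := h) h']
  constructor
  · rintro ⟨_, _, ⟨a, b, h1, rfl, rfl, h2⟩, h3⟩; exact ⟨a, b, h1, h3⟩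
  · rintro ⟨a, b, h1, rfl, rfl, h2⟩
    exact ⟨_, _, ⟨a, b, h1, rfl, rfl, fun hab => h2 (by rw [hab])⟩, rfl, rfl, h2⟩

theorem sub_contract (j : Fin m) : (Q.contract μ h').sub ν h j =
    (Q.sub (fun j => ∑ k, μ (blk ν h ⟨j, k⟩)) (sum_blocks h h') j).contract
      (fun k => μ (blk ν h ⟨j, k⟩)) rfl := by
  refine arrow_ext fun e x y => ?_
  simp only [contract_arrow_eq_some, sub_arrow_eq_some]
  constructor
  · rintro ⟨a, b, h1, h2, h3, h4⟩
    obtain ⟨a', rfl⟩ := exists_blk_of_eq h2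
    obtain ⟨b', rfl⟩ := exists_blk_of_eq h3
    refine ⟨blk _ rfl ⟨x, a'⟩, blk _ rfl ⟨y, b'⟩, ?_, by simp, by simp, fun hxy => h4 (by rw [hxy])⟩
    rw [blk_assoc h', blk_assoc h']; exact h1
  · rintro ⟨a, b, h1, h2, h3, h4⟩
    obtain ⟨a', rfl⟩ := exists_blk_of_eq h2
    obtain ⟨b', rfl⟩ := exists_blk_of_eq h3
    rw [blk_assoc h', blk_assoc h'] at h1
    exact ⟨_, _, h1, by simp, by simp, by simpa using h4⟩

theorem sub_sub (j : Fin m) (k : Fin (ν j)) : Q.sub μ h' (blk ν h ⟨j, k⟩) =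
    (Q.sub (fun j => ∑ k, μ (blk ν h ⟨j, k⟩)) (sum_blocks h h') j).sub
      (fun k => μ (blk ν h ⟨j, k⟩)) rfl k := by
  refine arrow_ext fun e x y => ?_
  rw [sub_arrow_eq_some, sub_arrow_eq_some, sub_arrow_eq_some, blk_assoc h', blk_assoc h']

end assoc

/-! ### Identities for flows on acyclic quivers -/

section identities

variable {G : Type*} [AddCommGroup G] {ν : Fin m → ℕ} {h : ∑ j, ν j = n} {Q : Quiv ι n}

open Classical in
/-- The set of the vertices which are externally connected to `a`. -/
def extSet (Q : Quiv ι n) (ν : Fin m → ℕ) (h : ∑ j, ν j = n) (a : Fin n) : Finset (Fin m) :=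
  Finset.univ.filter fun i => Q.ExtConn ν h i a

theorem mem_extSet {i : Fin m} {a : Fin n} : i ∈ Q.extSet ν h a ↔ Q.ExtConn ν h i a := by
  simp [extSet]

open Classical in
-- The flow out of the vertices of a block adds up to the divergence at the contracted vertex.
theorem sum_ext_block (hF : (Q.contract ν h).Acyclic) (ρ : Fin m → G)
    (hρ : ∀ i, ∑ k with (Q.contract ν h).Conn i k, ρ k = 0) (j : Fin m) :
    ∑ k, ∑ i ∈ Q.extSet ν h (blk ν h ⟨j, k⟩), ρ i = -ρ j := by
  obtain ⟨f, hf, hd⟩ := exists_flow ρ hρ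
  rw [← hd j, ← sum_div_contract, sum_filter_blkIdx]
  exact Finset.sum_congr rfl fun k _ => (flow_unique hF f hf ρ hd _).symm

open Classical in
-- A flow on the edges of `Q` does not leave a component of `Q`.
theorem sum_ext_conn (hF : (Q.contract ν h).Acyclic) (ρ : Fin m → G)
    (hρ : ∀ i, ∑ k with (Q.contract ν h).Conn i k, ρ k = 0) (a : Fin n) :
    ∑ b with Q.Conn a b, ∑ i ∈ Q.extSet ν h b, ρ i = 0 := by
  obtain ⟨f, hf, hd⟩ := exists_flow ρ hρ
  rw [← Q.sum_div_eq_zero f (Q.Conn a) fun e x y _ hxy hx => hx.trans hxy.conn]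
  exact Finset.sum_congr rfl fun k _ => (flow_unique hF f hf ρ hd _).symm

/-- The sinks `x` at the block of `k` and `-x` at the block of `c` are realised by the amount `x`
flowing through `e` from `c` to `k`; on `Q` its divergence is concentrated at these two vertices. -/
theorem sum_ext_edge (hF : (Q.contract ν h).Acyclic) {e : ι} {k c : Fin n} (he : Q.Joins e k c)
    (hne : blkIdx ν h k ≠ blkIdx ν h c) (x : G) (a : Fin n) :
    (∑ i ∈ Q.extSet ν h a, ((if i = blkIdx ν h k then x else 0) -
      (if i = blkIdx ν h c then x else 0))) =
      (if a = c then x else 0) - (if a = k then x else 0) := by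
  have h1 := flow_unique hF (Finsupp.single e (Q.incid e c • x)) (fun e' he' => ?_)
    (fun i => (if i = blkIdx ν h k then x else 0) - (if i = blkIdx ν h c then x else 0))
    (fun j => ?_) a
  · rw [extSet, ← h1, div_single]
    have := he.ne
    rcases he with he | he <;> simp only [incid_of_some he, eq_comm (a := a)] <;>
      split_ifs <;> simp_all
  · rw [Finsupp.single_eq_of_ne]
    rintro rfl
    exact he.arrow_contract_ne_none.2 hne he'
  · rw [div_single]
    have := he.ne
    have hne' := hne.symm
    rcases he with he | he
    · rw [incid_of_some he, incid_of_some (contract_arrow_eq_some.2 ⟨_, _, he, rfl, rfl, hne⟩)]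
      simp only [eq_comm (a := j)]
      split_ifs <;> simp_all
    · rw [incid_of_some he, incid_of_some (contract_arrow_eq_some.2 ⟨_, _, he, rfl, rfl, hne'⟩)]
      simp only [eq_comm (a := j)]
      split_ifs <;> simp_all

open Classical in
-- Additivity of flows at two levels. Let `f` be the flow on the coarse contraction with sinks `ρ`,
-- and `g j` the flow inside the `j`-th large block whose sinks are `τ` corrected by the flow of `f`
-- out of the vertices. Then `f + ∑ g j` has sinks `τ` on the fine contraction. Its divergence at a
-- vertex of `Q` is the left-hand side; those of `f` and `g j` are the two sums on the right.
theorem sum_ext_assoc {μ : Fin n → ℕ} {h' : ∑ k, μ k = l} {Q : Quiv ι l}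
    (hF : (Q.contract μ h').Acyclic) (hF' : ((Q.contract μ h').contract ν h).Acyclic)
    (τ : Fin n → G) (ρ : Fin m → G)
    (hρ : ∀ i, ∑ k with ((Q.contract μ h').contract ν h).Conn i k, ρ k = 0)
    (hτ : ∀ (j : Fin m) (k : Fin (ν j)), ∑ k' with ((Q.contract μ h').sub ν h j).Conn k k',
      (τ (blk ν h ⟨j, k'⟩) + ∑ i ∈ (Q.contract μ h').extSet ν h (blk ν h ⟨j, k'⟩), ρ i) = 0)
    (j : Fin m) (a : Fin (∑ k, μ (blk ν h ⟨j, k⟩))) :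
    ∑ k ∈ Q.extSet μ h' (blk (fun j => ∑ k, μ (blk ν h ⟨j, k⟩)) (sum_blocks h h') ⟨j, a⟩), τ k =
      ∑ i ∈ Q.extSet (fun j => ∑ k, μ (blk ν h ⟨j, k⟩)) (sum_blocks h h')
        (blk (fun j => ∑ k, μ (blk ν h ⟨j, k⟩)) (sum_blocks h h') ⟨j, a⟩), ρ i +
      ∑ k ∈ (Q.sub (fun j => ∑ k, μ (blk ν h ⟨j, k⟩)) (sum_blocks h h') j).extSet
        (fun k => μ (blk ν h ⟨j, k⟩)) rfl a,
        (τ (blk ν h ⟨j, k⟩) + ∑ i ∈ (Q.contract μ h').extSet ν h (blk ν h ⟨j, k⟩), ρ i) := by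
  obtain ⟨f, hf, hd⟩ := exists_flow ρ hρ
  choose g hg hdg using fun j => exists_flow (Q := (Q.contract μ h').sub ν h j)
    (fun k => τ (blk ν h ⟨j, k⟩) + ∑ i ∈ (Q.contract μ h').extSet ν h (blk ν h ⟨j, k⟩), ρ i) (hτ j)
  have hsup : ∀ e, (Q.contract μ h').arrow e = none → (f + ∑ j, g j) e = 0 := by
    intro e he
    rw [Finsupp.add_apply, hf e (contract_arrow_of_none he), Finsupp.finsetSum_apply, zero_add]
    refine Finset.sum_eq_zero fun j _ => hg j e ?_
    cases hq : ((Q.contract μ h').sub ν h j).arrow e with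
    | none => rfl
    | some q => rw [sub_arrow_eq_some.1 hq] at he; cases he
  -- The divergence of `f` at `k` is the correction built into the sinks of `g j`, so the two
  -- cancel.
  have hdiv : ∀ k, (Q.contract μ h').div (f + ∑ j, g j) k = -τ k := by
    intro k
    obtain ⟨⟨j, k⟩, rfl⟩ := (blk ν h).surjective k
    rw [div_add, div_sum, Finset.sum_eq_single j, div_sub_self (hg j), hdg,
      flow_unique hF' f hf ρ hd]
    · simp [extSet]
    · intro j' _ hj'
      exact div_sub_of_ne hj'.symm (hg j') k
    · simp
  have h1 := flow_unique hF _ hsup τ hdiv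
    (blk (fun j => ∑ k, μ (blk ν h ⟨j, k⟩)) (sum_blocks h h') ⟨j, a⟩)
  have hgs : ∀ j e, (Q.sub (fun j => ∑ k, μ (blk ν h ⟨j, k⟩)) (sum_blocks h h') j).arrow e = none →
      g j e = 0 := by
    intro j e he
    refine hg j e ?_
    rw [sub_contract, contract_arrow_of_none he]
  rw [extSet, ← h1, div_add, div_sum, Finset.sum_eq_single j, div_sub_self (hgs j)]
  · rw [contract_contract] at hF' hf hd
    congr 1
    · exact flow_unique hF' f hf ρ hd _
    · have h2 := hF.sub (ν := ν) (h := h) j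
      have h3 := hg j
      have h4 := hdg j
      rw [sub_contract] at h2 h3 h4
      exact flow_unique h2 (g j) h3 _ h4 a
  · intro j' _ hj'
    exact div_sub_of_ne hj'.symm (hgs j') a
  · simp

theorem div_dirPath {L : List ι} {a b : Fin n} (hp : Q.IsDirPath a L b) (x : G) (c : Fin n) :
    Q.div (L.map fun e => Finsupp.single e x).sum c =
      (if a = c then x else 0) - (if b = c then x else 0) := by
  induction L generalizing a with
  | nil => obtain rfl : a = b := hp; simp [div_zero]
  | cons e L ih =>
    obtain ⟨d, h1, h2⟩ := hp
    rw [List.map_cons, List.sum_cons, div_add, ih h2, div_single, incid_of_some h1]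
    split_ifs <;> simp

open Classical in
theorem list_single_apply {L : List ι} (hL : L.Nodup) (x : G) (e : ι) :
    (L.map fun e => Finsupp.single e x).sum e = if e ∈ L then x else 0 := by
  induction L with
  | nil => simp
  | cons a L ih =>
    rw [List.nodup_cons] at hL
    rw [List.map_cons, List.sum_cons, Finsupp.add_apply, ih hL.2, Finsupp.single_apply]
    by_cases ha : a = e
    · subst ha; simp [hL.1]
    · simp [ha, Ne.symm ha]

open Classical in
/-- Opening a directed cycle at two different edges between blocks changes the external connections
by a multiple of the cycle, which is invisible on the components of the blocks. -/
theorem sum_ext_cycle {L : List ι} (hL : Q.IsDirCycle L) {α β : ι} (hβ : β ∈ L)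
    (hFα : ((Q.del α).contract ν h).Acyclic) (hFβ : ((Q.del β).contract ν h).Acyclic)
    (hβc : (Q.contract ν h).arrow β ≠ none) (ρ : Fin m → G)
    (hρ : ∀ i, ∑ k with ((Q.del α).contract ν h).Conn i k, ρ k = 0) (j : Fin m) (x : Fin (ν j)) :
    ∑ y with (Q.sub ν h j).Conn x y, ∑ i ∈ (Q.del α).extSet ν h (blk ν h ⟨j, y⟩), ρ i =
      ∑ y with (Q.sub ν h j).Conn x y, ∑ i ∈ (Q.del β).extSet ν h (blk ν h ⟨j, y⟩), ρ i := by
  obtain ⟨-, hnd, a, hp⟩ := hL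
  obtain ⟨f, hf, hd⟩ := exists_flow ρ hρ
  have hfα : f α = 0 := hf α (by rw [contract_del, del_arrow_self])
  let L₀ := L.filter fun e => (Q.contract ν h).arrow e ≠ none
  -- The circulation of the amount `f β` along the edges of the cycle between blocks. Subtracting it
  -- keeps the sinks and empties the edge `β`, so `f - z` is the flow for `Q ∖ β`.
  let z : ι →₀ G := (L₀.map fun e => Finsupp.single e (f β)).sum
  have hz : ∀ e, z e = if e ∈ L₀ then f β else 0 := fun e => list_single_apply (hnd.filter _) _ e
  have hmem : ∀ e, e ∈ L₀ ↔ e ∈ L ∧ (Q.contract ν h).arrow e ≠ none := by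
    intro e; simp [L₀, List.mem_filter]
  have hdel : ∀ (γ : ι) (g : ι →₀ G), g γ = 0 → ∀ {n : ℕ} (F : Quiv ι n) c,
      (F.del γ).div g c = F.div g c := by
    intro γ g hg n F c
    refine Finset.sum_congr rfl fun e he => ?_
    have : e ≠ γ := by rintro rfl; exact Finsupp.mem_support_iff.1 he hg
    simp only [incid, del_arrow_of_ne this]
  have hgβ : (f - z) β = 0 := by
    rw [Finsupp.sub_apply, hz, if_pos ((hmem β).2 ⟨hβ, hβc⟩), sub_self]
  have hsub : ∀ {n : ℕ} (F : Quiv ι n) c, F.div (f - z) c = F.div f c - F.div z c := by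
    intro n F c
    have := F.div_add (f - z) z c
    rw [sub_add_cancel] at this
    rw [this, add_sub_cancel_right]
  have hzF : ∀ i, (Q.contract ν h).div z i = 0 := by
    intro i
    rw [div_dirPath (hp.contract (ν := ν) (h := h)), sub_self]
  have h2 : ∀ c, (Q.del β).div (f - z) c = ∑ i with (Q.del β).ExtConn ν h i c, ρ i := by
    refine flow_unique hFβ (f - z) (fun e he => ?_) ρ fun i => ?_
    · rw [contract_del] at he
      by_cases heβ : e = β
      · rw [heβ]; exact hgβ
      · rw [del_arrow_of_ne heβ] at he
        rw [Finsupp.sub_apply, hz, if_neg fun hm => ((hmem e).1 hm).2 he, sub_zero]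
        refine hf e ?_
        rw [contract_del]
        by_cases heα : e = α
        · rw [heα, del_arrow_self]
        · rw [del_arrow_of_ne heα, he]
    · rw [contract_del, hdel β _ hgβ, hsub, hzF, sub_zero, ← hd i, contract_del, hdel α _ hfα]
  have h1 := flow_unique hFα f hf ρ hd
  -- Completed by `w` on the edges of the cycle inside blocks, `z` becomes a circulation on `Q`
  -- without divergence. Hence `div z = -div w`, and `w` does not leave a component of a block.
  have h3 : ∑ y with (Q.sub ν h j).Conn x y, Q.div z (blk ν h ⟨j, y⟩) = 0 := by
    let w : ι →₀ G := ((L.filter fun e => ¬(Q.contract ν h).arrow e ≠ none).map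
      fun e => Finsupp.single e (f β)).sum
    have hzw : z + w = (L.map fun e => Finsupp.single e (f β)).sum := by
      ext e
      rw [Finsupp.add_apply, hz, list_single_apply (hnd.filter _), list_single_apply hnd]
      simp only [hmem]
      by_cases he : e ∈ L <;> by_cases hc : (Q.contract ν h).arrow e = none <;>
        simp [List.mem_filter, he, hc]
    have hw : ∀ c, Q.div z c = -Q.div w c := by
      intro c
      rw [eq_neg_iff_add_eq_zero, ← div_add, hzw, div_dirPath hp, sub_self]
    simp only [hw, Finset.sum_neg_distrib, neg_eq_zero]
    have h4 := Q.sum_div_eq_zero w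
      (fun c => ∃ y, (Q.sub ν h j).Conn x y ∧ c = blk ν h ⟨j, y⟩) ?_
    · rw [← h4]
      refine Finset.sum_nbij (fun y => blk ν h ⟨j, y⟩) (fun y hy => ?_) (fun y _ y' _ hy => ?_)
        (fun c hc => ?_) fun _ _ => rfl
      · simpa using hy
      · simpa using hy
      · simp only [Finset.coe_filter, Finset.mem_univ, true_and, Set.mem_ofPred_eq] at hc
        obtain ⟨y, hy, rfl⟩ := hc
        exact ⟨y, by simpa using hy, rfl⟩
    · rintro e c d he hcd ⟨y, hy, rfl⟩
      have he' : (Q.contract ν h).arrow e = none := by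
        by_contra hne
        refine he ?_
        simp only [w]
        rw [list_single_apply (hnd.filter _), if_neg]
        simp [List.mem_filter, hne]
      have hdj : blkIdx ν h d = j := by
        have := mt hcd.arrow_contract_ne_none.2 (not_not.2 he')
        rw [not_not, blkIdx_blk] at this
        exact this.symm
      obtain ⟨y', rfl⟩ := exists_blk_of_eq hdj
      exact ⟨y', hy.trans (sub_joins.2 hcd).conn, rfl⟩
  calc _ = ∑ y with (Q.sub ν h j).Conn x y, Q.div f (blk ν h ⟨j, y⟩) := by
        refine Finset.sum_congr rfl fun y _ => ?_
        rw [extSet, ← h1, hdel α _ hfα]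
    _ = ∑ y with (Q.sub ν h j).Conn x y, Q.div (f - z) (blk ν h ⟨j, y⟩) := by
        simp only [hsub, Finset.sum_sub_distrib, h3, sub_zero]
    _ = _ := by
        refine Finset.sum_congr rfl fun y _ => ?_
        rw [extSet, ← h2, hdel β _ hgβ]

end identities

end Quiv

/-! ### Ordered products -/

section products

theorem prod_ofFn_update {R : Type*} [Monoid R] {m : ℕ} (f : Fin m → R) (j : Fin m) (x : R) :
    (List.ofFn (Function.update f j x)).prod =
      ((List.ofFn f).take j).prod * x * ((List.ofFn f).drop (j + 1)).prod := by
  have h : List.ofFn (Function.update f j x) = (List.ofFn f).set j x := by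
    refine List.ext_getElem (by simp) fun i h1 h2 => ?_
    rw [List.getElem_set, List.getElem_ofFn]
    by_cases hi : (j : ℕ) = i
    · subst hi; simp
    · rw [if_neg hi, List.getElem_ofFn, Function.update_of_ne]
      exact fun hc => hi (by rw [← hc])
  rw [h, List.prod_set, if_pos (by simp)]

theorem prod_ofFn_split {R : Type*} [Monoid R] {m : ℕ} (f : Fin m → R) (j : Fin m) :
    (List.ofFn f).prod = ((List.ofFn f).take j).prod * f j * ((List.ofFn f).drop (j + 1)).prod := by
  rw [← prod_ofFn_update, Function.update_eq_self]

variable {K : Type*} [Field K] {N : ℕ} {A : Type*} {m : ℕ}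

open SPoly

theorem prod_ofFn_mem_par {f : Fin m → SPoly K N A} {α : Fin m → ZMod 2}
    (hf : ∀ j, f j ∈ par (α j)) : (List.ofFn f).prod ∈ par (∑ j, α j) := by
  induction m with
  | zero => simpa using one_mem_par
  | succ m ih =>
    rw [List.ofFn_succ, List.prod_cons, Fin.sum_univ_succ]
    exact mul_mem_par (hf 0) (ih fun j => hf j.succ)

theorem prod_take_mem_par {f : Fin m → SPoly K N A} {α : Fin m → ZMod 2}
    (hf : ∀ j, f j ∈ par (α j)) (j : ℕ) :
    ((List.ofFn f).take j).prod ∈ par (∑ i : Fin m, if (i : ℕ) < j then α i else 0) := by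
  induction m generalizing j with
  | zero => simpa using one_mem_par
  | succ m ih =>
    cases j with
    | zero => simpa using one_mem_par
    | succ j =>
      rw [List.ofFn_succ, List.take_succ_cons, List.prod_cons, Fin.sum_univ_succ]
      simpa using mul_mem_par (hf 0) (ih (fun j => hf j.succ) j)

theorem prod_ofFn_update_mul {f : Fin m → SPoly K N A} (j : Fin m) {c : SPoly K N A}
    (hc : ∀ a, c * a = a * c) :
    (List.ofFn (Function.update f j (c * f j))).prod = c * (List.ofFn f).prod := by
  rw [prod_ofFn_update, prod_ofFn_split f j]
  simp only [← mul_assoc]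
  rw [hc]

/-- The odd factor is moved to the front, past the factors with smaller index. -/
theorem prod_ofFn_update_odd {f : Fin m → SPoly K N A} {α : Fin m → ZMod 2}
    (hf : ∀ j, f j ∈ par (α j)) (j : Fin m) {c : SPoly K N A} (hc : ∀ a, c * a = tau a * c) :
    (List.ofFn (Function.update f j (c * f j))).prod =
      sg (∑ i, if i < j then α i else 0) • (c * (List.ofFn f).prod) := by
  rw [prod_ofFn_update, prod_ofFn_split f j]
  simp only [← mul_assoc]
  rw [hc, mem_par.1 (prod_take_mem_par hf j)]
  simp only [smul_mul_assoc, Fin.val_fin_lt, sg_smul_self]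

end products

/-- The powers of the parity involution. -/
def SPoly.tauPow {K : Type*} [Field K] {N : ℕ} {A : Type*} (b : ZMod 2) :
    SPoly K N A →ₗ[K] SPoly K N A :=
  if b = 0 then LinearMap.id else SPoly.tau.toLinearMap

section tauPow

variable {K : Type*} [Field K] {N : ℕ} {A : Type*}

open SPoly

theorem SPoly.tauPow_of_mem {b p : ZMod 2} {a : SPoly K N A} (ha : a ∈ par p) :
    tauPow b a = sg (b * p) • a := by
  have h2 : ∀ q : ZMod 2, q = 0 ∨ q = 1 := by decide
  rcases h2 b with rfl | rfl
  · simp [tauPow, sg_zero]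
  · simpa [tauPow] using mem_par.1 ha

theorem SPoly.tauPow_ev_mul (b : ZMod 2) (k : A) (a : SPoly K N A) :
    tauPow b (ev k * a) = ev k * tauPow b a := by
  unfold tauPow; split_ifs <;> simp [tau_ev]

theorem SPoly.tauPow_od_mul (b : ZMod 2) (k : A) (i : Fin N) (a : SPoly K N A) :
    tauPow b (od k i * a) = sg b • (od k i * tauPow b a) := by
  unfold tauPow sg; split_ifs <;> simp [tau_od]

theorem SPoly.tauPow_tau (b : ZMod 2) (a : SPoly K N A) : tauPow b (tau a) = tau (tauPow b a) := by
  unfold tauPow; split_ifs <;> simp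

end tauPow

section glue

variable {K : Type*} [Field K] {N : ℕ} {V : Type*} [AddCommGroup V] [Module K V]
  {H : HWSupermodule K N V} {ι : Type*} {m n : ℕ}

/-! ### The extension of `X` to polynomials -/

namespace PHom

variable (x : ZMod 2) (X : PHom H ι m) (Q : Quiv ι m) (b : Fin n → Fin m)

theorem extend_tmul (a : SPoly K N (Fin n)) (t : ⨂[K] _ : Fin m, V) :
    X.extend x Q b (a ⊗ₜ[K] t) =
      VNabla.lmul H n (SPoly.tauPow x a) (VNabla.collect H b (X.at Q t)) := by
  rw [extend, TensorProduct.lift.tmul, SPoly.tauPow]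
  split_ifs <;> rfl

theorem xi_inl_ev (k : Fin n) (a : SPoly K N (Fin n)) (t : ⨂[K] _ : Fin m, V) :
    xiAction H b (SPoly.ev (Sum.inl k)) (a ⊗ₜ[K] t) = (SPoly.ev k * a) ⊗ₜ[K] t := by
  simp only [xiAction, SPoly.lift_ev, LinearMap.add_apply, TensorProduct.map_tmul, xiEv, xiT,
    Sum.elim_inl, LinearMap.zero_apply, TensorProduct.tmul_zero, add_zero, LinearMap.mulLeft_apply,
    LinearMap.id_apply]

theorem xi_inl_od (k : Fin n) (i : Fin N) (a : SPoly K N (Fin n)) (t : ⨂[K] _ : Fin m, V) :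
    xiAction H b (SPoly.od (Sum.inl k) i) (a ⊗ₜ[K] t) = (SPoly.od k i * a) ⊗ₜ[K] t := by
  simp only [xiAction, SPoly.lift_od, LinearMap.add_apply, TensorProduct.map_tmul, xiOd, xiS,
    Sum.elim_inl, LinearMap.zero_apply, TensorProduct.tmul_zero, add_zero, LinearMap.mulLeft_apply,
    LinearMap.id_apply]

theorem extend_xi_inl_ev (k : Fin n) (s) :
    X.extend x Q b (xiAction H b (SPoly.ev (Sum.inl k)) s) =
      VNabla.lmul H n (SPoly.ev k) (X.extend x Q b s) := by
  induction s with
  | zero => simp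
  | add s s' hs hs' => simp only [map_add, hs, hs']
  | tmul a t =>
    simp only [xi_inl_ev, extend_tmul, SPoly.tauPow_ev_mul, VNabla.lmul_mul]

theorem extend_xi_inl_od (k : Fin n) (i : Fin N) (s) :
    X.extend x Q b (xiAction H b (SPoly.od (Sum.inl k) i) s) =
      sg x • VNabla.lmul H n (SPoly.od k i) (X.extend x Q b s) := by
  induction s with
  | zero => simp
  | add s s' hs hs' => simp only [map_add, hs, hs', smul_add]
  | tmul a t =>
    simp only [xi_inl_od, extend_tmul, SPoly.tauPow_od_mul, VNabla.lmul_mul, map_zsmul,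
      LinearMap.smul_apply]

theorem xi_inr_ev (i : Fin m) (a : SPoly K N (Fin n)) (t : ⨂[K] _ : Fin m, V) :
    xiAction H b (SPoly.ev (Sum.inr i)) (a ⊗ₜ[K] t) =
      ∑ k with b k = i, (SPoly.ev k * a) ⊗ₜ[K] t + a ⊗ₜ[K] H.Tat i t := by
  simp only [xiAction, SPoly.lift_ev, LinearMap.add_apply, TensorProduct.map_tmul, xiEv, xiT,
    Sum.elim_inr, LinearMap.mulLeft_apply, LinearMap.id_apply, Finset.sum_mul,
    TensorProduct.sum_tmul]

theorem xi_inr_od (i : Fin m) (s : Fin N) (a : SPoly K N (Fin n)) (t : ⨂[K] _ : Fin m, V) :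
    xiAction H b (SPoly.od (Sum.inr i) s) (a ⊗ₜ[K] t) =
      ∑ k with b k = i, (SPoly.od k s * a) ⊗ₜ[K] t + SPoly.tau a ⊗ₜ[K] H.Sat s i t := by
  simp only [xiAction, SPoly.lift_od, LinearMap.add_apply, TensorProduct.map_tmul, xiOd, xiS,
    Sum.elim_inr, LinearMap.mulLeft_apply, LinearMap.id_apply, Finset.sum_mul,
    TensorProduct.sum_tmul, AlgHom.toLinearMap_apply]

open Classical in
-- The even part of `Ξ_j` is `λ'_j + T^{(j)}`. Summed over a component, `T^{(j)}` is turned by `X`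
-- into `-λ'_j`.
theorem sum_extend_xi_inr_ev (hX : IsPcl x X) (i : Fin m) (s) :
    ∑ j with Q.Conn i j, X.extend x Q b (xiAction H b (SPoly.ev (Sum.inr j)) s) = 0 := by
  induction s with
  | zero => simp
  | add s s' hs hs' => simp only [map_add, Finset.sum_add_distrib, hs, hs', add_zero]
  | tmul a t =>
    simp only [xi_inr_ev, map_add, map_sum, extend_tmul, SPoly.tauPow_ev_mul, VNabla.lmul_mul,
      Finset.sum_add_distrib]
    rw [← map_sum, ← map_sum, hX.sesq₂ Q i t, map_neg, map_neg, map_sum, map_sum,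
      ← sub_eq_add_neg, sub_eq_zero]
    refine Finset.sum_congr rfl fun j _ => ?_
    rw [VNabla.collect_ev, map_sum]
    exact Finset.sum_congr rfl fun k _ => VNabla.lmul_ev_comm H k _ _

/-- Here no summation over a component is needed: the condition on `S^i` holds at each vertex
separately and cancels the two summands of the odd part of `Ξ_j`. -/
theorem extend_xi_inr_od (hX : IsPcl x X) (j : Fin m) (i : Fin N) (s) :
    X.extend x Q b (xiAction H b (SPoly.od (Sum.inr j) i) s) = 0 := by
  induction s with
  | zero => simp
  | add s s' hs hs' => simp only [map_add, hs, hs', add_zero]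
  | tmul a t =>
    simp only [xi_inr_od, map_add, map_sum, extend_tmul, SPoly.tauPow_od_mul, VNabla.lmul_mul,
      hX.sesq₃, map_neg, map_zsmul, VNabla.collect_od, LinearMap.smul_apply]
    rw [← Finset.smul_sum, ← smul_neg, ← smul_add, ← sub_eq_add_neg, ← Finset.sum_sub_distrib,
      Finset.sum_eq_zero, smul_zero]
    intro k _
    rw [← VNabla.lmul_mul, ← VNabla.lmul_mul, SPoly.od_mul, SPoly.tauPow_tau, sub_self]

theorem extend_eq_zero (hX : X.at Q = 0) (s) : X.extend x Q b s = 0 := by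
  induction s with
  | zero => simp
  | add s s' hs hs' => simp only [map_add, hs, hs', add_zero]
  | tmul a t => simp [extend_tmul, hX]

/-- The map `X^Q_{Λ'₁,…,Λ'ₘ}(P|_{Ξ_j = Λ'_j + ∇^{(j)}} t)`. -/
def core : SPoly K N (Fin n ⊕ Fin m) →ₗ[K] (⨂[K] _ : Fin m, V) →ₗ[K] VNabla H n :=
  (LinearMap.lcomp K (VNabla H n) (TensorProduct.mk K (SPoly K N (Fin n)) (⨂[K] _ : Fin m, V) 1)) ∘ₗ
    (LinearMap.llcomp K _ _ _ (X.extend x Q b)) ∘ₗ (xiAction H b).toLinearMap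

theorem core_apply (P : SPoly K N (Fin n ⊕ Fin m)) (t : ⨂[K] _ : Fin m, V) :
    X.core x Q b P t = X.extend x Q b (xiAction H b P (1 ⊗ₜ[K] t)) := rfl

theorem core_one (t : ⨂[K] _ : Fin m, V) : X.core x Q b 1 t = VNabla.collect H b (X.at Q t) := by
  rw [core_apply, map_one, Module.End.one_apply, extend_tmul]
  have : SPoly.tauPow x (1 : SPoly K N (Fin n)) = 1 := by
    unfold SPoly.tauPow; split_ifs <;> simp
  rw [this, VNabla.lmul_one]

theorem core_inl_ev (k : Fin n) (P) (t : ⨂[K] _ : Fin m, V) :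
    X.core x Q b (SPoly.ev (Sum.inl k) * P) t = VNabla.lmul H n (SPoly.ev k) (X.core x Q b P t) := by
  rw [core_apply, map_mul]; exact extend_xi_inl_ev x X Q b k _

theorem core_inl_od (k : Fin n) (i : Fin N) (P) (t : ⨂[K] _ : Fin m, V) :
    X.core x Q b (SPoly.od (Sum.inl k) i * P) t =
      sg x • VNabla.lmul H n (SPoly.od k i) (X.core x Q b P t) := by
  rw [core_apply, map_mul]; exact extend_xi_inl_od x X Q b k i _

theorem core_inr_od (hX : IsPcl x X) (j : Fin m) (i : Fin N) (P) (t : ⨂[K] _ : Fin m, V) :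
    X.core x Q b (SPoly.od (Sum.inr j) i * P) t = 0 := by
  rw [core_apply, map_mul]; exact extend_xi_inr_od x X Q b hX j i _

open Classical in
theorem sum_core_inr_ev (hX : IsPcl x X) (i : Fin m) (P) (t : ⨂[K] _ : Fin m, V) :
    ∑ j with Q.Conn i j, X.core x Q b (SPoly.ev (Sum.inr j) * P) t = 0 := by
  simp only [core_apply, map_mul]
  exact sum_extend_xi_inr_ev x X Q b hX i _

theorem core_eq_zero (hX : X.at Q = 0) (P) (t : ⨂[K] _ : Fin m, V) : X.core x Q b P t = 0 :=
  extend_eq_zero x X Q b hX _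

/-- An even generator is central, so it may act before `P`, on `1 ⊗ t`, where it is visibly the sum
of `λ'_i` and `T^{(i)}`. -/
theorem core_inr_ev (i : Fin m) (P) (t : ⨂[K] _ : Fin m, V) :
    X.core x Q b (SPoly.ev (Sum.inr i) * P) t =
      ∑ k with b k = i, VNabla.lmul H n (SPoly.ev k) (X.core x Q b P t) +
        X.core x Q b P (H.Tat i t) := by
  rw [SPoly.ev_mul, core_apply, map_mul, Module.End.mul_apply, xi_inr_ev, map_add, map_add, map_sum,
    map_sum]
  congr 1
  refine Finset.sum_congr rfl fun k _ => ?_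
  rw [← core_inl_ev, SPoly.ev_mul (Sum.inl k), core_apply, map_mul, Module.End.mul_apply, xi_inl_ev]

/-- The odd part of `Ξ_j` gives zero in front of `P`; moving it behind `P` expresses the
contribution of `(S^i)^{(j)}` on `t` through that of `θ'_j`. -/
theorem core_Sat (hX : IsPcl x X) (j : Fin m) (i : Fin N) {P : SPoly K N (Fin n ⊕ Fin m)} {p : ZMod 2}
    (hP : P ∈ SPoly.par p) (t : ⨂[K] _ : Fin m, V) :
    X.core x Q b P (H.Sat i j t) =
      -(sg (p + x) • ∑ k with b k = j, VNabla.lmul H n (SPoly.od k i) (X.core x Q b P t)) := by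
  have h1 := core_inr_od x X Q b hX j i P t
  rw [SPoly.od_mul_of_mem _ _ hP, map_zsmul, LinearMap.smul_apply, core_apply, map_mul,
    Module.End.mul_apply, xi_inr_od, map_add, map_add, map_sum, map_sum, map_one] at h1
  have h2 : X.core x Q b P (H.Sat i j t) = X.extend x Q b (xiAction H b P (1 ⊗ₜ[K] H.Sat i j t)) :=
    rfl
  have h3 : ∀ k, X.extend x Q b (xiAction H b P ((SPoly.od k i * 1) ⊗ₜ[K] t)) =
      sg (p + x) • VNabla.lmul H n (SPoly.od k i) (X.core x Q b P t) := by
    intro k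
    rw [add_comm, sg_add, mul_smul, ← map_zsmul (VNabla.lmul H n (SPoly.od k i)), ← map_zsmul,
      smul_comm]
    rw [map_zsmul, map_zsmul, ← core_inl_od, SPoly.od_mul_of_mem _ _ hP, map_zsmul,
      LinearMap.smul_apply, sg_smul_self, core_apply, map_mul, Module.End.mul_apply, xi_inl_od]
  rw [h2, eq_neg_iff_add_eq_zero, add_comm, Finset.smul_sum, ← Finset.sum_congr rfl fun k _ => h3 k]
  have := congrArg (fun y => sg p • y) h1
  simpa only [sg_smul_self, smul_zero] using this

end PHom

end glue

/-! ### Derivatives and parity of the core map, and gluing on polynomials. -/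

section glue

variable {K : Type*} [Field K] {N : ℕ} {V : Type*} [AddCommGroup V] [Module K V]
  {H : HWSupermodule K N V} {ι : Type*} {m n : ℕ}

/-- Chain rule: `λ_k` occurs in `Λ_k` and, through `Λ'_{b k}`, in `Ξ_{b k}`. The connection between
the two blocks is used only for `P = 1`, where it makes the derivatives of `X` itself agree. -/
theorem PHom.pdSub_core (x : ZMod 2) (X : PHom H ι m) (Q : Quiv ι m) (b : Fin n → Fin m)
    (hX : IsPcl x X) {k l : Fin n} (hkl : Q.Conn (b k) (b l)) (P : SPoly K N (Fin n ⊕ Fin m))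
    (t : ⨂[K] _ : Fin m, V) :
    VNabla.pdSub H k l (X.core x Q b P t) =
      X.core x Q b ((SPoly.pd (Sum.inl k) P + SPoly.pd (Sum.inr (b k)) P) -
        (SPoly.pd (Sum.inl l) P + SPoly.pd (Sum.inr (b l)) P)) t := by
  induction P using SPoly.induction_left generalizing t with
  | one =>
    rw [core_one, VNabla.pdSub_collect, hX.sesq₁ Q _ _ hkl, map_zero]
    simp [SPoly.pd_one]
  | add P P' h h' =>
    simp only [map_add, LinearMap.add_apply, h, h', map_sub, LinearMap.sub_apply]
    abel
  | smul c P h =>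
    simp only [map_smul, LinearMap.smul_apply, h, map_sub, LinearMap.sub_apply, map_add,
      LinearMap.add_apply, smul_add, smul_sub]
  | ev c P h =>
    rcases c with c | c
    · rw [core_inl_ev, VNabla.pdSub_ev, h, ← core_inl_ev]
      simp only [SPoly.pd_mul, SPoly.pd_ev, mul_add, mul_sub, map_add, map_sub,
        LinearMap.add_apply, LinearMap.sub_apply, reduceCtorEq, if_false, zero_mul, map_zero,
        LinearMap.zero_apply, Sum.inl.injEq, ite_mul, one_mul]
      split_ifs <;> simp <;> abel
    · rw [core_inr_ev, map_add, map_sum, h]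
      simp only [VNabla.pdSub_ev, h, Finset.sum_add_distrib]
      have h1 : ∀ i, (∑ k' with b k' = c, if k' = i then X.core x Q b P t else 0) =
          if c = b i then X.core x Q b P t else 0 := by
        intro i
        rw [Finset.sum_ite_eq']
        simp [eq_comm]
      rw [Finset.sum_sub_distrib, h1, h1, add_right_comm, ← core_inr_ev]
      simp only [SPoly.pd_mul, SPoly.pd_ev, mul_add, mul_sub, map_add, map_sub,
        LinearMap.add_apply, LinearMap.sub_apply, reduceCtorEq, if_false, zero_mul, map_zero,
        LinearMap.zero_apply, Sum.inr.injEq, ite_mul, one_mul]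
      split_ifs <;> simp <;> abel
  | od c i P h =>
    simp only [SPoly.pd_mul, SPoly.pd_od, zero_mul, add_zero, ← mul_add, ← mul_sub]
    rcases c with c | c
    · rw [core_inl_od, core_inl_od, map_zsmul, VNabla.pdSub_od, h]
    · rw [core_inr_od x X Q b hX, core_inr_od x X Q b hX, map_zero]

theorem PHom.eps_core [CharZero K] (x : ZMod 2) (X : PHom H ι m) (Q : Quiv ι m) (b : Fin n → Fin m)
    (hX : IsPcl x X) (P : SPoly K N (Fin n ⊕ Fin m)) (t : ⨂[K] _ : Fin m, V) :
    VNabla.eps H n (X.core x Q b P t) = sg x • X.core x Q b (SPoly.tau P) (H.epsTensor m t) := by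
  have h0 : ∀ t, VNabla.eps H m (X.at Q t) = sg x • X.at Q (H.epsTensor m t) := by
    refine LinearMap.congr_fun (f := VNabla.eps H m ∘ₗ X.at Q)
      (g := sg x • (X.at Q ∘ₗ H.epsTensor m)) (H.tensor_ext fun v p hv => ?_)
    simp only [LinearMap.comp_apply, LinearMap.smul_apply, H.epsTensor_of_mem hv, map_zsmul]
    rw [(VNabla.mem_par_iff H).1 (hX.parity Q p v hv), sg_smul_smul]
  have hT : ∀ i t, H.epsTensor m (H.Tat i t) = H.Tat i (H.epsTensor m t) := by
    intro i
    refine LinearMap.congr_fun (f := H.epsTensor m ∘ₗ H.Tat i) (g := H.Tat i ∘ₗ H.epsTensor m)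
      (PiTensorProduct.ext (MultilinearMap.ext fun v => ?_))
    simp only [LinearMap.compMultilinearMap_apply, LinearMap.comp_apply, H.Tat_tprod,
      H.epsTensor_tprod]
    congr 1
    funext j
    by_cases hj : j = i
    · subst hj; simp [H.eps_T]
    · simp [hj]
  induction P using SPoly.induction_left generalizing t with
  | one => rw [core_one, VNabla.eps_collect, h0, map_zsmul, map_one, core_one]
  | add P P' h h' => simp only [map_add, LinearMap.add_apply, h, h', smul_add]
  | smul c P h => simp only [map_smul, LinearMap.smul_apply, h, smul_comm c]
  | ev c P h =>
    rw [map_mul SPoly.tau, SPoly.tau_ev]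
    rcases c with c | c
    · rw [core_inl_ev, core_inl_ev, VNabla.eps_lmul_ev, h, map_zsmul]
    · rw [core_inr_ev, core_inr_ev, map_add, map_sum, h, hT, smul_add, Finset.smul_sum]
      simp only [VNabla.eps_lmul_ev, h, map_zsmul]
  | od c i P h =>
    rw [map_mul SPoly.tau, SPoly.tau_od, neg_mul, map_neg, LinearMap.neg_apply]
    rcases c with c | c
    · rw [core_inl_od, core_inl_od, map_zsmul, VNabla.eps_lmul_od, h, map_zsmul]
    · rw [core_inr_od x X Q b hX, core_inr_od x X Q b hX, map_zero, neg_zero, smul_zero]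

/-! ### The gluing map on polynomials -/

open Classical in
/-- The substitution `Λ_k ↦ Λ_k + ∑_{i ∈ ℰ(k)} Ξ_i` for all `k` in the `j`-th block. -/
def fullShift (K : Type*) [Field K] (N : ℕ) (ν : Fin m → ℕ) (h : ∑ j, ν j = n) (Q : Quiv ι n)
    (j : Fin m) : SPoly K N (Fin (ν j)) →ₐ[K] SPoly K N (Fin n ⊕ Fin m) :=
  SPoly.linSubst fun k => Sum.elim (fun l => if blk ν h ⟨j, k⟩ = l then 1 else 0)
    (fun i => if Q.ExtConn ν h i (blk ν h ⟨j, k⟩) then 1 else 0)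

section fullShift

variable (ν : Fin m → ℕ) (h : ∑ j, ν j = n) (Q : Quiv ι n) (j : Fin m)

theorem fullShift_ev (k : Fin (ν j)) : fullShift K N ν h Q j (SPoly.ev k) =
    SPoly.ev (Sum.inl (blk ν h ⟨j, k⟩)) +
      ∑ i ∈ Q.extSet ν h (blk ν h ⟨j, k⟩), SPoly.ev (Sum.inr i) := by
  rw [fullShift, SPoly.linSubst_ev, Fintype.sum_sum_type, Quiv.extSet, Finset.sum_filter]
  simp

theorem fullShift_od (k : Fin (ν j)) (s : Fin N) : fullShift K N ν h Q j (SPoly.od k s) =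
    SPoly.od (Sum.inl (blk ν h ⟨j, k⟩)) s +
      ∑ i ∈ Q.extSet ν h (blk ν h ⟨j, k⟩), SPoly.od (Sum.inr i) s := by
  rw [fullShift, SPoly.linSubst_od, Fintype.sum_sum_type, Quiv.extSet, Finset.sum_filter]
  simp

/-- On polynomials without the last variable of the block, the full substitution is the one of the
composition formula. -/
theorem fullShift_incl (a : SPoly K N (Fin (ν j - 1))) :
    fullShift K N ν h Q j (SPoly.linSubst
      (fun k l => if Fin.castLE (Nat.sub_le (ν j) 1) k = l then 1 else 0) a) =
      shift K N ν h Q j a := by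
  rw [fullShift, SPoly.linSubst_linSubst, shift]
  congr 2
  funext k l
  simp

end fullShift

/-- The projection of the tensor algebra onto `V^{⊗m}`. -/
def tensorProj (K V : Type*) [Field K] [AddCommGroup V] [Module K V] (m : ℕ) :
    TensorAlgebra K V →ₗ[K] ⨂[K] _ : Fin m, V :=
  DirectSum.component K ℕ (fun n => ⨂[K]^n V) m ∘ₗ TensorAlgebra.toDirectSum.toLinearMap

theorem tensorProj_prod (u : Fin m → V) :
    tensorProj K V m (List.ofFn fun j => TensorAlgebra.ι K (u j)).prod =
      PiTensorProduct.tprod K u := by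
  rw [← TensorAlgebra.tprod_apply, tensorProj, LinearMap.comp_apply, AlgHom.toLinearMap_apply,
    TensorAlgebra.toDirectSum_tensorPower_tprod]
  exact DirectSum.component.lof_self K m _

theorem prod_ofFn_tmul {A B : Type*} [Ring A] [Algebra K A] [Ring B] [Algebra K B]
    (a : Fin m → A) (b : Fin m → B) :
    (List.ofFn fun j => a j ⊗ₜ[K] b j).prod = (List.ofFn a).prod ⊗ₜ[K] (List.ofFn b).prod := by
  induction m with
  | zero => simp [Algebra.TensorProduct.one_def]
  | succ m ih => simp [List.ofFn_succ, ih]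

/-- The multilinear map `(a_j ⊗ u_j)_j ↦ ± X^{Δ_0(Q)}(∏_j a_j(Λ_k + ∑ Ξ_i) (u₁ ⊗ ⋯ ⊗ uₘ))`. -/
def preGlue (x : ZMod 2) (X : PHom H ι m) (Q : Quiv ι n) (ν : Fin m → ℕ) (h : ∑ j, ν j = n) :
    MultilinearMap K (fun j => SPoly K N (Fin (ν j)) ⊗[K] V) (VNabla H n) :=
  -- Summing over parities splits the `u_j` into homogeneous parts, so that the sign of moving `a_j`
  -- past the earlier `u_i` becomes the linear operator `tauPow`. The tensor algebra serves to form
  -- the product of the `u_j` in the same ordered product as that of the polynomials.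
  ∑ β : Fin m → ZMod 2,
    (TensorProduct.lift ((LinearMap.lcomp K (VNabla H n) (tensorProj K V m)) ∘ₗ
      X.core x (Q.contract ν h) (blkIdx ν h))).compMultilinearMap
    ((MultilinearMap.mkPiAlgebraFin K m (SPoly K N (Fin n ⊕ Fin m) ⊗[K] TensorAlgebra K V)
      ).compLinearMap fun j => TensorProduct.map
        ((fullShift K N ν h Q j).toLinearMap ∘ₗ SPoly.tauPow (∑ i, if i < j then β i else 0))
        (TensorAlgebra.ι K ∘ₗ H.proj (β j)))

theorem preGlue_tmul (x : ZMod 2) (X : PHom H ι m) (Q : Quiv ι n) (ν : Fin m → ℕ)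
    (h : ∑ j, ν j = n) (a : ∀ j, SPoly K N (Fin (ν j))) (u : Fin m → V) (β : Fin m → ZMod 2)
    (hu : ∀ j, u j ∈ H.par (β j)) :
    preGlue x X Q ν h (fun j => a j ⊗ₜ[K] u j) = X.core x (Q.contract ν h) (blkIdx ν h)
      (List.ofFn fun j => fullShift K N ν h Q j
        (SPoly.tauPow (∑ i, if i < j then β i else 0) (a j))).prod (PiTensorProduct.tprod K u) := by
  have hβ : ∀ γ : Fin m → ZMod 2, (fun j => H.proj (γ j) (u j)) =
      fun j => if β j = γ j then u j else 0 := fun γ => funext fun j => H.proj_of_mem (hu j)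
  rw [preGlue, sum_apply, Finset.sum_eq_single β]
  · simp only [LinearMap.compMultilinearMap_apply, MultilinearMap.compLinearMap_apply,
      TensorProduct.map_tmul, MultilinearMap.mkPiAlgebraFin_apply, LinearMap.comp_apply,
      AlgHom.toLinearMap_apply, prod_ofFn_tmul, TensorProduct.lift.tmul, LinearMap.lcomp_apply,
      congrFun (hβ β) _, if_true, tensorProj_prod]
  · intro γ _ hγ
    obtain ⟨j, hj⟩ := Function.ne_iff.1 hγ
    rw [LinearMap.compMultilinearMap_apply, MultilinearMap.compLinearMap_apply,
      MultilinearMap.map_coord_zero _ j, map_zero]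
    rw [TensorProduct.map_tmul, LinearMap.comp_apply, LinearMap.comp_apply, congrFun (hβ γ) j,
      if_neg (Ne.symm hj), map_zero, TensorProduct.tmul_zero]
  · simp

theorem preGlue_of_mem (x : ZMod 2) (X : PHom H ι m) (Q : Quiv ι n) (ν : Fin m → ℕ)
    (h : ∑ j, ν j = n) {a : ∀ j, SPoly K N (Fin (ν j))} {u : Fin m → V} {α β : Fin m → ZMod 2}
    (ha : ∀ j, a j ∈ SPoly.par (α j)) (hu : ∀ j, u j ∈ H.par (β j)) :
    preGlue x X Q ν h (fun j => a j ⊗ₜ[K] u j) = shuffleSign β α •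
      X.core x (Q.contract ν h) (blkIdx ν h) (List.ofFn fun j => fullShift K N ν h Q j (a j)).prod
        (PiTensorProduct.tprod K u) := by
  rw [preGlue_tmul x X Q ν h a u β hu]
  have h1 := (MultilinearMap.mkPiAlgebraFin K m (SPoly K N (Fin n ⊕ Fin m))).map_smul_univ
    (fun j => ((sg ((∑ i, if i < j then β i else 0) * α j) : ℤ) : K))
    (fun j => fullShift K N ν h Q j (a j))
  simp only [MultilinearMap.mkPiAlgebraFin_apply, Int.cast_smul_eq_zsmul, ← Int.cast_prod,
    ← sg_sum] at h1
  simp only [SPoly.tauPow_of_mem (ha _), map_zsmul]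
  rw [h1, map_zsmul, LinearMap.smul_apply, shuffleSign_eq]
  congr 2
  rw [shuffleExp, Finset.sum_comm]
  refine Finset.sum_congr rfl fun j _ => ?_
  rw [Finset.sum_mul]
  exact Finset.sum_congr rfl fun i _ => by split_ifs <;> simp

end glue

/-! ### The gluing map respects the relations of `V_∇`. -/

section glue

variable {K : Type*} [Field K] {N : ℕ} {V : Type*} [AddCommGroup V] [Module K V]
  {H : HWSupermodule K N V} {ι : Type*} {m n : ℕ}

variable (H) in
theorem span_tmul_mon (A : Type*) : Submodule.span K {t : SPoly K N A ⊗[K] V | ∃ a p d u q,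
    SPoly.IsMon SPoly.ev a p d ∧ u ∈ H.par q ∧ a ⊗ₜ[K] u = t} = ⊤ := by
  rw [← TensorProduct.map₂_mk_top_top_eq_top, ← SPoly.span_isMon, ← H.span_hom,
    Submodule.map₂_span_span]
  congr 1
  ext t
  constructor
  · rintro ⟨a, p, d, u, q, ha, hu, rfl⟩
    exact ⟨a, ⟨p, d, ha⟩, u, ⟨q, hu⟩, rfl⟩
  · rintro ⟨a, ⟨p, d, ha⟩, u, ⟨q, hu⟩, rfl⟩
    exact ⟨a, p, d, u, q, ha, hu, rfl⟩

section prod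

variable (ν : Fin m → ℕ) (h : ∑ j, ν j = n) (Q : Quiv ι n)

/-- The product of the shifted polynomials `a_j(Λ_k + ∑ Ξ_i)`. -/
def shiftProd (a : ∀ j, SPoly K N (Fin (ν j))) : SPoly K N (Fin n ⊕ Fin m) :=
  (List.ofFn fun j => fullShift K N ν h Q j (a j)).prod

theorem shiftProd_one : shiftProd ν h Q (fun _ => (1 : SPoly K N _)) = 1 := by
  simp [shiftProd, List.ofFn_const]

theorem shiftProd_update (a : ∀ j, SPoly K N (Fin (ν j))) (j : Fin m) (c : SPoly K N (Fin (ν j))) :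
    shiftProd ν h Q (Function.update a j c) = (List.ofFn (Function.update
      (fun j => fullShift K N ν h Q j (a j)) j (fullShift K N ν h Q j c))).prod := by
  rw [shiftProd]
  congr 2
  funext i
  exact Function.apply_update (fun i => fullShift K N ν h Q i) a j c i

theorem fullShift_ev_mul (j : Fin m) (k : Fin (ν j)) (a) :
    fullShift K N ν h Q j (SPoly.ev k) * a = a * fullShift K N ν h Q j (SPoly.ev k) := by
  simp only [fullShift_ev, add_mul, mul_add, Finset.sum_mul, Finset.mul_sum]
  rw [SPoly.ev_mul]
  congr 1
  exact Finset.sum_congr rfl fun i _ => SPoly.ev_mul _ _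

theorem fullShift_od_mul (j : Fin m) (k : Fin (ν j)) (s : Fin N) (a) :
    fullShift K N ν h Q j (SPoly.od k s) * a =
      SPoly.tau a * fullShift K N ν h Q j (SPoly.od k s) := by
  simp only [fullShift_od, add_mul, mul_add, Finset.sum_mul, Finset.mul_sum]
  rw [SPoly.od_mul]
  congr 1
  exact Finset.sum_congr rfl fun i _ => SPoly.od_mul _ _ _

theorem shiftProd_ev (a : ∀ j, SPoly K N (Fin (ν j))) (j : Fin m) (k : Fin (ν j)) :
    shiftProd ν h Q (Function.update a j (SPoly.ev k * a j)) =
      fullShift K N ν h Q j (SPoly.ev k) * shiftProd ν h Q a := by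
  rw [shiftProd_update, map_mul]
  exact prod_ofFn_update_mul (f := fun j => fullShift K N ν h Q j (a j)) j
    (fullShift_ev_mul ν h Q j k)

theorem shiftProd_od {a : ∀ j, SPoly K N (Fin (ν j))} {α : Fin m → ZMod 2}
    (ha : ∀ j, a j ∈ SPoly.par (α j)) (j : Fin m) (k : Fin (ν j)) (s : Fin N) :
    shiftProd ν h Q (Function.update a j (SPoly.od k s * a j)) =
      sg (∑ i, if i < j then α i else 0) •
        (fullShift K N ν h Q j (SPoly.od k s) * shiftProd ν h Q a) := by
  rw [shiftProd_update, map_mul]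
  exact prod_ofFn_update_odd (f := fun j => fullShift K N ν h Q j (a j)) (α := α)
    (fun i => SPoly.linSubst_mem_par _ (ha i)) j (fullShift_od_mul ν h Q j k s)

theorem shiftProd_mem {a : ∀ j, SPoly K N (Fin (ν j))} {α : Fin m → ZMod 2}
    (ha : ∀ j, a j ∈ SPoly.par (α j)) : shiftProd ν h Q a ∈ SPoly.par (∑ j, α j) :=
  prod_ofFn_mem_par fun i => SPoly.linSubst_mem_par _ (ha i)

end prod

theorem shuffleExp_update_right (p q : Fin m → ZMod 2) (j : Fin m) :
    shuffleExp p (Function.update q j (q j + 1)) =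
      shuffleExp p q + ∑ i, if i < j then p i else 0 := by
  rw [shuffleExp, shuffleExp, ← Finset.sum_add_distrib]
  refine Finset.sum_congr rfl fun i _ => ?_
  rw [← Finset.add_sum_erase _ _ (Finset.mem_univ j), ← Finset.add_sum_erase (s := Finset.univ)
    (f := fun j => if i < j then p i * q j else 0) (a := j) (h := Finset.mem_univ j)]
  have : ∀ j' ∈ Finset.univ.erase j, (if i < j' then p i * Function.update q j (q j + 1) j' else 0) =
      if i < j' then p i * q j' else 0 := by
    intro j' hj'
    rw [Function.update_of_ne (Finset.ne_of_mem_erase hj')]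
  rw [Finset.sum_congr rfl this, Function.update_self]
  split_ifs <;> ring

theorem shuffleExp_update_left (p q : Fin m → ZMod 2) (j : Fin m) :
    shuffleExp (Function.update p j (p j + 1)) q =
      shuffleExp p q + ∑ i, if j < i then q i else 0 := by
  rw [shuffleExp, shuffleExp, ← Finset.add_sum_erase _ _ (Finset.mem_univ j),
    ← Finset.add_sum_erase (s := Finset.univ)
    (f := fun i => ∑ i', if i < i' then p i * q i' else 0) (a := j) (h := Finset.mem_univ j)]
  have : ∀ j' ∈ Finset.univ.erase j, (∑ i', if j' < i' then Function.update p j (p j + 1) j' * q i'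
      else 0) = ∑ i', if j' < i' then p j' * q i' else 0 := by
    intro j' hj'
    rw [Function.update_of_ne (Finset.ne_of_mem_erase hj')]
  rw [Finset.sum_congr rfl this, Function.update_self, add_right_comm, ← Finset.sum_add_distrib]
  congr 2
  funext i
  split_ifs <;> ring

theorem sum_split_at {M : Type*} [AddCommMonoid M] (f : Fin m → M) (j : Fin m) :
    ∑ i, f i = (∑ i, if i < j then f i else 0) + f j + ∑ i, if j < i then f i else 0 := by
  rw [add_right_comm, ← Finset.sum_add_distrib, ← Finset.sum_erase_add _ _ (Finset.mem_univ j),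
    ← Finset.sum_erase_add (s := Finset.univ) (f := fun i => (if i < j then f i else 0) +
      if j < i then f i else 0) (a := j) (h := Finset.mem_univ j)]
  simp only [lt_irrefl, if_false, add_zero]
  congr 1
  refine Finset.sum_congr rfl fun i hi => ?_
  rcases lt_or_gt_of_ne (Finset.ne_of_mem_erase hi) with hij | hij
  · simp [hij, hij.not_gt]
  · simp [hij, hij.not_gt]

section preGlue

variable {x : ZMod 2} {X : PHom H ι m} {Q : Quiv ι n} {ν : Fin m → ℕ} {h : ∑ j, ν j = n}
  {a : ∀ j, SPoly K N (Fin (ν j))} {u : Fin m → V} {α β : Fin m → ZMod 2}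

theorem preGlue_pure (ha : ∀ j, a j ∈ SPoly.par (α j)) (hu : ∀ j, u j ∈ H.par (β j)) :
    preGlue x X Q ν h (fun j => a j ⊗ₜ[K] u j) = shuffleSign β α •
      X.core x (Q.contract ν h) (blkIdx ν h) (shiftProd ν h Q a) (PiTensorProduct.tprod K u) :=
  preGlue_of_mem x X Q ν h ha hu

theorem update_mul_mem {j : Fin m} {c : SPoly K N (Fin (ν j))} {p : ZMod 2} (hc : c ∈ SPoly.par p)
    (ha : ∀ j, a j ∈ SPoly.par (α j)) (i : Fin m) : Function.update a j (c * a j) i ∈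
      SPoly.par (Function.update α j (α j + p) i) := by
  by_cases hi : i = j
  · subst hi; simpa [add_comm] using SPoly.mul_mem_par hc (ha i)
  · simpa [hi] using ha i

theorem update_ev_mem {j : Fin m} (k : Fin (ν j)) (ha : ∀ j, a j ∈ SPoly.par (α j)) (i : Fin m) :
    Function.update a j (SPoly.ev k * a j) i ∈ SPoly.par (α i) := by
  simpa using update_mul_mem (SPoly.ev_mem_par k) ha i

theorem preGlue_ev (ha : ∀ j, a j ∈ SPoly.par (α j)) (hu : ∀ j, u j ∈ H.par (β j)) (j : Fin m)
    (k : Fin (ν j)) :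
    preGlue x X Q ν h (fun i => Function.update a j (SPoly.ev k * a j) i ⊗ₜ[K] u i) =
      VNabla.lmul H n (SPoly.ev (blk ν h ⟨j, k⟩)) (preGlue x X Q ν h fun i => a i ⊗ₜ[K] u i) +
      ∑ i ∈ Q.extSet ν h (blk ν h ⟨j, k⟩), shuffleSign β α • X.core x (Q.contract ν h) (blkIdx ν h)
        (SPoly.ev (Sum.inr i) * shiftProd ν h Q a) (PiTensorProduct.tprod K u) := by
  rw [preGlue_pure (update_ev_mem k ha) hu, shiftProd_ev, fullShift_ev, add_mul, map_add,
    LinearMap.add_apply, PHom.core_inl_ev, preGlue_pure ha hu, map_zsmul, smul_add, Finset.sum_mul,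
    map_sum, LinearMap.sum_apply, Finset.smul_sum]

/-- This is `T^{(i)} = Ξ_i - Λ'_i` in even components: the insertion of `Ξ_i` is expressible through
the gluing map itself, which later permits the definition of `glueXi` without representatives. -/
theorem preGlue_T (ha : ∀ j, a j ∈ SPoly.par (α j)) (hu : ∀ j, u j ∈ H.par (β j)) (i : Fin m) :
    preGlue x X Q ν h (fun j => a j ⊗ₜ[K] Function.update u i (H.T (u i)) j) =
      shuffleSign β α • X.core x (Q.contract ν h) (blkIdx ν h)
        (SPoly.ev (Sum.inr i) * shiftProd ν h Q a) (PiTensorProduct.tprod K u) -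
      ∑ c with blkIdx ν h c = i, VNabla.lmul H n (SPoly.ev c)
        (preGlue x X Q ν h fun j => a j ⊗ₜ[K] u j) := by
  rw [preGlue_pure ha (H.update_T_mem hu i), preGlue_pure ha hu, PHom.core_inr_ev, H.Tat_tprod,
    smul_add]
  simp only [map_zsmul, Finset.smul_sum]
  rw [add_sub_cancel_left]

/-- The shift of an odd variable by the odd parts of the `Ξ_i` is invisible to `X`. Only the
variable itself remains, with the sign of its way past `X` and the earlier arguments. -/
theorem preGlue_od (hX : IsPcl x X) (ha : ∀ j, a j ∈ SPoly.par (α j)) (hu : ∀ j, u j ∈ H.par (β j))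
    (j : Fin m) (k : Fin (ν j)) (s : Fin N) :
    preGlue x X Q ν h (fun i => Function.update a j (SPoly.od k s * a j) i ⊗ₜ[K] u i) =
      sg (x + ∑ i, if i < j then α i + β i else 0) •
        VNabla.lmul H n (SPoly.od (blk ν h ⟨j, k⟩) s)
          (preGlue x X Q ν h fun i => a i ⊗ₜ[K] u i) := by
  rw [preGlue_pure (update_mul_mem (SPoly.od_mem_par k s) ha) hu, shiftProd_od ν h Q ha, fullShift_od,
    add_mul, smul_add, map_add, map_zsmul, map_zsmul, Finset.sum_mul, map_sum]
  simp only [LinearMap.add_apply, LinearMap.smul_apply, LinearMap.sum_apply, PHom.core_inl_od,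
    PHom.core_inr_od x X _ _ hX, Finset.sum_const_zero, smul_zero, add_zero]
  rw [preGlue_pure ha hu, map_zsmul, shuffleSign_eq, shuffleSign_eq, shuffleExp_update_right,
    sg_smul_smul, sg_smul_smul, sg_smul_smul]
  congr 2
  have : ∀ i, (if i < j then α i + β i else 0) = (if i < j then α i else 0) +
      if i < j then β i else 0 := by intro i; split_ifs <;> simp
  simp only [this, Finset.sum_add_distrib]
  ring

theorem preGlue_S (hX : IsPcl x X) (ha : ∀ j, a j ∈ SPoly.par (α j)) (hu : ∀ j, u j ∈ H.par (β j))
    (j : Fin m) (s : Fin N) :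
    preGlue x X Q ν h (fun i => a i ⊗ₜ[K] Function.update u j (H.S s (u j)) i) =
      -(sg (x + α j + ∑ i, if i < j then α i + β i else 0) • ∑ c with blkIdx ν h c = j,
        VNabla.lmul H n (SPoly.od c s) (preGlue x X Q ν h fun i => a i ⊗ₜ[K] u i)) := by
  have h1 := PHom.core_Sat x X (Q.contract ν h) (blkIdx ν h) hX j s (shiftProd_mem ν h Q ha)
    (PiTensorProduct.tprod K u)
  rw [H.Sat_of_mem s j hu, map_zsmul] at h1
  have h2 := congrArg (fun y => sg (∑ l, if l < j then β l else 0) • y) h1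
  simp only [sg_smul_self] at h2
  rw [preGlue_pure ha (H.update_S_mem hu s j), h2, preGlue_pure ha hu, shuffleSign_eq,
    shuffleSign_eq, shuffleExp_update_left]
  simp only [map_zsmul, smul_neg, ← Finset.smul_sum, sg_smul_smul]
  congr 3
  have h4 : ∀ i, (if i < j then α i + β i else 0) = (if i < j then α i else 0) +
      if i < j then β i else 0 := by intro i; split_ifs <;> simp
  simp only [sum_split_at α j, h4, Finset.sum_add_distrib]
  have h5 := add_self_zmod (∑ i, if j < i then α i else 0)
  linear_combination h5

open Classical in
-- The flow identity applied to the family of insertions of the `Ξ_i`, whose sums over components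
-- vanish. If the contraction has a cycle, all terms are zero.
theorem sum_core_ext_block (hX : IsPcl x X) (P) (t : ⨂[K] _ : Fin m, V) (j : Fin m) :
    ∑ k, ∑ i ∈ Q.extSet ν h (blk ν h ⟨j, k⟩),
      X.core x (Q.contract ν h) (blkIdx ν h) (SPoly.ev (Sum.inr i) * P) t =
      -X.core x (Q.contract ν h) (blkIdx ν h) (SPoly.ev (Sum.inr j) * P) t := by
  by_cases hF : (Q.contract ν h).Acyclic
  · exact Quiv.sum_ext_block hF
      (fun i => X.core x (Q.contract ν h) (blkIdx ν h) (SPoly.ev (Sum.inr i) * P) t)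
      (fun i => PHom.sum_core_inr_ev x X _ _ hX i P t) j
  · simp [PHom.core_eq_zero x X _ _ (hX.cycle₁ _ hF)]

/-- The sum of the shifted `λ_k` over the block `j` is `λ'_j` minus the even part of `Ξ_j`, that is,
`-T^{(j)}`. -/
theorem preGlue_rel_T (hX : IsPcl x X) (ha : ∀ j, a j ∈ SPoly.par (α j))
    (hu : ∀ j, u j ∈ H.par (β j)) (j : Fin m) :
    (∑ k, preGlue x X Q ν h (fun i => Function.update a j (SPoly.ev k * a j) i ⊗ₜ[K] u i)) +
      preGlue x X Q ν h (fun i => a i ⊗ₜ[K] Function.update u j (H.T (u j)) i) = 0 := by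
  simp only [preGlue_ev ha hu, Finset.sum_add_distrib, ← Finset.smul_sum, sum_core_ext_block hX]
  rw [preGlue_T ha hu, sum_filter_blkIdx, smul_neg]
  abel

theorem preGlue_rel_S (hX : IsPcl x X) (ha : ∀ j, a j ∈ SPoly.par (α j))
    (hu : ∀ j, u j ∈ H.par (β j)) (j : Fin m) (s : Fin N) :
    (sg (α j) • ∑ k, preGlue x X Q ν h
      (fun i => Function.update a j (SPoly.od k s * a j) i ⊗ₜ[K] u i)) +
      preGlue x X Q ν h (fun i => a i ⊗ₜ[K] Function.update u j (H.S s (u j)) i) = 0 := by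
  simp only [preGlue_od hX ha hu, ← Finset.smul_sum]
  rw [preGlue_S hX ha hu, sum_filter_blkIdx, sg_smul_smul, add_left_comm, ← add_assoc, add_neg_cancel]

theorem update_tmul_left (a : ∀ j, SPoly K N (Fin (ν j))) (u : Fin m → V) (j : Fin m) (c) :
    Function.update (fun i => a i ⊗ₜ[K] u i) j (c ⊗ₜ[K] u j) =
      fun i => Function.update a j c i ⊗ₜ[K] u i := by
  funext i
  by_cases hi : i = j
  · subst hi; simp
  · simp [hi]

theorem update_tmul_right (a : ∀ j, SPoly K N (Fin (ν j))) (u : Fin m → V) (j : Fin m) (w : V) :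
    Function.update (fun i => a i ⊗ₜ[K] u i) j (a j ⊗ₜ[K] w) =
      fun i => a i ⊗ₜ[K] Function.update u j w i := by
  funext i
  by_cases hi : i = j
  · subst hi; simp
  · simp [hi]

/-- Well-definedness. The kernel of the projection is spanned by the two families of relations, and
each vanishes in one slot by `preGlue_rel_T` and `preGlue_rel_S`. These are available for
homogeneous data only, so the relations are stated as vanishing multilinear maps `slot …` and tested
on spanning sets. -/
theorem preGlue_eq_zero (hX : IsPcl x X) (t : ∀ j, SPoly K N (Fin (ν j)) ⊗[K] V) (j : Fin m)
    (ht : VNabla.mk H (ν j) (t j) = 0) : preGlue x X Q ν h t = 0 := by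
  have hT : slot (preGlue x X Q ν h) j (TensorProduct.map
      (LinearMap.mulRight K (∑ k, SPoly.ev k)) LinearMap.id + TensorProduct.map LinearMap.id H.T) =
      0 := by
    refine multilinear_ext_span _ (fun j => span_tmul_mon H (Fin (ν j))) fun t ht => ?_
    choose a p d u q ha hu ht using ht
    obtain rfl := funext ht
    have ha := fun j => (ha j).mem_par SPoly.ev_mem_par
    rw [slot_apply, LinearMap.add_apply, TensorProduct.map_tmul, TensorProduct.map_tmul,
      MultilinearMap.map_update_add, LinearMap.mulRight_apply, LinearMap.id_apply,
      LinearMap.id_apply, zero_apply, ← preGlue_rel_T (h := h) (Q := Q) hX ha hu j,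
      update_tmul_right]
    simp only [Finset.mul_sum, TensorProduct.sum_tmul, MultilinearMap.map_update_sum,
      update_tmul_left, SPoly.ev_mul]
  have hS : ∀ s, slot (preGlue x X Q ν h) j (TensorProduct.map
      (LinearMap.mulRight K (∑ k, SPoly.od k s)) LinearMap.id +
        TensorProduct.map LinearMap.id (H.S s)) = 0 := by
    intro s
    refine multilinear_ext_span _ (fun j => span_tmul_mon H (Fin (ν j))) fun t ht => ?_
    choose a p d u q ha hu ht using ht
    obtain rfl := funext ht
    have ha := fun j => (ha j).mem_par SPoly.ev_mem_par
    have hao : ∀ k, a j * SPoly.od k s = sg (p j) • (SPoly.od k s * a j) := by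
      intro k; rw [SPoly.od_mul_of_mem _ _ (ha j), sg_smul_self]
    rw [slot_apply, LinearMap.add_apply, TensorProduct.map_tmul, TensorProduct.map_tmul,
      MultilinearMap.map_update_add, LinearMap.mulRight_apply, LinearMap.id_apply,
      LinearMap.id_apply, zero_apply, ← preGlue_rel_S (h := h) (Q := Q) hX ha hu j s,
      update_tmul_right]
    simp only [Finset.mul_sum, TensorProduct.sum_tmul, MultilinearMap.map_update_sum, hao,
      Finset.smul_sum]
    congr 1
    refine Finset.sum_congr rfl fun k _ => ?_
    rw [← update_tmul_left]
    have := (preGlue x X Q ν h).map_update_smul (fun i => a i ⊗ₜ[K] u i) j ((sg (p j) : ℤ) : K)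
      ((SPoly.od k s * a j) ⊗ₜ[K] u j)
    simpa only [Int.cast_smul_eq_zsmul, TensorProduct.smul_tmul'] using this
  have hmem : t j ∈ relSub H (ν j) := by rwa [← VNabla.ker_mk, LinearMap.mem_ker]
  suffices hs : ∀ z ∈ relSub H (ν j), preGlue x X Q ν h (Function.update t j z) = 0 by
    simpa using hs _ hmem
  intro z hz
  induction hz using Submodule.span_induction with
  | mem z hz =>
    rcases hz with ⟨a, v, rfl⟩ | ⟨s, a, v, rfl⟩
    · have := DFunLike.congr_fun hT (Function.update t j (a ⊗ₜ v))
      simpa [slot_apply] using this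
    · have := DFunLike.congr_fun (hS s) (Function.update t j (a ⊗ₜ v))
      simpa [slot_apply] using this
  | zero => simp
  | add z z' _ _ hz hz' => rw [MultilinearMap.map_update_add, hz, hz', add_zero]
  | smul c z _ hz => rw [MultilinearMap.map_update_smul, hz, smul_zero]

end preGlue

end glue

/-! ### The gluing map on `V_∇`: generator rules and comparison principle. -/

section glue

variable {K : Type*} [Field K] {N : ℕ} {V : Type*} [AddCommGroup V] [Module K V]
  {H : HWSupermodule K N V} {ι : Type*} {m n : ℕ}

theorem map_sg_smul_univ {M : Fin m → Type*} {E : Type*} [∀ j, AddCommGroup (M j)]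
    [∀ j, Module K (M j)] [AddCommGroup E] [Module K E] (Φ : MultilinearMap K M E)
    (p : Fin m → ZMod 2) (y : ∀ j, M j) :
    Φ (fun j => sg (p j) • y j) = sg (∑ j, p j) • Φ y := by
  have := Φ.map_smul_univ (fun i => ((sg (p i) : ℤ) : K)) y
  simp only [Int.cast_smul_eq_zsmul] at this
  rw [this, sg_sum, ← Int.cast_prod, Int.cast_smul_eq_zsmul]

theorem map_update_zsmul {M : Fin m → Type*} {E : Type*} [∀ j, AddCommGroup (M j)]
    [∀ j, Module K (M j)] [AddCommGroup E] [Module K E] (Φ : MultilinearMap K M E)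
    (y : ∀ j, M j) (j : Fin m) (c : ℤ) (z : M j) :
    Φ (Function.update y j (c • z)) = c • Φ (Function.update y j z) := by
  have := Φ.map_update_smul y j (c : K) z
  simpa only [Int.cast_smul_eq_zsmul] using this

theorem map_update_neg {M : Fin m → Type*} {E : Type*} [∀ j, AddCommGroup (M j)]
    [∀ j, Module K (M j)] [AddCommGroup E] [Module K E] (Φ : MultilinearMap K M E)
    (y : ∀ j, M j) (j : Fin m) (z : M j) :
    Φ (Function.update y j (-z)) = -Φ (Function.update y j z) := by
  simpa only [neg_smul, one_smul] using map_update_zsmul Φ y j (-1) z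

namespace VNabla

variable (H) in
/-- A linear right inverse of the projection onto `V_∇[Λ_k]_k`. -/
def sec (n : ℕ) : VNabla H n →ₗ[K] SPoly K N (Fin n) ⊗[K] V :=
  Classical.choose ((mk H n).exists_rightInverse_of_surjective
    (LinearMap.range_eq_top.2 (mk_surjective H)))

theorem mk_sec (y : VNabla H n) : mk H n (sec H n y) = y :=
  LinearMap.congr_fun (Classical.choose_spec ((mk H n).exists_rightInverse_of_surjective
    (LinearMap.range_eq_top.2 (mk_surjective H)))) y

theorem mk_mem_par {a : SPoly K N (Fin n)} {v : V} {p q : ZMod 2} (ha : a ∈ SPoly.par p)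
    (hv : v ∈ H.par q) : mk H n (a ⊗ₜ[K] v) ∈ par H n (p + q) :=
  Submodule.subset_span ⟨p, q, a, v, rfl, ha, hv, rfl⟩

/-- Multilinear maps on the spaces `V_∇` which agree on the classes of homogeneous pure tensors are
equal. -/
theorem multilinear_ext {ν : Fin m → ℕ} {E : Type*} [AddCommGroup E] [Module K E]
    {Φ Ψ : MultilinearMap K (fun j => VNabla H (ν j)) E}
    (h : ∀ (a : ∀ j, SPoly K N (Fin (ν j))) (α : Fin m → ZMod 2) (d : Fin m → ℕ) (u : Fin m → V)
      (β : Fin m → ZMod 2), (∀ j, SPoly.IsMon SPoly.ev (a j) (α j) (d j)) →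
        (∀ j, u j ∈ H.par (β j)) → Φ (fun j => mk H (ν j) (a j ⊗ₜ[K] u j)) =
          Ψ (fun j => mk H (ν j) (a j ⊗ₜ[K] u j))) : Φ = Ψ := by
  refine multilinear_ext_span _ (fun j => span_mk_mon H) fun t ht => ?_
  choose a p d u q ha hu ht using ht
  obtain rfl := funext ht
  exact h a p d u q ha hu

theorem update_mk_left {ν : Fin m → ℕ} (a : ∀ j, SPoly K N (Fin (ν j))) (u : Fin m → V) (j : Fin m)
    (c) : Function.update (fun i => mk H (ν i) (a i ⊗ₜ[K] u i)) j (mk H (ν j) (c ⊗ₜ[K] u j)) =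
      fun i => mk H (ν i) (Function.update a j c i ⊗ₜ[K] u i) := by
  funext i
  by_cases hi : i = j
  · subst hi; simp
  · simp [hi]

theorem update_mk_right {ν : Fin m → ℕ} (a : ∀ j, SPoly K N (Fin (ν j))) (u : Fin m → V) (j : Fin m)
    (w : V) :
    Function.update (fun i => mk H (ν i) (a i ⊗ₜ[K] u i)) j (mk H (ν j) (a j ⊗ₜ[K] w)) =
      fun i => mk H (ν i) (a i ⊗ₜ[K] Function.update u j w i) := by
  funext i
  by_cases hi : i = j
  · subst hi; simp
  · simp [hi]

/-- Multiplication by `∑_k λ_k`. -/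
def tot (H : HWSupermodule K N V) (n : ℕ) : Module.End K (VNabla H n) :=
  ∑ k, lmul H n (SPoly.ev k)

theorem tot_apply (y : VNabla H n) : tot H n y = ∑ k, lmul H n (SPoly.ev k) y := by
  rw [tot, LinearMap.sum_apply]

theorem tot_mk (a : SPoly K N (Fin n)) (v : V) :
    tot H n (mk H n (a ⊗ₜ[K] v)) = -mk H n (a ⊗ₜ[K] H.T v) := by
  rw [mk_tmul_T, neg_neg, tot_apply]

theorem tot_mem [CharZero K] {p : ZMod 2} {y : VNabla H n} (hy : y ∈ par H n p) :
    tot H n y ∈ par H n p := by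
  rw [mem_par_iff] at *
  rw [tot_apply, map_sum, Finset.smul_sum]
  exact Finset.sum_congr rfl fun k _ => by rw [eps_lmul_ev, hy, map_zsmul]

theorem lmul_ev_mem [CharZero K] {p : ZMod 2} {y : VNabla H n} (k : Fin n) (hy : y ∈ par H n p) :
    lmul H n (SPoly.ev k) y ∈ par H n p := by
  rw [mem_par_iff] at *
  rw [eps_lmul_ev, hy, map_zsmul]

theorem lmul_od_mem [CharZero K] {p : ZMod 2} {y : VNabla H n} (k : Fin n) (s : Fin N)
    (hy : y ∈ par H n p) : lmul H n (SPoly.od k s) y ∈ par H n (p + 1) := by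
  rw [mem_par_iff] at *
  rw [eps_lmul_od, hy, map_zsmul, sg_add_one, neg_smul]

end VNabla

/-! ### The gluing map -/

/-- The multilinear map of the spaces `V_∇[Λ_k]_k` of the blocks by which composites with `X` are
computed. -/
def glue (x : ZMod 2) (X : PHom H ι m) (Q : Quiv ι n) (ν : Fin m → ℕ) (h : ∑ j, ν j = n) :
    MultilinearMap K (fun j => VNabla H (ν j)) (VNabla H n) :=
  (preGlue x X Q ν h).compLinearMap fun j => VNabla.sec H (ν j)

section rules

variable {x : ZMod 2} {X : PHom H ι m} {Q : Quiv ι n} {ν : Fin m → ℕ} {h : ∑ j, ν j = n}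

/-- By `preGlue_eq_zero` any representatives may be used in place of those picked by the section
`VNabla.sec`. -/
theorem glue_mk (hX : IsPcl x X) (t : ∀ j, SPoly K N (Fin (ν j)) ⊗[K] V) :
    glue x X Q ν h (fun j => VNabla.mk H (ν j) (t j)) = preGlue x X Q ν h t :=
  multilinear_congr_of_ker _ (fun j => VNabla.mk H (ν j)) (fun t j ht => preGlue_eq_zero hX t j ht)
    _ _ fun _ => VNabla.mk_sec _

theorem glue_one (hX : IsPcl x X) (u : Fin m → V) :
    glue x X Q ν h (fun j => VNabla.mk H (ν j) (1 ⊗ₜ[K] u j)) =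
      VNabla.collect H (blkIdx ν h) (X.at (Q.contract ν h) (PiTensorProduct.tprod K u)) := by
  rw [glue_mk hX]
  have := LinearMap.congr_fun (f := PiTensorProduct.lift ((preGlue x X Q ν h).compLinearMap
    fun j => TensorProduct.mk K (SPoly K N (Fin (ν j))) V 1)) (g := VNabla.collect H (blkIdx ν h) ∘ₗ
      X.at (Q.contract ν h)) (H.tensor_ext fun u β hu => ?_) (PiTensorProduct.tprod K u)
  · rwa [PiTensorProduct.lift.tprod] at this
  · rw [PiTensorProduct.lift.tprod, MultilinearMap.compLinearMap_apply]
    refine (preGlue_pure (fun _ => SPoly.one_mem_par) hu).trans ?_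
    rw [shiftProd_one, PHom.core_one]
    have : shuffleSign β (fun _ => 0) = 1 := by simp [shuffleSign, sg_zero]
    rw [this, one_smul]; rfl

/-- The operator `ξ_i` of the gluing map: it is the insertion of `Ξ_i = Λ'_i + ∇^{(i)}`. -/
def glueXi (x : ZMod 2) (X : PHom H ι m) (Q : Quiv ι n) (ν : Fin m → ℕ) (h : ∑ j, ν j = n)
    (i : Fin m) : MultilinearMap K (fun j => VNabla H (ν j)) (VNabla H n) :=
  -- Multiplication by the total `λ` of a block is `-T` on the factor `V`, so the difference is
  -- `Λ'_i + T^{(i)}` in even components.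
  (∑ c with blkIdx ν h c = i, VNabla.lmul H n (SPoly.ev c)).compMultilinearMap (glue x X Q ν h) -
    slot (glue x X Q ν h) i (VNabla.tot H (ν i))

theorem glueXi_apply (i : Fin m) (y : ∀ j, VNabla H (ν j)) : glueXi x X Q ν h i y =
    (∑ c with blkIdx ν h c = i, VNabla.lmul H n (SPoly.ev c) (glue x X Q ν h y)) -
      glue x X Q ν h (Function.update y i (VNabla.tot H (ν i) (y i))) := by
  rw [glueXi, sub_apply, slot_apply, LinearMap.compMultilinearMap_apply,
    LinearMap.sum_apply]

section pure

variable {a : ∀ j, SPoly K N (Fin (ν j))} {u : Fin m → V} {α β : Fin m → ZMod 2}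

theorem glueXi_pure (hX : IsPcl x X) (ha : ∀ j, a j ∈ SPoly.par (α j))
    (hu : ∀ j, u j ∈ H.par (β j)) (i : Fin m) :
    glueXi x X Q ν h i (fun j => VNabla.mk H (ν j) (a j ⊗ₜ[K] u j)) =
      shuffleSign β α • X.core x (Q.contract ν h) (blkIdx ν h)
        (SPoly.ev (Sum.inr i) * shiftProd ν h Q a) (PiTensorProduct.tprod K u) := by
  rw [glueXi_apply, VNabla.tot_mk, map_update_neg, VNabla.update_mk_right, glue_mk hX, glue_mk hX,
    preGlue_T ha hu]
  abel

end pure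

/-- The substitution for one variable, read on `V_∇`. Since `glueXi` is expressed by `glue`, this is
a recursion for the gluing map. -/
theorem glue_ev (hX : IsPcl x X) (y : ∀ j, VNabla H (ν j)) (j : Fin m) (k : Fin (ν j)) :
    glue x X Q ν h (Function.update y j (VNabla.lmul H (ν j) (SPoly.ev k) (y j))) =
      VNabla.lmul H n (SPoly.ev (blk ν h ⟨j, k⟩)) (glue x X Q ν h y) +
        ∑ i ∈ Q.extSet ν h (blk ν h ⟨j, k⟩), glueXi x X Q ν h i y := by
  have : slot (glue x X Q ν h) j (VNabla.lmul H (ν j) (SPoly.ev k)) =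
      (VNabla.lmul H n (SPoly.ev (blk ν h ⟨j, k⟩))).compMultilinearMap (glue x X Q ν h) +
        ∑ i ∈ Q.extSet ν h (blk ν h ⟨j, k⟩), glueXi x X Q ν h i := by
    refine VNabla.multilinear_ext fun a α d u β ha hu => ?_
    have ha := fun j => (ha j).mem_par SPoly.ev_mem_par
    rw [slot_apply, VNabla.lmul_mk, VNabla.update_mk_left, glue_mk hX, preGlue_ev ha hu,
      add_apply, LinearMap.compMultilinearMap_apply, glue_mk hX, sum_apply]
    simp only [glueXi_pure hX ha hu]
  have := DFunLike.congr_fun this y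
  rwa [slot_apply, add_apply, sum_apply, LinearMap.compMultilinearMap_apply] at this

theorem glue_od' (hX : IsPcl x X) (y : ∀ j, VNabla H (ν j)) (j : Fin m) (k : Fin (ν j)) (s : Fin N) :
    glue x X Q ν h (Function.update y j (VNabla.lmul H (ν j) (SPoly.od k s) (y j))) =
      sg x • VNabla.lmul H n (SPoly.od (blk ν h ⟨j, k⟩) s)
        (glue x X Q ν h fun i => if i < j then VNabla.eps H (ν i) (y i) else y i) := by
  have : slot (glue x X Q ν h) j (VNabla.lmul H (ν j) (SPoly.od k s)) =
      (sg x • VNabla.lmul H n (SPoly.od (blk ν h ⟨j, k⟩) s)).compMultilinearMap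
        ((glue x X Q ν h).compLinearMap
          fun i => if i < j then VNabla.eps H (ν i) else LinearMap.id) := by
    refine VNabla.multilinear_ext fun a α d u β ha hu => ?_
    have ha := fun j => (ha j).mem_par SPoly.ev_mem_par
    rw [slot_apply, VNabla.lmul_mk, VNabla.update_mk_left, glue_mk hX, preGlue_od hX ha hu,
      LinearMap.compMultilinearMap_apply, MultilinearMap.compLinearMap_apply]
    have h1 : (fun i => (if i < j then VNabla.eps H (ν i) else LinearMap.id)
        (VNabla.mk H (ν i) (a i ⊗ₜ[K] u i))) = fun i => sg (if i < j then α i + β i else 0) •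
          VNabla.mk H (ν i) (a i ⊗ₜ[K] u i) := by
      funext i
      split_ifs
      · exact VNabla.eps_mk_of_mem H (ha i) (hu i)
      · simp [sg_zero]
    rw [h1, map_sg_smul_univ, glue_mk hX, LinearMap.smul_apply, map_zsmul, sg_smul_smul]
  have := DFunLike.congr_fun this y
  rw [slot_apply, LinearMap.compMultilinearMap_apply, MultilinearMap.compLinearMap_apply,
    LinearMap.smul_apply] at this
  rw [this]
  congr 3
  funext i
  split_ifs <;> rfl

theorem glue_od [CharZero K] (hX : IsPcl x X) {y : ∀ j, VNabla H (ν j)} {p : Fin m → ZMod 2}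
    (hy : ∀ j, y j ∈ VNabla.par H (ν j) (p j)) (j : Fin m) (k : Fin (ν j)) (s : Fin N) :
    glue x X Q ν h (Function.update y j (VNabla.lmul H (ν j) (SPoly.od k s) (y j))) =
      sg (x + ∑ i, if i < j then p i else 0) • VNabla.lmul H n (SPoly.od (blk ν h ⟨j, k⟩) s)
        (glue x X Q ν h y) := by
  have h1 : (fun i => if i < j then VNabla.eps H (ν i) (y i) else y i) =
      fun i => sg (if i < j then p i else 0) • y i := by
    funext i
    split_ifs
    · exact (VNabla.mem_par_iff H).1 (hy i)
    · simp [sg_zero]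
  rw [glue_od' hX, h1, map_sg_smul_univ, map_zsmul, sg_smul_smul]

open Classical in
theorem sum_glueXi (hX : IsPcl x X) (i : Fin m) (y : ∀ j, VNabla H (ν j)) :
    ∑ j with (Q.contract ν h).Conn i j, glueXi x X Q ν h j y = 0 := by
  have : ∑ j with (Q.contract ν h).Conn i j, glueXi x X Q ν h j = 0 := by
    refine VNabla.multilinear_ext fun a α d u β ha hu => ?_
    have ha := fun j => (ha j).mem_par SPoly.ev_mem_par
    rw [sum_apply, zero_apply]
    simp only [glueXi_pure hX ha hu]
    rw [← Finset.smul_sum, PHom.sum_core_inr_ev x X _ _ hX, smul_zero]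
  have := DFunLike.congr_fun this y
  rwa [sum_apply, zero_apply] at this

theorem glue_eps [CharZero K] (hX : IsPcl x X) (y : ∀ j, VNabla H (ν j)) :
    VNabla.eps H n (glue x X Q ν h y) =
      sg x • glue x X Q ν h fun i => VNabla.eps H (ν i) (y i) := by
  have : (VNabla.eps H n).compMultilinearMap (glue x X Q ν h) =
      (sg x • LinearMap.id (R := K)).compMultilinearMap
      ((glue x X Q ν h).compLinearMap fun i => VNabla.eps H (ν i)) := by
    refine VNabla.multilinear_ext fun a α d u β ha hu => ?_
    have ha := fun j => (ha j).mem_par SPoly.ev_mem_par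
    simp only [LinearMap.compMultilinearMap_apply, MultilinearMap.compLinearMap_apply,
      VNabla.eps_mk_of_mem H (ha _) (hu _), LinearMap.smul_apply, LinearMap.id_apply,
      map_sg_smul_univ, glue_mk hX, preGlue_pure ha hu, map_zsmul, PHom.eps_core x X _ _ hX,
      SPoly.mem_par.1 (shiftProd_mem ν h Q ha), H.epsTensor_of_mem hu]
    simp only [shuffleSign_eq, sg_smul_smul]
    congr 2
    rw [Finset.sum_add_distrib]
    ring
  exact DFunLike.congr_fun this y

theorem glue_mem [CharZero K] (hX : IsPcl x X) {y : ∀ j, VNabla H (ν j)} {p : Fin m → ZMod 2}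
    (hy : ∀ j, y j ∈ VNabla.par H (ν j) (p j)) :
    glue x X Q ν h y ∈ VNabla.par H n (x + ∑ j, p j) := by
  rw [VNabla.mem_par_iff, glue_eps hX]
  simp only [(VNabla.mem_par_iff H).1 (hy _)]
  rw [map_sg_smul_univ, sg_smul_smul]

theorem glue_eq_zero (hX : X.at (Q.contract ν h) = 0) : glue x X Q ν h = 0 := by
  have : preGlue x X Q ν h = 0 := by
    rw [preGlue]
    refine Finset.sum_eq_zero fun β _ => ?_
    have h0 : X.core x (Q.contract ν h) (blkIdx ν h) = 0 :=
      LinearMap.ext fun P => LinearMap.ext fun t => PHom.core_eq_zero x X _ _ hX P t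
    rw [h0, LinearMap.comp_zero]
    ext t
    simp only [LinearMap.compMultilinearMap_apply]
    generalize ((MultilinearMap.mkPiAlgebraFin K m (SPoly K N (Fin n ⊕ Fin m) ⊗[K]
      TensorAlgebra K V)).compLinearMap _) t = z
    induction z with
    | zero => simp
    | add z z' hz hz' => rw [map_add, hz, hz']; simp
    | tmul P w => simp
  rw [glue, this]
  rfl

end rules

/-- Multilinear maps which satisfy the same rules for generators are equal. -/
theorem glue_unique [CharZero K] {ν : Fin m → ℕ} {W : Type*} [AddCommGroup W] [Module K W]
    (A : ∀ j, Fin (ν j) → W → W) (B : Fin m → W → W) (R : ∀ j, Fin (ν j) → (Fin m → W) → W)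
    (O : ∀ j, Fin (ν j) → Fin N → W → W)
    {Φ Ψ : MultilinearMap K (fun j => VNabla H (ν j)) W}
    (one : ∀ (u : Fin m → V) (β : Fin m → ZMod 2), (∀ j, u j ∈ H.par (β j)) →
      Φ (fun j => VNabla.mk H (ν j) (1 ⊗ₜ[K] u j)) = Ψ (fun j => VNabla.mk H (ν j) (1 ⊗ₜ[K] u j)))
    (evΦ : ∀ y (p : Fin m → ZMod 2), (∀ j, y j ∈ VNabla.par H (ν j) (p j)) → ∀ j k,
      Φ (Function.update y j (VNabla.lmul H (ν j) (SPoly.ev k) (y j))) = A j k (Φ y) +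
        R j k fun i => B i (Φ y) - Φ (Function.update y i (VNabla.tot H (ν i) (y i))))
    (evΨ : ∀ y (p : Fin m → ZMod 2), (∀ j, y j ∈ VNabla.par H (ν j) (p j)) → ∀ j k,
      Ψ (Function.update y j (VNabla.lmul H (ν j) (SPoly.ev k) (y j))) = A j k (Ψ y) +
        R j k fun i => B i (Ψ y) - Ψ (Function.update y i (VNabla.tot H (ν i) (y i))))
    (odΦ : ∀ y (p : Fin m → ZMod 2), (∀ j, y j ∈ VNabla.par H (ν j) (p j)) → ∀ j k s,
      Φ (Function.update y j (VNabla.lmul H (ν j) (SPoly.od k s) (y j))) =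
        sg (∑ i, if i < j then p i else 0) • O j k s (Φ y))
    (odΨ : ∀ y (p : Fin m → ZMod 2), (∀ j, y j ∈ VNabla.par H (ν j) (p j)) → ∀ j k s,
      Ψ (Function.update y j (VNabla.lmul H (ν j) (SPoly.od k s) (y j))) =
        sg (∑ i, if i < j then p i else 0) • O j k s (Ψ y)) : Φ = Ψ := by
  refine VNabla.multilinear_ext fun a α d u β ha hu => ?_
  -- The induction is over the polynomials with all `u` quantified inside: the term with
  -- `VNabla.tot` replaces `u i` by `T (u i)` up to sign and leaves the polynomials unchanged, so
  -- the induction hypothesis covers it.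
  suffices h : ∀ (u : Fin m → V) (β : Fin m → ZMod 2), (∀ j, u j ∈ H.par (β j)) →
      Φ (fun j => VNabla.mk H (ν j) (a j ⊗ₜ[K] u j)) =
        Ψ (fun j => VNabla.mk H (ν j) (a j ⊗ₜ[K] u j)) from h u β hu
  refine SPoly.mon_induction (fun j => SPoly.ev) (P := fun a α => ∀ (u : Fin m → V)
    (β : Fin m → ZMod 2), (∀ j, u j ∈ H.par (β j)) →
      Φ (fun j => VNabla.mk H (ν j) (a j ⊗ₜ[K] u j)) =
        Ψ (fun j => VNabla.mk H (ν j) (a j ⊗ₜ[K] u j))) (fun j => SPoly.ev_mem_par) one ?_ ?_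
    a α d ha
  · intro a α j k ha IH u β hu
    have hy := fun j => VNabla.mk_mem_par (ha j) (hu j)
    have e1 := evΦ _ _ hy j k
    have e2 := evΨ _ _ hy j k
    simp only [VNabla.tot_mk, map_update_neg, VNabla.update_mk_right] at e1 e2
    rw [VNabla.lmul_mk, VNabla.update_mk_left] at e1 e2
    rw [e1, e2, IH u β hu]
    congr 2
    funext i
    rw [IH _ β (H.update_T_mem hu i)]
  · intro a α j k s ha IH u β hu
    have hy := fun j => VNabla.mk_mem_par (ha j) (hu j)
    have e1 := odΦ _ _ hy j k s
    have e2 := odΨ _ _ hy j k s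
    rw [VNabla.lmul_mk, VNabla.update_mk_left] at e1 e2
    rw [e1, e2, IH u β hu]

end glue

section glue

variable {K : Type*} [Field K] {N : ℕ} {V : Type*} [AddCommGroup V] [Module K V]
  {H : HWSupermodule K N V} {ι : Type*} {m n : ℕ}

/-! ### Derivatives of the gluing map -/

section derivations

variable {A B : Type*}

/-- A linear map satisfying the Leibniz rule, which maps the even generators to scalars and the
odd generators to zero. -/
structure IsDer (D : SPoly K N A →ₗ[K] SPoly K N A) (r : A → K) : Prop where
  mul : ∀ f g, D (f * g) = f * D g + D f * g
  ev : ∀ a, D (SPoly.ev a) = r a • 1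
  od : ∀ a i, D (SPoly.od a i) = 0

theorem IsDer.one {D : SPoly K N A →ₗ[K] SPoly K N A} {r : A → K} (hD : IsDer D r) : D 1 = 0 := by
  simpa using hD.mul 1 1

theorem isDer_pd [DecidableEq A] (a : A) :
    IsDer (SPoly.pd a : SPoly K N A →ₗ[K] _) fun b => if b = a then 1 else 0 :=
  ⟨SPoly.pd_mul a, fun b => by rw [SPoly.pd_ev, ite_smul, one_smul, zero_smul], SPoly.pd_od a⟩

theorem IsDer.add {D D' : SPoly K N A →ₗ[K] SPoly K N A} {r r' : A → K} (h : IsDer D r)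
    (h' : IsDer D' r') : IsDer (D + D') fun b => r b + r' b :=
  ⟨fun f g => by simp only [LinearMap.add_apply, h.mul, h'.mul, mul_add, add_mul]; abel,
    fun a => by rw [LinearMap.add_apply, h.ev, h'.ev, add_smul],
    fun a i => by rw [LinearMap.add_apply, h.od, h'.od, add_zero]⟩

theorem IsDer.sub {D D' : SPoly K N A →ₗ[K] SPoly K N A} {r r' : A → K} (h : IsDer D r)
    (h' : IsDer D' r') : IsDer (D - D') fun b => r b - r' b :=
  ⟨fun f g => by simp only [LinearMap.sub_apply, h.mul, h'.mul, mul_sub, sub_mul]; abel,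
    fun a => by rw [LinearMap.sub_apply, h.ev, h'.ev, sub_smul],
    fun a i => by rw [LinearMap.sub_apply, h.od, h'.od, sub_zero]⟩

theorem isDer_zero : IsDer (0 : SPoly K N A →ₗ[K] SPoly K N A) 0 :=
  ⟨fun f g => by simp, fun a => by simp, fun a i => by simp⟩

/-- Both compositions satisfy the Leibniz rule along the substitution, so they agree once they agree
on generators; for the even ones this is the hypothesis on the coefficients. -/
theorem IsDer.linSubst [Fintype B] {D : SPoly K N A →ₗ[K] SPoly K N A}
    {D' : SPoly K N B →ₗ[K] SPoly K N B} {r : A → K} {r' : B → K} (h : IsDer D r) (h' : IsDer D' r')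
    (c : A → B → K) (hr : ∀ a, ∑ b, c a b * r' b = r a) (f : SPoly K N A) :
    D' (SPoly.linSubst c f) = SPoly.linSubst c (D f) := by
  induction f using SPoly.induction_left with
  | one => rw [map_one, h.one, h'.one, map_zero]
  | add f g hf hg => simp only [map_add, hf, hg]
  | smul s f hf => simp only [map_smul, hf]
  | ev a f hf =>
    rw [map_mul, h'.mul, hf, h.mul, map_add, map_mul, map_mul, h.ev, SPoly.linSubst_ev, map_sum]
    congr 2
    simp only [map_smul, h'.ev, smul_smul, ← Finset.sum_smul, hr, map_one]
  | od a i f hf =>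
    rw [map_mul, h'.mul, hf, h.mul, map_add, map_mul, map_mul, h.od, SPoly.linSubst_od, map_sum]
    congr 2
    simp [h'.od]

theorem IsDer.prod_eq_zero {D : SPoly K N A →ₗ[K] SPoly K N A} {r : A → K} (h : IsDer D r)
    (L : List (SPoly K N A)) (hL : ∀ f ∈ L, D f = 0) : D L.prod = 0 := by
  induction L with
  | nil => exact h.one
  | cons f L ih =>
    rw [List.prod_cons, h.mul, ih fun g hg => hL g (by simp [hg]), hL f (by simp)]; simp

theorem IsDer.prod_ofFn {D : SPoly K N A →ₗ[K] SPoly K N A} {r : A → K} (h : IsDer D r)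
    (f : Fin m → SPoly K N A) (j : Fin m) (hf : ∀ i, i ≠ j → D (f i) = 0) :
    D (List.ofFn f).prod = (List.ofFn (Function.update f j (D (f j)))).prod := by
  have h1 : D ((List.ofFn f).take j).prod = 0 := by
    refine h.prod_eq_zero _ fun g hg => ?_
    obtain ⟨i, hi, rfl⟩ := List.mem_take_iff_getElem.1 hg
    rw [List.getElem_ofFn]
    refine hf _ fun hc => ?_
    rw [← hc] at hi
    simp at hi
  have h2 : D ((List.ofFn f).drop (j + 1)).prod = 0 := by
    refine h.prod_eq_zero _ fun g hg => ?_
    obtain ⟨i, hi, rfl⟩ := List.mem_drop_iff_getElem.1 hg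
    rw [List.getElem_ofFn]
    refine hf _ fun hc => ?_
    have := congrArg Fin.val hc
    simp at this
    omega
  rw [prod_ofFn_update, prod_ofFn_split f j, h.mul, h.mul, h1, h2]
  simp

end derivations

/-- The derivation of polynomials in `Λ_k` and `Ξ_j` corresponding to `∂/∂λ_k - ∂/∂λ_l`. -/
def xiDer (K : Type*) [Field K] (N : ℕ) (b : Fin n → Fin m) (k l : Fin n) :
    SPoly K N (Fin n ⊕ Fin m) →ₗ[K] SPoly K N (Fin n ⊕ Fin m) :=
  (SPoly.pd (Sum.inl k) + SPoly.pd (Sum.inr (b k))) -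
    (SPoly.pd (Sum.inl l) + SPoly.pd (Sum.inr (b l)))

theorem isDer_xiDer (b : Fin n → Fin m) (k l : Fin n) : IsDer (xiDer K N b k l)
    fun c => ((if c = Sum.inl k then 1 else 0) + if c = Sum.inr (b k) then 1 else 0) -
      ((if c = Sum.inl l then 1 else 0) + if c = Sum.inr (b l) then 1 else 0) :=
  ((isDer_pd _).add (isDer_pd _)).sub ((isDer_pd _).add (isDer_pd _))

section rules

variable {x : ZMod 2} {X : PHom H ι m} {Q : Quiv ι n} {ν : Fin m → ℕ} {h : ∑ j, ν j = n}

theorem xiDer_fullShift {k l : Fin n} {j : Fin m} {D : SPoly K N (Fin (ν j)) →ₗ[K] _}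
    {r : Fin (ν j) → K} (hD : IsDer D r)
    (hr : ∀ c, ((if blk ν h ⟨j, c⟩ = k then 1 else 0) - (if blk ν h ⟨j, c⟩ = l then 1 else 0)) +
      ∑ i ∈ Q.extSet ν h (blk ν h ⟨j, c⟩), ((if i = blkIdx ν h k then 1 else 0) -
        (if i = blkIdx ν h l then 1 else 0)) = r c) (f : SPoly K N (Fin (ν j))) :
    xiDer K N (blkIdx ν h) k l (fullShift K N ν h Q j f) = fullShift K N ν h Q j (D f) := by
  refine hD.linSubst (isDer_xiDer _ k l) _ (fun c => ?_) f
  rw [← hr, Fintype.sum_sum_type]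
  congr 1
  · simp [mul_sub]
  · rw [Quiv.extSet, Finset.sum_filter]
    simp

/-- For two vertices of the same block the derivatives along `Ξ` cancel. What remains differentiates
the `j`-th polynomial and kills the others. -/
theorem glue_pdSub_block [CharZero K] (hX : IsPcl x X) (y : ∀ j, VNabla H (ν j)) (j : Fin m)
    (k l : Fin (ν j)) :
    VNabla.pdSub H (blk ν h ⟨j, k⟩) (blk ν h ⟨j, l⟩) (glue x X Q ν h y) =
      glue x X Q ν h (Function.update y j (VNabla.pdSub H k l (y j))) := by
  have : (VNabla.pdSub H (blk ν h ⟨j, k⟩) (blk ν h ⟨j, l⟩)).compMultilinearMap (glue x X Q ν h) =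
      slot (glue x X Q ν h) j (VNabla.pdSub H k l) := by
    refine VNabla.multilinear_ext fun a α d u β ha hu => ?_
    have ha := fun j => (ha j).mem_par SPoly.ev_mem_par
    have ha' : ∀ i, Function.update a j (SPoly.pd k (a j) - SPoly.pd l (a j)) i ∈
        SPoly.par (α i) := by
      intro i
      by_cases hi : i = j
      · subst hi
        simpa using sub_mem (SPoly.pd_mem_par k (ha i)) (SPoly.pd_mem_par l (ha i))
      · simpa [hi] using ha i
    rw [LinearMap.compMultilinearMap_apply, slot_apply, VNabla.pdSub_mk, VNabla.update_mk_left,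
      glue_mk hX, glue_mk hX, preGlue_pure ha hu, preGlue_pure ha' hu, map_zsmul,
      PHom.pdSub_core x X _ _ hX (by rw [blkIdx_blk, blkIdx_blk]; exact Quiv.Conn.refl _)]
    congr 2
    refine congrArg _ (?_ : xiDer K N (blkIdx ν h) (blk ν h ⟨j, k⟩) (blk ν h ⟨j, l⟩)
      (shiftProd ν h Q a) = _)
    rw [shiftProd, (isDer_xiDer _ _ _).prod_ofFn _ j, shiftProd_update]
    · congr 3
      refine xiDer_fullShift ((isDer_pd k).sub (isDer_pd l)) (fun c => ?_) (a j)
      simp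
    · intro i hi
      rw [xiDer_fullShift (isDer_zero (A := Fin (ν i))) (fun c => ?_), LinearMap.zero_apply, map_zero]
      simp [hi]
  have := DFunLike.congr_fun this y
  rwa [LinearMap.compMultilinearMap_apply, slot_apply] at this

/-- Along an edge between blocks the derivation kills every shifted variable: by `Quiv.sum_ext_edge`
the derivative of its `Ξ`-part is opposite to that of its `Λ`-part. -/
theorem glue_pdSub_edge [CharZero K] (hX : IsPcl x X) (y : ∀ j, VNabla H (ν j)) {e : ι}
    {k l : Fin n} (he : Q.Joins e k l) (hkl : blkIdx ν h k ≠ blkIdx ν h l) :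
    VNabla.pdSub H k l (glue x X Q ν h y) = 0 := by
  by_cases hF : (Q.contract ν h).Acyclic
  · have : (VNabla.pdSub H k l).compMultilinearMap (glue x X Q ν h) = 0 := by
      refine VNabla.multilinear_ext fun a α d u β ha hu => ?_
      have ha := fun j => (ha j).mem_par SPoly.ev_mem_par
      have h0 : xiDer K N (blkIdx ν h) k l (shiftProd ν h Q a) = 0 := by
        refine (isDer_xiDer _ _ _).prod_eq_zero _ fun f hf => ?_
        obtain ⟨i, rfl⟩ := (List.mem_ofFn' _ _).1 hf
        rw [xiDer_fullShift (isDer_zero (A := Fin (ν i))) (fun c => ?_), LinearMap.zero_apply,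
          map_zero]
        rw [Quiv.sum_ext_edge hF he hkl]
        simp
      rw [LinearMap.compMultilinearMap_apply, glue_mk hX, preGlue_pure ha hu, map_zsmul,
        PHom.pdSub_core x X _ _ hX (he.contract hkl).conn, zero_apply]
      change shuffleSign β α • X.core x (Q.contract ν h) (blkIdx ν h)
        (xiDer K N (blkIdx ν h) k l (shiftProd ν h Q a)) _ = 0
      rw [h0, map_zero, LinearMap.zero_apply, smul_zero]
    exact DFunLike.congr_fun this y
  · rw [glue_eq_zero (hX.cycle₁ _ hF), zero_apply, map_zero]

end rules

/-! ### Linear dependence on `X` -/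

theorem PHom.core_add (x : ZMod 2) (X Y : PHom H ι m) (Q : Quiv ι m) (b : Fin n → Fin m) :
    (X + Y).core x Q b = X.core x Q b + Y.core x Q b := by
  have : (X + Y).extend x Q b = X.extend x Q b + Y.extend x Q b :=
    TensorProduct.ext' fun a t => by
      simp only [extend_tmul, LinearMap.add_apply, PHom.at_add, map_add]
  refine LinearMap.ext fun P => LinearMap.ext fun t => ?_
  simp only [core_apply, LinearMap.add_apply, this]

theorem PHom.core_smul (x : ZMod 2) (c : K) (X : PHom H ι m) (Q : Quiv ι m) (b : Fin n → Fin m) :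
    (c • X).core x Q b = c • X.core x Q b := by
  have : (c • X).extend x Q b = c • X.extend x Q b :=
    TensorProduct.ext' fun a t => by
      simp only [extend_tmul, LinearMap.smul_apply, PHom.at_smul, map_smul]
  refine LinearMap.ext fun P => LinearMap.ext fun t => ?_
  simp only [core_apply, LinearMap.smul_apply, this]

theorem glue_add (x : ZMod 2) (X Y : PHom H ι m) (Q : Quiv ι n) (ν : Fin m → ℕ)
    (h : ∑ j, ν j = n) : glue x (X + Y) Q ν h = glue x X Q ν h + glue x Y Q ν h := by
  ext y
  simp only [glue, preGlue, PHom.core_add, LinearMap.comp_add, MultilinearMap.compLinearMap_apply,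
    sum_apply, LinearMap.compMultilinearMap_apply, add_apply, ← Finset.sum_add_distrib]
  refine Finset.sum_congr rfl fun β _ => ?_
  rw [← LinearMap.add_apply]
  congr 1
  exact TensorProduct.ext' fun P w => by simp

theorem glue_smul (x : ZMod 2) (c : K) (X : PHom H ι m) (Q : Quiv ι n) (ν : Fin m → ℕ)
    (h : ∑ j, ν j = n) : glue x (c • X) Q ν h = c • glue x X Q ν h := by
  ext y
  simp only [glue, preGlue, PHom.core_smul, LinearMap.comp_smul, MultilinearMap.compLinearMap_apply,
    sum_apply, LinearMap.compMultilinearMap_apply, smul_apply, Finset.smul_sum]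
  refine Finset.sum_congr rfl fun β _ => ?_
  rw [← LinearMap.smul_apply]
  congr 1
  exact TensorProduct.ext' fun P w => by simp

end glue

theorem multilinear_eq_of_mem_span {K : Type*} [Field K] {m : ℕ} {M : Fin m → Type*} {E : Type*}
    [∀ j, AddCommGroup (M j)] [∀ j, Module K (M j)] [AddCommGroup E] [Module K E]
    {Φ Ψ : MultilinearMap K M E} (S : ∀ j, Set (M j))
    (h : ∀ n, (∀ j, n j ∈ S j) → Φ n = Ψ n) (n : ∀ j, M j)
    (hn : ∀ j, n j ∈ Submodule.span K (S j)) : Φ n = Ψ n := by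
  suffices hs : ∀ s : Finset (Fin m), ∀ n, (∀ j, n j ∈ Submodule.span K (S j)) →
      (∀ j, j ∉ s → n j ∈ S j) → Φ n = Ψ n from hs Finset.univ n hn (by simp)
  intro s
  induction s using Finset.induction_on with
  | empty => exact fun n _ hn => h n fun j => hn j (by simp)
  | insert j s hj ih =>
    intro n hn' hn
    have : ∀ x ∈ Submodule.span K (S j), Φ (Function.update n j x) = Ψ (Function.update n j x) := by
      intro x hx
      induction hx using Submodule.span_induction with
      | mem x hx =>
        refine ih _ (fun i => ?_) fun i hi => ?_
        · by_cases hij : i = j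
          · subst hij; simpa using Submodule.subset_span hx
          · simpa [hij] using hn' i
        · by_cases hij : i = j
          · subst hij; simpa using hx
          · simpa [hij] using hn i (by simp [hij, hi])
      | zero => simp
      | add x y _ _ hx hy => simp [hx, hy]
      | smul c x _ hx => simp [hx]
    simpa using this (n j) (hn' j)

namespace VNabla

variable {K : Type*} [Field K] {N : ℕ} {V : Type*} [AddCommGroup V] [Module K V]
  {H : HWSupermodule K N V} {ι : Type*} {k : ℕ}

/-! ### Elements which are constant along the components of a quiver -/

section components

variable (F : Quiv ι k)

open Classical in
/-- The sum of the `λ_c` over the component of `d`. -/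
def compEv (K : Type*) [Field K] (N : ℕ) (F : Quiv ι k) (d : Fin k) : SPoly K N (Fin k) :=
  ∑ c with F.Conn d c, SPoly.ev c

theorem compEv_mem_par (d : Fin k) : compEv K N F d ∈ SPoly.par 0 :=
  sum_mem fun c _ => SPoly.ev_mem_par c

open Classical in
theorem lmul_compEv (d : Fin k) (y : VNabla H k) :
    lmul H k (compEv K N F d) y = ∑ c with F.Conn d c, lmul H k (SPoly.ev c) y := by
  rw [compEv, map_sum, LinearMap.sum_apply]

open Classical in
/-- The averaging coefficients of the components of a quiver. -/
def avg (K : Type*) [Field K] (F : Quiv ι k) (c d : Fin k) : K :=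
  if F.Conn c d then ((Finset.univ.filter fun e => F.Conn c e).card : K)⁻¹ else 0

theorem avg_symm (c d : Fin k) : avg K F c d = avg K F d c := by
  classical
  rw [avg, avg]
  by_cases h : F.Conn c d
  · rw [if_pos h, if_pos h.symm]
    have : ∀ e, F.Conn c e ↔ F.Conn d e := fun e => ⟨h.symm.trans, h.trans⟩
    simp only [this]
  · rw [if_neg h, if_neg fun h' => h h'.symm]

theorem sum_avg [CharZero K] (c : Fin k) : ∑ d, avg K F c d = 1 := by
  classical
  simp only [avg]
  rw [← Finset.sum_filter, Finset.sum_const, nsmul_eq_mul, mul_inv_cancel₀]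
  exact Nat.cast_ne_zero.2 (Finset.card_ne_zero.2 ⟨c, by simpa using Quiv.Conn.refl c⟩)

variable (H) in
/-- The Euler operator in the differences of the `λ_c` inside the components. -/
def euler : Module.End K (VNabla H k) :=
  ∑ c, ∑ d, avg K F c d • (lmul H k (SPoly.ev c) * pdSub H c d)

open Classical in
theorem sum_avg_lmul (d : Fin k) (y : VNabla H k) :
    ∑ c, avg K F d c • lmul H k (SPoly.ev c) y =
      ((Finset.univ.filter fun e => F.Conn d e).card : K)⁻¹ • lmul H k (compEv K N F d) y := by
  rw [lmul_compEv, Finset.smul_sum, Finset.sum_filter]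
  refine Finset.sum_congr rfl fun c _ => ?_
  rw [avg, ite_smul, zero_smul]

/-- The operator acts as a derivation which sends `λ_e` to `λ_e` minus the mean over its component.
It counts the degree in these differences and treats the component sums as constants. -/
theorem euler_ev [CharZero K] (e : Fin k) (y : VNabla H k) :
    euler H F (lmul H k (SPoly.ev e) y) = lmul H k (SPoly.ev e) (euler H F y) +
      (lmul H k (SPoly.ev e) y - ∑ c, avg K F e c • lmul H k (SPoly.ev c) y) := by
  simp only [euler, LinearMap.sum_apply, LinearMap.smul_apply, Module.End.mul_apply, pdSub_ev,
    map_add, map_sub, smul_add, smul_sub, Finset.sum_add_distrib, Finset.sum_sub_distrib, map_sum,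
    map_smul]
  congr 1
  · refine Finset.sum_congr rfl fun c _ => Finset.sum_congr rfl fun d _ => ?_
    rw [lmul_ev_comm]
  congr 1
  · rw [Finset.sum_eq_single e]
    · simp only [if_true, ← Finset.sum_smul, sum_avg, one_smul]
    · intro c _ hc; simp [hc.symm]
    · simp
  · refine Finset.sum_congr rfl fun c _ => ?_
    rw [Finset.sum_eq_single e]
    · simp [avg_symm F c e]
    · intro d _ hd; simp [hd.symm]
    · simp

theorem euler_od (e : Fin k) (s : Fin N) (y : VNabla H k) :
    euler H F (lmul H k (SPoly.od e s) y) = lmul H k (SPoly.od e s) (euler H F y) := by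
  simp only [euler, LinearMap.sum_apply, LinearMap.smul_apply, Module.End.mul_apply, pdSub_od,
    map_sum, map_smul, lmul_ev_comm]

theorem euler_compEv [CharZero K] (d : Fin k) (y : VNabla H k) :
    euler H F (lmul H k (compEv K N F d) y) = lmul H k (compEv K N F d) (euler H F y) := by
  classical
  rw [lmul_compEv, lmul_compEv, map_sum]
  simp only [euler_ev, Finset.sum_add_distrib, Finset.sum_sub_distrib]
  rw [add_eq_left, sub_eq_zero]
  have : ∀ c ∈ Finset.univ.filter (F.Conn d),
      ∑ e, avg K F c e • lmul H k (SPoly.ev e) y = ∑ e, avg K F d e • lmul H k (SPoly.ev e) y := by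
    intro c hc
    have hc : F.Conn d c := by simpa using hc
    have h1 : ∀ e, F.Conn c e ↔ F.Conn d e := fun e => ⟨hc.trans, hc.symm.trans⟩
    simp only [avg, h1]
  rw [Finset.sum_congr rfl this, sum_avg_lmul, Finset.sum_const, ← lmul_compEv, ← Nat.cast_smul_eq_nsmul K,
    smul_smul, mul_inv_cancel₀, one_smul]
  exact Nat.cast_ne_zero.2 (Finset.card_ne_zero.2 ⟨d, by simpa using Quiv.Conn.refl d⟩)

/-- The span of the products of the odd variables and of the sums of the even variables over the
components of the quiver. -/
def constSub (H : HWSupermodule K N V) (F : Quiv ι k) : Submodule K (VNabla H k) :=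
  Submodule.span K {y | ∃ a p d u q, SPoly.IsMon (compEv K N F) a p d ∧ u ∈ H.par q ∧
    y = mk H k (a ⊗ₜ[K] u)}

theorem compEv_mem (d : Fin k) {y : VNabla H k} (hy : y ∈ constSub H F) :
    lmul H k (compEv K N F d) y ∈ constSub H F := by
  induction hy using Submodule.span_induction with
  | mem y hy =>
    obtain ⟨a, p, d', u, q, ha, hu, rfl⟩ := hy
    rw [lmul_mk]
    exact Submodule.subset_span ⟨_, _, _, u, q, .ev d a p d' ha, hu, rfl⟩
  | zero => simp
  | add x y _ _ hx hy => rw [map_add]; exact add_mem hx hy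
  | smul c x _ hx => rw [map_smul]; exact Submodule.smul_mem _ _ hx

theorem od_mem (e : Fin k) (s : Fin N) {y : VNabla H k} (hy : y ∈ constSub H F) :
    lmul H k (SPoly.od e s) y ∈ constSub H F := by
  induction hy using Submodule.span_induction with
  | mem y hy =>
    obtain ⟨a, p, d', u, q, ha, hu, rfl⟩ := hy
    rw [lmul_mk]
    exact Submodule.subset_span ⟨_, _, _, u, q, .od e s a p d' ha, hu, rfl⟩
  | zero => simp
  | add x y _ _ hx hy => rw [map_add]; exact add_mem hx hy
  | smul c x _ hx => rw [map_smul]; exact Submodule.smul_mem _ _ hx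

/-- The operator commutes with component sums and with odd variables, and it kills `1 ⊗ u`. -/
theorem constSub_le [CharZero K] {y : VNabla H k} (hy : y ∈ constSub H F) : euler H F y = 0 := by
  have key : ∀ (a : SPoly K N (Fin k)) p d, SPoly.IsMon (compEv K N F) a p d → ∀ u : V,
      euler H F (mk H k (a ⊗ₜ[K] u)) = 0 := by
    intro a p d ha u
    induction ha with
    | one => simp [euler, pdSub_mk, SPoly.pd_one]
    | ev e a p d _ ih => rw [← lmul_mk, euler_compEv, ih, map_zero]
    | od e s a p d _ ih => rw [← lmul_mk, euler_od, ih, map_zero]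
  induction hy using Submodule.span_induction with
  | mem y hy =>
    obtain ⟨a, p, d', u, q, ha, hu, rfl⟩ := hy
    exact key a p d' ha u
  | zero => simp
  | add x y _ _ hx hy => rw [map_add, hx, hy, add_zero]
  | smul c x _ hx => rw [map_smul, hx, smul_zero]

/-- Each `λ_e` is a difference from the mean plus the mean. The first raises the eigenvalue by one,
while the second and the odd variables preserve it, so every product of generators splits into a
part in `constSub` and eigenvectors with positive integral eigenvalues. -/
theorem mem_constSub_sup [CharZero K] (y : VNabla H k) :
    y ∈ constSub H F ⊔ ⨆ d : ℕ, Module.End.eigenspace (euler H F) ((d : K) + 1) := by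
  classical
  obtain ⟨U, hU, hU'⟩ : ∃ U : Submodule K (VNabla H k),
      (∀ d : ℕ, Module.End.eigenspace (euler H F) ((d : K) + 1) ≤ U) ∧
      U = ⨆ d : ℕ, Module.End.eigenspace (euler H F) ((d : K) + 1) :=
    ⟨_, fun d => le_iSup (fun d : ℕ => Module.End.eigenspace (euler H F) ((d : K) + 1)) d, rfl⟩
  have hle : ∀ f : Module.End K (VNabla H k), (∀ (d : ℕ) z, euler H F z = ((d : K) + 1) • z →
      f z ∈ U) → ∀ z ∈ U, f z ∈ U := by
    intro f hf z hz
    rw [hU'] at hz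
    refine (iSup_le fun d z hz => hf d z ?_ :
      (⨆ d : ℕ, Module.End.eigenspace (euler H F) ((d : K) + 1)) ≤ U.comap f) hz
    exact Module.End.mem_eigenspace_iff.1 hz
  rw [← hU']
  have hC : ∀ e z, z ∈ U → lmul H k (compEv K N F e) z ∈ U := by
    refine fun e => hle _ fun d z hz => hU d (Module.End.mem_eigenspace_iff.2 ?_)
    rw [euler_compEv, hz, map_smul]
  have hO : ∀ e s z, z ∈ U → lmul H k (SPoly.od e s) z ∈ U := by
    refine fun e s => hle _ fun d z hz => hU d (Module.End.mem_eigenspace_iff.2 ?_)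
    rw [euler_od, hz, map_smul]
  -- Multiplication by `λ_e` minus the mean of its component.
  let D : Fin k → Module.End K (VNabla H k) := fun e => lmul H k (SPoly.ev e) -
    ((Finset.univ.filter fun c => F.Conn e c).card : K)⁻¹ • lmul H k (compEv K N F e)
  have hD : ∀ e z, euler H F (D e z) = D e (euler H F z) + D e z := by
    intro e z
    simp only [D, LinearMap.sub_apply, LinearMap.smul_apply, map_sub, map_smul, euler_compEv,
      euler_ev, sum_avg_lmul]
    abel
  have hDU : ∀ e z, z ∈ U → D e z ∈ U := by
    refine fun e => hle _ fun d z hz => hU (d + 1) (Module.End.mem_eigenspace_iff.2 ?_)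
    rw [hD, hz, map_smul, Nat.cast_add, Nat.cast_one]
    simp only [add_smul, one_smul]
  have hD0 : ∀ e {z}, z ∈ constSub H F → D e z ∈ U := by
    intro e z hz
    refine hU 0 (Module.End.mem_eigenspace_iff.2 ?_)
    rw [hD, constSub_le F hz, map_zero]
    simp
  have hev : ∀ e {z}, z ∈ constSub H F ⊔ U → lmul H k (SPoly.ev e) z ∈ constSub H F ⊔ U := by
    intro e z hz
    have h1 : lmul H k (SPoly.ev e) z = D e z + ((Finset.univ.filter fun c => F.Conn e c).card : K)⁻¹ •
        lmul H k (compEv K N F e) z := by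
      simp [D]
    rw [h1]
    obtain ⟨w, hw, u, hu, rfl⟩ := Submodule.mem_sup.1 hz
    rw [map_add, map_add]
    exact add_mem (add_mem (Submodule.mem_sup_right (hD0 e hw)) (Submodule.mem_sup_right (hDU e u hu)))
      (Submodule.smul_mem _ _ (add_mem (Submodule.mem_sup_left (compEv_mem F e hw))
        (Submodule.mem_sup_right (hC e u hu))))
  have hod : ∀ e s {z}, z ∈ constSub H F ⊔ U → lmul H k (SPoly.od e s) z ∈ constSub H F ⊔ U := by
    intro e s z hz
    obtain ⟨w, hw, u, hu, rfl⟩ := Submodule.mem_sup.1 hz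
    rw [map_add]
    exact add_mem (Submodule.mem_sup_left (od_mem F e s hw)) (Submodule.mem_sup_right (hO e s u hu))
  have hy : y ∈ Submodule.span K {y : VNabla H k | ∃ a p d u q,
      SPoly.IsMon SPoly.ev a p d ∧ u ∈ H.par q ∧ y = mk H k (a ⊗ₜ[K] u)} := by
    rw [span_mk_mon]; trivial
  induction hy using Submodule.span_induction with
  | mem y hy =>
    obtain ⟨a, p, d, u, q, ha, hu, rfl⟩ := hy
    induction ha with
    | one => exact Submodule.mem_sup_left (Submodule.subset_span ⟨1, 0, 0, u, q, .one, hu, rfl⟩)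
    | ev e a p d _ ih => rw [← lmul_mk]; exact hev e ih
    | od e s a p d _ ih => rw [← lmul_mk]; exact hod e s ih
  | zero => simp
  | add x y _ _ hx hy => exact add_mem hx hy
  | smul c x _ hx => exact Submodule.smul_mem _ _ hx

/-- An element whose derivatives inside the components coincide depends only on the sums of the even
variables over the components. -/
theorem mem_constSub [CharZero K] {y : VNabla H k}
    (hy : ∀ c d, F.Conn c d → pdSub H c d y = 0) : y ∈ constSub H F := by
  have h0 : euler H F y = 0 := by
    simp only [euler, LinearMap.sum_apply, LinearMap.smul_apply, Module.End.mul_apply]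
    refine Finset.sum_eq_zero fun c _ => Finset.sum_eq_zero fun d _ => ?_
    by_cases h : F.Conn c d
    · rw [hy c d h]; simp
    · rw [avg, if_neg h, zero_smul]
  obtain ⟨w, hw, u, hu, rfl⟩ := Submodule.mem_sup.1 (mem_constSub_sup F y)
  rw [map_add, constSub_le F hw, zero_add] at h0
  -- In characteristic zero the eigenvalues `d + 1` differ from `0`. By independence of eigenspaces,
  -- the part `u`, which is itself annihilated, vanishes.
  have h1 := Module.End.eigenspaces_iSupIndep (euler H F) 0
  have h2 : u ∈ ⨆ (μ : K) (_ : μ ≠ 0), Module.End.eigenspace (euler H F) μ := by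
    refine (iSup_le fun d => ?_ : (⨆ d : ℕ, Module.End.eigenspace (euler H F) ((d : K) + 1)) ≤ _) hu
    exact le_iSup₂_of_le ((d : K) + 1) (Nat.cast_add_one_ne_zero d) le_rfl
  have h3 : u ∈ Module.End.eigenspace (euler H F) 0 := by
    rw [Module.End.mem_eigenspace_iff, h0, zero_smul]
  rw [(Submodule.disjoint_def.1 h1) u h3 h2, add_zero]
  exact hw

end components

end VNabla

section composite

variable {K : Type*} [Field K] {N : ℕ} {V : Type*} [AddCommGroup V] [Module K V]
  {H : HWSupermodule K N V} {ι : Type*} {m n : ℕ}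

/-! ### Homomorphisms given by families -/

namespace PHom

/-- The map with given components `X^Q`. -/
def ofAt (F : Quiv ι n → (⨂[K] _ : Fin n, V) →ₗ[K] VNabla H n) : PHom H ι n :=
  TensorProduct.lift (LinearMap.flip (Finsupp.linearCombination K F))

theorem ofAt_at (F : Quiv ι n → (⨂[K] _ : Fin n, V) →ₗ[K] VNabla H n) (Q : Quiv ι n) :
    (ofAt F).at Q = F Q := by
  refine LinearMap.ext fun t => ?_
  simp [PHom.at, ofAt]

theorem ext_at {X Y : PHom H ι n} (h : ∀ Q, X.at Q = Y.at Q) : X = Y := by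
  refine TensorProduct.ext (LinearMap.ext fun t => Finsupp.lhom_ext' fun Q => LinearMap.ext_ring ?_)
  exact LinearMap.congr_fun (h Q) t

/-- Maps which agree on homogeneous pure tensors are equal. -/
theorem ext_hom {X Y : PHom H ι n} (h : ∀ Q (v : Fin n → V) (p : Fin n → ZMod 2),
    (∀ i, v i ∈ H.par (p i)) → X.at Q (PiTensorProduct.tprod K v) =
      Y.at Q (PiTensorProduct.tprod K v)) : X = Y :=
  ext_at fun Q => H.tensor_ext fun v p hv => h Q v p hv

end PHom

/-- The powers of the parity involution of `V^{⊗n}`. -/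
def HWSupermodule.epsPow (H : HWSupermodule K N V) (n : ℕ) (e : ZMod 2) :
    Module.End K (⨂[K] _ : Fin n, V) :=
  if e = 0 then LinearMap.id else H.epsTensor n

theorem HWSupermodule.epsPow_of_mem (e : ZMod 2) {v : Fin n → V} {p : Fin n → ZMod 2}
    (hv : ∀ i, v i ∈ H.par (p i)) : H.epsPow n e (PiTensorProduct.tprod K v) =
      sg (e * ∑ i, p i) • PiTensorProduct.tprod K v := by
  have h2 : ∀ q : ZMod 2, q = 0 ∨ q = 1 := by decide
  rcases h2 e with rfl | rfl
  · simp [epsPow, sg_zero]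
  · simpa [epsPow] using H.epsTensor_of_mem hv

/-- The sum of the parities after the `j`-th one. -/
def tailPar (y : Fin m → ZMod 2) (j : Fin m) : ZMod 2 := ∑ i, if j < i then y i else 0

/-- Grouped by the `w_j`, the sign is a power of the parity involution on each `w_j` with exponent
depending on the `Y_i` only; this makes it linear in the arguments. -/
theorem shuffleExp_eq_tailPar (p y : Fin m → ZMod 2) :
    shuffleExp p y = ∑ j, tailPar y j * p j := by
  refine Finset.sum_congr rfl fun j _ => ?_
  rw [tailPar, Finset.sum_mul]
  exact Finset.sum_congr rfl fun i _ => by split_ifs <;> ring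

/-- The composite `X ∘ (Y₁ ⊙ ⋯ ⊙ Yₘ)` of maps of parity `x` and `y_j`. -/
def PHom.composite (ν : Fin m → ℕ) (h : ∑ j, ν j = n) (x : ZMod 2) (X : PHom H ι m)
    (y : Fin m → ZMod 2) (Y : ∀ j, PHom H ι (ν j)) : PHom H ι n :=
  PHom.ofAt fun Q => PiTensorProduct.lift (nest ν h (glue x X Q ν h) fun j =>
    -- The Koszul sign of moving the later `Y_i` past `w_j`.
    ((Y j).at (Q.sub ν h j) ∘ₗ H.epsPow (ν j) (tailPar y j)).compMultilinearMap
      (PiTensorProduct.tprod K))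

section

variable {ν : Fin m → ℕ} {h : ∑ j, ν j = n} {x : ZMod 2} {X : PHom H ι m} {y : Fin m → ZMod 2}
  {Y : ∀ j, PHom H ι (ν j)}

theorem PHom.composite_at (Q : Quiv ι n) {v : Fin n → V} {p : Fin n → ZMod 2}
    (hv : ∀ i, v i ∈ H.par (p i)) :
    (X.composite ν h x y Y).at Q (PiTensorProduct.tprod K v) =
      shuffleSign (fun j => ∑ k, p (blk ν h ⟨j, k⟩)) y • glue x X Q ν h (fun j =>
        (Y j).at (Q.sub ν h j) (PiTensorProduct.tprod K fun k => v (blk ν h ⟨j, k⟩))) := by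
  rw [composite, ofAt_at, PiTensorProduct.lift.tprod, nest_apply]
  simp only [LinearMap.compMultilinearMap_apply, LinearMap.comp_apply,
    H.epsPow_of_mem _ (fun k => hv (blk ν h ⟨_, k⟩)), map_zsmul]
  rw [map_sg_smul_univ, shuffleSign_eq, shuffleExp_eq_tailPar]

/-- The presentation of the values of `Y_j` without the last variables is one choice of
representatives; expanding by multilinearity gives the required formula. -/
theorem PHom.isComposite_composite (hX : IsPcl x X) :
    IsComposite ν h x X y Y (X.composite ν h x y Y) := by
  intro Q p v r α β a u hv ha hu hY
  rw [composite_at Q hv]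
  congr 1
  simp only [hY, map_sum, VNabla.ofReduced_tmul]
  rw [MultilinearMap.map_sum]
  refine Finset.sum_congr rfl fun s _ => ?_
  rw [glue_mk hX, preGlue_of_mem x X Q ν h (fun j => SPoly.linSubst_mem_par _ (ha j (s j)))
    fun j => hu j (s j)]
  simp only [fullShift_incl]
  rfl

/-! ### The composite satisfies the sesquilinearity conditions -/

/-- The arguments of the gluing map in a composite. -/
def PHom.inner (Y : ∀ j, PHom H ι (ν j)) (h : ∑ j, ν j = n) (Q : Quiv ι n) (v : Fin n → V) (j : Fin m) :
    VNabla H (ν j) :=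
  (Y j).at (Q.sub ν h j) (PiTensorProduct.tprod K fun k => v (blk ν h ⟨j, k⟩))

theorem PHom.inner_update (Q : Quiv ι n) (v : Fin n → V) (j : Fin m) (k : Fin (ν j)) (w : V) :
    PHom.inner Y h Q (Function.update v (blk ν h ⟨j, k⟩) w) = Function.update (PHom.inner Y h Q v) j
      ((Y j).at (Q.sub ν h j)
        (PiTensorProduct.tprod K (Function.update (fun k => v (blk ν h ⟨j, k⟩)) k w))) :=
  blocks_update ν h (fun j w => (Y j).at (Q.sub ν h j) (PiTensorProduct.tprod K w)) v j k w

theorem PHom.inner_mem (h : ∑ j, ν j = n) (hY : ∀ j, IsPcl (y j) (Y j)) (Q : Quiv ι n) {v : Fin n → V}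
    {p : Fin n → ZMod 2} (hv : ∀ i, v i ∈ H.par (p i)) (j : Fin m) :
    PHom.inner Y h Q v j ∈ VNabla.par H (ν j) (y j + ∑ k, p (blk ν h ⟨j, k⟩)) :=
  (hY j).parity _ _ _ fun _ => hv _

variable [CharZero K]

theorem IsPcl.composite_parity (hX : IsPcl x X) (hY : ∀ j, IsPcl (y j) (Y j)) (Q : Quiv ι n)
    (p : Fin n → ZMod 2) (v : Fin n → V) (hv : ∀ i, v i ∈ H.par (p i)) :
    (X.composite ν h x y Y).at Q (PiTensorProduct.tprod K v) ∈
      VNabla.par H n (x + ∑ j, y j + ∑ i, p i) := by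
  rw [PHom.composite_at Q hv]
  refine zsmul_mem ?_ _
  have := glue_mem (h := h) (Q := Q) hX (PHom.inner_mem h hY Q hv)
  rwa [Finset.sum_add_distrib, ← sum_blk p, ← add_assoc] at this

omit [CharZero K] in
theorem IsPcl.composite_cycle₁ (hX : IsPcl x X) (hY : ∀ j, IsPcl (y j) (Y j)) (Q : Quiv ι n)
    (hQ : ¬Q.Acyclic) : (X.composite ν h x y Y).at Q = 0 := by
  refine H.tensor_ext fun v p hv => ?_
  rw [PHom.composite_at Q hv, LinearMap.zero_apply]
  by_cases h0 : (Q.contract ν h).Acyclic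
  · obtain ⟨j, hj⟩ : ∃ j, ¬(Q.sub ν h j).Acyclic := by
      by_contra hc
      push Not at hc
      exact hQ (Quiv.acyclic_of_blocks h0 hc)
    rw [MultilinearMap.map_coord_zero _ j, smul_zero]
    rw [(hY j).cycle₁ _ hj, LinearMap.zero_apply]
  · rw [glue_eq_zero (hX.cycle₁ _ h0), zero_apply, smul_zero]

/-- The differences of derivatives add up along a path, so a single edge suffices. Inside a block
the condition on `Y_j` applies, between blocks `glue_pdSub_edge`. -/
theorem IsPcl.composite_sesq₁ (hX : IsPcl x X) (hY : ∀ j, IsPcl (y j) (Y j)) (Q : Quiv ι n)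
    (k l : Fin n) (hkl : Q.Conn k l) (t) :
    VNabla.pdSub H k l ((X.composite ν h x y Y).at Q t) = 0 := by
  have hedge : ∀ (e : ι) (k l : Fin n), Q.Joins e k l → ∀ v : Fin n → V,
      VNabla.pdSub H k l (glue x X Q ν h (PHom.inner Y h Q v)) = 0 := by
    intro e k l he v
    by_cases hkl : blkIdx ν h k = blkIdx ν h l
    · obtain ⟨⟨j, k⟩, rfl⟩ := (blk ν h).surjective k
      rw [blkIdx_blk] at hkl
      obtain ⟨l, rfl⟩ := exists_blk_of_eq hkl.symm
      rw [glue_pdSub_block hX, PHom.inner, (hY j).sesq₁ _ _ _ (Quiv.sub_joins.2 he).conn,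
        MultilinearMap.map_update_zero]
    · exact glue_pdSub_edge hX _ he hkl
  refine LinearMap.congr_fun (f := VNabla.pdSub H k l ∘ₗ (X.composite ν h x y Y).at Q) (g := 0)
    (H.tensor_ext fun v p hv => ?_) t
  rw [LinearMap.comp_apply, PHom.composite_at Q hv, map_zsmul, LinearMap.zero_apply]
  obtain ⟨L, hL⟩ := hkl
  suffices hs : VNabla.pdSub H k l (glue x X Q ν h (PHom.inner Y h Q v)) = 0 from
    (congrArg _ hs).trans (smul_zero _)
  induction L generalizing k with
  | nil => obtain rfl : k = l := hL; exact VNabla.pdSub_self H k _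
  | cons e L ih =>
    obtain ⟨c, h1, h2⟩ := hL
    rw [← VNabla.pdSub_add H k c l, hedge e k c h1, ih c h2, add_zero]

omit [CharZero K] in
open Classical in
-- A component of `Q` meets a block in a union of components of the block, so the condition is
-- needed for such unions. Components are split off one at a time.
theorem IsPcl.sum_Tat {x : ZMod 2} {X : PHom H ι n} (hX : IsPcl x X) (Q : Quiv ι n)
    (P : Fin n → Prop) (hP : ∀ k l, Q.Conn k l → P k → P l) (t) :
    ∑ l with P l, X.at Q (H.Tat l t) =
      -∑ l with P l, VNabla.lmul H n (SPoly.ev l) (X.at Q t) := by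
  suffices hs : ∀ s : Finset (Fin n), (∀ k l, Q.Conn k l → k ∈ s → l ∈ s) →
      ∑ l ∈ s, (X.at Q (H.Tat l t) + VNabla.lmul H n (SPoly.ev l) (X.at Q t)) = 0 by
    have := hs (Finset.univ.filter P) (by simpa using hP)
    rwa [Finset.sum_add_distrib, ← eq_neg_iff_add_eq_zero] at this
  intro s
  induction hs : s.card using Nat.strong_induction_on generalizing s with
  | _ c ih =>
    intro hcl
    rcases s.eq_empty_or_nonempty with rfl | ⟨k, hk⟩
    · simp
    · have hsub : Finset.univ.filter (Q.Conn k) ⊆ s := by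
        intro l hl
        exact hcl k l (by simpa using hl) hk
      rw [← Finset.sum_sdiff hsub, Finset.sum_add_distrib (s := Finset.univ.filter (Q.Conn k)),
        hX.sesq₂ Q k t, neg_add_cancel, add_zero]
      refine ih _ ?_ _ rfl fun a b hab ha => ?_
      · rw [← hs]
        refine Finset.card_lt_card (Finset.ssubset_iff_subset_ne.2 ⟨Finset.sdiff_subset, fun hc => ?_⟩)
        rw [← hc] at hk
        simp at hk
        exact hk.2 (Quiv.Conn.refl k)
      · simp only [Finset.mem_sdiff, Finset.mem_filter, Finset.mem_univ, true_and] at ha ⊢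
        exact ⟨hcl a b hab ha.1, fun hb => ha.2 (hb.trans hab.symm)⟩

omit [CharZero K] in
open Classical in
theorem sum_ext_glueXi (hX : IsPcl x X) (Q : Quiv ι n) (g : ∀ j, VNabla H (ν j)) (a : Fin n) :
    ∑ b with Q.Conn a b, ∑ i ∈ Q.extSet ν h b, glueXi x X Q ν h i g = 0 := by
  by_cases hF : (Q.contract ν h).Acyclic
  · exact Quiv.sum_ext_conn hF (fun i => glueXi x X Q ν h i g) (fun i => sum_glueXi hX i g) a
  · simp [glueXi_apply, glue_eq_zero (hX.cycle₁ _ hF)]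

omit [CharZero K] in
-- In each block `Y_j` turns the `T^{(l)}` into `-λ_l`, and gluing replaces `λ_l` by `λ_l` plus
-- insertions of the `Ξ_i`. The insertions cancel over a component of `Q` by `sum_ext_glueXi`.
theorem IsPcl.composite_sesq₂ (hX : IsPcl x X) (hY : ∀ j, IsPcl (y j) (Y j)) (Q : Quiv ι n)
    (k : Fin n) (t : ⨂[K] _ : Fin n, V) : ∀ [DecidablePred (Q.Conn k)],
    ∑ l with Q.Conn k l, (X.composite ν h x y Y).at Q (H.Tat l t) =
      -∑ l with Q.Conn k l, VNabla.lmul H n (SPoly.ev l) ((X.composite ν h x y Y).at Q t) := by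
  intro _
  have := LinearMap.congr_fun
    (f := ∑ l with Q.Conn k l, (X.composite ν h x y Y).at Q ∘ₗ H.Tat l)
    (g := -∑ l with Q.Conn k l, VNabla.lmul H n (SPoly.ev l) ∘ₗ (X.composite ν h x y Y).at Q)
    (H.tensor_ext fun v p hv => ?_) t
  · simpa only [LinearMap.sum_apply, LinearMap.neg_apply, LinearMap.comp_apply] using this
  simp only [LinearMap.sum_apply, LinearMap.neg_apply, LinearMap.comp_apply, H.Tat_tprod,
    PHom.composite_at Q hv, PHom.composite_at Q (H.update_T_mem hv _), map_zsmul]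
  rw [← Finset.smul_sum, ← Finset.smul_sum, ← smul_neg]
  congr 1
  have key : ∀ j : Fin m, ∑ c with Q.Conn k (blk ν h ⟨j, c⟩), glue x X Q ν h (PHom.inner Y h Q
      (Function.update v (blk ν h ⟨j, c⟩) (H.T (v (blk ν h ⟨j, c⟩))))) =
      -∑ c with Q.Conn k (blk ν h ⟨j, c⟩), (VNabla.lmul H n (SPoly.ev (blk ν h ⟨j, c⟩))
        (glue x X Q ν h (PHom.inner Y h Q v)) +
        ∑ i ∈ Q.extSet ν h (blk ν h ⟨j, c⟩), glueXi x X Q ν h i (PHom.inner Y h Q v)) := by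
    intro j
    have h1 : ∀ c, H.Tat c (PiTensorProduct.tprod K fun k => v (blk ν h ⟨j, k⟩)) =
        PiTensorProduct.tprod K (Function.update (fun k => v (blk ν h ⟨j, k⟩)) c
          (H.T (v (blk ν h ⟨j, c⟩)))) := fun c => H.Tat_tprod _ _
    simp only [PHom.inner_update, ← h1]
    have h2 := (hY j).sum_Tat (Q.sub ν h j) (fun c => Q.Conn k (blk ν h ⟨j, c⟩))
      (fun a b hab ha => ha.trans hab.of_sub) (PiTensorProduct.tprod K fun k => v (blk ν h ⟨j, k⟩))
    rw [← MultilinearMap.map_update_sum]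
    have h3 : ∑ c with Q.Conn k (blk ν h ⟨j, c⟩), (Y j).at (Q.sub ν h j)
        (H.Tat c (PiTensorProduct.tprod K fun k => v (blk ν h ⟨j, k⟩))) =
        -∑ c with Q.Conn k (blk ν h ⟨j, c⟩), VNabla.lmul H (ν j) (SPoly.ev c)
          (PHom.inner Y h Q v j) := by
      convert h2; rfl
    rw [h3, map_update_neg, MultilinearMap.map_update_sum]
    simp only [glue_ev hX]
  simp only [Finset.sum_filter] at key ⊢
  rw [sum_blk (ν := ν) (h := h)]
  refine (Finset.sum_congr rfl fun j _ => key j).trans ?_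
  rw [Finset.sum_neg_distrib, ← sum_blk (ν := ν) (h := h) fun a => if Q.Conn k a then
    VNabla.lmul H n (SPoly.ev a) (glue x X Q ν h (PHom.inner Y h Q v)) +
        ∑ i ∈ Q.extSet ν h a, glueXi x X Q ν h i (PHom.inner Y h Q v) else 0,
    ← Finset.sum_filter, Finset.sum_add_distrib, ← Finset.sum_filter]
  have h4 := sum_ext_glueXi (h := h) hX Q (PHom.inner Y h Q v) k
  have h5 : ∑ b with Q.Conn k b, ∑ i ∈ Q.extSet ν h b, glueXi x X Q ν h i (PHom.inner Y h Q v) = 0 := by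
    convert h4
  rw [h5, add_zero]
  rfl

omit [CharZero K] in
theorem sum_lt_blk {M : Type*} [AddCommMonoid M] (p : Fin n → M) (j : Fin m) (c : Fin (ν j)) :
    (∑ l, if l < blk ν h ⟨j, c⟩ then p l else 0) =
      (∑ j', if j' < j then ∑ c', p (blk ν h ⟨j', c'⟩) else 0) +
        ∑ c', if c' < c then p (blk ν h ⟨j, c'⟩) else 0 := by
  rw [sum_blk (ν := ν) (h := h), ← Finset.add_sum_erase _ _ (Finset.mem_univ j),
    ← Finset.add_sum_erase _ (fun j' => if j' < j then ∑ c', p (blk ν h ⟨j', c'⟩) else 0)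
      (Finset.mem_univ j)]
  simp only [blk_lt_iff, lt_irrefl, false_or, true_and, if_false, zero_add, Fin.val_fin_lt]
  rw [add_comm]
  congr 1
  refine Finset.sum_congr rfl fun j' hj' => ?_
  have : j' ≠ j := Finset.ne_of_mem_erase hj'
  by_cases hlt : j' < j <;> simp [this, hlt]

/-- Only signs matter, because gluing does not shift odd variables: they come from moving `S^i` past
the `v`, `θ` past `X` and the earlier arguments, and the changed parity of one `v` past the later
`Y`. -/
theorem IsPcl.composite_sesq₃ (hX : IsPcl x X) (hY : ∀ j, IsPcl (y j) (Y j)) (Q : Quiv ι n)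
    (k : Fin n) (s : Fin N) (t : ⨂[K] _ : Fin n, V) :
    (X.composite ν h x y Y).at Q (H.Sat s k t) = -(sg (x + ∑ j, y j) •
      VNabla.lmul H n (SPoly.od k s) ((X.composite ν h x y Y).at Q t)) := by
  have := LinearMap.congr_fun (f := (X.composite ν h x y Y).at Q ∘ₗ H.Sat s k)
    (g := -(sg (x + ∑ j, y j) • VNabla.lmul H n (SPoly.od k s) ∘ₗ (X.composite ν h x y Y).at Q))
    (H.tensor_ext fun v p hv => ?_) t
  · simpa only [LinearMap.smul_apply, LinearMap.neg_apply, LinearMap.comp_apply] using this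
  obtain ⟨⟨j, c⟩, rfl⟩ := (blk ν h).surjective k
  simp only [LinearMap.smul_apply, LinearMap.neg_apply, LinearMap.comp_apply]
  rw [H.Sat_of_mem _ _ hv, map_zsmul, PHom.composite_at Q (H.update_S_mem hv _ _),
    PHom.composite_at Q hv]
  have h1 := H.Sat_of_mem s c (fun k => hv (blk ν h ⟨j, k⟩))
  have h2 := congrArg ((Y j).at (Q.sub ν h j)) h1
  rw [(hY j).sesq₃, map_zsmul] at h2
  have h3 := congrArg (fun z => sg (∑ l, if l < c then p (blk ν h ⟨j, l⟩) else 0) • z) h2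
  simp only [sg_smul_self] at h3
  have h4 := PHom.inner_update (h := h) (Y := Y) Q v j c (H.S s (v (blk ν h ⟨j, c⟩)))
  rw [← h3] at h4
  have h5 : glue x X Q ν h (PHom.inner Y h Q
      (Function.update v (blk ν h ⟨j, c⟩) (H.S s (v (blk ν h ⟨j, c⟩))))) =
      -(sg ((∑ l, if l < c then p (blk ν h ⟨j, l⟩) else 0) + y j +
        (x + ∑ i, if i < j then y i + ∑ k, p (blk ν h ⟨i, k⟩) else 0)) •
        VNabla.lmul H n (SPoly.od (blk ν h ⟨j, c⟩) s) (glue x X Q ν h (PHom.inner Y h Q v))) := by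
    rw [h4, smul_neg, map_update_neg, map_update_zsmul, map_update_zsmul]
    have := glue_od (h := h) (Q := Q) hX (PHom.inner_mem h hY Q hv) j c s
    rw [PHom.inner] at this
    rw [this, sg_smul_smul, sg_smul_smul]
  refine (congrArg (fun z => _ • _ • z) h5).trans ?_
  have h6 : (fun j' => ∑ k, Function.update p (blk ν h ⟨j, c⟩) (p (blk ν h ⟨j, c⟩) + 1)
      (blk ν h ⟨j', k⟩)) = Function.update (fun j' => ∑ k, p (blk ν h ⟨j', k⟩)) j
        (∑ k, p (blk ν h ⟨j, k⟩) + 1) := by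
    rw [blocks_update ν h (M := fun _ => ZMod 2) (L := fun _ => ZMod 2) (fun j p => ∑ k, p k) p]
    congr 1
    rw [Finset.sum_update_of_mem (Finset.mem_univ c), ← Finset.add_sum_erase _ _ (Finset.mem_univ c),
      Finset.sdiff_singleton_eq_erase]
    ring
  rw [h6, shuffleSign_eq, shuffleSign_eq, shuffleExp_update_left, sum_lt_blk (ν := ν) (h := h)]
  simp only [smul_neg, map_zsmul, sg_smul_smul]
  congr 3
  have h7 : ∀ i, (if i < j then y i + ∑ k, p (blk ν h ⟨i, k⟩) else 0) = (if i < j then y i else 0) +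
      if i < j then ∑ k, p (blk ν h ⟨i, k⟩) else 0 := by intro i; split_ifs <;> simp
  simp only [h7, Finset.sum_add_distrib, sum_split_at y j]
  have h8 := add_self_zmod (∑ i, if i < j then ∑ k, p (blk ν h ⟨i, k⟩) else 0)
  have h9 := add_self_zmod (∑ l, if l < c then p (blk ν h ⟨j, l⟩) else 0)
  linear_combination h8 + h9

end

end composite

/-! ### The cycle relation for composites. -/

section cycle

variable {K : Type*} [Field K] {N : ℕ} {V : Type*} [AddCommGroup V] [Module K V]
  {H : HWSupermodule K N V} {ι : Type*} {m n : ℕ} {ν : Fin m → ℕ} {h : ∑ j, ν j = n} {x : ZMod 2}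
  {X : PHom H ι m} {y : Fin m → ZMod 2} {Y : ∀ j, PHom H ι (ν j)}

/-- The quiver enters the gluing map only through its contraction and its external connections, in
particular not through the edges inside blocks. -/
theorem glue_congr {Q Q' : Quiv ι n} (hQ : Q.contract ν h = Q'.contract ν h)
    (hE : ∀ i a, Q.ExtConn ν h i a ↔ Q'.ExtConn ν h i a) : glue x X Q ν h = glue x X Q' ν h := by
  have hs : ∀ j, fullShift K N ν h Q j = fullShift K N ν h Q' j := by
    intro j
    have : ∀ a, Q.extSet ν h a = Q'.extSet ν h a := fun a => Finset.ext fun i => by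
      rw [Quiv.mem_extSet, Quiv.mem_extSet, hE]
    exact SPoly.algHom_ext (fun k => by simp only [fullShift_ev, this])
      fun k s => by simp only [fullShift_od, this]
  simp only [glue, preGlue, hs, hQ]

theorem glue_del {Q : Quiv ι n} {α : ι} (hα : (Q.contract ν h).arrow α = none) :
    glue x X (Q.del α) ν h = glue x X Q ν h :=
  glue_congr (by rw [Quiv.contract_del, Quiv.del_eq_self hα]) (Quiv.extConn_del hα)

theorem Quiv.sub_del_of_contract {Q : Quiv ι n} {α : ι} (hα : (Q.contract ν h).arrow α ≠ none)
    (j : Fin m) : (Q.del α).sub ν h j = Q.sub ν h j := by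
  rw [Quiv.sub_del, Quiv.del_eq_self]
  by_contra hne
  obtain ⟨⟨a, b⟩, hab⟩ := Option.ne_none_iff_exists'.1 hne
  have h1 := Quiv.sub_arrow_eq_some.1 hab
  exact hα (by rw [Quiv.contract_arrow_of_some h1]; simp)

theorem Quiv.sub_del_of_ne {Q : Quiv ι n} {α : ι} {i j : Fin m} (hij : i ≠ j)
    (hα : (Q.sub ν h j).arrow α ≠ none) : (Q.del α).sub ν h i = Q.sub ν h i := by
  rw [Quiv.sub_del, Quiv.del_eq_self]
  by_contra hne
  obtain ⟨⟨a, b⟩, hab⟩ := Option.ne_none_iff_exists'.1 hne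
  obtain ⟨⟨a', b'⟩, hab'⟩ := Option.ne_none_iff_exists'.1 hα
  have h1 := Quiv.sub_arrow_eq_some.1 hab
  have h2 := Quiv.sub_arrow_eq_some.1 hab'
  rw [h1] at h2
  simp only [Option.some.injEq, Prod.mk.injEq] at h2
  have := congrArg (blkIdx ν h) h2.1
  rw [blkIdx_blk, blkIdx_blk] at this
  exact hij this

theorem Quiv.IsDirPath.arrow_ne_none {Q : Quiv ι n} {a b : Fin n} {L : List ι}
    (hp : Q.IsDirPath a L b) {e : ι} (he : e ∈ L) : Q.arrow e ≠ none := by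
  induction L generalizing a with
  | nil => cases he
  | cons e' L ih =>
    obtain ⟨c, h1, h2⟩ := hp
    rcases List.mem_cons.1 he with rfl | he
    · rw [h1]; simp
    · exact ih h2 he

theorem Quiv.IsDirCycle.not_acyclic {Q : Quiv ι n} {L : List ι} (hL : Q.IsDirCycle L) :
    ¬Q.Acyclic := by
  obtain ⟨h1, h2, a, h3⟩ := hL
  exact fun hQ => hQ a L h1 h2 h3.isPath

variable [CharZero K]

omit [CharZero K] in
open Classical in
theorem IsPcl.sum_cycle {x : ZMod 2} {X : PHom H ι n} (hX : IsPcl x X) {Q : Quiv ι n} {L : List ι}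
    (hL : Q.IsDirCycle L) (t) : ∑ α ∈ L.toFinset, X.at (Q.del α) t = 0 := by
  rw [List.sum_toFinset _ hL.2.1]
  have := LinearMap.congr_fun (hX.cycle₂ Q L hL) t
  rwa [← List.sum_toFinset _ hL.2.1, LinearMap.sum_apply, List.sum_toFinset _ hL.2.1] at this

open Classical in
/-- The sum of the gluing maps over the edges of a directed cycle which does not stay in one
block. -/
theorem sum_glue_cycle (hX : IsPcl x X) {Q : Quiv ι n} {L : List ι} (hL : Q.IsDirCycle L)
    {L₀ : List ι} (hL₀ : (Q.contract ν h).IsDirCycle L₀)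
    (hsub : ∀ α, α ∈ L₀ ↔ α ∈ L ∧ (Q.contract ν h).arrow α ≠ none) (g : ∀ j, VNabla H (ν j))
    (hg : ∀ j, g j ∈ VNabla.constSub H (Q.sub ν h j)) :
    ∑ α ∈ L₀.toFinset, glue x X (Q.del α) ν h g = 0 := by
  -- Edges whose removal leaves a cycle in the contraction contribute zero; for the others the flow
  -- identities are available.
  set A := L₀.toFinset.filter fun α => ((Q.del α).contract ν h).Acyclic with hA
  have h0 : ∀ g, ∑ α ∈ L₀.toFinset, glue x X (Q.del α) ν h g =
      ∑ α ∈ A, glue x X (Q.del α) ν h g := by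
    intro g
    rw [hA, Finset.sum_filter]
    refine Finset.sum_congr rfl fun α _ => ?_
    split_ifs with hc
    · rfl
    · rw [glue_eq_zero (hX.cycle₁ _ hc), zero_apply]
  have key : ∀ (a : ∀ j, SPoly K N (Fin (ν j))) (α : Fin m → ZMod 2) (d : Fin m → ℕ) (_ : ∀ j, SPoly.IsMon
      (VNabla.compEv K N (Q.sub ν h j)) (a j) (α j) (d j)) (u : Fin m → V) (β : Fin m → ZMod 2),
      (∀ j, u j ∈ H.par (β j)) →
      ∑ e ∈ A, glue x X (Q.del e) ν h (fun j => VNabla.mk H (ν j) (a j ⊗ₜ[K] u j)) = 0 := by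
    intro a α d hmon
    refine SPoly.mon_induction (fun j => VNabla.compEv K N (Q.sub ν h j)) (P := fun a α =>
      ∀ (u : Fin m → V) (β : Fin m → ZMod 2), (∀ j, u j ∈ H.par (β j)) →
        ∑ e ∈ A, glue x X (Q.del e) ν h (fun j => VNabla.mk H (ν j) (a j ⊗ₜ[K] u j)) = 0)
      (fun j k => VNabla.compEv_mem_par _ k) ?_ ?_ ?_ a α d hmon
    -- Without variables nothing is shifted, and the claim is the cycle relation of `X` for the
    -- contracted cycle.
    · intro u β hu
      rw [← h0]
      simp only [glue_one hX, Quiv.contract_del]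
      rw [← map_sum, hX.sum_cycle hL₀, map_zero]
    · intro a α j d ha ih u β hu
      set g : ∀ j, VNabla H (ν j) := fun i => VNabla.mk H (ν i) (a i ⊗ₜ[K] u i) with hg
      have h5 : ∑ e ∈ A, glue x X (Q.del e) ν h g = 0 := ih u β hu
      have h1 : ∀ e, glue x X (Q.del e) ν h (fun i => VNabla.mk H (ν i)
          (Function.update a j (VNabla.compEv K N (Q.sub ν h j) d * a j) i ⊗ₜ[K] u i)) =
          (∑ c with (Q.sub ν h j).Conn d c, VNabla.lmul H n (SPoly.ev (blk ν h ⟨j, c⟩))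
            (glue x X (Q.del e) ν h g)) +
          ∑ c with (Q.sub ν h j).Conn d c, ∑ i ∈ (Q.del e).extSet ν h (blk ν h ⟨j, c⟩),
            glueXi x X (Q.del e) ν h i g := by
        intro e
        rw [← VNabla.update_mk_left, ← VNabla.lmul_mk, VNabla.lmul_compEv,
          MultilinearMap.map_update_sum, ← Finset.sum_add_distrib]
        exact Finset.sum_congr rfl fun c _ => glue_ev hX g j c
      -- The insertion of `Ξ_i` involves the same polynomials, with `u` possibly replaced, so its
      -- sum over the edges vanishes by induction.
      have h2 : ∀ i, ∑ e ∈ A, glueXi x X (Q.del e) ν h i g = 0 := by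
        intro i
        simp only [glueXi_apply]
        have h3 : ∀ e, glue x X (Q.del e) ν h (Function.update g i (VNabla.tot H (ν i) (g i))) =
            -glue x X (Q.del e) ν h (fun k => VNabla.mk H (ν k)
              (a k ⊗ₜ[K] Function.update u i (H.T (u i)) k)) := by
          intro e
          rw [hg, VNabla.tot_mk, map_update_neg, VNabla.update_mk_right]
        simp only [h3, sub_neg_eq_add]
        rw [Finset.sum_add_distrib, ih _ β (H.update_T_mem hu i), add_zero, Finset.sum_comm]
        simp only [← map_sum, h5, map_zero, Finset.sum_const_zero]
      simp only [h1]
      rw [Finset.sum_add_distrib, Finset.sum_comm]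
      simp only [← map_sum, h5, map_zero, Finset.sum_const_zero, zero_add]
      -- The external connections depend on the removed edge `e`. On a component sum of a block they
      -- may be replaced by those for one fixed edge `β₀`; then the sum over `e` can be taken inside
      -- and `h2` applies.
      rcases A.eq_empty_or_nonempty with hA0 | ⟨β₀, hβ₀⟩
      · rw [hA0, Finset.sum_empty]
      have hmem : ∀ e ∈ A, (e ∈ L ∧ (Q.contract ν h).arrow e ≠ none) ∧
          ((Q.del e).contract ν h).Acyclic := by
        intro e he
        rw [hA, Finset.mem_filter, List.mem_toFinset, hsub] at he
        exact he
      have h4 := fun e he => Quiv.sum_ext_cycle hL (hmem β₀ hβ₀).1.1 (hmem e he).2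
        (hmem β₀ hβ₀).2 (hmem β₀ hβ₀).1.2 (fun i => glueXi x X (Q.del e) ν h i g)
        (fun i => sum_glueXi hX i g) j d
      rw [Finset.sum_congr rfl h4, Finset.sum_comm]
      refine Finset.sum_eq_zero fun c _ => ?_
      rw [Finset.sum_comm]
      exact Finset.sum_eq_zero fun i _ => h2 i
    · intro a α j k s ha ih u β hu
      have h1 : ∀ e, glue x X (Q.del e) ν h (fun i => VNabla.mk H (ν i)
          (Function.update a j (SPoly.od k s * a j) i ⊗ₜ[K] u i)) =
          sg (x + ∑ i, if i < j then α i + β i else 0) • VNabla.lmul H n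
            (SPoly.od (blk ν h ⟨j, k⟩) s)
            (glue x X (Q.del e) ν h fun i => VNabla.mk H (ν i) (a i ⊗ₜ[K] u i)) := by
        intro e
        rw [← VNabla.update_mk_left, ← VNabla.lmul_mk]
        exact glue_od hX (fun i => VNabla.mk_mem_par (ha i) (hu i)) j k s
      simp only [h1]
      rw [← Finset.smul_sum, ← map_sum, ih u β hu, map_zero, smul_zero]
  rw [h0]
  have := multilinear_eq_of_mem_span (Φ := ∑ α ∈ A, glue x X (Q.del α) ν h) (Ψ := 0) _ ?_ g hg
  · simpa only [sum_apply, zero_apply] using this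
  intro g hg
  choose a p d u q h1 h2 h3 using hg
  obtain rfl : g = fun j => VNabla.mk H (ν j) (a j ⊗ₜ[K] u j) := funext h3
  rw [sum_apply, zero_apply]
  exact key a p d h1 u q h2

theorem IsPcl.composite_cycle₂ (hX : IsPcl x X) (hY : ∀ j, IsPcl (y j) (Y j)) (Q : Quiv ι n)
    (L : List ι) (hL : Q.IsDirCycle L) :
    (L.map fun α => (X.composite ν h x y Y).at (Q.del α)).sum = 0 := by
  classical
  refine H.tensor_ext fun v p hv => ?_
  rw [← List.sum_toFinset _ hL.2.1, LinearMap.sum_apply, LinearMap.zero_apply]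
  simp only [PHom.composite_at _ hv]
  rw [← Finset.smul_sum]
  refine (congrArg _ ?_).trans (smul_zero _)
  change ∑ α ∈ L.toFinset, glue x X (Q.del α) ν h (PHom.inner Y h (Q.del α) v) = 0
  obtain ⟨hne, hnd, a, hp⟩ := hL
  -- If the cycle stays in one block, the relation is that of `Y_j` in one slot of a fixed gluing
  -- map. Otherwise its edges between blocks form a directed cycle of the contraction.
  by_cases hin : ∀ e ∈ L, (Q.contract ν h).arrow e = none
  · obtain ⟨⟨j, k⟩, rfl⟩ := (blk ν h).surjective a
    obtain ⟨k', hk', hp'⟩ := hp.sub hin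
    obtain rfl : k = k' := by
      have := (blk ν h).injective hk'
      simpa using this
    have h1 : ∀ α ∈ L.toFinset, glue x X (Q.del α) ν h (PHom.inner Y h (Q.del α) v) =
        glue x X Q ν h (Function.update (PHom.inner Y h Q v) j
          ((Y j).at ((Q.sub ν h j).del α) (PiTensorProduct.tprod K fun k => v (blk ν h ⟨j, k⟩)))) := by
      intro α hα
      rw [List.mem_toFinset] at hα
      rw [glue_del (hin α hα)]
      congr 1
      funext i
      by_cases hi : i = j
      · subst hi
        rw [Function.update_self, PHom.inner, Quiv.sub_del]
      · rw [Function.update_of_ne hi, PHom.inner,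
          Quiv.sub_del_of_ne hi (hp'.arrow_ne_none hα)]
        rfl
    rw [Finset.sum_congr rfl h1, ← MultilinearMap.map_update_sum,
      (hY j).sum_cycle ⟨hne, hnd, k, hp'⟩, MultilinearMap.map_update_zero]
  · push Not at hin
    obtain ⟨e₀, he₀, he₀'⟩ := hin
    set L₀ := L.filter fun e => (Q.contract ν h).arrow e ≠ none with hL₀
    have hsub : ∀ α, α ∈ L₀ ↔ α ∈ L ∧ (Q.contract ν h).arrow α ≠ none := by
      intro α; simp [hL₀]
    have hcyc : (Q.contract ν h).IsDirCycle L₀ := by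
      refine ⟨List.ne_nil_of_mem ((hsub e₀).2 ⟨he₀, he₀'⟩), hnd.filter _, blkIdx ν h a, ?_⟩
      convert hp.contract (ν := ν) (h := h)
    -- Removing an edge inside a block leaves the contracted cycle intact, so `X` gives zero.
    have h2 : ∀ α ∈ L.toFinset, α ∉ L₀.toFinset →
        glue x X (Q.del α) ν h (PHom.inner Y h (Q.del α) v) = 0 := by
      intro α hα hα'
      rw [List.mem_toFinset] at hα hα'
      have hc : (Q.contract ν h).arrow α = none := by
        by_contra hc
        exact hα' ((hsub α).2 ⟨hα, hc⟩)
      rw [glue_del hc, glue_eq_zero (hX.cycle₁ _ hcyc.not_acyclic), zero_apply]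
    rw [← Finset.sum_subset (fun α hα => List.mem_toFinset.2 ((hsub α).1 (List.mem_toFinset.1 hα)).1) h2]
    have h3 : ∀ α ∈ L₀.toFinset, glue x X (Q.del α) ν h (PHom.inner Y h (Q.del α) v) =
        glue x X (Q.del α) ν h (PHom.inner Y h Q v) := by
      intro α hα
      congr 1
      funext j
      rw [PHom.inner, Quiv.sub_del_of_contract ((hsub α).1 (List.mem_toFinset.1 hα)).2]
      rfl
    rw [Finset.sum_congr rfl h3]
    -- The values of the `Y_j` depend on the `λ` only through component sums, which is what the
    -- comparison of different removed edges requires.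
    exact sum_glue_cycle hX ⟨hne, hnd, a, hp⟩ hcyc hsub _
      fun j => VNabla.mem_constSub _ fun c d hcd => (hY j).sesq₁ _ c d hcd _

open Classical in
/-- Composites satisfy the cycle relations and the sesquilinearity conditions. -/
theorem IsPcl.composite (hX : IsPcl x X) (hY : ∀ j, IsPcl (y j) (Y j)) :
    IsPcl (x + ∑ j, y j) (X.composite ν h x y Y) where
  parity := hX.composite_parity hY
  cycle₁ := hX.composite_cycle₁ hY
  cycle₂ := hX.composite_cycle₂ hY
  sesq₁ := hX.composite_sesq₁ hY
  sesq₂ Q k t := hX.composite_sesq₂ hY Q k t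
  sesq₃ := hX.composite_sesq₃ hY

end cycle

/-! ### Gluing and the substitution of sums of variables. -/

section collect

variable {K : Type*} [Field K] [CharZero K] {N : ℕ} {V : Type*} [AddCommGroup V] [Module K V]
  {H : HWSupermodule K N V} {ι : Type*} {l m n : ℕ} {ν : Fin m → ℕ} {h : ∑ j, ν j = n}
  {μ : Fin n → ℕ} {h' : ∑ k, μ k = l}

omit [CharZero K] in
theorem sum_filter_blk {M : Type*} [AddCommMonoid M] (f : Fin l → M) (j : Fin m) (k : Fin (ν j)) :
    ∑ a with blkIdx μ h' a = blk ν h ⟨j, k⟩, f a =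
      ∑ a with blkIdx (fun k => μ (blk ν h ⟨j, k⟩)) rfl a = k,
        f (blk (fun j => ∑ k, μ (blk ν h ⟨j, k⟩)) (sum_blocks h h') ⟨j, a⟩) := by
  rw [sum_filter_blkIdx, sum_filter_blkIdx]
  simp only [blk_assoc h']

open Classical in
/-- Sums over external connections are compatible with the contraction of smaller blocks. -/
theorem Quiv.sum_ext_contract {G : Type*} [AddCommGroup G] {Q : Quiv ι l}
    (hF : ((Q.contract μ h').contract ν h).Acyclic) (ρ : Fin m → G)
    (hρ : ∀ i, ∑ k with ((Q.contract μ h').contract ν h).Conn i k, ρ k = 0) (c : Fin n) :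
    ∑ a with blkIdx μ h' a = c, ∑ i ∈ Q.extSet (fun j => ∑ k, μ (blk ν h ⟨j, k⟩))
      (sum_blocks h h') a, ρ i = ∑ i ∈ (Q.contract μ h').extSet ν h c, ρ i := by
  obtain ⟨f, hf, hd⟩ := Quiv.exists_flow ρ hρ
  have h1 := Quiv.flow_unique hF f hf ρ hd
  rw [Quiv.contract_contract] at hF hf hd
  have h2 := Quiv.flow_unique hF f hf ρ hd
  have h3 := Quiv.sum_div_contract (ν := μ) (h := h') (Q := Q) f c
  simp only [h1, h2] at h3
  simpa only [Quiv.extSet] using h3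

omit [CharZero K] in
theorem VNabla.tot_collect (b : Fin n → Fin m) (y : VNabla H m) :
    VNabla.tot H n (VNabla.collect H b y) = VNabla.collect H b (VNabla.tot H m y) := by
  rw [tot_apply, tot_apply, map_sum]
  simp only [collect_ev]
  rw [← Finset.sum_fiberwise (Finset.univ) b]

theorem VNabla.collect_mem (b : Fin n → Fin m) {y : VNabla H m} {p : ZMod 2}
    (hy : y ∈ VNabla.par H m p) : VNabla.collect H b y ∈ VNabla.par H n p := by
  rw [mem_par_iff] at hy ⊢
  rw [eps_collect, hy, map_zsmul]

/-- The gluing maps are compatible with the substitutions `Λ_j ↦ Λ'_j`. -/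
theorem glue_collect {x : ZMod 2} {X : PHom H ι m} (hX : IsPcl x X) (Q : Quiv ι l)
    (y : ∀ j, VNabla H (ν j)) :
    glue x X Q (fun j => ∑ k, μ (blk ν h ⟨j, k⟩)) (sum_blocks h h')
      (fun j => VNabla.collect H (blkIdx (fun k => μ (blk ν h ⟨j, k⟩)) rfl) (y j)) =
    VNabla.collect H (blkIdx μ h') (glue x X (Q.contract μ h') ν h y) := by
  -- With a cycle in the coarse contraction both sides vanish. Otherwise both are determined by
  -- their generator rules, and the shifts agree by `Quiv.sum_ext_contract`.
  by_cases hF : ((Q.contract μ h').contract ν h).Acyclic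
  swap
  · rw [glue_eq_zero (hX.cycle₁ _ hF), glue_eq_zero (hX.cycle₁ _ (by
      rwa [Quiv.contract_contract] at hF)), zero_apply, zero_apply, map_zero]
  set κ : Fin m → ℕ := fun j => ∑ k, μ (blk ν h ⟨j, k⟩) with hκ
  set hs := sum_blocks h h' with hhs
  set C : ∀ j, VNabla H (ν j) →ₗ[K] VNabla H (κ j) :=
    fun j => VNabla.collect H (blkIdx (fun k => μ (blk ν h ⟨j, k⟩)) rfl) with hC
  suffices hsuff : (glue x X Q κ hs).compLinearMap C =
      (VNabla.collect H (blkIdx μ h')).compMultilinearMap (glue x X (Q.contract μ h') ν h) from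
    DFunLike.congr_fun hsuff y
  have hupd : ∀ (y : ∀ j, VNabla H (ν j)) j w,
      (fun i => C i (Function.update y j w i)) = Function.update (fun i => C i (y i)) j (C j w) :=
    fun y j w => funext fun i => Function.apply_update (fun i => C i) y j w i
  have hXi : ∀ (y : ∀ j, VNabla H (ν j)) i, glueXi x X Q κ hs i (fun j => C j (y j)) =
      (∑ a with blkIdx κ hs a = i, VNabla.lmul H l (SPoly.ev a)
        ((glue x X Q κ hs).compLinearMap C y)) - (glue x X Q κ hs).compLinearMap C
          (Function.update y i (VNabla.tot H (ν i) (y i))) := by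
    intro y i
    rw [glueXi_apply, VNabla.tot_collect, MultilinearMap.compLinearMap_apply,
      MultilinearMap.compLinearMap_apply, hupd]
  refine glue_unique (H := H)
    (A := fun j k w => ∑ a with blkIdx μ h' a = blk ν h ⟨j, k⟩, VNabla.lmul H l (SPoly.ev a) w)
    (B := fun i w => ∑ a with blkIdx κ hs a = i, VNabla.lmul H l (SPoly.ev a) w)
    (R := fun j k f => ∑ i ∈ (Q.contract μ h').extSet ν h (blk ν h ⟨j, k⟩), f i)
    (O := fun j k s w => sg x • ∑ a with blkIdx μ h' a = blk ν h ⟨j, k⟩,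
      VNabla.lmul H l (SPoly.od a s) w) ?_ ?_ ?_ ?_ ?_
  · intro u β hu
    have h1 : ∀ j, C j (VNabla.mk H (ν j) (1 ⊗ₜ[K] u j)) = VNabla.mk H (κ j) (1 ⊗ₜ[K] u j) := by
      intro j
      rw [hC]
      simp only [VNabla.collect, VNabla.subst_mk, map_one]
    rw [MultilinearMap.compLinearMap_apply, LinearMap.compMultilinearMap_apply, glue_one hX,
      VNabla.collect_collect]
    simp only [h1]
    rw [glue_one hX, Quiv.contract_contract]
    congr 2
    exact funext fun a => blkIdx_blkIdx h' a
  · intro y p hy j k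
    rw [MultilinearMap.compLinearMap_apply, hupd]
    have h1 : C j (VNabla.lmul H (ν j) (SPoly.ev k) (y j)) =
        ∑ a with blkIdx (fun k => μ (blk ν h ⟨j, k⟩)) rfl a = k,
          VNabla.lmul H (κ j) (SPoly.ev a) (C j (y j)) := VNabla.collect_ev _ _ _ _
    rw [h1, MultilinearMap.map_update_sum,
      Finset.sum_congr rfl fun a _ => glue_ev hX (fun i => C i (y i)) j a,
      Finset.sum_add_distrib, ← sum_filter_blk (h' := h') (fun a => VNabla.lmul H l (SPoly.ev a)
        (glue x X Q κ hs fun i => C i (y i))) j k,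
      ← sum_filter_blk (h' := h') (fun a => ∑ i ∈ Q.extSet κ hs a,
        glueXi x X Q κ hs i fun i => C i (y i)) j k,
      Quiv.sum_ext_contract hF _ (fun i => ?_)]
    · simp only [hXi]
      rfl
    · rw [Quiv.contract_contract]
      exact sum_glueXi hX i _
  · intro y p hy j k
    simp only [LinearMap.compMultilinearMap_apply]
    rw [glue_ev hX, map_add, VNabla.collect_ev, map_sum]
    congr 1
    refine Finset.sum_congr rfl fun i _ => ?_
    rw [glueXi_apply, map_sub, map_sum]
    congr 1
    simp only [VNabla.collect_ev]
    rw [← Finset.sum_biUnion]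
    · refine Finset.sum_congr (Finset.ext fun a => ?_) fun _ _ => rfl
      have := blkIdx_blkIdx (h := h) h' a
      simp [← this, hκ]
    · intro c _ d _ hcd
      refine Finset.disjoint_left.2 fun a ha hb => hcd ?_
      simp only [Finset.mem_filter] at ha hb
      rw [← ha.2, ← hb.2]
  · intro y p hy j k s
    rw [MultilinearMap.compLinearMap_apply, hupd]
    have h1 : C j (VNabla.lmul H (ν j) (SPoly.od k s) (y j)) =
        ∑ a with blkIdx (fun k => μ (blk ν h ⟨j, k⟩)) rfl a = k,
          VNabla.lmul H (κ j) (SPoly.od a s) (C j (y j)) := VNabla.collect_od _ _ _ _ _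
    rw [h1, MultilinearMap.map_update_sum,
      Finset.sum_congr rfl fun a _ => glue_od (y := fun i => C i (y i)) hX
        (fun i => VNabla.collect_mem _ (hy i)) j a s,
      ← Finset.smul_sum, ← sum_filter_blk (h' := h') (fun a => VNabla.lmul H l (SPoly.od a s)
        (glue x X Q κ hs fun i => C i (y i))) j k, add_comm x, ← sg_smul_smul]
    rfl
  · intro y p hy j k s
    simp only [LinearMap.compMultilinearMap_apply]
    rw [glue_od hX hy, map_zsmul, VNabla.collect_od, add_comm x, ← sg_smul_smul]

end collect

/-! ### Gluing with a composite. -/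

section assoc

variable {K : Type*} [Field K] [CharZero K] {N : ℕ} {V : Type*} [AddCommGroup V] [Module K V]
  {H : HWSupermodule K N V} {ι : Type*} {l m n : ℕ}

/-- The powers of the parity involution. -/
def VNabla.epsPow (H : HWSupermodule K N V) (n : ℕ) (e : ZMod 2) : Module.End K (VNabla H n) :=
  if e = 0 then LinearMap.id else VNabla.eps H n

theorem VNabla.epsPow_of_mem (e : ZMod 2) {y : VNabla H n} {r : ZMod 2}
    (hy : y ∈ VNabla.par H n r) : VNabla.epsPow H n e y = sg (e * r) • y := by
  have h2 : ∀ q : ZMod 2, q = 0 ∨ q = 1 := by decide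
  rcases h2 e with rfl | rfl
  · simp [epsPow, sg_zero]
  · simpa [epsPow] using (VNabla.mem_par_iff H).1 hy

variable {ν : Fin m → ℕ} {h : ∑ j, ν j = n} {μ : Fin n → ℕ} {h' : ∑ k, μ k = l} {x : ZMod 2}
  {X : PHom H ι m} {y : Fin m → ZMod 2} {Y : ∀ j, PHom H ι (ν j)}

/-- The iterated gluing map. -/
def glueNest (x : ZMod 2) (X : PHom H ι m) (y : Fin m → ZMod 2) (ν : Fin m → ℕ) (h : ∑ j, ν j = n)
    (Y : ∀ j, PHom H ι (ν j)) (μ : Fin n → ℕ) (h' : ∑ k, μ k = l) (Q : Quiv ι l) :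
    MultilinearMap K (fun k => VNabla H (μ k)) (VNabla H l) :=
  nest ν h (glue x X Q (fun j => ∑ k, μ (blk ν h ⟨j, k⟩)) (sum_blocks h h')) fun j =>
    glue (y j) (Y j) (Q.sub (fun j => ∑ k, μ (blk ν h ⟨j, k⟩)) (sum_blocks h h') j)
      (fun k => μ (blk ν h ⟨j, k⟩)) rfl

omit [CharZero K] in
theorem glueNest_update (Q : Quiv ι l) (g : ∀ k, VNabla H (μ k)) (j : Fin m) (k : Fin (ν j)) (w) :
    glueNest x X y ν h Y μ h' Q (Function.update g (blk ν h ⟨j, k⟩) w) =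
      glue x X Q (fun j => ∑ k, μ (blk ν h ⟨j, k⟩)) (sum_blocks h h') (Function.update
        (fun j => glue (y j) (Y j) (Q.sub (fun j => ∑ k, μ (blk ν h ⟨j, k⟩)) (sum_blocks h h') j)
          (fun k => μ (blk ν h ⟨j, k⟩)) rfl fun k => g (blk ν h ⟨j, k⟩)) j
        (glue (y j) (Y j) (Q.sub (fun j => ∑ k, μ (blk ν h ⟨j, k⟩)) (sum_blocks h h') j)
          (fun k => μ (blk ν h ⟨j, k⟩)) rfl
          (Function.update (fun k => g (blk ν h ⟨j, k⟩)) k w))) := by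
  rw [glueNest, nest_apply]
  congr 1
  exact blocks_update ν h (fun j (g : ∀ k, VNabla H (μ (blk ν h ⟨j, k⟩))) =>
    glue (y j) (Y j) (Q.sub (fun j => ∑ k, μ (blk ν h ⟨j, k⟩)) (sum_blocks h h') j)
          (fun k => μ (blk ν h ⟨j, k⟩)) rfl g) g j k w

theorem glueNest_od (hX : IsPcl x X) (hY : ∀ j, IsPcl (y j) (Y j)) (Q : Quiv ι l)
    {g : ∀ k, VNabla H (μ k)} {q : Fin n → ZMod 2} (hg : ∀ k, g k ∈ VNabla.par H (μ k) (q k))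
    (j : Fin m) (k : Fin (ν j)) (c : Fin (μ (blk ν h ⟨j, k⟩))) (s : Fin N) :
    glueNest x X y ν h Y μ h' Q (Function.update g (blk ν h ⟨j, k⟩)
      (VNabla.lmul H _ (SPoly.od c s) (g (blk ν h ⟨j, k⟩)))) =
      sg (x + (∑ i, if i < j then y i else 0) + y j +
          ∑ i, if i < blk ν h ⟨j, k⟩ then q i else 0) •
        VNabla.lmul H l (SPoly.od (blk μ h' ⟨blk ν h ⟨j, k⟩, c⟩) s)
          (glueNest x X y ν h Y μ h' Q g) := by
  rw [glueNest_update, glue_od (y := fun k => g (blk ν h ⟨j, k⟩)) (hY j) (fun k => hg _) k c s,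
    map_update_zsmul]
  have := glue_od (Q := Q) (h := sum_blocks h h') hX
    (fun j => glue_mem (Q := Q.sub _ (sum_blocks h h') j) (h := rfl) (hY j)
      fun k => hg (blk ν h ⟨j, k⟩)) j (blk (fun k => μ (blk ν h ⟨j, k⟩)) rfl ⟨k, c⟩) s
  rw [this, sg_smul_smul, blk_assoc h', sum_lt_blk (ν := ν) (h := h)]
  have h7 : ∀ i, (if i < j then y i + ∑ k, q (blk ν h ⟨i, k⟩) else 0) = (if i < j then y i else 0) +
      if i < j then ∑ k, q (blk ν h ⟨i, k⟩) else 0 := by intro i; split_ifs <;> simp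
  simp only [h7, Finset.sum_add_distrib]
  congr 2
  ring

omit [CharZero K] in
open Classical in
-- The rule for `λ` which the gluing map of a composite must satisfy. Shifting by the inner and then
-- by the outer insertions amounts to a single shift by the external connections of the fine
-- contraction; this is `Quiv.sum_ext_assoc` with the insertions as sinks.
theorem glueNest_ev (hX : IsPcl x X) (hY : ∀ j, IsPcl (y j) (Y j)) (Q : Quiv ι l)
    (hQ : (Q.contract μ h').Acyclic) (hF : ((Q.contract μ h').contract ν h).Acyclic)
    (g : ∀ k, VNabla H (μ k)) (c : Fin n) (k : Fin (μ c)) :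
    glueNest x X y ν h Y μ h' Q (Function.update g c (VNabla.lmul H _ (SPoly.ev k) (g c))) =
      VNabla.lmul H l (SPoly.ev (blk μ h' ⟨c, k⟩)) (glueNest x X y ν h Y μ h' Q g) +
      ∑ i ∈ Q.extSet μ h' (blk μ h' ⟨c, k⟩),
        ((∑ a with blkIdx μ h' a = i, VNabla.lmul H l (SPoly.ev a)
          (glueNest x X y ν h Y μ h' Q g)) -
        glueNest x X y ν h Y μ h' Q (Function.update g i (VNabla.tot H (μ i) (g i)))) := by
  obtain ⟨⟨j, k₀⟩, rfl⟩ := (blk ν h).surjective c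
  set κ : Fin m → ℕ := fun j => ∑ k, μ (blk ν h ⟨j, k⟩) with hκ
  set hs := sum_blocks h h' with hhs
  set G : ∀ j, VNabla H (κ j) := fun j => glue (y j) (Y j) (Q.sub κ hs j)
    (fun k => μ (blk ν h ⟨j, k⟩)) rfl fun k => g (blk ν h ⟨j, k⟩) with hG
  set ρ : Fin m → VNabla H l := fun i => glueXi x X Q κ hs i G with hρ
  set τ : Fin n → VNabla H l := fun i => (∑ a with blkIdx μ h' a = i, VNabla.lmul H l (SPoly.ev a)
    (glueNest x X y ν h Y μ h' Q g)) -
      glueNest x X y ν h Y μ h' Q (Function.update g i (VNabla.tot H (μ i) (g i))) with hτ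
  have hsρ : ∀ i, ∑ k with ((Q.contract μ h').contract ν h).Conn i k, ρ k = 0 := by
    intro i
    rw [Quiv.contract_contract]
    exact sum_glueXi hX i G
  have hnest : glueNest x X y ν h Y μ h' Q g = glue x X Q κ hs G := rfl
  -- An inner insertion is itself subject to the outer substitution: it becomes the insertion `τ` of
  -- the iterated map plus the outer insertions at the vertex concerned.
  have hXi : ∀ j k, glue x X Q κ hs (Function.update G j (glueXi (y j) (Y j) (Q.sub κ hs j)
      (fun k => μ (blk ν h ⟨j, k⟩)) rfl k fun k => g (blk ν h ⟨j, k⟩))) =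
      τ (blk ν h ⟨j, k⟩) + ∑ i ∈ (Q.contract μ h').extSet ν h (blk ν h ⟨j, k⟩), ρ i := by
    intro j k
    rw [glueXi_apply, MultilinearMap.map_update_sub, MultilinearMap.map_update_sum,
      Finset.sum_congr rfl fun a _ => glue_ev hX G j a, Finset.sum_add_distrib,
      ← sum_filter_blk (h' := h') (fun a => VNabla.lmul H l (SPoly.ev a) (glue x X Q κ hs G)) j k,
      ← sum_filter_blk (h' := h') (fun a => ∑ i ∈ Q.extSet κ hs a, ρ i) j k,
      Quiv.sum_ext_contract hF ρ hsρ, ← glueNest_update (h' := h')]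
    simp only [hτ, hnest]
    abel
  rw [glueNest_update, glue_ev (hY j) (fun k => g (blk ν h ⟨j, k⟩)) k₀ k,
    MultilinearMap.map_update_add, MultilinearMap.map_update_sum]
  have h1 := glue_ev (Q := Q) (h := hs) hX G j (blk (fun k => μ (blk ν h ⟨j, k⟩)) rfl ⟨k₀, k⟩)
  have h2 := Quiv.sum_ext_assoc (h := h) (h' := h') hQ hF τ ρ hsρ (fun j' k' => by
    simp only [← hXi]
    rw [← MultilinearMap.map_update_sum, Quiv.sub_contract, sum_glueXi (hY j'),
      MultilinearMap.map_update_zero]) j (blk (fun k => μ (blk ν h ⟨j, k⟩)) rfl ⟨k₀, k⟩)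
  rw [blk_assoc h'] at h1 h2
  rw [h2]
  refine (congrArg₂ (· + ·) h1 (Finset.sum_congr rfl fun k _ => hXi j k)).trans ?_
  rw [add_assoc]
  rfl

open Classical in
/-- The gluing maps of composites are the iterated ones. -/
theorem glue_composite (hX : IsPcl x X) (hY : ∀ j, IsPcl (y j) (Y j)) (Q : Quiv ι l)
    {g : ∀ k, VNabla H (μ k)} {q : Fin n → ZMod 2} (hg : ∀ k, g k ∈ VNabla.par H (μ k) (q k)) :
    glue (x + ∑ j, y j) (X.composite ν h x y Y) Q μ h' g =
      sg (shuffleExp (fun j => ∑ k, q (blk ν h ⟨j, k⟩)) y) • glueNest x X y ν h Y μ h' Q g := by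
  -- A cycle in the coarse contraction kills `X`, and a cycle in the fine one kills `X` or some
  -- `Y_j`; so both contractions may be assumed to be forests.
  by_cases hF : ((Q.contract μ h').contract ν h).Acyclic
  swap
  · have h1 : (X.composite ν h x y Y).at (Q.contract μ h') = 0 := H.tensor_ext fun v p hv => by
      rw [PHom.composite_at _ hv, glue_eq_zero (hX.cycle₁ _ hF), zero_apply, smul_zero,
        LinearMap.zero_apply]
    rw [glue_eq_zero h1, zero_apply, glueNest, nest_apply, glue_eq_zero, zero_apply, smul_zero]
    rw [← Quiv.contract_contract (h' := h')]
    exact hX.cycle₁ _ hF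
  by_cases hQ : (Q.contract μ h').Acyclic
  swap
  · rw [glue_eq_zero ((hX.composite hY).cycle₁ _ hQ), zero_apply, glueNest, nest_apply]
    obtain ⟨j, hj⟩ : ∃ j, ¬((Q.contract μ h').sub ν h j).Acyclic := by
      by_contra hc
      push Not at hc
      exact hQ (Quiv.acyclic_of_blocks hF hc)
    rw [MultilinearMap.map_coord_zero _ j, smul_zero]
    rw [Quiv.sub_contract] at hj
    rw [glue_eq_zero ((hY j).cycle₁ _ hj), zero_apply]
  -- The sign depends on the parities of the arguments. Absorbed into powers of the parity
  -- involution, it gives a multilinear map to which `glue_unique` applies.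
  set Ψ : MultilinearMap K (fun k => VNabla H (μ k)) (VNabla H l) :=
    (glueNest x X y ν h Y μ h' Q).compLinearMap fun k =>
      VNabla.epsPow H (μ k) (tailPar y (blkIdx ν h k)) with hΨ
  have hΨ₀ : ∀ {g : ∀ k, VNabla H (μ k)} {q : Fin n → ZMod 2},
      (∀ k, g k ∈ VNabla.par H (μ k) (q k)) → Ψ g =
      sg (shuffleExp (fun j => ∑ k, q (blk ν h ⟨j, k⟩)) y) • glueNest x X y ν h Y μ h' Q g := by
    intro g q hg
    rw [hΨ, MultilinearMap.compLinearMap_apply]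
    simp only [VNabla.epsPow_of_mem _ (hg _)]
    rw [map_sg_smul_univ, sum_blk (ν := ν) (h := h), shuffleExp_eq_tailPar]
    simp only [blkIdx_blk, Finset.mul_sum]
  rw [← hΨ₀ hg]
  congr 1
  have hmem : ∀ {g : ∀ k, VNabla H (μ k)} {q : Fin n → ZMod 2},
      (∀ k, g k ∈ VNabla.par H (μ k) (q k)) → ∀ (j : Fin n) w, w ∈ VNabla.par H (μ j) (q j) →
      ∀ k, Function.update g j w k ∈ VNabla.par H (μ k) (q k) := by
    intro g q hg j w hw k
    by_cases hk : k = j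
    · subst hk; simpa using hw
    · simpa [hk] using hg k
  refine glue_unique (H := H)
    (A := fun j k w => VNabla.lmul H l (SPoly.ev (blk μ h' ⟨j, k⟩)) w)
    (B := fun i w => ∑ a with blkIdx μ h' a = i, VNabla.lmul H l (SPoly.ev a) w)
    (R := fun j k f => ∑ i ∈ Q.extSet μ h' (blk μ h' ⟨j, k⟩), f i)
    (O := fun j k s w => sg (x + ∑ j, y j) • VNabla.lmul H l (SPoly.od (blk μ h' ⟨j, k⟩) s) w)
    ?_ ?_ ?_ ?_ ?_
  · intro u β hu
    have h1 : ∀ k, VNabla.mk H (μ k) (1 ⊗ₜ[K] u k) ∈ VNabla.par H (μ k) (β k) := fun k => by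
      simpa using VNabla.mk_mem_par (H := H) (SPoly.one_mem_par (K := K) (N := N)) (hu k)
    rw [hΨ₀ h1, glue_one (hX.composite hY), PHom.composite_at _ hu, map_zsmul, shuffleSign_eq,
      ← glue_collect hX, glueNest, nest_apply]
    congr 3
    funext j
    rw [glue_one (hY j), Quiv.sub_contract]
  · intro g q hg j k
    rw [glue_ev (hX.composite hY)]
    simp only [glueXi_apply]
  · intro g q hg j k
    rw [hΨ₀ (hmem hg j _ (VNabla.lmul_ev_mem k (hg j))), glueNest_ev hX hY Q hQ hF, hΨ₀ hg]
    simp only [fun i => hΨ₀ (hmem hg i _ (VNabla.tot_mem (hg i)))]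
    simp only [map_zsmul, smul_add, Finset.smul_sum, smul_sub]
  · intro g q hg j k s
    rw [glue_od (hX.composite hY) hg, add_comm (x + _), ← sg_smul_smul]
  · intro g q hg c k s
    obtain ⟨⟨j, k₀⟩, rfl⟩ := (blk ν h).surjective c
    have hmo : ∀ k', Function.update g (blk ν h ⟨j, k₀⟩) (VNabla.lmul H _ (SPoly.od k s)
        (g (blk ν h ⟨j, k₀⟩))) k' ∈ VNabla.par H (μ k') (Function.update q (blk ν h ⟨j, k₀⟩)
          (q (blk ν h ⟨j, k₀⟩) + 1) k') := by
      intro k'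
      by_cases hk : k' = blk ν h ⟨j, k₀⟩
      · subst hk; simpa using VNabla.lmul_od_mem k s (hg _)
      · simpa [hk] using hg k'
    rw [hΨ₀ hmo, glueNest_od hX hY Q hg, hΨ₀ hg]
    have h6 : (fun j' => ∑ k, Function.update q (blk ν h ⟨j, k₀⟩) (q (blk ν h ⟨j, k₀⟩) + 1)
        (blk ν h ⟨j', k⟩)) = Function.update (fun j' => ∑ k, q (blk ν h ⟨j', k⟩)) j
          (∑ k, q (blk ν h ⟨j, k⟩) + 1) := by
      rw [blocks_update ν h (M := fun _ => ZMod 2) (L := fun _ => ZMod 2) (fun j p => ∑ k, p k) q]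
      congr 1
      rw [Finset.sum_update_of_mem (Finset.mem_univ k₀),
        ← Finset.add_sum_erase _ _ (Finset.mem_univ k₀), Finset.sdiff_singleton_eq_erase]
      ring
    rw [h6, shuffleExp_update_left]
    simp only [map_zsmul, sg_smul_smul]
    congr 2
    rw [sum_split_at y j]
    have h9 := add_self_zmod (∑ i, if j < i then y i else 0)
    ring

end assoc

/-! ### Associativity and unit laws. -/

section laws

variable {K : Type*} [Field K] {N : ℕ} {V : Type*} [AddCommGroup V] [Module K V]
  {H : HWSupermodule K N V} {ι : Type*} {l m n : ℕ}

theorem tailPar_blk {ν : Fin m → ℕ} {h : ∑ j, ν j = n} (q : Fin n → ZMod 2) (j : Fin m)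
    (c : Fin (ν j)) : tailPar q (blk ν h ⟨j, c⟩) =
      tailPar (fun j => ∑ k, q (blk ν h ⟨j, k⟩)) j + tailPar (fun k => q (blk ν h ⟨j, k⟩)) c := by
  rw [tailPar, tailPar, tailPar, sum_blk (ν := ν) (h := h),
    ← Finset.add_sum_erase _ _ (Finset.mem_univ j), ← Finset.add_sum_erase _ (fun j' =>
      if j < j' then ∑ c', q (blk ν h ⟨j', c'⟩) else 0) (Finset.mem_univ j)]
  simp only [blk_lt_iff, lt_irrefl, false_or, true_and, if_false, zero_add, Fin.val_fin_lt]
  rw [add_comm]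
  congr 1
  refine Finset.sum_congr rfl fun j' hj' => ?_
  have : j ≠ j' := (Finset.ne_of_mem_erase hj').symm
  by_cases hlt : j < j' <;> simp [this, hlt]

/-- A pair of increasing indices lies in two different blocks or inside one block. -/
theorem shuffleExp_blk {ν : Fin m → ℕ} {h : ∑ j, ν j = n} (p q : Fin n → ZMod 2) :
    shuffleExp p q = shuffleExp (fun j => ∑ k, p (blk ν h ⟨j, k⟩))
      (fun j => ∑ k, q (blk ν h ⟨j, k⟩)) +
      ∑ j, shuffleExp (fun k => p (blk ν h ⟨j, k⟩)) (fun k => q (blk ν h ⟨j, k⟩)) := by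
  simp only [shuffleExp_eq_tailPar]
  rw [sum_blk (ν := ν) (h := h), ← Finset.sum_add_distrib]
  refine Finset.sum_congr rfl fun j _ => ?_
  simp only [tailPar_blk, add_mul, Finset.sum_add_distrib, Finset.mul_sum]

theorem tailPar_add (p q : Fin m → ZMod 2) (j : Fin m) :
    tailPar (fun i => p i + q i) j = tailPar p j + tailPar q j := by
  simp only [tailPar]
  rw [← Finset.sum_add_distrib]
  exact Finset.sum_congr rfl fun i _ => by split_ifs <;> simp

theorem shuffleExp_add_left (p p' q : Fin m → ZMod 2) :
    shuffleExp (fun j => p j + p' j) q = shuffleExp p q + shuffleExp p' q := by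
  simp only [shuffleExp_eq_tailPar, mul_add, Finset.sum_add_distrib]

theorem shuffleExp_add_right (p q q' : Fin m → ZMod 2) :
    shuffleExp p (fun j => q j + q' j) = shuffleExp p q + shuffleExp p q' := by
  simp only [shuffleExp_eq_tailPar, tailPar_add, add_mul, Finset.sum_add_distrib]

theorem shuffleExp_zero_right (p : Fin m → ZMod 2) : shuffleExp p (fun _ => 0) = 0 := by
  simp [shuffleExp_eq_tailPar, tailPar]

theorem PHom.at_zsmul (c : ℤ) (X : PHom H ι n) (Q : Quiv ι n) : (c • X).at Q = c • X.at Q := rfl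

/-- Associativity of the composition. -/
theorem PHom.composite_assoc [CharZero K] {ν : Fin m → ℕ} {h : ∑ j, ν j = n} {μ : Fin n → ℕ}
    {h' : ∑ k, μ k = l} {x : ZMod 2} {X : PHom H ι m} {y : Fin m → ZMod 2}
    {Y : ∀ j, PHom H ι (ν j)} {z : Fin n → ZMod 2} {Z : ∀ k, PHom H ι (μ k)} (hX : IsPcl x X)
    (hY : ∀ j, IsPcl (y j) (Y j)) (hZ : ∀ k, IsPcl (z k) (Z k)) :
    (X.composite ν h x y Y).composite μ h' (x + ∑ j, y j) z Z =
      shuffleSign (fun j => ∑ k, z (blk ν h ⟨j, k⟩)) y •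
        X.composite (fun j => ∑ k, μ (blk ν h ⟨j, k⟩)) (sum_blocks h h') x
          (fun j => y j + ∑ k, z (blk ν h ⟨j, k⟩))
          (fun j => (Y j).composite (fun k => μ (blk ν h ⟨j, k⟩)) rfl (y j)
            (fun k => z (blk ν h ⟨j, k⟩)) (fun k => Z (blk ν h ⟨j, k⟩))) := by
  refine PHom.ext_hom fun Q v p hv => ?_
  have h1 := glue_composite (h := h) (h' := h') hX hY Q (PHom.inner_mem h' hZ Q hv)
  rw [PHom.at_zsmul, LinearMap.smul_apply, PHom.composite_at Q hv, PHom.composite_at Q hv]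
  refine (congrArg _ h1).trans ?_
  have h2 : ∀ j, ((Y j).composite (fun k => μ (blk ν h ⟨j, k⟩)) rfl (y j)
      (fun k => z (blk ν h ⟨j, k⟩)) (fun k => Z (blk ν h ⟨j, k⟩))).at
      (Q.sub (fun j => ∑ k, μ (blk ν h ⟨j, k⟩)) (sum_blocks h h') j)
      (PiTensorProduct.tprod K fun a => v (blk (fun j => ∑ k, μ (blk ν h ⟨j, k⟩))
        (sum_blocks h h') ⟨j, a⟩)) =
      sg (shuffleExp (fun k => ∑ c, p (blk μ h' ⟨blk ν h ⟨j, k⟩, c⟩))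
        (fun k => z (blk ν h ⟨j, k⟩))) • glue (y j) (Y j)
        (Q.sub (fun j => ∑ k, μ (blk ν h ⟨j, k⟩)) (sum_blocks h h') j)
        (fun k => μ (blk ν h ⟨j, k⟩)) rfl fun k => PHom.inner Z h' Q v (blk ν h ⟨j, k⟩) := by
    intro j
    rw [PHom.composite_at _ (fun a => hv _), shuffleSign_eq]
    simp only [blk_assoc h', PHom.inner, Quiv.sub_sub]
  simp only [h2]
  rw [map_sg_smul_univ, glueNest, nest_apply]
  simp only [shuffleSign_eq, sg_smul_smul]
  congr 2
  rw [shuffleExp_blk (ν := ν) (h := h), shuffleExp_add_right]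
  simp only [Finset.sum_add_distrib]
  rw [shuffleExp_add_left]
  have h3 : ∀ j, ∑ a, p (blk (fun j => ∑ k, μ (blk ν h ⟨j, k⟩)) (sum_blocks h h') ⟨j, a⟩) =
      ∑ k, ∑ c, p (blk μ h' ⟨blk ν h ⟨j, k⟩, c⟩) := by
    intro j
    rw [sum_blk (ν := fun k => μ (blk ν h ⟨j, k⟩)) (h := rfl)]
    simp only [blk_assoc h']
  simp only [h3]
  ring

theorem PHom.one_at (Q : Quiv ι 1) (v : Fin 1 → V) :
    (PHom.one H ι).at Q (PiTensorProduct.tprod K v) = VNabla.mk H 1 (1 ⊗ₜ[K] v 0) := by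
  simp [PHom.one, PHom.at]

theorem Quiv.not_joins_of_subsingleton [Subsingleton (Fin n)] {Q : Quiv ι n} {e : ι} {a b : Fin n}
    (h : Q.Joins e a b) : False := h.ne (Subsingleton.elim a b)

theorem Quiv.acyclic_of_subsingleton [Subsingleton (Fin n)] (Q : Quiv ι n) : Q.Acyclic := by
  rintro a (_ | ⟨e, L⟩) hL - hp
  · exact hL rfl
  · obtain ⟨c, h1, -⟩ := hp
    exact Quiv.not_joins_of_subsingleton h1

open Classical in
-- On one vertex there are no edges, so the graph conditions are empty; the two conditions on `T`
-- and `S^i` are the relations of `V_∇[Λ₁]`.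
theorem isPcl_one : IsPcl 0 (PHom.one H ι) := by
  constructor
  · intro Q p v hv
    rw [PHom.one_at]
    simpa using VNabla.mk_mem_par (SPoly.one_mem_par (K := K) (N := N) (A := Fin 1)) (hv 0)
  · intro Q hQ
    exact absurd Q.acyclic_of_subsingleton hQ
  · intro Q L hL
    exact absurd Q.acyclic_of_subsingleton hL.not_acyclic
  · intro Q k l hkl t
    rw [Subsingleton.elim k l]
    exact VNabla.pdSub_self H l _
  · intro Q k t
    have h1 : Finset.univ.filter (Q.Conn k) = {k} := by
      refine Finset.eq_singleton_iff_unique_mem.2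
        ⟨Finset.mem_filter.2 ⟨Finset.mem_univ _, Quiv.Conn.refl k⟩, fun a _ => Subsingleton.elim _ _⟩
    rw [h1, Finset.sum_singleton, Finset.sum_singleton]
    refine LinearMap.congr_fun (f := (PHom.one H ι).at Q ∘ₗ H.Tat k)
      (g := -(VNabla.lmul H 1 (SPoly.ev k) ∘ₗ (PHom.one H ι).at Q))
      (H.tensor_ext fun v p hv => ?_) t
    simp only [LinearMap.comp_apply, LinearMap.neg_apply, H.Tat_tprod, PHom.one_at]
    obtain rfl : k = 0 := Subsingleton.elim _ _
    rw [Function.update_self, VNabla.mk_tmul_T]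
    simp
  · intro Q k i t
    refine LinearMap.congr_fun (f := (PHom.one H ι).at Q ∘ₗ H.Sat i k)
      (g := -(sg 0 • VNabla.lmul H 1 (SPoly.od k i) ∘ₗ (PHom.one H ι).at Q))
      (H.tensor_ext fun v p hv => ?_) t
    obtain rfl : k = 0 := Subsingleton.elim _ _
    rw [LinearMap.comp_apply, H.Sat_of_mem i 0 hv, LinearMap.neg_apply, LinearMap.smul_apply,
      LinearMap.comp_apply, map_zsmul, PHom.one_at, PHom.one_at, Function.update_self,
      VNabla.mk_tmul_S H i SPoly.one_mem_par]
    simp [sg_zero]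

theorem blk_const_one (h : ∑ _j : Fin n, 1 = n) (j : Fin n) (k : Fin 1) :
    blk (fun _ => 1) h ⟨j, k⟩ = j := by
  have h1 : ∀ j : Fin n, ∑ i : Fin n, (if i < j then 1 else 0) = (j : ℕ) := by
    intro j
    rw [← Finset.sum_filter, Finset.sum_const, smul_eq_mul, mul_one, Finset.filter_gt_eq_Iio,
      Fin.card_Iio]
  refine Fin.ext ?_
  rw [blk_val, Subsingleton.elim k 0]
  simpa using h1 j

theorem blk_single (h : ∑ _j : Fin 1, n = n) (j : Fin 1) (k : Fin n) :
    blk (fun _ => n) h ⟨j, k⟩ = k := by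
  refine Fin.ext ?_
  rw [blk_val]
  simp

theorem blkIdx_const_one (h : ∑ _j : Fin n, 1 = n) (j : Fin n) : blkIdx (fun _ => 1) h j = j := by
  conv_lhs => rw [← blk_const_one h j 0]
  rw [blkIdx_blk]

/-- The unit is a right unit. -/
theorem PHom.composite_one (h : ∑ _j : Fin n, 1 = n) {x : ZMod 2} {X : PHom H ι n}
    (hX : IsPcl x X) :
    X.composite (fun _ => 1) h x (fun _ => 0) (fun _ => PHom.one H ι) = X := by
  refine PHom.ext_hom fun Q v p hv => ?_
  rw [PHom.composite_at Q hv, shuffleSign_eq, shuffleExp_zero_right, sg_zero, one_smul]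
  simp only [PHom.one_at, blk_const_one]
  rw [glue_one hX]
  have h1 : Q.contract (fun _ => 1) h = Q := by
    refine Quiv.arrow_ext fun e a b => ?_
    rw [Quiv.contract_arrow_eq_some]
    simp only [blkIdx_const_one]
    constructor
    · rintro ⟨a, b, h1, rfl, rfl, -⟩
      exact h1
    · intro h1
      exact ⟨a, b, h1, rfl, rfl, fun hab => Q.noLoop e b (hab ▸ h1)⟩
  have h2 : blkIdx (fun _ => 1) h = id := funext (blkIdx_const_one h)
  rw [h1, h2, VNabla.collect_id]

/-- The unit is a left unit. -/
theorem PHom.one_composite [CharZero K] (h : ∑ _j : Fin 1, n = n) (x : ZMod 2) (X : PHom H ι n) :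
    (PHom.one H ι).composite (fun _ => n) h 0 (fun _ => x) (fun _ => X) = X := by
  refine PHom.ext_hom fun Q v p hv => ?_
  have h0 : shuffleSign (fun j : Fin 1 => ∑ k, p (blk (fun _ => n) h ⟨j, k⟩)) (fun _ => x) = 1 := by
    rw [shuffleSign_eq, shuffleExp_eq_tailPar]
    simp [tailPar, sg_zero]
  have h1 : ∀ j, Q.sub (fun _ => n) h j = Q := fun j => Quiv.arrow_ext fun e a b => by
    rw [Quiv.sub_arrow_eq_some, blk_single, blk_single]
  rw [PHom.composite_at Q hv, h0, one_smul]
  simp only [h1, blk_single]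
  set z := X.at Q (PiTensorProduct.tprod K v) with hz
  -- With a single block the contraction has no edges, hence no variable is shifted.
  have h2 : ∀ a, Q.extSet (fun _ : Fin 1 => n) h a = ∅ := by
    intro a
    refine Finset.eq_empty_of_forall_notMem fun i hi => ?_
    obtain ⟨L, -, h3, e, h4, -⟩ := Quiv.mem_extSet.1 hi
    obtain ⟨_, _, _, _, -, -, h5, -⟩ := h3.split h4
    exact Quiv.not_joins_of_subsingleton h5
  suffices hs : glue 0 (PHom.one H ι) Q (fun _ => n) h =
      MultilinearMap.ofSubsingleton K (VNabla H n) (VNabla H n) 0 LinearMap.id from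
    DFunLike.congr_fun hs fun _ => z
  refine glue_unique (H := H) (A := fun _ k w => VNabla.lmul H n (SPoly.ev k) w)
    (B := fun i w => ∑ c with blkIdx (fun _ => n) h c = i, VNabla.lmul H n (SPoly.ev c) w)
    (R := fun _ _ _ => 0)
    (O := fun _ k s w => VNabla.lmul H n (SPoly.od k s) w) ?_ ?_ ?_ ?_ ?_
  · intro u β hu
    rw [glue_one isPcl_one, PHom.one_at, VNabla.collect, VNabla.subst_mk, map_one]
    rfl
  · intro y p hy j k
    rw [glue_ev isPcl_one, h2, Finset.sum_empty, blk_single]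
  · intro y p hy j k
    obtain rfl : j = 0 := Subsingleton.elim _ _
    simp
  · intro y p hy j k s
    rw [glue_od isPcl_one hy, blk_single, zero_add]
  · intro y p hy j k s
    obtain rfl : j = 0 := Subsingleton.elim _ _
    simp [sg_zero]

end laws

section perm

variable {m n : ℕ}

/-! ### Signs of permutations -/

/-- A symmetric summand depends on unordered pairs only, so the linear order which selects their
representatives is irrelevant. -/
theorem sum_lt_perm {M : Type*} [AddCommMonoid M] (τ : Equiv.Perm (Fin n)) (f : Fin n → Fin n → M)
    (hf : ∀ i j, f i j = f j i) :
    ∑ i, ∑ j, (if i < j then f i j else 0) = ∑ i, ∑ j, if τ i < τ j then f i j else 0 := by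
  have key : ∀ P : Fin n → Fin n → Prop, ∀ [DecidableRel P],
      ∑ i, ∑ j, (if P i j then f i j else 0) = ∑ i, ∑ j, if P j i then f i j else 0 := by
    intro P _
    rw [Finset.sum_comm]
    exact Finset.sum_congr rfl fun i _ => Finset.sum_congr rfl fun j _ => by rw [hf]
  have h1 : ∀ i j, (if i < j then f i j else 0) = (if i < j ∧ τ i < τ j then f i j else 0) +
      if i < j ∧ τ j < τ i then f i j else 0 := by
    intro i j
    by_cases h : i < j
    · rcases lt_or_gt_of_ne (τ.injective.ne h.ne) with h' | h' <;> simp [h, h', h'.not_gt]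
    · simp [h]
  have h2 : ∀ i j, (if τ i < τ j then f i j else 0) = (if i < j ∧ τ i < τ j then f i j else 0) +
      if j < i ∧ τ i < τ j then f i j else 0 := by
    intro i j
    by_cases h : τ i < τ j
    · have : i ≠ j := fun hij => h.ne (congrArg τ hij)
      rcases lt_or_gt_of_ne this with h' | h' <;> simp [h, h', h'.not_gt]
    · simp [h]
  simp only [h1, h2, Finset.sum_add_distrib]
  rw [key fun i j => i < j ∧ τ j < τ i]

/-- A pair is inverted by the product when it is inverted by exactly one of the two steps; pairs
inverted twice cancel modulo two. -/
theorem permExp_mul (σ τ : Equiv.Perm (Fin n)) (p : Fin n → ZMod 2) :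
    permExp (σ * τ) p = permExp τ p + permExp σ (p ∘ τ.symm) := by
  have h1 : permExp σ (p ∘ τ.symm) =
      ∑ i, ∑ j, if τ i < τ j ∧ σ (τ j) < σ (τ i) then p i * p j else 0 := by
    rw [permExp, ← Equiv.sum_comp τ]
    refine Finset.sum_congr rfl fun i _ => ?_
    rw [← Equiv.sum_comp τ]
    simp
  have h2 : ∑ i, ∑ j, (if τ i < τ j ∧ σ (τ j) < σ (τ i) then p i * p j else 0) =
      ∑ i, ∑ j, if i < j then (if (τ i < τ j ∧ σ (τ j) < σ (τ i)) ∨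
        (τ j < τ i ∧ σ (τ i) < σ (τ j)) then p i * p j else 0) else 0 := by
    rw [sum_lt_perm τ _ fun i j => by simp only [mul_comm (p i), or_comm]]
    refine Finset.sum_congr rfl fun i _ => Finset.sum_congr rfl fun j _ => ?_
    by_cases h : τ i < τ j
    · simp [h, h.not_gt]
    · simp [h]
  rw [h1, h2, permExp, permExp, ← Finset.sum_add_distrib]
  refine Finset.sum_congr rfl fun i _ => ?_
  rw [← Finset.sum_add_distrib]
  refine Finset.sum_congr rfl fun j _ => ?_
  simp only [Equiv.Perm.mul_apply]
  by_cases h : i < j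
  · rcases lt_or_gt_of_ne (τ.injective.ne h.ne) with h' | h'
    · simp [h, h', h'.not_gt]
    · rcases lt_or_gt_of_ne (σ.injective.ne (τ.injective.ne h.ne)) with h3 | h3
      · simp [h, h', h'.not_gt, h3, h3.not_gt, add_self_zmod]
      · simp [h, h', h'.not_gt, h3, h3.not_gt]
  · simp [h]

/-- Polarisation of the quadratic exponent. The cross terms are the products `p_i q_j` over ordered
pairs whose order is changed by `σ`, which is the difference of the shuffle exponents before and
after permuting. -/
theorem permExp_add (σ : Equiv.Perm (Fin n)) (p q : Fin n → ZMod 2) :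
    permExp σ (fun i => p i + q i) + permExp σ p + permExp σ q =
      shuffleExp p q + shuffleExp (p ∘ σ.symm) (q ∘ σ.symm) := by
  have h1 : shuffleExp (p ∘ σ.symm) (q ∘ σ.symm) =
      ∑ i, ∑ j, if σ i < σ j then p i * q j else 0 := by
    rw [shuffleExp, ← Equiv.sum_comp σ]
    refine Finset.sum_congr rfl fun i _ => ?_
    rw [← Equiv.sum_comp σ]
    simp
  have h2 : ∑ i, ∑ j, (if i < j ∧ σ j < σ i then q i * p j else 0) =
      ∑ i, ∑ j, if j < i ∧ σ i < σ j then p i * q j else 0 := by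
    rw [Finset.sum_comm]
    exact Finset.sum_congr rfl fun i _ => Finset.sum_congr rfl fun j _ => by rw [mul_comm]
  have h3 : permExp σ (fun i => p i + q i) = permExp σ p + permExp σ q +
      (∑ i, ∑ j, (if i < j ∧ σ j < σ i then p i * q j else 0) +
        ∑ i, ∑ j, if i < j ∧ σ j < σ i then q i * p j else 0) := by
    simp only [permExp, ← Finset.sum_add_distrib]
    refine Finset.sum_congr rfl fun i _ => Finset.sum_congr rfl fun j _ => ?_
    split_ifs <;> ring
  rw [h3, h2, h1, shuffleExp]
  have h4 : ∑ i, ∑ j, (if i < j ∧ σ j < σ i then p i * q j else 0) +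
      ∑ i, ∑ j, (if j < i ∧ σ i < σ j then p i * q j else 0) =
      ∑ i, ∑ j, (if i < j then p i * q j else 0) + ∑ i, ∑ j, if σ i < σ j then p i * q j else 0 := by
    simp only [← Finset.sum_add_distrib]
    refine Finset.sum_congr rfl fun i _ => Finset.sum_congr rfl fun j _ => ?_
    rcases lt_trichotomy i j with h | rfl | h
    · rcases lt_or_gt_of_ne (σ.injective.ne h.ne) with h' | h' <;>
        simp [h, h', h.not_gt, h'.not_gt, add_self_zmod]
    · simp
    · rcases lt_or_gt_of_ne (σ.injective.ne h.ne) with h' | h' <;>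
        simp [h, h', h.not_gt, h'.not_gt]
  rw [h4]
  have h5 := add_self_zmod (permExp σ p)
  have h6 := add_self_zmod (permExp σ q)
  linear_combination h5 + h6

/-- The case of `permExp_add` in which the second family is the indicator of `k`, whose own exponent
vanishes. -/
theorem permExp_update (σ : Equiv.Perm (Fin n)) (p : Fin n → ZMod 2) (k : Fin n) :
    permExp σ (Function.update p k (p k + 1)) = permExp σ p +
      ((∑ i, if i < k then p i else 0) + ∑ i, if σ i < σ k then p i else 0) := by
  have h1 : Function.update p k (p k + 1) = fun i => p i + (Pi.single k 1 : Fin n → ZMod 2) i := by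
    funext i
    by_cases hi : i = k
    · subst hi; simp
    · simp [hi]
  have h2 : permExp σ (Pi.single k (1 : ZMod 2)) = 0 := by
    refine Finset.sum_eq_zero fun i _ => Finset.sum_eq_zero fun j _ => ?_
    by_cases hi : i = k
    · by_cases hj : j = k
      · simp [hi, hj]
      · simp [hj]
    · simp [hi]
  have h3 : ∀ q : Fin n → ZMod 2, ∀ k, shuffleExp q (Pi.single k 1) = ∑ i, if i < k then q i else 0 := by
    intro q k
    refine Finset.sum_congr rfl fun i _ => ?_
    rw [Finset.sum_eq_single k (fun j _ hj => by simp [hj]) (by simp)]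
    simp
  have h4 := permExp_add σ p (Pi.single k 1)
  have h5 : (Pi.single k (1 : ZMod 2) : Fin n → ZMod 2) ∘ σ.symm = Pi.single (σ k) 1 := by
    funext i
    simp [Pi.single_apply, Equiv.symm_apply_eq]
  have h7 := Equiv.sum_comp σ (fun i => if i < σ k then (p ∘ σ.symm) i else 0)
  simp only [Function.comp_apply, Equiv.symm_apply_apply] at h7
  rw [h5, h3, h3, h2, ← h1] at h4
  simp only [Function.comp_apply] at h4
  rw [← h7] at h4
  have h6 := add_self_zmod (permExp σ p)
  linear_combination h4 - h6

theorem permExp_one (p : Fin n → ZMod 2) : permExp 1 p = 0 := by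
  refine Finset.sum_eq_zero fun i _ => Finset.sum_eq_zero fun j _ => if_neg ?_
  rintro ⟨h1, h2⟩
  exact absurd h1 h2.not_gt

end perm

namespace Quiv

/-! ### Renaming the vertices of quivers -/

variable {ι : Type*} {n : ℕ} {Q : Quiv ι n} {σ : Equiv.Perm (Fin n)} {e : ι} {L : List ι}

theorem perm_arrow_eq_some {a b : Fin n} : (Q.perm σ).arrow e = some (σ a, σ b) ↔
    Q.arrow e = some (a, b) := by
  simp only [perm, Option.map_eq_some_iff, Prod.exists, Prod.map_apply, Prod.mk.injEq,
    EmbeddingLike.apply_eq_iff_eq]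
  constructor
  · rintro ⟨a, b, h, rfl, rfl⟩; exact h
  · exact fun h => ⟨a, b, h, rfl, rfl⟩

theorem perm_arrow_eq_some' {a b : Fin n} : (Q.perm σ).arrow e = some (a, b) ↔
    Q.arrow e = some (σ.symm a, σ.symm b) := by
  obtain ⟨a, rfl⟩ := σ.surjective a
  obtain ⟨b, rfl⟩ := σ.surjective b
  rw [perm_arrow_eq_some, Equiv.symm_apply_apply, Equiv.symm_apply_apply]

theorem perm_joins {a b : Fin n} : (Q.perm σ).Joins e (σ a) (σ b) ↔ Q.Joins e a b := by
  rw [Joins, Joins, perm_arrow_eq_some, perm_arrow_eq_some]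

theorem perm_isPath {a b : Fin n} : (Q.perm σ).IsPath (σ a) L (σ b) ↔ Q.IsPath a L b := by
  induction L generalizing a with
  | nil => exact σ.injective.eq_iff
  | cons e L ih =>
    constructor
    · rintro ⟨c, h1, h2⟩
      obtain ⟨c, rfl⟩ := σ.surjective c
      exact ⟨c, perm_joins.1 h1, ih.1 h2⟩
    · rintro ⟨c, h1, h2⟩
      exact ⟨σ c, perm_joins.2 h1, ih.2 h2⟩

theorem perm_isDirPath {a b : Fin n} : (Q.perm σ).IsDirPath (σ a) L (σ b) ↔ Q.IsDirPath a L b := by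
  induction L generalizing a with
  | nil => exact σ.injective.eq_iff
  | cons e L ih =>
    constructor
    · rintro ⟨c, h1, h2⟩
      obtain ⟨c, rfl⟩ := σ.surjective c
      exact ⟨c, perm_arrow_eq_some.1 h1, ih.1 h2⟩
    · rintro ⟨c, h1, h2⟩
      exact ⟨σ c, perm_arrow_eq_some.2 h1, ih.2 h2⟩

theorem perm_conn {a b : Fin n} : (Q.perm σ).Conn (σ a) (σ b) ↔ Q.Conn a b := by
  simp only [Conn, perm_isPath]

theorem perm_acyclic : (Q.perm σ).Acyclic ↔ Q.Acyclic := by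
  constructor
  · exact fun h a L h1 h2 h3 => h (σ a) L h1 h2 (perm_isPath.2 h3)
  · intro h a L h1 h2 h3
    obtain ⟨a, rfl⟩ := σ.surjective a
    exact h a L h1 h2 (perm_isPath.1 h3)

theorem IsDirCycle.perm (hL : Q.IsDirCycle L) : (Q.perm σ).IsDirCycle L := by
  obtain ⟨h1, h2, a, h3⟩ := hL
  exact ⟨h1, h2, σ a, perm_isDirPath.2 h3⟩

theorem perm_del (α : ι) : (Q.del α).perm σ = (Q.perm σ).del α := by
  refine arrow_ext fun e a b => ?_
  rw [perm_arrow_eq_some', del_arrow_eq_some, del_arrow_eq_some, perm_arrow_eq_some']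

theorem perm_one : Q.perm 1 = Q := by
  refine arrow_ext fun e a b => ?_
  rw [perm_arrow_eq_some']
  rfl

theorem perm_perm (τ : Equiv.Perm (Fin n)) : (Q.perm τ).perm σ = Q.perm (σ * τ) := by
  refine arrow_ext fun e a b => ?_
  rw [perm_arrow_eq_some', perm_arrow_eq_some', perm_arrow_eq_some']
  rfl

end Quiv

section act

variable {K : Type*} [Field K] {N : ℕ} {V : Type*} [AddCommGroup V] [Module K V]
  {H : HWSupermodule K N V} {ι : Type*} {n : ℕ}

/-! ### The action of the symmetric groups -/

theorem permTensor_of_mem (σ : Equiv.Perm (Fin n)) {v : Fin n → V} {p : Fin n → ZMod 2}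
    (hv : ∀ i, v i ∈ H.par (p i)) : permTensor H σ (PiTensorProduct.tprod K v) =
      permSign σ p • PiTensorProduct.tprod K (v ∘ σ.symm) := by
  have h1 : ∀ (c : ℤ) (f : Module.End K (⨂[K] _ : Fin n, V)) t, (c • f) t = c • f t :=
    fun _ _ _ => rfl
  rw [permTensor, LinearMap.sum_apply, Finset.sum_eq_single p]
  · rw [h1, LinearMap.comp_apply, PiTensorProduct.map_tprod]
    simp only [H.proj_of_mem (hv _), if_true]
    congr 1
    exact PiTensorProduct.reindex_tprod _ _
  · intro q _ hq
    obtain ⟨i, hi⟩ := Function.ne_iff.1 hq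
    rw [h1, LinearMap.comp_apply, PiTensorProduct.map_tprod,
      MultilinearMap.map_coord_zero _ i, map_zero]
    · exact zsmul_zero _
    rw [H.proj_of_mem (hv i), if_neg (Ne.symm hi)]
  · simp

theorem PHom.act_at (σ : Equiv.Perm (Fin n)) (X : PHom H ι n) (Q : Quiv ι n) {v : Fin n → V}
    {p : Fin n → ZMod 2} (hv : ∀ i, v i ∈ H.par (p i)) :
    (PHom.act σ X).at Q (PiTensorProduct.tprod K v) = permSign σ p •
      VNabla.collect H σ (X.at (Q.perm σ) (PiTensorProduct.tprod K (v ∘ σ.symm))) := by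
  have h1 : ∀ t, (PHom.act σ X).at Q t =
      VNabla.collect H σ (X.at (Q.perm σ) (permTensor H σ t)) := fun t => by
    simp only [PHom.at, PHom.act, LinearMap.comp_apply, LinearMap.flip_apply,
      TensorProduct.mk_apply, TensorProduct.map_tmul, Finsupp.lmapDomain_apply,
      Finsupp.mapDomain_single, VNabla.perm_eq_collect]
  rw [h1, permTensor_of_mem σ hv, map_zsmul, map_zsmul]

theorem PHom.act_eq_zero {σ : Equiv.Perm (Fin n)} {X : PHom H ι n} {Q : Quiv ι n}
    (hX : X.at (Q.perm σ) = 0) : (PHom.act σ X).at Q = 0 :=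
  H.tensor_ext fun v p hv => by
    rw [PHom.act_at σ X Q hv, hX, LinearMap.zero_apply, map_zero, smul_zero, LinearMap.zero_apply]

theorem VNabla.collect_perm_ev (σ : Equiv.Perm (Fin n)) (k : Fin n) (y : VNabla H n) :
    VNabla.collect H σ (VNabla.lmul H n (SPoly.ev k) y) =
      VNabla.lmul H n (SPoly.ev (σ.symm k)) (VNabla.collect H σ y) := by
  have : Finset.univ.filter (fun l => σ l = k) = {σ.symm k} := by
    ext l; simp [Equiv.eq_symm_apply]
  rw [VNabla.collect_ev, this, Finset.sum_singleton]

theorem VNabla.collect_perm_od (σ : Equiv.Perm (Fin n)) (k : Fin n) (s : Fin N) (y : VNabla H n) :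
    VNabla.collect H σ (VNabla.lmul H n (SPoly.od k s) y) =
      VNabla.lmul H n (SPoly.od (σ.symm k) s) (VNabla.collect H σ y) := by
  have : Finset.univ.filter (fun l => σ l = k) = {σ.symm k} := by
    ext l; simp [Equiv.eq_symm_apply]
  rw [VNabla.collect_od, this, Finset.sum_singleton]

theorem update_comp_symm {β : Type*} (σ : Equiv.Perm (Fin n)) (v : Fin n → β) (k : Fin n) (w : β) :
    Function.update v k w ∘ σ.symm = Function.update (v ∘ σ.symm) (σ k) w := by
  funext i
  by_cases hi : σ.symm i = k
  · have : i = σ k := by rw [← hi, Equiv.apply_symm_apply]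
    subst this; simp
  · have : i ≠ σ k := fun h => hi (by rw [h, Equiv.symm_apply_apply])
    simp [hi, this]

open Classical in
/-- The action of permutations preserves the cycle relations and the sesquilinearity conditions. -/
theorem IsPcl.act [CharZero K] {x : ZMod 2} {X : PHom H ι n} (hX : IsPcl x X)
    (σ : Equiv.Perm (Fin n)) : IsPcl x (PHom.act σ X) := by
  constructor
  · intro Q p v hv
    rw [PHom.act_at σ X Q hv, ← Equiv.sum_comp σ.symm p]
    exact zsmul_mem (VNabla.collect_mem _ (hX.parity _ (p ∘ σ.symm) _ fun i => hv _)) _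
  · intro Q hQ
    exact PHom.act_eq_zero (hX.cycle₁ _ fun h => hQ (Quiv.perm_acyclic.1 h))
  · intro Q L hL
    refine H.tensor_ext fun v p hv => ?_
    rw [← List.sum_toFinset _ hL.2.1, LinearMap.sum_apply, LinearMap.zero_apply]
    simp only [PHom.act_at σ X _ hv, Quiv.perm_del]
    rw [← Finset.smul_sum, ← map_sum, hX.sum_cycle hL.perm, map_zero, smul_zero]
  · intro Q k l hkl t
    refine LinearMap.congr_fun (f := VNabla.pdSub H k l ∘ₗ (PHom.act σ X).at Q) (g := 0)
      (H.tensor_ext fun v p hv => ?_) t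
    rw [LinearMap.comp_apply, PHom.act_at σ X Q hv, map_zsmul, VNabla.pdSub_collect,
      hX.sesq₁ _ _ _ (Quiv.perm_conn.2 hkl), map_zero, smul_zero, LinearMap.zero_apply]
  · intro Q k t
    have := LinearMap.congr_fun (f := ∑ l with Q.Conn k l, (PHom.act σ X).at Q ∘ₗ H.Tat l)
      (g := -∑ l with Q.Conn k l, VNabla.lmul H n (SPoly.ev l) ∘ₗ (PHom.act σ X).at Q)
      (H.tensor_ext fun v p hv => ?_) t
    · simpa only [LinearMap.sum_apply, LinearMap.neg_apply, LinearMap.comp_apply] using this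
    simp only [LinearMap.sum_apply, LinearMap.neg_apply, LinearMap.comp_apply, H.Tat_tprod,
      PHom.act_at σ X Q hv, PHom.act_at σ X Q (H.update_T_mem hv _), map_zsmul]
    rw [← Finset.smul_sum, ← Finset.smul_sum, ← smul_neg]
    congr 1
    have h1 := congrArg (VNabla.collect H σ)
      (hX.sesq₂ (Q.perm σ) (σ k) (PiTensorProduct.tprod K (v ∘ σ.symm)))
    rw [map_neg, map_sum, map_sum] at h1
    simp only [Finset.sum_filter] at h1 ⊢
    rw [← Equiv.sum_comp σ, ← Equiv.sum_comp σ (fun a => if (Q.perm σ).Conn (σ k) a then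
      VNabla.collect H σ (VNabla.lmul H n (SPoly.ev a) _) else 0)] at h1
    simpa only [Quiv.perm_conn, H.Tat_tprod, VNabla.collect_perm_ev, Equiv.symm_apply_apply,
      update_comp_symm, Function.comp_apply] using h1
  · intro Q k i t
    have := LinearMap.congr_fun (f := (PHom.act σ X).at Q ∘ₗ H.Sat i k)
      (g := -(sg x • VNabla.lmul H n (SPoly.od k i) ∘ₗ (PHom.act σ X).at Q))
      (H.tensor_ext fun v p hv => ?_) t
    · simpa only [LinearMap.smul_apply, LinearMap.neg_apply, LinearMap.comp_apply] using this
    simp only [LinearMap.smul_apply, LinearMap.neg_apply, LinearMap.comp_apply]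
    have h1 := congrArg (VNabla.collect H σ)
      (hX.sesq₃ (Q.perm σ) (σ k) i (PiTensorProduct.tprod K (v ∘ σ.symm)))
    rw [H.Sat_of_mem i (σ k) (v := v ∘ σ.symm) (p := p ∘ σ.symm) (fun i => hv _), map_zsmul, map_zsmul, map_neg,
      map_zsmul, VNabla.collect_perm_od, Equiv.symm_apply_apply, ← Equiv.sum_comp σ] at h1
    simp only [Function.comp_apply, Equiv.symm_apply_apply] at h1
    have h2 := congrArg (fun z => sg (∑ i, if σ i < σ k then p i else 0) • z) h1
    simp only [sg_smul_self] at h2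
    rw [H.Sat_of_mem i k hv, map_zsmul, PHom.act_at σ X Q (H.update_S_mem hv i k),
      PHom.act_at σ X Q hv, update_comp_symm, permSign_eq, permSign_eq, permExp_update]
    refine (congrArg (fun z => _ • _ • z) h2).trans ?_
    simp only [smul_neg, map_zsmul, sg_smul_smul]
    congr 3
    have h8 := add_self_zmod (∑ i, if σ i < σ k then p i else 0)
    have h9 := add_self_zmod (∑ i, if i < k then p i else 0)
    linear_combination h8 + h9

theorem PHom.act_one (X : PHom H ι n) : PHom.act 1 X = X := by
  refine PHom.ext_hom fun Q v p hv => ?_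
  rw [PHom.act_at _ X Q hv, permSign_eq, permExp_one, sg_zero, one_smul, Quiv.perm_one]
  exact VNabla.collect_id H _

theorem PHom.act_mul (σ τ : Equiv.Perm (Fin n)) (X : PHom H ι n) :
    PHom.act (σ * τ) X = PHom.act τ (PHom.act σ X) := by
  refine PHom.ext_hom fun Q v p hv => ?_
  rw [PHom.act_at _ X Q hv, PHom.act_at _ _ Q hv,
    PHom.act_at _ X (Q.perm τ) (v := v ∘ τ.symm) (p := p ∘ τ.symm) (fun i => hv _), map_zsmul,
    VNabla.collect_collect, Quiv.perm_perm, permSign_eq, permSign_eq, permSign_eq, sg_smul_smul,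
    permExp_mul]
  rfl

end act

/-! ### Block permutations and gluing with a permuted map. -/

section blockPerm

variable {m n : ℕ} {ν : Fin m → ℕ} {h : ∑ j, ν j = n} {σ : Equiv.Perm (Fin m)}
  {τ : ∀ j, Equiv.Perm (Fin (ν j))}

theorem blockPerm_symm_blk (j : Fin m) (k : Fin (ν (σ.symm j))) :
    (blockPerm ν h σ τ).symm (blk (fun j => ν (σ.symm j)) (sum_comp_symm ν h σ) ⟨j, k⟩) =
      blk ν h ⟨σ.symm j, (τ (σ.symm j)).symm k⟩ := by
  rw [Equiv.symm_apply_eq]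
  simp only [blockPerm, Equiv.trans_apply, Equiv.symm_apply_apply, Equiv.sigmaCongrRight_apply,
    Equiv.apply_symm_apply]
  congr 1
  rw [← Equiv.symm_apply_eq]
  rfl

theorem blkIdx_blockPerm (a : Fin n) :
    blkIdx (fun j => ν (σ.symm j)) (sum_comp_symm ν h σ) (blockPerm ν h σ τ a) =
      σ (blkIdx ν h a) := by
  obtain ⟨b, rfl⟩ := (blockPerm ν h σ τ).symm.surjective a
  obtain ⟨⟨j, k⟩, rfl⟩ := (blk (fun j => ν (σ.symm j)) (sum_comp_symm ν h σ)).surjective b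
  rw [Equiv.apply_symm_apply, blkIdx_blk, blockPerm_symm_blk, blkIdx_blk, Equiv.apply_symm_apply]

theorem blkIdx_blockPerm_symm (a : Fin n) : blkIdx ν h ((blockPerm ν h σ τ).symm a) =
    σ.symm (blkIdx (fun j => ν (σ.symm j)) (sum_comp_symm ν h σ) a) := by
  rw [Equiv.eq_symm_apply, ← blkIdx_blockPerm (τ := τ), Equiv.apply_symm_apply]

theorem blockPerm_lt_iff {j j' : Fin m} {k : Fin (ν j)} {k' : Fin (ν j')} :
    blockPerm ν h σ τ (blk ν h ⟨j, k⟩) < blockPerm ν h σ τ (blk ν h ⟨j', k'⟩) ↔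
      σ j < σ j' ∨ (j = j' ∧ (τ j k : ℕ) < τ j' k') := by
  obtain ⟨j, rfl⟩ := σ.symm.surjective j
  obtain ⟨j', rfl⟩ := σ.symm.surjective j'
  obtain ⟨k, rfl⟩ := (τ _).symm.surjective k
  obtain ⟨k', rfl⟩ := (τ _).symm.surjective k'
  rw [← blockPerm_symm_blk, ← blockPerm_symm_blk, Equiv.apply_symm_apply, Equiv.apply_symm_apply,
    blk_lt_iff]
  simp

/-- An inversion is either a pair from two blocks exchanged by `σ` or an inversion of `τ j` inside
one block. -/
theorem permExp_blockPerm (p : Fin n → ZMod 2) : permExp (blockPerm ν h σ τ) p =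
    permExp σ (fun j => ∑ k, p (blk ν h ⟨j, k⟩)) +
      ∑ j, permExp (τ j) fun k => p (blk ν h ⟨j, k⟩) := by
  rw [permExp, sum_blk (ν := ν) (h := h), permExp, ← Finset.sum_add_distrib]
  refine Finset.sum_congr rfl fun j _ => ?_
  have h1 : ∀ k, ∑ b, (if blk ν h ⟨j, k⟩ < b ∧ blockPerm ν h σ τ b <
      blockPerm ν h σ τ (blk ν h ⟨j, k⟩) then p (blk ν h ⟨j, k⟩) * p b else 0) =
      (∑ j', if j < j' ∧ σ j' < σ j then p (blk ν h ⟨j, k⟩) * ∑ k', p (blk ν h ⟨j', k'⟩) else 0) +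
      ∑ k', if k < k' ∧ τ j k' < τ j k then p (blk ν h ⟨j, k⟩) * p (blk ν h ⟨j, k'⟩) else 0 := by
    intro k
    rw [sum_blk (ν := ν) (h := h), ← Finset.add_sum_erase _ _ (Finset.mem_univ j),
      ← Finset.add_sum_erase _ (fun j' => if j < j' ∧ σ j' < σ j then _ else 0)
      (Finset.mem_univ j)]
    simp only [blk_lt_iff, blockPerm_lt_iff, lt_irrefl, false_or, true_and, false_and, if_false,
      zero_add, Fin.val_fin_lt]
    rw [add_comm]
    congr 1
    refine Finset.sum_congr rfl fun j' hj' => ?_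
    have : j ≠ j' := (Finset.ne_of_mem_erase hj').symm
    by_cases hlt : j < j' ∧ σ j' < σ j <;> simp [this, this.symm, hlt, Finset.mul_sum]
  simp only [h1, Finset.sum_add_distrib]
  rw [Finset.sum_comm]
  congr 1
  refine Finset.sum_congr rfl fun j' _ => ?_
  split_ifs
  · rw [Finset.sum_mul]
  · simp

namespace Quiv

variable {ι : Type*} {Q : Quiv ι n}

theorem perm_sub (j : Fin m) : (Q.perm (blockPerm ν h σ τ)).sub (fun j => ν (σ.symm j))
    (sum_comp_symm ν h σ) j = (Q.sub ν h (σ.symm j)).perm (τ (σ.symm j)) := by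
  refine arrow_ext fun e a b => ?_
  rw [sub_arrow_eq_some, perm_arrow_eq_some', perm_arrow_eq_some', sub_arrow_eq_some,
    blockPerm_symm_blk, blockPerm_symm_blk]

theorem perm_contract : (Q.perm (blockPerm ν h σ τ)).contract (fun j => ν (σ.symm j))
    (sum_comp_symm ν h σ) = (Q.contract ν h).perm σ := by
  refine arrow_ext fun e i j => ?_
  rw [contract_arrow_eq_some, perm_arrow_eq_some', contract_arrow_eq_some]
  constructor
  · rintro ⟨a, b, h1, rfl, rfl, h2⟩
    refine ⟨_, _, perm_arrow_eq_some'.1 h1, blkIdx_blockPerm_symm _, blkIdx_blockPerm_symm _,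
      fun h3 => h2 (σ.symm.injective h3)⟩
  · rintro ⟨a, b, h1, h2, h3, h4⟩
    refine ⟨_, _, perm_arrow_eq_some.2 h1, ?_, ?_, fun h5 => h4 (congrArg _ h5)⟩
    · rw [blkIdx_blockPerm, h2, Equiv.apply_symm_apply]
    · rw [blkIdx_blockPerm, h3, Equiv.apply_symm_apply]

theorem perm_extConn (i : Fin m) (a : Fin n) :
    (Q.perm (blockPerm ν h σ τ)).ExtConn (fun j => ν (σ.symm j)) (sum_comp_symm ν h σ) (σ i)
      (blockPerm ν h σ τ a) ↔ Q.ExtConn ν h i a := by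
  simp only [ExtConn, perm_contract, blkIdx_blockPerm, perm_isPath]
  refine exists_congr fun L => and_congr_right fun _ => and_congr_right fun _ =>
    exists_congr fun e => and_congr_right fun _ => ?_
  constructor
  · rintro ⟨b, hb⟩
    obtain ⟨b, rfl⟩ := (blockPerm ν h σ τ).surjective b
    exact ⟨b, perm_joins.1 hb⟩
  · rintro ⟨b, hb⟩
    exact ⟨_, perm_joins.2 hb⟩

theorem sum_perm_extSet {G : Type*} [AddCommMonoid G] (f : Fin m → G) (a : Fin n) :
    ∑ i ∈ (Q.perm (blockPerm ν h σ τ)).extSet (fun j => ν (σ.symm j)) (sum_comp_symm ν h σ)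
      (blockPerm ν h σ τ a), f i = ∑ i ∈ Q.extSet ν h a, f (σ i) := by
  symm
  refine Finset.sum_bij (fun i _ => σ i) (fun i hi => ?_) (fun i _ j _ hij => σ.injective hij)
    (fun i hi => ?_) fun i _ => rfl
  · exact mem_extSet.2 ((perm_extConn i a).2 (mem_extSet.1 hi))
  · obtain ⟨i, rfl⟩ := σ.surjective i
    exact ⟨i, mem_extSet.2 ((perm_extConn i a).1 (mem_extSet.1 hi)), rfl⟩

end Quiv

section glue

variable {K : Type*} [Field K] [CharZero K] {N : ℕ} {V : Type*} [AddCommGroup V] [Module K V]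
  {H : HWSupermodule K N V} {ι : Type*}

/-- The projection of `V_∇[Λ_k]_k` onto its part of parity `q`. -/
def VNabla.proj (H : HWSupermodule K N V) (n : ℕ) (q : ZMod 2) : Module.End K (VNabla H n) :=
  (2 : K)⁻¹ • (LinearMap.id + sg q • VNabla.eps H n)

theorem VNabla.proj_of_mem {p q : ZMod 2} {y : VNabla H n} (hy : y ∈ VNabla.par H n p) :
    VNabla.proj H n q y = if p = q then y else 0 := by
  have h1 : VNabla.proj H n q y = (2 : K)⁻¹ • (y + sg (q + p) • y) := by
    rw [← sg_smul_smul, ← (VNabla.mem_par_iff H).1 hy]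
    rfl
  have h2 : ∀ q : ZMod 2, q = 0 ∨ q = 1 := by decide
  rw [h1]
  split_ifs with hpq
  · subst hpq
    rw [add_self_zmod, sg_zero, one_smul, ← two_smul K y, smul_smul, inv_mul_cancel₀ two_ne_zero,
      one_smul]
  · have h3 : ∀ q p : ZMod 2, ¬p = q → q + p = 1 := by decide
    have := h3 q p hpq
    rw [this, show sg 1 = -1 from rfl, neg_one_zsmul, add_neg_cancel, smul_zero]

/-- The gluing maps of `X^σ`. -/
theorem glue_act {x : ZMod 2} {X : PHom H ι m} (hX : IsPcl x X) (Q : Quiv ι n)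
    {f : ∀ j, VNabla H (ν j)} {q : Fin m → ZMod 2} (hf : ∀ j, f j ∈ VNabla.par H (ν j) (q j)) :
    glue x (PHom.act σ X) Q ν h (fun j => VNabla.collect H (τ j) (f j)) =
      permSign σ q • VNabla.collect H (blockPerm ν h σ τ) (glue x X (Q.perm (blockPerm ν h σ τ))
        (fun j => ν (σ.symm j)) (sum_comp_symm ν h σ) fun j => f (σ.symm j)) := by
  set ρ := blockPerm ν h σ τ with hρ
  set Φ : MultilinearMap K (fun j => VNabla H (ν j)) (VNabla H n) :=
    (glue x (PHom.act σ X) Q ν h).compLinearMap fun j => VNabla.collect H (τ j) with hΦ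
  set Γ : MultilinearMap K (fun j => VNabla H (ν j)) (VNabla H n) :=
    (MultilinearMap.domDomCongrLinearEquiv' K K (fun j => VNabla H (ν j)) (VNabla H n) σ).symm
      (glue x X (Q.perm ρ) (fun j => ν (σ.symm j)) (sum_comp_symm ν h σ)) with hΓ
  have hΓ₀ : ∀ f, Γ f = glue x X (Q.perm ρ) (fun j => ν (σ.symm j)) (sum_comp_symm ν h σ)
    fun j => f (σ.symm j) := fun f => rfl
  -- The Koszul sign is quadratic in the parities of the arguments, so it is made multilinear by
  -- projecting each argument onto its homogeneous parts.
  set Ψ : MultilinearMap K (fun j => VNabla H (ν j)) (VNabla H n) :=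
    ∑ q : Fin m → ZMod 2, permSign σ q • (VNabla.collect H ρ).compMultilinearMap
      (Γ.compLinearMap fun j => VNabla.proj H (ν j) (q j)) with hΨ
  have hΨ₀ : ∀ {f : ∀ j, VNabla H (ν j)} {q : Fin m → ZMod 2},
      (∀ j, f j ∈ VNabla.par H (ν j) (q j)) → Ψ f = permSign σ q • VNabla.collect H ρ (Γ f) := by
    intro f q hf
    rw [hΨ, sum_apply, Finset.sum_eq_single q]
    · rw [smul_apply, LinearMap.compMultilinearMap_apply, MultilinearMap.compLinearMap_apply]
      simp only [VNabla.proj_of_mem (hf _), if_true]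
    · intro q' _ hq'
      obtain ⟨j, hj⟩ := Function.ne_iff.1 hq'
      rw [smul_apply, LinearMap.compMultilinearMap_apply, MultilinearMap.compLinearMap_apply,
        MultilinearMap.map_coord_zero _ j, map_zero, smul_zero]
      rw [VNabla.proj_of_mem (hf j), if_neg (Ne.symm hj)]
    · simp
  refine Eq.trans (b := Ψ f) ?_ (hΨ₀ hf)
  change Φ f = Ψ f
  congr 1
  have hmem : ∀ {f : ∀ k, VNabla H (ν k)} {q : Fin m → ZMod 2},
      (∀ k, f k ∈ VNabla.par H (ν k) (q k)) → ∀ (j : Fin m) w p, w ∈ VNabla.par H (ν j) p →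
      ∀ k, Function.update f j w k ∈ VNabla.par H (ν k) (Function.update q j p k) := by
    intro f q hf j w p hw k
    by_cases hk : k = j
    · subst hk; simpa using hw
    · simpa [hk] using hf k
  have hΦu : ∀ (f : ∀ j, VNabla H (ν j)) j w, Φ (Function.update f j w) = glue x (PHom.act σ X) Q ν h
      (Function.update (fun j => VNabla.collect H (τ j) (f j)) j (VNabla.collect H (τ j) w)) := by
    intro f j w
    rw [hΦ, MultilinearMap.compLinearMap_apply]
    congr 1
    exact funext fun i => Function.apply_update (fun i => VNabla.collect H (τ i)) f j w i
  have hΓu : ∀ (f : ∀ j, VNabla H (ν j)) j w, Γ (Function.update f (σ.symm j) w) =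
      glue x X (Q.perm ρ) (fun j => ν (σ.symm j)) (sum_comp_symm ν h σ)
        (Function.update (fun j => f (σ.symm j)) j w) := by
    intro f j w
    rw [hΓ₀, Function.update_comp_eq_of_injective' f σ.symm.injective]
  refine glue_unique (H := H)
    (A := fun j k w => VNabla.lmul H n (SPoly.ev (blk ν h ⟨j, (τ j).symm k⟩)) w)
    (B := fun i w => ∑ a with blkIdx ν h a = i, VNabla.lmul H n (SPoly.ev a) w)
    (R := fun j k f => ∑ i ∈ Q.extSet ν h (blk ν h ⟨j, (τ j).symm k⟩), f i)
    (O := fun j k s w => sg x • VNabla.lmul H n (SPoly.od (blk ν h ⟨j, (τ j).symm k⟩) s) w)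
    ?_ ?_ ?_ ?_ ?_
  · intro u β hu
    have h1 : ∀ j, VNabla.mk H (ν j) (1 ⊗ₜ[K] u j) ∈ VNabla.par H (ν j) (β j) := fun j => by
      simpa using VNabla.mk_mem_par (H := H) (SPoly.one_mem_par (K := K) (N := N)) (hu j)
    have h2 : ∀ j, VNabla.collect H (τ j) (VNabla.mk H (ν j) (1 ⊗ₜ[K] u j)) =
        VNabla.mk H (ν j) (1 ⊗ₜ[K] u j) := fun j => by
      simp only [VNabla.collect, VNabla.subst_mk, map_one]
    rw [hΨ₀ h1, hΓ₀, glue_one hX (fun j => u (σ.symm j)), hΦ, MultilinearMap.compLinearMap_apply]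
    simp only [h2]
    rw [glue_one (hX.act σ), PHom.act_at σ X _ hu, map_zsmul, VNabla.collect_collect,
      VNabla.collect_collect, Quiv.perm_contract]
    have h3 : σ ∘ blkIdx ν h = blkIdx (fun j => ν (σ.symm j)) (sum_comp_symm ν h σ) ∘ ρ :=
      funext fun a => (blkIdx_blockPerm a).symm
    rw [h3]
    rfl
  · intro f q hf j k
    rw [hΦu, VNabla.collect_perm_ev]
    refine (glue_ev (hX.act σ) (fun j => VNabla.collect H (τ j) (f j)) j _).trans ?_
    simp only [glueXi_apply, VNabla.tot_collect, hΦu]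
    rfl
  · intro f q hf j k
    obtain ⟨j, rfl⟩ := σ.symm.surjective j
    have h1 := hmem hf (σ.symm j) _ _ (VNabla.lmul_ev_mem k (hf _))
    have h2 : ∀ i, Ψ (Function.update f i (VNabla.tot H (ν i) (f i))) = permSign σ q •
        VNabla.collect H ρ (Γ (Function.update f i (VNabla.tot H (ν i) (f i)))) := fun i => by
      have := hmem hf i _ _ (VNabla.tot_mem (hf _))
      rw [Function.update_eq_self] at this
      exact hΨ₀ this
    rw [Function.update_eq_self] at h1
    simp only [h2]
    have hb : blk (fun j => ν (σ.symm j)) (sum_comp_symm ν h σ) ⟨j, k⟩ =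
        ρ (blk ν h ⟨σ.symm j, (τ (σ.symm j)).symm k⟩) := by
      rw [← blockPerm_symm_blk, Equiv.apply_symm_apply]
    rw [hΨ₀ h1, hΨ₀ hf, hΓu, glue_ev (Q := Q.perm ρ) (h := sum_comp_symm ν h σ) hX
      (fun j => f (σ.symm j)) j k, map_add, VNabla.collect_perm_ev, blockPerm_symm_blk, hb,
      Quiv.sum_perm_extSet, smul_add, map_zsmul, map_sum, Finset.smul_sum]
    congr 1
    refine Finset.sum_congr rfl fun i _ => ?_
    obtain ⟨i, rfl⟩ := σ.symm.surjective i
    rw [hΓu, Equiv.apply_symm_apply, glueXi_apply, map_sub, smul_sub, map_sum]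
    congr 1
    simp only [VNabla.collect_perm_ev, map_zsmul, Finset.smul_sum, Finset.sum_filter]
    rw [← Equiv.sum_comp ρ]
    simp only [hρ, blkIdx_blockPerm, Equiv.symm_apply_apply, Equiv.eq_symm_apply]
    simp only [smul_ite, smul_zero]
    rfl
  · intro f q hf j k s
    rw [hΦu, VNabla.collect_perm_od]
    refine (glue_od (hX.act σ) (fun j => VNabla.collect_mem _ (hf j)) j _ s).trans ?_
    rw [add_comm x, ← sg_smul_smul]
    rfl
  · intro f q hf j k s
    obtain ⟨j, rfl⟩ := σ.symm.surjective j
    have h1 := hmem hf (σ.symm j) _ _ (VNabla.lmul_od_mem k s (hf _))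
    rw [hΨ₀ h1, hΨ₀ hf, hΓu]
    have h3 := glue_od (Q := Q.perm ρ) (h := sum_comp_symm ν h σ) hX
      (fun j => hf (σ.symm j)) j k s
    rw [h3, map_zsmul, VNabla.collect_perm_od, blockPerm_symm_blk, permSign_eq, permSign_eq,
      permExp_update]
    have h7 := Equiv.sum_comp σ (fun i => if i < j then q (σ.symm i) else 0)
    simp only [Equiv.symm_apply_apply] at h7
    rw [← h7]
    simp only [Equiv.apply_symm_apply, map_zsmul, sg_smul_smul]
    congr 2
    have h8 := add_self_zmod (∑ i, if σ i < j then q i else 0)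
    linear_combination h8

end glue

end blockPerm

/-! ### Equivariance and multilinearity of the composition. -/

section linear

variable {K : Type*} [Field K] {N : ℕ} {V : Type*} [AddCommGroup V] [Module K V]
  {H : HWSupermodule K N V} {ι : Type*} {m n : ℕ}

variable (H ι) in
/-- The action of a permutation as a linear map. -/
def PHom.actLin (σ : Equiv.Perm (Fin n)) : PHom H ι n →ₗ[K] PHom H ι n where
  toFun := PHom.act σ
  map_add' X Y := by rw [PHom.act, PHom.act, PHom.act, LinearMap.add_comp, LinearMap.comp_add]
  map_smul' c X := by
    rw [PHom.act, PHom.act, LinearMap.smul_comp, LinearMap.comp_smul, RingHom.id_apply]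

/-- Equivariance of the composition. -/
theorem PHom.composite_act [CharZero K] {ν : Fin m → ℕ} {h : ∑ j, ν j = n}
    (σ : Equiv.Perm (Fin m)) (τ : ∀ j, Equiv.Perm (Fin (ν j))) {x : ZMod 2} {X : PHom H ι m}
    {y : Fin m → ZMod 2} {Y : ∀ j, PHom H ι (ν j)} (hX : IsPcl x X) (hY : ∀ j, IsPcl (y j) (Y j)) :
    (PHom.act σ X).composite ν h x y (fun j => PHom.act (τ j) (Y j)) =
      PHom.act (blockPerm ν h σ τ) (permSign σ y • X.composite (fun j => ν (σ.symm j))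
        (sum_comp_symm ν h σ) x (fun j => y (σ.symm j)) fun j => Y (σ.symm j)) := by
  refine PHom.ext_hom fun Q v p hv => ?_
  set ρ := blockPerm ν h σ τ with hρ
  set f : ∀ j, VNabla H (ν j) := fun j => (Y j).at ((Q.sub ν h j).perm (τ j))
    (PiTensorProduct.tprod K ((fun k => v (blk ν h ⟨j, k⟩)) ∘ (τ j).symm)) with hf
  have hfm : ∀ j, f j ∈ VNabla.par H (ν j) (y j + ∑ k, p (blk ν h ⟨j, k⟩)) := by
    intro j
    rw [← Equiv.sum_comp (τ j).symm]
    exact (hY j).parity _ (fun k => p (blk ν h ⟨j, (τ j).symm k⟩)) _ fun k => hv _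
  have hfs : ∀ j, (Y (σ.symm j)).at ((Q.perm ρ).sub (fun j => ν (σ.symm j))
      (sum_comp_symm ν h σ) j) (PiTensorProduct.tprod K fun k => (v ∘ ρ.symm)
        (blk (fun j => ν (σ.symm j)) (sum_comp_symm ν h σ) ⟨j, k⟩)) = f (σ.symm j) := by
    intro j
    rw [hρ, Quiv.perm_sub]
    simp only [Function.comp_apply, blockPerm_symm_blk]
    rfl
  have hlin : ∀ (c : ℤ) (Z : PHom H ι n), PHom.act ρ (c • Z) = c • PHom.act ρ Z :=
    fun c Z => map_zsmul (PHom.actLin H ι ρ) c Z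
  rw [hlin, PHom.at_zsmul, LinearMap.smul_apply, PHom.act_at ρ _ Q hv,
    PHom.composite_at (Q.perm ρ) (v := v ∘ ρ.symm) (p := p ∘ ρ.symm) fun i => hv _,
    PHom.composite_at Q hv]
  simp only [hfs]
  have h1 : ∀ j, (PHom.act (τ j) (Y j)).at (Q.sub ν h j)
      (PiTensorProduct.tprod K fun k => v (blk ν h ⟨j, k⟩)) =
      sg (permExp (τ j) fun k => p (blk ν h ⟨j, k⟩)) • VNabla.collect H (τ j) (f j) := by
    intro j
    rw [PHom.act_at (τ j) (Y j) _ fun k => hv (blk ν h ⟨j, k⟩), permSign_eq]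
  simp only [h1]
  rw [map_sg_smul_univ, glue_act hX Q hfm, map_zsmul]
  simp only [permSign_eq, shuffleSign_eq, sg_smul_smul]
  congr 2
  have h2 : (fun j => ∑ k, (p ∘ ρ.symm) (blk (fun j => ν (σ.symm j)) (sum_comp_symm ν h σ) ⟨j, k⟩))
      = (fun j => ∑ k, p (blk ν h ⟨j, k⟩)) ∘ σ.symm := by
    funext j
    simp only [Function.comp_apply, hρ, blockPerm_symm_blk]
    exact Equiv.sum_comp (τ (σ.symm j)).symm fun k => p (blk ν h ⟨σ.symm j, k⟩)
  have h3 := permExp_add σ y (fun j => ∑ k, p (blk ν h ⟨j, k⟩))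
  -- The signs of moving the `Y_j` past the `w_i` before and after permuting differ by the Koszul
  -- signs of `σ` on the products `Y_j w_j`, on the `Y_j` and on the `w_j`.
  have h4 := permExp_add σ (fun j => ∑ k, p (blk ν h ⟨j, k⟩)) y
  have h5 := add_self_zmod (permExp σ fun j => ∑ k, p (blk ν h ⟨j, k⟩))
  have h6 := add_self_zmod (permExp σ y)
  have h7 := add_self_zmod (shuffleExp (fun j => ∑ k, p (blk ν h ⟨j, k⟩)) y)
  have h8 : (fun i => ∑ k, p (blk ν h ⟨i, k⟩) + y i) = fun i => y i + ∑ k, p (blk ν h ⟨i, k⟩) :=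
    funext fun i => add_comm _ _
  rw [h8] at h4
  rw [h2, permExp_blockPerm]
  change _ = _ + (_ + shuffleExp _ (y ∘ σ.symm))
  linear_combination h4 - h5 - h6 + h7

variable {ν : Fin m → ℕ} {h : ∑ j, ν j = n}

theorem PHom.update_at (Y : ∀ j, PHom H ι (ν j)) (j : Fin m) (Z : PHom H ι (ν j))
    (Q : ∀ j, Quiv ι (ν j)) (t : ∀ j, ⨂[K] _ : Fin (ν j), V) :
    (fun i => (Function.update Y j Z i).at (Q i) (t i)) =
      Function.update (fun i => (Y i).at (Q i) (t i)) j (Z.at (Q j) (t j)) :=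
  funext fun i => Function.apply_update (fun i (Z : PHom H ι (ν i)) => Z.at (Q i) (t i)) Y j Z i

variable (H ι) in
/-- The composition of maps of given parities as a multilinear map. -/
def PHom.compositeMul (ν : Fin m → ℕ) (h : ∑ j, ν j = n) (x : ZMod 2) (y : Fin m → ZMod 2)
    (X : PHom H ι m) : MultilinearMap K (fun j => PHom H ι (ν j)) (PHom H ι n) where
  toFun Y := X.composite ν h x y Y
  map_update_add' {hd} Y j A B := by
    -- The field quantifies over all decidability instances, while `PHom.update_at` uses the
    -- standard one.
    obtain rfl : hd = instDecidableEqFin m := Subsingleton.elim _ _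
    refine PHom.ext_hom fun Q v p hv => ?_
    rw [PHom.at_add, LinearMap.add_apply]
    simp only [PHom.composite_at Q hv, PHom.update_at, PHom.at_add, LinearMap.add_apply,
      MultilinearMap.map_update_add, smul_add]
  map_update_smul' {hd} Y j c A := by
    obtain rfl : hd = instDecidableEqFin m := Subsingleton.elim _ _
    refine PHom.ext_hom fun Q v p hv => ?_
    rw [PHom.at_smul, LinearMap.smul_apply]
    simp only [PHom.composite_at Q hv, PHom.update_at, PHom.at_smul, LinearMap.smul_apply,
      MultilinearMap.map_update_smul]
    rw [smul_comm]

variable (H ι) in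
/-- The composition of maps of given parities, as a linear map in the first argument. -/
def PHom.compositeLin (ν : Fin m → ℕ) (h : ∑ j, ν j = n) (x : ZMod 2) (y : Fin m → ZMod 2) :
    PHom H ι m →ₗ[K] MultilinearMap K (fun j => PHom H ι (ν j)) (PHom H ι n) where
  toFun X := PHom.compositeMul H ι ν h x y X
  map_add' X X' := by
    refine MultilinearMap.ext fun Y => PHom.ext_hom fun Q v p hv => ?_
    rw [add_apply, PHom.at_add, LinearMap.add_apply]
    change (PHom.composite ν h x (X + X') y Y).at Q _ =
      (PHom.composite ν h x X y Y).at Q _ + (PHom.composite ν h x X' y Y).at Q _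
    simp only [PHom.composite_at Q hv, glue_add, add_apply, smul_add]
  map_smul' c X := by
    refine MultilinearMap.ext fun Y => PHom.ext_hom fun Q v p hv => ?_
    rw [smul_apply, PHom.at_smul, LinearMap.smul_apply]
    change (PHom.composite ν h x (c • X) y Y).at Q _ = c • (PHom.composite ν h x X y Y).at Q _
    simp only [PHom.composite_at Q hv, glue_smul, smul_apply]
    rw [smul_comm]

end linear

/-! ### Projections and extension principles for superspaces. -/

section internal

variable {K : Type*} [Field K] {M : Type*} [AddCommGroup M] [Module K M]
  {A : ZMod 2 → Submodule K M} (hA : DirectSum.IsInternal A)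

/-- The projection of a superspace onto its part of parity `p`. -/
def parProj (p : ZMod 2) : M →ₗ[K] M :=
  (A p).subtype ∘ₗ DirectSum.component K (ZMod 2) (fun q => A q) p ∘ₗ
    (LinearEquiv.ofBijective (DirectSum.coeLinearMap A) hA).symm.toLinearMap

theorem parProj_mem (p : ZMod 2) (v : M) : parProj hA p v ∈ A p := Subtype.property _

theorem parProj_of_mem {p q : ZMod 2} {v : M} (hv : v ∈ A q) :
    parProj hA p v = if q = p then v else 0 := by
  have h1 : (LinearEquiv.ofBijective (DirectSum.coeLinearMap A) hA).symm v =
      DirectSum.lof K (ZMod 2) (fun q => A q) q ⟨v, hv⟩ := by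
    rw [LinearEquiv.symm_apply_eq]
    exact (DirectSum.coeLinearMap_lof A q ⟨v, hv⟩).symm
  simp only [parProj, LinearMap.comp_apply, LinearEquiv.coe_coe, h1]
  by_cases hq : q = p
  · subst hq
    simp [DirectSum.component.lof_self]
  · rw [DirectSum.component.of, dif_neg hq]
    simp [hq]

theorem span_par_eq_top {A : ZMod 2 → Submodule K M} (hA : DirectSum.IsInternal A) :
    Submodule.span K {v : M | ∃ p, v ∈ A p} = ⊤ := by
  rw [← hA.submodule_iSup_eq_top]
  refine le_antisymm (Submodule.span_le.2 ?_) (iSup_le fun p v hv => Submodule.subset_span ⟨p, hv⟩)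
  rintro v ⟨p, hv⟩
  exact Submodule.mem_iSup_of_mem p hv

theorem linearMap_ext_par {A : ZMod 2 → Submodule K M} (hA : DirectSum.IsInternal A)
    {E : Type*} [AddCommGroup E] [Module K E] {f g : M →ₗ[K] E}
    (h : ∀ p, ∀ v ∈ A p, f v = g v) : f = g :=
  LinearMap.ext_on (span_par_eq_top hA) fun v ⟨p, hv⟩ => h p v hv

theorem par_induction {A : ZMod 2 → Submodule K M} (hA : DirectSum.IsInternal A) {P : M → Prop}
    (hm : ∀ p, ∀ v ∈ A p, P v) (ha : ∀ v w, P v → P w → P (v + w)) (v : M) : P v :=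
  Submodule.iSup_induction A (motive := P)
    (by rw [hA.submodule_iSup_eq_top]; trivial : v ∈ ⨆ p, A p) hm (hm 0 0 (zero_mem _)) ha

end internal

/-! ### Action and composition on `P^cl_W(V)`. -/

section Pcl

variable {K : Type*} [Field K] [CharZero K] {N : ℕ} {V : Type*} [AddCommGroup V] [Module K V]
  {H : HWSupermodule K N V} {ι : Type*} {m n : ℕ}

theorem VNabla.eq_zero_of_mem {p : ZMod 2} {y : VNabla H n} (h0 : y ∈ VNabla.par H n p)
    (h1 : y ∈ VNabla.par H n (p + 1)) : y = 0 := by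
  have h2 := VNabla.proj_of_mem (q := p) h0
  rw [VNabla.proj_of_mem h1, if_pos rfl, if_neg ((by decide : ∀ p : ZMod 2, ¬p + 1 = p) p)] at h2
  exact h2.symm

variable (H ι n) in
-- A map of both parities takes homogeneous tensors to elements of both parities, which vanish; that
-- the two parts span is built into the definition of `Pcl`.
theorem Pcl.isInternal : DirectSum.IsInternal (Pcl.par H ι n) := by
  rw [DirectSum.isInternal_submodule_iff_isCompl (Pcl.par H ι n) (i := 0) (j := 1) (by decide)
    (by ext p; revert p; decide)]
  constructor
  · rw [Submodule.disjoint_def]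
    intro X h0 h1
    refine Subtype.ext (PHom.ext_hom fun Q v p hv => ?_)
    refine VNabla.eq_zero_of_mem (p := 0 + ∑ i, p i) (IsPcl.parity h0 Q p v hv) ?_
    have := IsPcl.parity h1 Q p v hv
    rwa [zero_add, add_comm]
  · rw [codisjoint_iff, eq_top_iff]
    suffices key : ∀ X ∈ ⨆ x, pclPar H ι n x, ∀ hX : X ∈ Pcl H ι n,
        (⟨X, hX⟩ : Pcl H ι n) ∈ Pcl.par H ι n 0 ⊔ Pcl.par H ι n 1 from
      fun X _ => key X X.2 X.2
    intro X hX
    induction hX using Submodule.iSup_induction' with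
    | mem x X hX =>
      intro _
      have h2 : ∀ q : ZMod 2, q = 0 ∨ q = 1 := by decide
      rcases h2 x with rfl | rfl
      · exact Submodule.mem_sup_left hX
      · exact Submodule.mem_sup_right hX
    | zero => exact fun _ => zero_mem _
    | add X X' hX hX' h1 h2 => exact fun _ => add_mem (h1 hX) (h2 hX')

omit [CharZero K] in
theorem IsPcl.mem {x : ZMod 2} {X : PHom H ι n} (hX : IsPcl x X) : X ∈ Pcl H ι n :=
  Submodule.mem_iSup_of_mem (p := pclPar H ι n) x hX

variable (H ι) in
/-- The action of a permutation on `P^cl_W(V)(n)`. -/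
def Pcl.act (σ : Equiv.Perm (Fin n)) : Pcl H ι n →ₗ[K] Pcl H ι n :=
  (PHom.actLin H ι σ).restrict fun X hX => by
    rw [Pcl] at hX
    induction hX using Submodule.iSup_induction' with
    | mem x X hX => exact (IsPcl.act hX σ).mem
    | zero => rw [map_zero]; exact zero_mem _
    | add X X' _ _ h1 h2 => rw [map_add]; exact add_mem h1 h2

variable (H ι) in
/-- The composition on `P^cl_W(V)`. -/
def Pcl.comp (ν : Fin m → ℕ) (h : ∑ j, ν j = n) :
    Pcl H ι m →ₗ[K] MultilinearMap K (fun j => Pcl H ι (ν j)) (Pcl H ι n) where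
  -- The composite formula depends on the parities of its arguments. It is extended by splitting
  -- every argument into homogeneous parts.
  toFun X := (∑ x : ZMod 2, ∑ y : Fin m → ZMod 2,
    (PHom.compositeLin H ι ν h x y (parProj (Pcl.isInternal H ι m) x X)).compLinearMap
      fun j => (Pcl H ι (ν j)).subtype ∘ₗ parProj (Pcl.isInternal H ι (ν j)) (y j)).codRestrict
    (Pcl H ι n) fun Y => by
      simp only [sum_apply]
      exact sum_mem fun x _ => sum_mem fun y _ => (IsPcl.composite
        (show IsPcl x (_ : PHom H ι m) from parProj_mem (Pcl.isInternal H ι m) x X) fun j =>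
        show IsPcl (y j) (_ : PHom H ι (ν j)) from
          parProj_mem (Pcl.isInternal H ι (ν j)) (y j) (Y j)).mem
  map_add' X X' := by
    refine MultilinearMap.ext fun Y => Subtype.ext ?_
    simp only [MultilinearMap.codRestrict_apply_coe, sum_apply, add_apply, map_add,
      Submodule.coe_add, MultilinearMap.compLinearMap_apply, Finset.sum_add_distrib]
  map_smul' c X := by
    refine MultilinearMap.ext fun Y => Subtype.ext ?_
    simp only [MultilinearMap.codRestrict_apply_coe, sum_apply, smul_apply, map_smul,
      Submodule.coe_smul, MultilinearMap.compLinearMap_apply, Finset.smul_sum, RingHom.id_apply]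

theorem Pcl.comp_of_mem {ν : Fin m → ℕ} {h : ∑ j, ν j = n} {x : ZMod 2} {y : Fin m → ZMod 2}
    {X : Pcl H ι m} {Y : ∀ j, Pcl H ι (ν j)} (hX : X ∈ Pcl.par H ι m x)
    (hY : ∀ j, Y j ∈ Pcl.par H ι (ν j) (y j)) :
    (Pcl.comp H ι ν h X Y : PHom H ι n) =
      (X : PHom H ι m).composite ν h x y fun j => (Y j : PHom H ι (ν j)) := by
  change (∑ x : ZMod 2, ∑ y : Fin m → ZMod 2,
    (PHom.compositeLin H ι ν h x y (parProj (Pcl.isInternal H ι m) x X)).compLinearMap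
      fun j => (Pcl H ι (ν j)).subtype ∘ₗ parProj (Pcl.isInternal H ι (ν j)) (y j)) Y = _
  rw [sum_apply, Finset.sum_eq_single x]
  · rw [sum_apply, Finset.sum_eq_single y]
    · simp only [MultilinearMap.compLinearMap_apply, LinearMap.comp_apply,
        parProj_of_mem _ (hY _), parProj_of_mem _ hX, if_true]
      rfl
    · intro y' _ hy'
      obtain ⟨j, hj⟩ := Function.ne_iff.1 hy'
      rw [MultilinearMap.compLinearMap_apply, MultilinearMap.map_coord_zero _ j]
      rw [LinearMap.comp_apply, parProj_of_mem _ (hY j), if_neg (Ne.symm hj), map_zero]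
    · simp
  · intro x' _ hx'
    rw [parProj_of_mem _ hX, if_neg (Ne.symm hx')]
    simp
  · simp

end Pcl

/-! ### Composites are determined by the composition formula. -/

section unique

variable {K : Type*} [Field K] {N : ℕ} {V : Type*} [AddCommGroup V] [Module K V]
  {H : HWSupermodule K N V} {ι : Type*} {m n : ℕ}

/-- Every element of `V_∇[Λ₁, …, Λₙ]` is a sum of homogeneous elements of `V[Λ₁, …, Λₙ₋₁]`. -/
theorem VNabla.exists_ofReduced_sum (f : VNabla H n) : ∃ (r : ℕ) (α β : Fin r → ZMod 2)
    (a : Fin r → SPoly K N (Fin (n - 1))) (u : Fin r → V), (∀ s, a s ∈ SPoly.par (α s)) ∧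
      (∀ s, u s ∈ H.par (β s)) ∧ f = VNabla.ofReduced H n (∑ s, a s ⊗ₜ[K] u s) := by
  obtain ⟨t, rfl⟩ := VNabla.ofReduced_surjective H f
  have ht : t ∈ Submodule.span K {t : SPoly K N (Fin (n - 1)) ⊗[K] V | ∃ a p d u q,
      SPoly.IsMon SPoly.ev a p d ∧ u ∈ H.par q ∧ a ⊗ₜ[K] u = t} := by
    rw [span_tmul_mon]; trivial
  obtain ⟨r, c, g, rfl⟩ := Submodule.mem_span_set'.1 ht
  choose a p d u q ha hu hg using fun s => (g s).2
  refine ⟨r, p, q, fun s => c s • a s, u,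
    fun s => Submodule.smul_mem _ _ ((ha s).mem_par SPoly.ev_mem_par), hu, ?_⟩
  congr 1
  exact Finset.sum_congr rfl fun s _ => by rw [← hg s, TensorProduct.smul_tmul']

theorem IsComposite.unique {ν : Fin m → ℕ} {h : ∑ j, ν j = n} {x : ZMod 2} {X : PHom H ι m}
    {y : Fin m → ZMod 2} {Y : ∀ j, PHom H ι (ν j)} {Z Z' : PHom H ι n}
    (hZ : IsComposite ν h x X y Y Z) (hZ' : IsComposite ν h x X y Y Z') : Z = Z' := by
  refine PHom.ext_hom fun Q v p hv => ?_
  choose r α β a u ha hu hf using fun j => VNabla.exists_ofReduced_sum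
    ((Y j).at (Q.sub ν h j) (PiTensorProduct.tprod K fun k => v (blk ν h ⟨j, k⟩)))
  rw [hZ Q p v r α β a u hv ha hu hf, hZ' Q p v r α β a u hv ha hu hf]

end unique

/-! ### The superoperad structure. -/

section superoperad

variable {K : Type*} [Field K] [CharZero K] {N : ℕ} {V : Type*} [AddCommGroup V] [Module K V]
  (H : HWSupermodule K N V) (ι : Type*)

/-- The unit of `P^cl_W(V)`. -/
def Pcl.one : Pcl H ι 1 := ⟨PHom.one H ι, isPcl_one.mem⟩

omit [CharZero K] in
theorem Pcl.one_mem : Pcl.one H ι ∈ Pcl.par H ι 1 0 :=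
  show IsPcl 0 (PHom.one H ι) from isPcl_one

variable {H ι}

theorem Pcl.act_mem {n : ℕ} (σ : Equiv.Perm (Fin n)) {p : ZMod 2} {X : Pcl H ι n}
    (hX : X ∈ Pcl.par H ι n p) : Pcl.act H ι σ X ∈ Pcl.par H ι n p :=
  show IsPcl p (PHom.act σ (X : PHom H ι n)) from IsPcl.act hX σ

theorem Pcl.comp_mem {m n : ℕ} {ν : Fin m → ℕ} {h : ∑ j, ν j = n} {x : ZMod 2}
    {y : Fin m → ZMod 2} {X : Pcl H ι m} {Y : ∀ j, Pcl H ι (ν j)} (hX : X ∈ Pcl.par H ι m x)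
    (hY : ∀ j, Y j ∈ Pcl.par H ι (ν j) (y j)) :
    Pcl.comp H ι ν h X Y ∈ Pcl.par H ι n (x + ∑ j, y j) := by
  change IsPcl _ (Pcl.comp H ι ν h X Y : PHom H ι n)
  rw [Pcl.comp_of_mem hX hY]
  exact IsPcl.composite hX hY

theorem Pcl.one_comp {n : ℕ} (h : ∑ _j : Fin 1, n = n) (X : Pcl H ι n) :
    Pcl.comp H ι (fun _ : Fin 1 => n) h (Pcl.one H ι) (fun _ => X) = X := by
  have key := linearMap_ext_par (Pcl.isInternal H ι n)
    (f := (LinearMap.id : Pcl H ι n →ₗ[K] Pcl H ι n))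
    (g := (Pcl.comp H ι (fun _ : Fin 1 => n) h (Pcl.one H ι)).toLinearMap (fun _ => 0) 0)
    fun p X hX => ?_
  · have h1 := LinearMap.congr_fun key X
    rw [MultilinearMap.toLinearMap_apply, LinearMap.id_apply] at h1
    convert h1.symm using 2
    · funext j
      rw [Subsingleton.elim j 0, Function.update_self]
  · rw [MultilinearMap.toLinearMap_apply, show Function.update (fun _ : Fin 1 => (0 : Pcl H ι n)) 0 X =
      fun _ => X from funext fun j => by rw [Subsingleton.elim j 0, Function.update_self]]
    refine Subtype.ext ?_
    rw [Pcl.comp_of_mem (Pcl.one_mem H ι) fun _ => hX]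
    exact (PHom.one_composite h p _).symm

theorem Pcl.comp_one {n : ℕ} (h : ∑ _j : Fin n, 1 = n) (X : Pcl H ι n) :
    Pcl.comp H ι (fun _ : Fin n => 1) h X (fun _ => Pcl.one H ι) = X := by
  induction X using par_induction (Pcl.isInternal H ι n) with
  | hm p X hX =>
    refine Subtype.ext ?_
    exact (Pcl.comp_of_mem hX fun _ => Pcl.one_mem H ι).trans (PHom.composite_one h hX)
  | ha X X' h1 h2 =>
    rw [map_add, add_apply, h1, h2]

/-- The sign does not involve the parity of `X`, so `X` may be split into homogeneous parts although
it is arbitrary. -/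
theorem Pcl.comp_assoc {l m n : ℕ} (ν : Fin m → ℕ) (h : ∑ j, ν j = n) (μ : Fin n → ℕ)
    (h' : ∑ k, μ k = l) (y : Fin m → ZMod 2) (z : Fin n → ZMod 2) (X : Pcl H ι m)
    (Y : ∀ j, Pcl H ι (ν j)) (Z : ∀ k, Pcl H ι (μ k)) (hY : ∀ j, Y j ∈ Pcl.par H ι (ν j) (y j))
    (hZ : ∀ k, Z k ∈ Pcl.par H ι (μ k) (z k)) :
    Pcl.comp H ι μ h' (Pcl.comp H ι ν h X Y) Z =
      shuffleSign (fun j => ∑ k, z (blk ν h ⟨j, k⟩)) y •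
        Pcl.comp H ι (fun j => ∑ k, μ (blk ν h ⟨j, k⟩)) (sum_blocks h h') X
          (fun j => Pcl.comp H ι (fun k => μ (blk ν h ⟨j, k⟩)) rfl (Y j)
            (fun k => Z (blk ν h ⟨j, k⟩))) := by
  induction X using par_induction (Pcl.isInternal H ι m) with
  | hm x X hX =>
    refine Subtype.ext ?_
    have h1 : ∀ j, Pcl.comp H ι (fun k => μ (blk ν h ⟨j, k⟩)) rfl (Y j)
        (fun k => Z (blk ν h ⟨j, k⟩)) ∈ Pcl.par H ι _ (y j + ∑ k, z (blk ν h ⟨j, k⟩)) :=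
      fun j => Pcl.comp_mem (hY j) fun k => hZ _
    rw [Pcl.comp_of_mem (Pcl.comp_mem hX hY) hZ, Pcl.comp_of_mem hX hY]
    refine (PHom.composite_assoc hX hY hZ).trans ?_
    rw [AddSubgroupClass.coe_zsmul, Pcl.comp_of_mem hX h1]
    simp only [fun j => Pcl.comp_of_mem (h := rfl) (hY j) fun k => hZ (blk ν h ⟨j, k⟩)]
    rfl
  | ha X X' h1 h2 =>
    rw [map_add, add_apply, map_add, add_apply, h1, h2, map_add, add_apply, smul_add]

theorem Pcl.comp_equivariant {m n : ℕ} (ν : Fin m → ℕ) (h : ∑ j, ν j = n)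
    (σ : Equiv.Perm (Fin m)) (τ : ∀ j, Equiv.Perm (Fin (ν j))) (y : Fin m → ZMod 2)
    (X : Pcl H ι m) (Y : ∀ j, Pcl H ι (ν j)) (hY : ∀ j, Y j ∈ Pcl.par H ι (ν j) (y j)) :
    Pcl.comp H ι ν h (Pcl.act H ι σ X) (fun j => Pcl.act H ι (τ j) (Y j)) =
      Pcl.act H ι (blockPerm ν h σ τ) (permSign σ y •
        Pcl.comp H ι (fun j => ν (σ.symm j)) (sum_comp_symm ν h σ) X
          (fun j => Y (σ.symm j))) := by
  induction X using par_induction (Pcl.isInternal H ι m) with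
  | hm x X hX =>
    refine Subtype.ext ?_
    rw [Pcl.comp_of_mem (Pcl.act_mem σ hX) fun j => Pcl.act_mem (τ j) (hY j)]
    refine (PHom.composite_act σ τ hX hY).trans ?_
    exact congrArg (fun Z => PHom.act (blockPerm ν h σ τ) (permSign σ y • Z))
      (Pcl.comp_of_mem hX fun j => hY (σ.symm j)).symm
  | ha X X' h1 h2 =>
    rw [map_add, map_add, add_apply, h1, h2, map_add, add_apply, smul_add, map_add]

variable (H ι) in
/-- The superoperad `P^cl_W(V)`. -/
def Pcl.superoperad : Superoperad K (fun n => Pcl H ι n) (fun n => Pcl.par H ι n) where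
  isInternal n := Pcl.isInternal H ι n
  act σ := Pcl.act H ι σ
  act_one _ := Subtype.ext (PHom.act_one _)
  act_mul σ τ _ := Subtype.ext (PHom.act_mul σ τ _)
  act_mem σ _ _ hX := Pcl.act_mem σ hX
  comp ν h := Pcl.comp H ι ν h
  comp_mem _ _ _ _ _ _ hX hY := Pcl.comp_mem hX hY
  one := Pcl.one H ι
  one_mem := Pcl.one_mem H ι
  one_comp := Pcl.one_comp
  comp_one := Pcl.comp_one
  assoc := Pcl.comp_assoc
  equivariant := Pcl.comp_equivariant

theorem Pcl.isComposite_comp {m n : ℕ} {ν : Fin m → ℕ} {h : ∑ j, ν j = n} {x : ZMod 2}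
    {y : Fin m → ZMod 2} {X : Pcl H ι m} {Y : ∀ j, Pcl H ι (ν j)} (hX : X ∈ Pcl.par H ι m x)
    (hY : ∀ j, Y j ∈ Pcl.par H ι (ν j) (y j)) :
    IsComposite ν h x (X : PHom H ι m) y (fun j => (Y j : PHom H ι (ν j)))
      (Pcl.comp H ι ν h X Y : PHom H ι n) := by
  rw [Pcl.comp_of_mem hX hY]
  exact PHom.isComposite_composite hX

end superoperad

/-! ### Equality of superoperad structures. -/

section ext

variable {K : Type*} [Field K]

/-- Superoperad structures with the same actions, compositions and unit are equal. -/
theorem Superoperad.ext_data {P : ℕ → Type*} [∀ n, AddCommGroup (P n)] [∀ n, Module K (P n)]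
    {par : ∀ n, ZMod 2 → Submodule K (P n)} {O O' : Superoperad K P par}
    (hact : ∀ (n : ℕ) (σ : Equiv.Perm (Fin n)), O.act σ = O'.act σ)
    (hcomp : ∀ (m n : ℕ) (ν : Fin m → ℕ) (h : ∑ j, ν j = n), O.comp ν h = O'.comp ν h)
    (hone : O.one = O'.one) : O = O' := by
  have h1 : @O.act = @O'.act := funext fun n => funext fun σ => hact n σ
  have h2 : @O.comp = @O'.comp :=
    funext fun m => funext fun n => funext fun ν => funext fun h => hcomp m n ν h
  cases O
  cases O'
  cases h1
  cases h2
  cases hone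
  rfl

/-- Two compositions which agree on homogeneous elements are equal. -/
theorem Superoperad.comp_ext {P : ℕ → Type*} [∀ n, AddCommGroup (P n)] [∀ n, Module K (P n)]
    {par : ∀ n, ZMod 2 → Submodule K (P n)} (hP : ∀ n, DirectSum.IsInternal (par n)) {m n : ℕ}
    {ν : Fin m → ℕ} {Φ Ψ : P m →ₗ[K] MultilinearMap K (fun j => P (ν j)) (P n)}
    (h : ∀ (x : ZMod 2) (y : Fin m → ZMod 2) (X : P m) (Y : ∀ j, P (ν j)), X ∈ par m x →
      (∀ j, Y j ∈ par (ν j) (y j)) → Φ X Y = Ψ X Y) : Φ = Ψ := by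
  refine LinearMap.ext_on (span_par_eq_top (hP m)) fun X ⟨x, hX⟩ => ?_
  refine multilinear_ext_span _ (fun j => span_par_eq_top (hP (ν j))) fun Y hY => ?_
  choose y hY using hY
  exact h x y X Y hX hY

end ext

end SUSYCoisson

end

theorem mainTheorem5 {K : Type*} [Field K] [CharZero K] (N : ℕ) {V : Type*} [AddCommGroup V]
    [Module K V] (H : HWSupermodule K N V) (ι : Type*) :
    ∃! O : Superoperad K (fun n => Pcl H ι n) (fun n => Pcl.par H ι n),
      (∀ (n : ℕ) (σ : Equiv.Perm (Fin n)) (X : Pcl H ι n),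
        (O.act σ X : PHom H ι n) = PHom.act σ (X : PHom H ι n)) ∧
      (∀ (m n : ℕ) (ν : Fin m → ℕ) (h : ∑ j, ν j = n) (x : ZMod 2) (y : Fin m → ZMod 2)
        (X : Pcl H ι m) (Y : ∀ j, Pcl H ι (ν j)),
        X ∈ Pcl.par H ι m x → (∀ j, Y j ∈ Pcl.par H ι (ν j) (y j)) →
        IsComposite ν h x (X : PHom H ι m) y (fun j => (Y j : PHom H ι (ν j)))
          (O.comp ν h X Y : PHom H ι n)) ∧
      (O.one : PHom H ι 1) = PHom.one H ι := by
  refine ⟨Pcl.superoperad H ι, ⟨fun n σ X => rfl, fun m n ν h x y X Y hX hY =>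
    Pcl.isComposite_comp hX hY, rfl⟩, fun O ⟨hact, hcomp, hone⟩ => ?_⟩
  -- The formulas prescribe the action and the unit outright, but the composition only on
  -- homogeneous arguments; these span by `Pcl.isInternal`.
  refine Superoperad.ext_data (fun n σ => LinearMap.ext fun X => Subtype.ext (hact n σ X))
    (fun m n ν h => ?_) (Subtype.ext hone)
  exact Superoperad.comp_ext (Pcl.isInternal H ι) fun x y X Y hX hY => Subtype.ext <|
    (hcomp m n ν h x y X Y hX hY).unique (Pcl.isComposite_comp hX hY)
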